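/- Let $\Omega\subset\mathbb R^d$ ($d\ge 1$) be a bounded Lipschitz domain (open and connected) with outward unit normal $\mathbf n$, let $T>0$ and $\gamma>0$, and let $\mathbf b_1,\dots,\mathbf b_m\in C^1(\overline\Omega;\mathbb R^d)$ be orthonormal in $L^2(\Omega;\mathbb R^d)$ with $\operatorname{div}\mathbf b_i=0$ in $\Omega$ and $\mathbf b_i\cdot\mathbf n=0$ on $\partial\Omega$ (wherever the normal exists). Put $U=\operatorname{span}\{\mathbf b_1,\dots,\mathbf b_m\}\subset L^2(\Omega;\mathbb R^d)$, and let $P_U$ be the orthogonal projection of $L^2(\Omega;\mathbb R^d)$ onto $U$. Let $\theta^0\in L^\infty(\Omega)$ with $\int_\Omega\theta^0\,dx=0$. For $f\in L^2(\Omega)$ write $$\|f\|_{\dot H^{-1}(\Omega)}=\sup\Big\{\int_\Omega f\phi\,dx:\ \phi\in H^1(\Omega),\ \int_\Omega\phi\,dx=0,\ \int_\Omega|\nabla\phi|^2dx\le1\Big\}.$$ For every $\mathbf v\in L^2((0,T);U)$ there is a unique weak solution $\theta=\theta(\cdot;\mathbf v)\in C([0,T];L^2(\Omega))$ of $\partial_t\theta+\operatorname{div}(\mathbf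 v\theta)=0$, $\theta|_{t=0}=\theta^0$, that is, $$\int_0^T\!\!\int_\Omega\theta(-\partial_t\varphi-\mathbf v\cdot\nabla\varphi)\,dx\,dt=\int_\Omega\theta^0(x)\varphi(0,x)\,dx\qquad\forall\,\varphi\in C_0^\infty([0,T)\times\Omega),$$ and $\|\theta(T;\mathbf v)\|_{\dot H^{-1}(\Omega)}<\infty$. Define $$J(\mathbf v)=\tfrac12\|\theta(T;\mathbf v)\|_{\dot H^{-1}(\Omega)}^2+\tfrac\gamma2\int_0^T\|\mathbf v(t)\|_{L^2(\Omega;\mathbb R^d)}^2\,dt .$$ Let $\mathbf v\in L^2((0,T);U)$ and $\theta=\theta(\cdot;\mathbf v)$. There is a unique $\eta\in H^1(\Omega)$ with $\int_\Omega\eta\,dx=0$ and $\int_\Omega\nabla\eta\cdot\nabla\varphi\,dx=\int_\Omega\theta(T)\varphi\,dx$ for all $\varphi\in H^1(\Omega)$ (the zero-mean weak solution of $-\Delta\eta=\theta(T)$ in $\Omega$, $\partial_{\mathbf n}\eta=0$ on $\partial\Omega$). There is a unique $\rho\in C([0,T];H^1(\Omega))$ that solves $\partial_t\rho+\operatorname{div}(\mathbf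 v\rho)=0$, $\rho|_{t=T}=\eta$ weakly, that is, $$\int_0^T\!\!\int_\Omega\rho(-\partial_t\varphi-\mathbf v\cdot\nabla\varphi)\,dx\,dt=-\int_\Omega\eta(x)\varphi(T,x)\,dx\qquad\forall\,\varphi\in C_0^\infty((0,T]\times\Omega).$$ Moreover $\theta\nabla\rho\in L^2((0,T);L^2(\Omega;\mathbb R^d))$, and $J$ is Gâteaux differentiable at $\mathbf v$ with gradient $$J'(\mathbf v)=P_U(\gamma\mathbf v+\theta\nabla\rho)\quad\text{in }L^2((0,T);U),$$ where $P_U$ acts at almost every time; that is, for every $\mathbf w\in L^2((0,T);U)$, $$\lim_{\varepsilon\to0}\frac{J(\mathbf v+\varepsilon\mathbf w)-J(\mathbf v)}\varepsilon=\langle J'(\mathbf v),\mathbf w\rangle_{L^2((0,T);U)}.$$ -/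

import Mathlib

open MeasureTheory Set Filter Topology
open scoped ContDiff ENNReal

namespace MixingControl

noncomputable section

/-- `ℝᵈ` with its Euclidean norm. -/
abbrev E (d : ℕ) : Type := EuclideanSpace ℝ (Fin d)

/-! ### The domain -/

/-- A bounded Lipschitz domain: a bounded, open, connected (in particular nonempty) set that is,
near each boundary point and for a suitable unit vector `e`, the region strictly below the graph
of a Lipschitz function over the hyperplane orthogonal to `e`. (Only the values of `f` on that
hyperplane matter; `y - ⟪e, y⟫ e` is the orthogonal projection of `y` onto it.) -/
structure IsBoundedLipschitzDomain {d : ℕ} (Ω : Set (E d)) : Prop where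
  isOpen : IsOpen Ω
  isConnected : IsConnected Ω
  isBounded : Bornology.IsBounded Ω
  lipschitz_boundary : ∀ x ∈ frontier Ω, ∃ e : E d, ‖e‖ = 1 ∧
    ∃ (K : NNReal) (f : E d → ℝ), LipschitzWith K f ∧
      ∃ r > 0, ∀ y ∈ Metric.ball x r,
        (y ∈ Ω ↔ inner ℝ e y < f (y - (inner ℝ e y : ℝ) • e))

/-- `n` is the outward unit normal of `Ω` at the boundary point `x`: to first order at `x`, the
set `Ω` is the half-space `{y | ⟪n, y - x⟫ < 0}`. For a Lipschitz domain such an `n` exists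
exactly at the boundary points where the local graph is differentiable, hence almost everywhere
on the boundary. -/
def IsOutwardNormal {d : ℕ} (Ω : Set (E d)) (x n : E d) : Prop :=
  x ∈ frontier Ω ∧ ‖n‖ = 1 ∧ ∀ ε : ℝ, 0 < ε → ∀ᶠ y in 𝓝 x,
    (inner ℝ n (y - x) < -ε * ‖y - x‖ → y ∈ Ω) ∧
    (ε * ‖y - x‖ < inner ℝ n (y - x) → y ∉ Ω)

/-- The divergence of a vector field at a point. -/
def divergence {d : ℕ} (b : E d → E d) (x : E d) : ℝ :=
  ∑ i : Fin d, (fderiv ℝ b x (EuclideanSpace.single i 1)) i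

/-- A `C¹` vector field on the closure of `Ω` which is incompressible in `Ω` and satisfies the
no-penetration condition on the boundary. -/
structure IsStirringField {d : ℕ} (Ω : Set (E d)) (b : E d → E d) : Prop where
  contDiffOn : ContDiffOn ℝ 1 b (closure Ω)
  div_eq_zero : ∀ x ∈ Ω, divergence b x = 0
  no_penetration : ∀ x n : E d, IsOutwardNormal Ω x n → inner ℝ (b x) n = 0

/-! ### Function spaces on `Ω` -/

/-- `L²(Ω)`. -/
abbrev L2 {d : ℕ} (Ω : Set (E d)) : Type := Lp ℝ 2 (volume.restrict Ω)

/-- `L²(Ω; ℝᵈ)`. -/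
abbrev L2Vec {d : ℕ} (Ω : Set (E d)) : Type := Lp (E d) 2 (volume.restrict Ω)

/-- `g` is the weak gradient of `u` in `Ω`. -/
def IsWeakGradient {d : ℕ} (Ω : Set (E d)) (u : L2 Ω) (g : L2Vec Ω) : Prop :=
  ∀ φ : E d → ℝ, ContDiff ℝ ∞ φ → HasCompactSupport φ → tsupport φ ⊆ Ω → ∀ e : E d,
    (∫ x in Ω, u x * fderiv ℝ φ x e) = - ∫ x in Ω, (inner ℝ (g x) e : ℝ) * φ x

lemma integrable_mul_test {d : ℕ} {Ω : Set (E d)} {u : E d → ℝ} {φ : E d → ℝ}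
    (hu : MemLp u 2 (volume.restrict Ω)) (hφ : Continuous φ) (hc : HasCompactSupport φ) :
    Integrable (fun x => u x * φ x) (volume.restrict Ω) :=
  hu.integrable_mul ((hφ.memLp_of_hasCompactSupport hc (p := 2)).restrict Ω)

lemma integrable_left {d : ℕ} {Ω : Set (E d)} (u : L2 Ω) {φ : E d → ℝ}
    (hφ : ContDiff ℝ ∞ φ) (hc : HasCompactSupport φ) (e : E d) :
    Integrable (fun x => u x * fderiv ℝ φ x e) (volume.restrict Ω) :=
  integrable_mul_test (Lp.memLp u)
    ((hφ.continuous_fderiv (by simp)).clm_apply continuous_const)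
    (hc.fderiv_apply (𝕜 := ℝ) e)

lemma integrable_right {d : ℕ} {Ω : Set (E d)} (g : L2Vec Ω) {φ : E d → ℝ}
    (hφ : ContDiff ℝ ∞ φ) (hc : HasCompactSupport φ) (e : E d) :
    Integrable (fun x => (inner ℝ (g x) e : ℝ) * φ x) (volume.restrict Ω) :=
  integrable_mul_test ((Lp.memLp g).inner_const e) hφ.continuous hc

/-- The Sobolev space `H¹(Ω)`, as the space of pairs `(u, ∇u)` of an `L²(Ω)` function and its weak
gradient in `L²(Ω; ℝᵈ)`. It carries the norm `(‖u‖² + ‖∇u‖²)^(1/2)`. -/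
def H1 {d : ℕ} (Ω : Set (E d)) : Submodule ℝ (WithLp 2 (L2 Ω × L2Vec Ω)) where
  carrier := {p | IsWeakGradient Ω p.fst p.snd}
  zero_mem' := by
    intro φ _ _ _ e
    have h1 : ∀ᵐ x ∂(volume.restrict Ω), ((0 : L2 Ω) : E d → ℝ) x * fderiv ℝ φ x e = 0 := by
      filter_upwards [Lp.coeFn_zero ℝ 2 (volume.restrict Ω)] with x hx
      rw [hx]; exact zero_mul _
    have h2 : ∀ᵐ x ∂(volume.restrict Ω),
        (inner ℝ (((0 : L2Vec Ω) : E d → E d) x) e : ℝ) * φ x = 0 := by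
      filter_upwards [Lp.coeFn_zero (E d) 2 (volume.restrict Ω)] with x hx
      rw [hx]; exact (congrArg (· * φ x) (inner_zero_left e)).trans (zero_mul _)
    simp only [WithLp.zero_fst, WithLp.zero_snd]
    rw [integral_eq_zero_of_ae h1, integral_eq_zero_of_ae h2, neg_zero]
  add_mem' := by
    intro p q hp hq φ hφ hc hs e
    have h1 : (fun x => ((p.fst + q.fst : L2 Ω) : E d → ℝ) x * fderiv ℝ φ x e)
        =ᵐ[volume.restrict Ω]
        fun x => p.fst x * fderiv ℝ φ x e + q.fst x * fderiv ℝ φ x e := by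
      filter_upwards [Lp.coeFn_add p.fst q.fst] with x hx
      rw [hx, Pi.add_apply, add_mul]
    have h2 : (fun x => (inner ℝ (((p.snd + q.snd : L2Vec Ω) : E d → E d) x) e : ℝ) * φ x)
        =ᵐ[volume.restrict Ω]
        fun x => (inner ℝ (p.snd x) e : ℝ) * φ x + (inner ℝ (q.snd x) e : ℝ) * φ x := by
      filter_upwards [Lp.coeFn_add p.snd q.snd] with x hx
      rw [hx, Pi.add_apply, inner_add_left, add_mul]
    simp only [WithLp.add_fst, WithLp.add_snd]
    rw [integral_congr_ae h1, integral_congr_ae h2,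
      integral_add (integrable_left _ hφ hc e) (integrable_left _ hφ hc e),
      integral_add (integrable_right _ hφ hc e) (integrable_right _ hφ hc e),
      hp φ hφ hc hs e, hq φ hφ hc hs e, neg_add]
  smul_mem' := by
    intro c p hp φ hφ hc hs e
    have h1 : (fun x => ((c • p.fst : L2 Ω) : E d → ℝ) x * fderiv ℝ φ x e)
        =ᵐ[volume.restrict Ω] fun x => c * (p.fst x * fderiv ℝ φ x e) := by
      filter_upwards [Lp.coeFn_smul c p.fst] with x hx
      rw [hx, Pi.smul_apply, smul_eq_mul, mul_assoc]
    have h2 : (fun x => (inner ℝ (((c • p.snd : L2Vec Ω) : E d → E d) x) e : ℝ) * φ x)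
        =ᵐ[volume.restrict Ω] fun x => c * ((inner ℝ (p.snd x) e : ℝ) * φ x) := by
      filter_upwards [Lp.coeFn_smul c p.snd] with x hx
      rw [hx, Pi.smul_apply, real_inner_smul_left, mul_assoc]
    simp only [WithLp.smul_fst, WithLp.smul_snd]
    rw [integral_congr_ae h1, integral_congr_ae h2, integral_const_mul, integral_const_mul,
      hp φ hφ hc hs e, mul_neg]

/-- The function underlying an element of `H¹(Ω)`. -/
def val {d : ℕ} {Ω : Set (E d)} (u : H1 Ω) : L2 Ω := (u : WithLp 2 (L2 Ω × L2Vec Ω)).fst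

/-- The weak gradient of an element of `H¹(Ω)`. -/
def grad {d : ℕ} {Ω : Set (E d)} (u : H1 Ω) : L2Vec Ω :=
  (u : WithLp 2 (L2 Ω × L2Vec Ω)).snd

/-- The set of values `∫ f φ` for zero-mean `φ ∈ H¹(Ω)` with `∫ |∇φ|² ≤ 1`. -/
def dualPairings {d : ℕ} (Ω : Set (E d)) (f : L2 Ω) : Set ℝ :=
  {s | ∃ φ : H1 Ω, (∫ x in Ω, val φ x) = 0 ∧ (∫ x in Ω, ‖grad φ x‖ ^ 2) ≤ 1 ∧
    s = ∫ x in Ω, f x * val φ x}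

/-- The homogeneous negative Sobolev norm of `f ∈ L²(Ω)`. -/
def negSobolevNorm {d : ℕ} (Ω : Set (E d)) (f : L2 Ω) : ℝ := sSup (dualPairings Ω f)

/-! ### Controls -/

/-- The span `U` of the fields `b₁, …, bₘ`, inside `L²(Ω; ℝᵈ)`. -/
def controlSpace {d m : ℕ} (Ω : Set (E d)) (b : Fin m → E d → E d) :
    Submodule ℝ (L2Vec Ω) :=
  Submodule.span ℝ {f : L2Vec Ω | ∃ i, f =ᵐ[volume.restrict Ω] b i}

instance controlSpace_finiteDimensional {d m : ℕ} (Ω : Set (E d)) (b : Fin m → E d → E d) :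
    FiniteDimensional ℝ (controlSpace Ω b) := by
  apply FiniteDimensional.span_of_finite
  have h : {f : L2Vec Ω | ∃ i, f =ᵐ[volume.restrict Ω] b i}
      = ⋃ i, {f : L2Vec Ω | f =ᵐ[volume.restrict Ω] b i} := by
    ext f; simp
  rw [h]
  refine Set.finite_iUnion fun i => Set.Subsingleton.finite ?_
  intro f hf g hg
  have hf' : f =ᵐ[volume.restrict Ω] b i := hf
  have hg' : g =ᵐ[volume.restrict Ω] b i := hg
  exact Lp.ext (hf'.trans hg'.symm)

/-- The control space `L²((0,T); U)`. -/
abbrev Control {d m : ℕ} (Ω : Set (E d)) (b : Fin m → E d → E d) (T : ℝ) : Type :=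
  Lp (controlSpace Ω b) 2 (volume.restrict (Ioo (0 : ℝ) T))

/-- The velocity field `v(t, ·)` in `L²(Ω; ℝᵈ)`. -/
def velocity {d m : ℕ} {Ω : Set (E d)} {b : Fin m → E d → E d} {T : ℝ}
    (v : Control Ω b T) (t : ℝ) : L2Vec Ω := (v t : controlSpace Ω b)

/-! ### State, multiplier and adjoint equations -/

/-- `∫₀ᵀ ∫_Ω θ (-∂ₜφ - v · ∇φ) dx dt`. -/
def transportForm {d : ℕ} (Ω : Set (E d)) (T : ℝ) (v : ℝ → L2Vec Ω) (θ : ℝ → L2 Ω)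
    (φ : ℝ × E d → ℝ) : ℝ :=
  ∫ t in Ioo (0 : ℝ) T, ∫ x in Ω,
    θ t x * (- fderiv ℝ φ (t, x) (1, 0) - fderiv ℝ φ (t, x) (0, v t x))

/-- `θ ∈ C([0,T]; L²(Ω))` is a weak solution of `∂ₜθ + div(vθ) = 0`, `θ(0) = θ⁰`; the test
functions have compact support in `[0,T) × Ω`. -/
structure IsStateSolution {d : ℕ} (Ω : Set (E d)) (T : ℝ) (v : ℝ → L2Vec Ω) (θ₀ : E d → ℝ)
    (θ : ℝ → L2 Ω) : Prop where
  continuousOn : ContinuousOn θ (Icc 0 T)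
  weak : ∀ φ : ℝ × E d → ℝ, ContDiff ℝ ∞ φ → HasCompactSupport φ →
    tsupport φ ⊆ Iio T ×ˢ Ω →
    transportForm Ω T v θ φ = ∫ x in Ω, θ₀ x * φ (0, x)

/-- `ρ ∈ C([0,T]; H¹(Ω))` is a weak solution of `∂ₜρ + div(vρ) = 0`, `ρ(T) = η`; the test
functions have compact support in `(0,T] × Ω`. -/
structure IsAdjointSolution {d : ℕ} (Ω : Set (E d)) (T : ℝ) (v : ℝ → L2Vec Ω) (η : H1 Ω)
    (ρ : ℝ → H1 Ω) : Prop where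
  continuousOn : ContinuousOn ρ (Icc 0 T)
  weak : ∀ φ : ℝ × E d → ℝ, ContDiff ℝ ∞ φ → HasCompactSupport φ →
    tsupport φ ⊆ Ioi 0 ×ˢ Ω →
    transportForm Ω T v (fun t => val (ρ t)) φ = - ∫ x in Ω, val η x * φ (T, x)

/-- `η ∈ H¹(Ω)` is the weak solution of `-Δη = f` in `Ω` with homogeneous Neumann boundary
condition and zero mean. -/
structure IsNeumannSolution {d : ℕ} (Ω : Set (E d)) (f : L2 Ω) (η : H1 Ω) : Prop where
  mean_zero : (∫ x in Ω, val η x) = 0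
  weak : ∀ φ : H1 Ω, (∫ x in Ω, (inner ℝ (grad η x) (grad φ x) : ℝ)) = ∫ x in Ω, f x * val φ x

/-- The solution `θ(·; v)` of the state equation (an arbitrary function if there is none; existence
and uniqueness on `[0,T]` are to be shown). -/
def state {d m : ℕ} (Ω : Set (E d)) (b : Fin m → E d → E d) (T : ℝ) (θ₀ : E d → ℝ)
    (v : Control Ω b T) : ℝ → L2 Ω :=
  Classical.epsilon fun θ => IsStateSolution Ω T (velocity v) θ₀ θ

/-! ### Cost functional -/

/-- The cost `J(v) = ½ ‖θ(T; v)‖² + (γ/2) ∫₀ᵀ ‖v(t)‖² dt`, the first norm being the negative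
Sobolev norm and the second one that of `L²(Ω; ℝᵈ)`. -/
def cost {d m : ℕ} (Ω : Set (E d)) (b : Fin m → E d → E d) (T γ : ℝ) (θ₀ : E d → ℝ)
    (v : Control Ω b T) : ℝ :=
  1 / 2 * negSobolevNorm Ω (state Ω b T θ₀ v T) ^ 2
    + γ / 2 * ∫ t in Ioo (0 : ℝ) T, ‖velocity v t‖ ^ 2

/-- `F` is Gâteaux differentiable at `v` with gradient `G`: the directional derivative in every
direction `w` exists and equals `⟪G, w⟫`. -/
def HasGateauxGradientAt {H : Type*} [NormedAddCommGroup H] [InnerProductSpace ℝ H]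
    (F : H → ℝ) (G v : H) : Prop :=
  ∀ w : H, HasDerivAt (fun ε : ℝ => F (v + ε • w)) (inner ℝ G w) 0

/-- The map `P_U` applied at almost every time: `L²((0,T); L²(Ω; ℝᵈ)) → L²((0,T); U)`. -/
def projControl {d m : ℕ} (Ω : Set (E d)) (b : Fin m → E d → E d) (T : ℝ)
    (F : Lp (L2Vec Ω) 2 (volume.restrict (Ioo (0 : ℝ) T))) : Control Ω b T :=
  (controlSpace Ω b).orthogonalProjectionOnto.compLp F

/-- The inclusion `L²((0,T); U) → L²((0,T); L²(Ω; ℝᵈ))`. -/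
def inclControl {d m : ℕ} (Ω : Set (E d)) (b : Fin m → E d → E d) (T : ℝ)
    (v : Control Ω b T) : Lp (L2Vec Ω) 2 (volume.restrict (Ioo (0 : ℝ) T)) :=
  (controlSpace Ω b).subtypeL.compLp v

end

end MixingControl

open MixingControl

/-!
The control `𝐯` enters through finitely many divergence-free tangential fields, so along the flow
everything is governed by the operators `D(c)ψ = 𝐯_c · ∇ψ`, `c` a coefficient vector. The proof
rests on `D(c)` being skew-symmetric on all of `H¹(Ω)`, with no boundary term.

*The transport operator.* A Lipschitz domain is quasi-convex at small scale, so a field in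
`C¹(Ω̄)` is Lipschitz up to the boundary and extends to a bounded Lipschitz field on `ℝᵈ`. A
Lipschitz boundary has a normal at almost every point in graph coordinates. Tangency at those
points yields cutoffs `χ` with compact support in `Ω` along which `𝐯 · ∇χ` stays controlled
(`exists_tangentialCutoff`). Hence test functions are dense in `H¹` for the norm `‖w‖ + ‖𝐯 · ∇w‖`
(`fieldGraph_mem_closure`), and `inner_transportOp` follows by integrating by
parts against them.

*The two evolutions.* Both continuity equations are equivalent to the abstract weak evolution
`⟪θ(t) - θ(s), ψ⟫ = ∫ₛᵗ ⟪θ, D(c)ψ⟫` for all `ψ ∈ H¹` (`IsWeakEvolution`, `isStateSolution_iff`,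
`isAdjointSolution_iff`). For a continuous control it is solved by composing with the flow, which
preserves Lebesgue measure and `Ω` and, being Lipschitz, maps `H¹` to itself. A control in `L²` is
approximated by continuous ones, with bounds that depend only on its `L¹` norm in time
(`hasRegularEvolution`). The product of a weak evolution with an `H¹`-valued one satisfies a product
rule (`IsWeakEvolution.pairing_evolution`); since the `H¹`-valued evolutions reach every terminal
value in the dense space `H¹`, this gives uniqueness.

*The negative norm.* Overlapping charts link any two points of the connected domain, which gives
the Poincaré inequality (`poincare`). Lax–Milgram then gives the Neumann solution `η`, with
`‖f‖ = ‖∇η‖` for the negative norm (`negSobolevNorm_eq`), and an exact second-order expansion of its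
square (`negSobolevNorm_sq_eq`).

*The derivative.* Let `θ_ε` be the state for `𝐯 + ε𝐰`. The product rule with the adjoint state `ρ`
gives `⟪θ_ε(T) - θ(T), η⟫ = ε ∫ ⟪θ_ε, D(𝐰)ρ⟫`. As `ε → 0`, `θ_ε(t) → θ(t)` weakly with a uniform
bound, so the integral converges by dominated convergence; the quadratic term of the expansion is
`O(ε²)`, because pairing with any `H¹` function costs only `O(ε)`
(`hasDerivAt_negSobolevNorm_sq`). Finally `⟪θ, D(𝐰)ρ⟫ = ⟪θ∇ρ, 𝐰⟫`, and projecting onto `U` reads off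
the gradient.
-/

namespace MixingControl

/-! ### Mollification in `L²` -/

section Mollification

variable {d : ℕ} {F : Type*} [NormedAddCommGroup F] [InnerProductSpace ℝ F]

/-- Jensen's inequality for the square of the norm. -/
lemma enorm_integral_sq_le {α : Type*} [MeasurableSpace α] (ν : Measure α) [IsProbabilityMeasure ν]
    {f : α → F} (hf : AEMeasurable (fun x => ‖f x‖ₑ) ν) :
    ‖∫ x, f x ∂ν‖ₑ ^ 2 ≤ ∫⁻ x, ‖f x‖ₑ ^ 2 ∂ν := by
  have h := ENNReal.lintegral_mul_le_Lp_mul_Lq ν Real.HolderConjugate.two_two hf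
    (aemeasurable_const (b := (1 : ℝ≥0∞)))
  simp only [Pi.mul_apply, mul_one, ENNReal.one_rpow, lintegral_const, measure_univ] at h
  calc ‖∫ x, f x ∂ν‖ₑ ^ 2 ≤ (∫⁻ x, ‖f x‖ₑ ∂ν) ^ 2 := by
        gcongr; exact enorm_integral_le_lintegral_enorm f
    _ ≤ ((∫⁻ x, ‖f x‖ₑ ^ (2 : ℝ) ∂ν) ^ (1 / (2 : ℝ))) ^ 2 := by gcongr
    _ = ∫⁻ x, ‖f x‖ₑ ^ 2 ∂ν := by
        rw [← ENNReal.rpow_natCast, ← ENNReal.rpow_mul]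
        norm_num

/-- Convolution with a normalised bump function. -/
noncomputable def mollify (ρ : ContDiffBump (0 : E d)) (f : E d → F) : E d → F :=
  convolution (ρ.normed volume) f (ContinuousLinearMap.lsmul ℝ ℝ) volume

lemma mollify_apply (ρ : ContDiffBump (0 : E d)) (f : E d → F) (x : E d) :
    mollify ρ f x = ∫ t, ρ.normed volume t • f (x - t) := by
  simp [mollify, convolution_def]

/-- Young's inequality: mollification does not increase the `L²` norm. -/
lemma eLpNorm_mollify_le (ρ : ContDiffBump (0 : E d)) {f : E d → F}
    (hf : AEStronglyMeasurable f volume) :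
    eLpNorm (mollify ρ f) 2 volume ≤ eLpNorm f 2 volume := by
  -- the mollification averages the translates of `f` with respect to the probability measure `ν`
  set w : E d → ℝ≥0∞ := fun t => ENNReal.ofReal (ρ.normed volume t) with hw
  have hwm : Measurable w := ENNReal.measurable_ofReal.comp ρ.continuous_normed.measurable
  set ν : Measure (E d) := volume.withDensity w with hν
  have hprob : IsProbabilityMeasure ν := by
    constructor
    rw [hν, withDensity_apply _ MeasurableSet.univ, Measure.restrict_univ, hw,
      ← ofReal_integral_eq_lintegral_ofReal ρ.integrable_normed
        (Eventually.of_forall ρ.nonneg_normed), ρ.integral_normed, ENNReal.ofReal_one]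
  have hmol : ∀ x, mollify ρ f x = ∫ t, f (x - t) ∂ν := by
    intro x
    rw [mollify_apply, hν, integral_withDensity_eq_integral_toReal_smul hwm
      (Eventually.of_forall fun _ => ENNReal.ofReal_lt_top)]
    refine integral_congr_ae (Eventually.of_forall fun t => ?_)
    simp only [hw]
    rw [ENNReal.toReal_ofReal (ρ.nonneg_normed t)]
  have hac : ν ≪ volume := withDensity_absolutelyContinuous _ _
  have hjoint : AEStronglyMeasurable (fun p : E d × E d => f (p.1 - p.2))
      ((volume : Measure (E d)).prod ν) := by
    have h1 : AEStronglyMeasurable (fun p : E d × E d => f (p.1 - p.2))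
        ((volume : Measure (E d)).prod volume) :=
      hf.comp_quasiMeasurePreserving (quasiMeasurePreserving_sub_of_right_invariant _ _)
    exact h1.mono_ac (Measure.AbsolutelyContinuous.rfl.prod hac)
  have hsl : ∀ x, AEMeasurable (fun t => ‖f (x - t)‖ₑ) ν := by
    intro x
    have : AEStronglyMeasurable (fun t => f (x - t)) volume :=
      hf.comp_quasiMeasurePreserving (quasiMeasurePreserving_sub_left volume x)
    exact (this.mono_ac hac).enorm
  rw [eLpNorm_eq_lintegral_rpow_enorm_toReal (by norm_num) (by norm_num),
    eLpNorm_eq_lintegral_rpow_enorm_toReal (by norm_num) (by norm_num)]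
  simp only [ENNReal.toReal_ofNat, ENNReal.rpow_ofNat]
  gcongr ?_ ^ _
  calc ∫⁻ x, ‖mollify ρ f x‖ₑ ^ 2 ≤ ∫⁻ x, ∫⁻ t, ‖f (x - t)‖ₑ ^ 2 ∂ν := by
        refine lintegral_mono fun x => ?_
        simp only [hmol x]
        exact enorm_integral_sq_le ν (hsl x)
    _ = ∫⁻ t, ∫⁻ x, ‖f (x - t)‖ₑ ^ 2 ∂volume ∂ν :=
        lintegral_lintegral_swap (hjoint.enorm.pow_const 2)
    _ = ∫⁻ t, ∫⁻ x, ‖f x‖ₑ ^ 2 ∂volume ∂ν := by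
        refine lintegral_congr fun t => ?_
        exact lintegral_sub_right_eq_self (fun x => ‖f x‖ₑ ^ 2) t
    _ = ∫⁻ x, ‖f x‖ₑ ^ 2 := by simp

lemma mollify_sub (ρ : ContDiffBump (0 : E d)) {f g : E d → F}
    (hf : LocallyIntegrable f volume) (hg : LocallyIntegrable g volume) :
    mollify ρ (f - g) = mollify ρ f - mollify ρ g := by
  funext x
  have H : ∀ {h : E d → F}, LocallyIntegrable h volume →
      ConvolutionExistsAt (ρ.normed volume) h x (ContinuousLinearMap.lsmul ℝ ℝ) volume :=
    fun hh => ρ.hasCompactSupport_normed.convolutionExists_left _ ρ.continuous_normed hh x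
  have h1 := H hf
  have h2 := H hg
  simp only [ConvolutionExistsAt, ContinuousLinearMap.lsmul_apply] at h1 h2
  rw [Pi.sub_apply, mollify_apply, mollify_apply, mollify_apply, ← integral_sub h1 h2]
  simp [smul_sub]

lemma tsupport_mollify_subset (ρ : ContDiffBump (0 : E d)) {f : E d → F} {K : Set (E d)}
    (hf : ∀ x ∉ K, f x = 0) :
    tsupport (mollify ρ f) ⊆ Metric.cthickening ρ.rOut K := by
  refine closure_minimal ?_ Metric.isClosed_cthickening
  refine (support_convolution_subset _).trans ?_
  rintro x ⟨a, ha, b, hb, rfl⟩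
  rw [ρ.support_normed_eq] at ha
  have hbK : b ∈ K := by by_contra h; exact hb (hf b h)
  refine Metric.mem_cthickening_of_dist_le _ b _ _ hbK ?_
  simpa [dist_eq_norm] using (mem_ball_zero_iff.1 ha).le

/-- Mollification converges in `L²` as the radius of the bump tends to `0`. -/
lemma tendsto_eLpNorm_mollify_sub [CompleteSpace F] {ρ : ℕ → ContDiffBump (0 : E d)}
    (hρ : Tendsto (fun n => (ρ n).rOut) atTop (𝓝 0)) {f : E d → F} (hf : MemLp f 2 volume) :
    Tendsto (fun n => eLpNorm (mollify (ρ n) f - f) 2 volume) atTop (𝓝 0) := by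
  have hfl : LocallyIntegrable f volume := hf.locallyIntegrable (by norm_num)
  rw [ENNReal.tendsto_nhds_zero]
  intro ε hε
  by_cases hεtop : ε = ⊤
  · simp [hεtop]
  have hε3 : ε / 3 ≠ 0 := (ENNReal.div_pos hε.ne' (by norm_num)).ne'
  -- `f` is replaced by a continuous, compactly supported `g`; the difference is controlled by
  -- Young's inequality
  obtain ⟨g, hgc, hgε, hgcont, hgL⟩ := hf.exists_hasCompactSupport_eLpNorm_sub_le (by norm_num) hε3
  have hgl : LocallyIntegrable g volume := hgL.locallyIntegrable (by norm_num)
  -- uniform convergence for the compactly supported continuous approximation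
  set K' := Metric.cthickening 1 (tsupport g) with hK'
  have hK'c : IsCompact K' := hgc.isCompact.cthickening
  obtain ⟨η, hη, hηε⟩ : ∃ η : ℝ, 0 < η ∧ ENNReal.ofReal η * volume K' ^ (1 / (2 : ℝ)) ≤ ε / 3 := by
    have hfin : volume K' ^ (1 / (2 : ℝ)) ≠ ⊤ :=
      ENNReal.rpow_ne_top_of_nonneg (by norm_num) hK'c.measure_lt_top.ne
    obtain ⟨η, hη, h⟩ : ∃ η : NNReal, 0 < η ∧ (η : ℝ≥0∞) * volume K' ^ (1 / (2 : ℝ)) < ε / 3 :=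
      ENNReal.exists_nnreal_pos_mul_lt hfin hε3
    exact ⟨η, hη, by simpa using h.le⟩
  have huc : UniformContinuous g := hgc.uniformContinuous_of_continuous hgcont
  obtain ⟨δ, hδ, hδg⟩ := Metric.uniformContinuous_iff.1 huc η hη
  have hev : ∀ᶠ n in atTop, (ρ n).rOut < min δ 1 := by
    have := (tendsto_order.1 hρ).2 (min δ 1) (by positivity)
    exact this
  filter_upwards [hev] with n hn
  have hgn : eLpNorm (mollify (ρ n) g - g) 2 volume ≤ ε / 3 := by
    have hsupp : ∀ x ∉ K', (mollify (ρ n) g - g) x = 0 := by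
      intro x hx
      have h1 : mollify (ρ n) g x = 0 := by
        refine image_eq_zero_of_notMem_tsupport fun h => hx ?_
        refine Metric.cthickening_mono (le_of_lt (lt_of_lt_of_le hn (min_le_right _ _))) _
          (tsupport_mollify_subset (ρ n)
            (fun y hy => image_eq_zero_of_notMem_tsupport hy) h)
      have h2 : g x = 0 := image_eq_zero_of_notMem_tsupport fun h =>
        hx (Metric.self_subset_cthickening _ h)
      simp [h1, h2]
    have hbd : ∀ x, ‖(mollify (ρ n) g - g) x‖ ≤ η := by
      intro x
      rw [Pi.sub_apply, ← dist_eq_norm]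
      refine (ρ n).dist_normed_convolution_le hgcont.aestronglyMeasurable fun y hy => ?_
      exact (hδg (lt_of_lt_of_le (Metric.mem_ball.1 hy)
        (hn.le.trans (min_le_left _ _)))).le
    have : (mollify (ρ n) g - g) = K'.indicator (mollify (ρ n) g - g) := by
      funext x
      by_cases hx : x ∈ K'
      · rw [indicator_of_mem hx]
      · rw [indicator_of_notMem hx, hsupp x hx]
    rw [this, eLpNorm_indicator_eq_eLpNorm_restrict Metric.isClosed_cthickening.measurableSet]
    refine (eLpNorm_le_of_ae_bound (Eventually.of_forall hbd)).trans ?_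
    rw [Measure.restrict_apply_univ, mul_comm]
    simpa using hηε
  have hdec : mollify (ρ n) f - f = mollify (ρ n) (f - g) + (mollify (ρ n) g - g) - (f - g) := by
    rw [mollify_sub _ hfl hgl]; abel
  have hmm : ∀ {h : E d → F}, LocallyIntegrable h volume →
      AEStronglyMeasurable (mollify (ρ n) h) volume := fun hh =>
    ((ρ n).hasCompactSupport_normed.continuous_convolution_left _
      (ρ n).continuous_normed hh).aestronglyMeasurable
  have m1 := hmm (hfl.sub hgl)
  have m2 := (hmm hgl).sub hgcont.aestronglyMeasurable
  have m3 := hf.1.sub hgcont.aestronglyMeasurable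
  rw [hdec]
  calc _ ≤ eLpNorm (mollify (ρ n) (f - g) + (mollify (ρ n) g - g)) 2 volume
        + eLpNorm (f - g) 2 volume := eLpNorm_sub_le (m1.add m2) m3 (by norm_num)
    _ ≤ (eLpNorm (mollify (ρ n) (f - g)) 2 volume + eLpNorm (mollify (ρ n) g - g) 2 volume)
        + eLpNorm (f - g) 2 volume := by
        gcongr; exact eLpNorm_add_le m1 m2 (by norm_num)
    _ ≤ (ε / 3 + ε / 3) + ε / 3 := by
        gcongr
        exact (eLpNorm_mollify_le _ m3).trans hgε
    _ = ε := by rw [ENNReal.add_thirds]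

end Mollification


/-! ### Weak gradients, Lipschitz test functions and cutoffs -/

section WeakGradient

variable {d : ℕ}

lemma inner_gradient (φ : E d → ℝ) (x e : E d) : inner ℝ (gradient φ x) e = fderiv ℝ φ x e := by
  simp [gradient]

lemma norm_gradient (φ : E d → ℝ) (x : E d) : ‖gradient φ x‖ = ‖fderiv ℝ φ x‖ := by
  simp [gradient]

lemma measurable_gradient (φ : E d → ℝ) : Measurable (gradient φ) := by
  have h : Continuous (InnerProductSpace.toDual ℝ (E d)).symm :=
    (InnerProductSpace.toDual ℝ (E d)).symm.continuous
  exact h.measurable.comp (measurable_fderiv ℝ φ)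

lemma continuous_gradient {φ : E d → ℝ} (hφ : ContDiff ℝ ∞ φ) : Continuous (gradient φ) :=
  (InnerProductSpace.toDual ℝ (E d)).symm.continuous.comp (hφ.continuous_fderiv (by simp))

lemma gradient_eq_zero_of_notMem_tsupport {φ : E d → ℝ} {x : E d} (hx : x ∉ tsupport φ) :
    gradient φ x = 0 := by
  have : fderiv ℝ φ x = 0 := image_eq_zero_of_notMem_tsupport
    fun h => hx (tsupport_fderiv_subset ℝ h)
  simp [gradient, this]

lemma hasCompactSupport_gradient {φ : E d → ℝ} (hc : HasCompactSupport φ) :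
    HasCompactSupport (gradient φ) :=
  HasCompactSupport.intro hc.isCompact fun _ hx => gradient_eq_zero_of_notMem_tsupport hx

lemma memLp_gradient {φ : E d → ℝ} (hφ : ContDiff ℝ ∞ φ) (hc : HasCompactSupport φ) :
    MemLp (gradient φ) 2 volume :=
  (continuous_gradient hφ).memLp_of_hasCompactSupport (hasCompactSupport_gradient hc)

/-- A test function on `Ω`: smooth, with compact support in `Ω`. -/
structure IsTest (Ω : Set (E d)) (φ : E d → ℝ) : Prop where
  contDiff : ContDiff ℝ ∞ φ
  compact : HasCompactSupport φ
  subset : tsupport φ ⊆ Ω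

lemma IsTest.memLp {Ω : Set (E d)} {φ : E d → ℝ} (h : IsTest Ω φ) : MemLp φ 2 volume :=
  h.contDiff.continuous.memLp_of_hasCompactSupport h.compact

lemma IsTest.memLp_gradient {Ω : Set (E d)} {φ : E d → ℝ} (h : IsTest Ω φ) :
    MemLp (gradient φ) 2 volume := MixingControl.memLp_gradient h.contDiff h.compact

lemma IsTest.lipschitz {Ω : Set (E d)} {φ : E d → ℝ} (h : IsTest Ω φ) :
    ∃ K, LipschitzWith K φ := h.contDiff.lipschitzWith_of_hasCompactSupport h.compact (by simp)

/-- Pairings with a fixed `L²` function are continuous along `L²` convergence. -/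
lemma tendsto_integral_inner {α F : Type*} [MeasurableSpace α] {ν : Measure α}
    [NormedAddCommGroup F] [InnerProductSpace ℝ F] {h f : α → F} {u : ℕ → α → F}
    (hh : MemLp h 2 ν) (hf : MemLp f 2 ν) (hu : ∀ n, MemLp (u n) 2 ν)
    (hlim : Tendsto (fun n => eLpNorm (u n - f) 2 ν) atTop (𝓝 0)) :
    Tendsto (fun n => ∫ x, inner ℝ (h x) (u n x) ∂ν) atTop (𝓝 (∫ x, inner ℝ (h x) (f x) ∂ν)) := by
  have key : ∀ {g : α → F} (hg : MemLp g 2 ν),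
      ∫ x, inner ℝ (h x) (g x) ∂ν = inner ℝ (hh.toLp h) (hg.toLp g) := by
    intro g hg
    rw [L2.inner_def]
    refine integral_congr_ae ?_
    filter_upwards [hh.coeFn_toLp, hg.coeFn_toLp] with x h1 h2
    rw [h1, h2]
  have hL : Tendsto (fun n => (hu n).toLp (u n)) atTop (𝓝 (hf.toLp f)) :=
    (Lp.tendsto_Lp_iff_tendsto_eLpNorm'' _ hu _ hf).2 hlim
  simp only [key hf, key (hu _)]
  exact tendsto_const_nhds.inner hL

lemma tendsto_eLpNorm_restrict {α F : Type*} [MeasurableSpace α] {ν : Measure α} {s : Set α}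
    [NormedAddCommGroup F] {u : ℕ → α → F}
    (h : Tendsto (fun n => eLpNorm (u n) 2 ν) atTop (𝓝 0)) :
    Tendsto (fun n => eLpNorm (u n) 2 (ν.restrict s)) atTop (𝓝 0) :=
  tendsto_of_tendsto_of_tendsto_of_le_of_le tendsto_const_nhds h (fun _ => zero_le)
    fun _ => eLpNorm_mono_measure _ Measure.restrict_le_self

/-- The gradient of a mollified function is the mollified weak gradient. -/
lemma gradient_mollify (ρ : ContDiffBump (0 : E d)) {u : E d → ℝ} {g : E d → E d}
    (hu : LocallyIntegrable u volume) (hg : LocallyIntegrable g volume)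
    (hw : ∀ φ : E d → ℝ, ContDiff ℝ ∞ φ → HasCompactSupport φ → ∀ e : E d,
      (∫ x, u x * fderiv ℝ φ x e) = - ∫ x, inner ℝ (g x) e * φ x) (x : E d) :
    gradient (mollify ρ u) x = mollify ρ g x := by
  set L := ContinuousLinearMap.lsmul (E := ℝ) ℝ ℝ with hL
  set r : E d → ℝ := ρ.normed volume with hr
  have hrs : ContDiff ℝ ∞ r := ρ.contDiff_normed
  have hrc : HasCompactSupport r := ρ.hasCompactSupport_normed
  have hder : HasFDerivAt (mollify ρ u) ((convolution (fderiv ℝ r) u (L.precompL (E d)) volume) x)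
      x := hrc.hasFDerivAt_convolution_left L (hrs.of_le (by simp)) hu x
  refine ext_inner_right ℝ fun e => ?_
  rw [inner_gradient, hder.fderiv]
  -- the test function whose derivative produces the convolution kernel at `x`
  have hφs : ContDiff ℝ ∞ (fun y => r (x - y)) := hrs.comp (contDiff_const.sub contDiff_id)
  have hφc : HasCompactSupport (fun y => r (x - y)) :=
    hrc.comp_homeomorph (Homeomorph.subLeft x)
  have hφd : ∀ y, fderiv ℝ (fun y => r (x - y)) y e = - fderiv ℝ r (x - y) e := by
    intro y
    have h1 : HasFDerivAt (fun y => x - y) (-(ContinuousLinearMap.id ℝ (E d))) y := by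
      simpa using (hasFDerivAt_id y).const_sub x
    have h2 := ((hrs.differentiable (by simp)) (x - y)).hasFDerivAt.comp y h1
    have h3 : (fun y => r (x - y)) = r ∘ fun y => x - y := rfl
    rw [h3, h2.fderiv]
    simp
  have hex : ConvolutionExistsAt (fderiv ℝ r) u x (L.precompL (E d)) volume :=
    (hrc.fderiv (𝕜 := ℝ)).convolutionExists_left _ (hrs.continuous_fderiv (by simp)) hu x
  have hexg : ConvolutionExistsAt r g x (ContinuousLinearMap.lsmul (E := E d) ℝ ℝ) volume :=
    hrc.convolutionExists_left _ hrs.continuous hg x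
  have e1 : (convolution (fderiv ℝ r) u (L.precompL (E d)) volume x) e
      = ∫ y, u y * fderiv ℝ r (x - y) e := by
    rw [convolution_eq_swap, ContinuousLinearMap.integral_apply hex.integrable_swap]
    refine integral_congr_ae (Eventually.of_forall fun y => ?_)
    simp [hL, ContinuousLinearMap.precompL_apply, mul_comm]
  have e2 : inner ℝ (mollify ρ g x) e = ∫ y, inner ℝ (g y) e * r (x - y) := by
    have : mollify ρ g x = ∫ y, r (x - y) • g y := by
      rw [mollify, convolution_eq_swap]; rfl
    have hi : Integrable (fun y => r (x - y) • g y) volume := hexg.integrable_swap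
    rw [this, real_inner_comm, ← integral_inner hi]
    refine integral_congr_ae (Eventually.of_forall fun y => ?_)
    simp only [inner_smul_right, real_inner_comm e]
    exact mul_comm _ _
  rw [e1, e2]
  have := hw _ hφs hφc e
  simp only [hφd, mul_neg, integral_neg] at this
  exact neg_inj.1 this

/-- Bump functions with radius tending to zero. -/
noncomputable def stdBump (d : ℕ) (n : ℕ) : ContDiffBump (0 : E d) where
  rIn := 1 / (2 * (n + 1))
  rOut := 1 / (n + 1)
  rIn_pos := by positivity
  rIn_lt_rOut := by
    have : (0 : ℝ) < n + 1 := by positivity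
    exact one_div_lt_one_div_of_lt this (by linarith)

lemma tendsto_stdBump_rOut (d : ℕ) : Tendsto (fun n => (stdBump d n).rOut) atTop (𝓝 0) :=
  tendsto_one_div_add_atTop_nhds_zero_nat

/-- A compactly supported `H¹` function is the limit, in `H¹`, of test functions. -/
lemma exists_test_approx {Ω K : Set (E d)} (hΩ : IsOpen Ω) (hK : IsCompact K) (hKΩ : K ⊆ Ω)
    {u : E d → ℝ} {g : E d → E d} (hu : MemLp u 2 volume) (hg : MemLp g 2 volume)
    (hu0 : ∀ x ∉ K, u x = 0)
    (hw : ∀ φ : E d → ℝ, ContDiff ℝ ∞ φ → HasCompactSupport φ → ∀ e : E d,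
      (∫ x, u x * fderiv ℝ φ x e) = - ∫ x, inner ℝ (g x) e * φ x) :
    ∃ φ : ℕ → E d → ℝ, (∀ n, IsTest Ω (φ n)) ∧
      Tendsto (fun n => eLpNorm (φ n - u) 2 volume) atTop (𝓝 0) ∧
      Tendsto (fun n => eLpNorm (gradient (φ n) - g) 2 volume) atTop (𝓝 0) := by
  obtain ⟨δ, hδ, hδΩ⟩ := hK.exists_cthickening_subset_open hΩ hKΩ
  obtain ⟨N, hN⟩ := eventually_atTop.1 ((tendsto_order.1 (tendsto_stdBump_rOut d)).2 δ hδ)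
  have hul : LocallyIntegrable u volume := hu.locallyIntegrable (by norm_num)
  have hgl : LocallyIntegrable g volume := hg.locallyIntegrable (by norm_num)
  have hlim : Tendsto (fun n => (stdBump d (n + N)).rOut) atTop (𝓝 0) :=
    (tendsto_stdBump_rOut d).comp (tendsto_add_atTop_nat N)
  refine ⟨fun n => mollify (stdBump d (n + N)) u, fun n => ?_,
    tendsto_eLpNorm_mollify_sub hlim hu, ?_⟩
  · have hs := tsupport_mollify_subset (stdBump d (n + N)) hu0
    refine ⟨?_, ?_, ?_⟩
    · exact (stdBump d (n + N)).hasCompactSupport_normed.contDiff_convolution_left _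
        (stdBump d (n + N)).contDiff_normed hul
    · exact hK.cthickening.of_isClosed_subset (isClosed_tsupport _) hs
    · exact hs.trans ((Metric.cthickening_mono (hN _ (by omega)).le K).trans hδΩ)
  · have : ∀ n, gradient (mollify (stdBump d (n + N)) u) = mollify (stdBump d (n + N)) g :=
      fun n => funext fun x => gradient_mollify _ hul hgl hw x
    simp only [this]
    exact tendsto_eLpNorm_mollify_sub hlim hg

lemma norm_gradient_le_of_lipschitz {K : NNReal} {ξ : E d → ℝ} (hξ : LipschitzWith K ξ) (x : E d) :
    ‖gradient ξ x‖ ≤ K := by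
  rw [norm_gradient]; exact norm_fderiv_le_of_lipschitz ℝ hξ

/-- The pointwise gradient of a Lipschitz function is its weak gradient. -/
lemma integral_lipschitz_mul_fderiv {K : NNReal} {ξ : E d → ℝ} (hξ : LipschitzWith K ξ)
    {φ : E d → ℝ} (hφ : ContDiff ℝ ∞ φ) (hc : HasCompactSupport φ) (e : E d) :
    (∫ x, ξ x * fderiv ℝ φ x e) = - ∫ x, inner ℝ (gradient ξ x) e * φ x := by
  obtain ⟨C, hC⟩ := hφ.lipschitzWith_of_hasCompactSupport hc (by simp)
  have h := hξ.integral_lineDeriv_mul_eq (μ := volume) hC hc e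
  have h1 : ∫ x, lineDeriv ℝ ξ x e * φ x = ∫ x, inner ℝ (gradient ξ x) e * φ x := by
    refine integral_congr_ae ?_
    filter_upwards [hξ.ae_differentiableAt] with x hx
    rw [hx.lineDeriv_eq_fderiv, inner_gradient]
  have h2 : ∫ x, lineDeriv ℝ φ x (-e) * ξ x = - ∫ x, ξ x * fderiv ℝ φ x e := by
    rw [← integral_neg]
    refine integral_congr_ae (Eventually.of_forall fun x => ?_)
    simp only [((hφ.differentiable (by simp)) x).lineDeriv_eq_fderiv, map_neg]
    ring
  rw [← h1, h, h2, neg_neg]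

lemma memLp_lipschitz {K : NNReal} {ξ : E d → ℝ} (hξ : LipschitzWith K ξ)
    (hc : HasCompactSupport ξ) : MemLp ξ 2 volume :=
  hξ.continuous.memLp_of_hasCompactSupport hc

lemma memLp_gradient_lipschitz {K : NNReal} {ξ : E d → ℝ} (hξ : LipschitzWith K ξ)
    (hc : HasCompactSupport ξ) : MemLp (gradient ξ) 2 volume := by
  have h : MemLp (gradient ξ) ∞ volume := memLp_top_of_bound
    (measurable_gradient ξ).aestronglyMeasurable K
    (Eventually.of_forall (norm_gradient_le_of_lipschitz hξ))
  exact h.mono_exponent_of_measure_support_ne_top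
    (fun x hx => gradient_eq_zero_of_notMem_tsupport hx) hc.isCompact.measure_lt_top.ne le_top

/-- The defining identity of the weak gradient extends to Lipschitz test functions. -/
lemma weakGradient_lipschitz {Ω : Set (E d)} (hΩ : IsOpen Ω) {u : L2 Ω} {g : L2Vec Ω}
    (h : IsWeakGradient Ω u g) {K : NNReal} {ξ : E d → ℝ} (hξ : LipschitzWith K ξ)
    (hc : HasCompactSupport ξ) (hs : tsupport ξ ⊆ Ω) (e : E d) :
    (∫ x in Ω, u x * fderiv ℝ ξ x e) = - ∫ x in Ω, (inner ℝ (g x) e : ℝ) * ξ x := by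
  -- approximation of `ξ` by mollified test functions, in the norm of `H¹`
  obtain ⟨φ, hφ, hφ1, hφ2⟩ := exists_test_approx hΩ hc.isCompact hs (memLp_lipschitz hξ hc)
    (memLp_gradient_lipschitz hξ hc) (fun x hx => image_eq_zero_of_notMem_tsupport hx)
    (fun φ hφ hφc e => integral_lipschitz_mul_fderiv hξ hφ hφc e)
  have hue : MemLp (fun x => u x • e) 2 (volume.restrict Ω) :=
    (ContinuousLinearMap.toSpanSingleton ℝ e).comp_memLp' (Lp.memLp u)
  have t1 := tendsto_integral_inner hue ((memLp_gradient_lipschitz hξ hc).restrict Ω)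
    (fun n => ((hφ n).memLp_gradient).restrict Ω) (tendsto_eLpNorm_restrict hφ2)
  have t2 := tendsto_integral_inner ((Lp.memLp g).inner_const (𝕜 := ℝ) e)
    ((memLp_lipschitz hξ hc).restrict Ω)
    (fun n => ((hφ n).memLp).restrict Ω) (tendsto_eLpNorm_restrict hφ1)
  have hl : ∀ ζ : E d → ℝ, ∀ x, inner ℝ (u x • e) (gradient ζ x) = u x * fderiv ℝ ζ x e := by
    intro ζ x
    rw [real_inner_smul_left, real_inner_comm, inner_gradient]
  have hr : ∀ ζ : E d → ℝ, ∀ x, inner ℝ (inner ℝ (g x) e : ℝ) (ζ x)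
      = (inner ℝ (g x) e : ℝ) * ζ x := fun ζ x => mul_comm _ _
  simp only [hl] at t1
  simp only [hr] at t2
  refine tendsto_nhds_unique t1 ?_
  have := t2.neg
  refine this.congr fun n => ?_
  exact (h (φ n) (hφ n).contDiff (hφ n).compact (hφ n).subset e).symm

end WeakGradient


/-! ### The Hilbert space `H¹(Ω)` -/

section SobolevSpace

variable {d : ℕ} {Ω : Set (E d)}

/-- The map `u ↦ u` from `H¹(Ω)` to `L²(Ω)`. -/
noncomputable def valL (Ω : Set (E d)) : H1 Ω →L[ℝ] L2 Ω :=
  (WithLp.fstL 2 ℝ (L2 Ω) (L2Vec Ω)).comp (H1 Ω).subtypeL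

/-- The weak gradient, from `H¹(Ω)` to `L²(Ω; ℝᵈ)`. -/
noncomputable def gradL (Ω : Set (E d)) : H1 Ω →L[ℝ] L2Vec Ω :=
  (WithLp.sndL 2 ℝ (L2 Ω) (L2Vec Ω)).comp (H1 Ω).subtypeL

@[simp] lemma valL_apply (u : H1 Ω) : valL Ω u = val u := rfl
@[simp] lemma gradL_apply (u : H1 Ω) : gradL Ω u = grad u := rfl

lemma norm_sq_H1 (u : H1 Ω) : ‖u‖ ^ 2 = ‖val u‖ ^ 2 + ‖grad u‖ ^ 2 := by
  have := WithLp.prod_norm_sq_eq_of_L2 (u : WithLp 2 (L2 Ω × L2Vec Ω))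
  exact this

lemma isWeakGradient_grad (u : H1 Ω) : IsWeakGradient Ω (val u) (grad u) := u.2

lemma inner_L2_eq (u v : L2 Ω) : inner ℝ u v = ∫ x in Ω, u x * v x := by
  rw [L2.inner_def]
  exact integral_congr_ae (Eventually.of_forall fun x => mul_comm _ _)

lemma inner_L2Vec_eq (u v : L2Vec Ω) : inner ℝ u v = ∫ x in Ω, inner ℝ (u x) (v x) :=
  L2.inner_def _ _

lemma norm_sq_L2Vec (u : L2Vec Ω) : ‖u‖ ^ 2 = ∫ x in Ω, ‖u x‖ ^ 2 := by
  rw [← real_inner_self_eq_norm_sq, inner_L2Vec_eq]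
  simp

lemma integral_mul_toLp (u : L2 Ω) {f : E d → ℝ} (hf : MemLp f 2 (volume.restrict Ω)) :
    ∫ x in Ω, u x * f x = inner ℝ u (hf.toLp f) := by
  rw [inner_L2_eq]
  refine integral_congr_ae ?_
  filter_upwards [hf.coeFn_toLp] with x hx
  rw [hx]

lemma memLp_smul_test {φ : E d → ℝ} (hφ : Continuous φ) (hc : HasCompactSupport φ) (e : E d) :
    MemLp (fun x => φ x • e) 2 (volume.restrict Ω) :=
  ((ContinuousLinearMap.toSpanSingleton ℝ e).comp_memLp'
    (hφ.memLp_of_hasCompactSupport hc)).restrict Ω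

lemma integral_inner_mul_toLp (g : L2Vec Ω) {φ : E d → ℝ} (hφ : Continuous φ)
    (hc : HasCompactSupport φ) (e : E d) :
    ∫ x in Ω, (inner ℝ (g x) e : ℝ) * φ x = inner ℝ g ((memLp_smul_test hφ hc e).toLp _) := by
  rw [inner_L2Vec_eq]
  refine integral_congr_ae ?_
  filter_upwards [(memLp_smul_test (Ω := Ω) hφ hc e).coeFn_toLp] with x hx
  rw [hx, real_inner_smul_right, mul_comm]

lemma isClosed_H1 (Ω : Set (E d)) :
    IsClosed ((H1 Ω : Submodule ℝ (WithLp 2 (L2 Ω × L2Vec Ω))) : Set (WithLp 2 (L2 Ω × L2Vec Ω))) := by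
  have : ((H1 Ω : Submodule ℝ (WithLp 2 (L2 Ω × L2Vec Ω))) : Set (WithLp 2 (L2 Ω × L2Vec Ω))) =
      ⋂ (φ : E d → ℝ) (_ : ContDiff ℝ ∞ φ) (_ : HasCompactSupport φ) (_ : tsupport φ ⊆ Ω)
        (e : E d), {p : WithLp 2 (L2 Ω × L2Vec Ω) | (∫ x in Ω, p.fst x * fderiv ℝ φ x e)
          = - ∫ x in Ω, (inner ℝ (p.snd x) e : ℝ) * φ x} := by
    ext p
    simp only [mem_iInter]
    rfl
  rw [this]
  refine isClosed_iInter fun φ => isClosed_iInter fun hφ => isClosed_iInter fun hc =>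
    isClosed_iInter fun _ => isClosed_iInter fun e => ?_
  have hf : MemLp (fun x => fderiv ℝ φ x e) 2 (volume.restrict Ω) :=
    (((hφ.continuous_fderiv (by simp)).clm_apply continuous_const).memLp_of_hasCompactSupport
      (hc.fderiv_apply (𝕜 := ℝ) e)).restrict Ω
  simp only [integral_mul_toLp _ hf, integral_inner_mul_toLp _ hφ.continuous hc e]
  refine isClosed_eq ?_ ?_
  · exact ((WithLp.fstL 2 ℝ (L2 Ω) (L2Vec Ω)).continuous).inner continuous_const
  · exact (((WithLp.sndL 2 ℝ (L2 Ω) (L2Vec Ω)).continuous).inner continuous_const).neg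

instance instCompleteSpaceH1 : CompleteSpace (H1 Ω) := (isClosed_H1 Ω).completeSpace_coe

/-- An element of `H¹(Ω)` from a function and its weak gradient. -/
noncomputable def mkH1 {u : E d → ℝ} {g : E d → E d} (hu : MemLp u 2 (volume.restrict Ω))
    (hg : MemLp g 2 (volume.restrict Ω))
    (h : ∀ φ : E d → ℝ, IsTest Ω φ → ∀ e : E d,
      (∫ x in Ω, u x * fderiv ℝ φ x e) = - ∫ x in Ω, (inner ℝ (g x) e : ℝ) * φ x) : H1 Ω :=
  ⟨WithLp.toLp 2 (hu.toLp u, hg.toLp g), by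
    intro φ hφ hc hs e
    rw [integral_congr_ae (g := fun x => u x * fderiv ℝ φ x e), h φ ⟨hφ, hc, hs⟩ e]
    · congr 1
      refine integral_congr_ae ?_
      filter_upwards [hg.coeFn_toLp] with x hx
      simp [hx]
    · filter_upwards [hu.coeFn_toLp] with x hx
      simp [hx]⟩

section mk

variable {u : E d → ℝ} {g : E d → E d} (hu : MemLp u 2 (volume.restrict Ω))
    (hg : MemLp g 2 (volume.restrict Ω))
    (h : ∀ φ : E d → ℝ, IsTest Ω φ → ∀ e : E d,
      (∫ x in Ω, u x * fderiv ℝ φ x e) = - ∫ x in Ω, (inner ℝ (g x) e : ℝ) * φ x)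

lemma coeFn_val_mkH1 : val (mkH1 hu hg h) =ᵐ[volume.restrict Ω] u := hu.coeFn_toLp
lemma coeFn_grad_mkH1 : grad (mkH1 hu hg h) =ᵐ[volume.restrict Ω] g := hg.coeFn_toLp

end mk

/-- An `L²(Ω)` function orthogonal to all test functions vanishes. -/
lemma ae_zero_of_forall_test {F : Type*} [NormedAddCommGroup F] [NormedSpace ℝ F]
    [CompleteSpace F] (hΩ : IsOpen Ω) {f : E d → F} (hf : MemLp f 2 (volume.restrict Ω))
    (h : ∀ φ, IsTest Ω φ → ∫ x in Ω, φ x • f x = 0) : f =ᵐ[volume.restrict Ω] 0 := by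
  have hl : LocallyIntegrableOn f Ω volume :=
    locallyIntegrableOn_of_locallyIntegrable_restrict (hf.locallyIntegrable (by norm_num))
  have := hΩ.ae_eq_zero_of_integral_contDiff_smul_eq_zero hl fun φ h1 h2 h3 => by
    rw [← h φ ⟨h1, h2, h3⟩]
    refine (setIntegral_eq_integral_of_forall_compl_eq_zero fun x hx => ?_).symm
    rw [image_eq_zero_of_notMem_tsupport fun h => hx (h3 h), zero_smul]
  exact (ae_restrict_iff' hΩ.measurableSet).2 this

/-- A function of `H¹(Ω)` is determined by its values: weak gradients are unique. -/
lemma val_injective (hΩ : IsOpen Ω) {u w : H1 Ω} (h : val u = val w) : u = w := by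
  have h0 : val (u - w) = 0 := by
    have := map_sub (valL Ω) u w
    simpa [h] using this
  have hg : grad (u - w) =ᵐ[volume.restrict Ω] 0 := by
    refine ae_zero_of_forall_test hΩ (Lp.memLp _) fun φ hφ => ?_
    have hi : Integrable (fun x => φ x • (grad (u - w)) x) (volume.restrict Ω) :=
      memLp_one_iff_integrable.1 ((Lp.memLp (grad (u - w))).smul (r := 1) (hφ.memLp.restrict Ω))
    refine ext_inner_right ℝ fun e => ?_
    rw [real_inner_comm, ← integral_inner hi, inner_zero_left]
    have h1 := isWeakGradient_grad (u - w) φ hφ.contDiff hφ.compact hφ.subset e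
    rw [h0] at h1
    have h2 : ∫ x in Ω, ((0 : L2 Ω) : E d → ℝ) x * fderiv ℝ φ x e = 0 := by
      refine integral_eq_zero_of_ae ?_
      filter_upwards [Lp.coeFn_zero ℝ 2 (volume.restrict Ω)] with x hx
      rw [hx]; exact zero_mul _
    rw [h2] at h1
    rw [← neg_eq_zero, h1]
    congr 1
    refine integral_congr_ae (Eventually.of_forall fun x => ?_)
    simp only [real_inner_smul_right, real_inner_comm e]
    exact mul_comm _ _
  have hg' : grad (u - w) = 0 := by
    refine Lp.ext (hg.trans (Lp.coeFn_zero _ _ _).symm)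
  have : ‖u - w‖ ^ 2 = 0 := by rw [norm_sq_H1, h0, hg']; simp
  exact sub_eq_zero.1 (norm_eq_zero.1 (pow_eq_zero_iff (two_ne_zero) |>.1 this))

/-- A Lipschitz function on a bounded open set belongs to `H¹`. -/
lemma exists_H1_of_lipschitz (hΩ : IsOpen Ω) (hb : Bornology.IsBounded Ω) {K : NNReal} {ξ : E d → ℝ}
    (hξ : LipschitzWith K ξ) : ∃ w : H1 Ω, val w =ᵐ[volume.restrict Ω] ξ ∧
      grad w =ᵐ[volume.restrict Ω] gradient ξ := by
  have hfin : IsFiniteMeasure (volume.restrict Ω) := ⟨by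
    rw [Measure.restrict_apply_univ]; exact hb.measure_lt_top⟩
  have hu : MemLp ξ 2 (volume.restrict Ω) := by
    obtain ⟨C, hC⟩ := (hξ.isBounded_image hb).exists_norm_le
    refine MemLp.of_bound hξ.continuous.aestronglyMeasurable C ?_
    have : ∀ x ∈ Ω, ‖ξ x‖ ≤ C := fun x hx => hC _ (mem_image_of_mem _ hx)
    exact ae_restrict_of_forall_mem hΩ.measurableSet this
  have hg : MemLp (gradient ξ) 2 (volume.restrict Ω) :=
    MemLp.of_bound (measurable_gradient ξ).aestronglyMeasurable K
      (Eventually.of_forall (norm_gradient_le_of_lipschitz hξ))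
  have h : ∀ φ : E d → ℝ, IsTest Ω φ → ∀ e : E d,
      (∫ x in Ω, ξ x * fderiv ℝ φ x e) = - ∫ x in Ω, (inner ℝ (gradient ξ x) e : ℝ) * φ x := by
    intro φ hφ e
    rw [setIntegral_eq_integral_of_forall_compl_eq_zero,
      setIntegral_eq_integral_of_forall_compl_eq_zero,
      integral_lipschitz_mul_fderiv hξ hφ.contDiff hφ.compact]
    · intro x hx
      rw [image_eq_zero_of_notMem_tsupport fun h => hx (hφ.subset h), mul_zero]
    · intro x hx
      rw [← inner_gradient, gradient_eq_zero_of_notMem_tsupport fun h => hx (hφ.subset h),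
        inner_zero_left, mul_zero]
  exact ⟨mkH1 hu hg h, coeFn_val_mkH1 hu hg h, coeFn_grad_mkH1 hu hg h⟩

/-- A product of bounded Lipschitz functions is Lipschitz. -/
lemma lipschitzWith_mul_of_bound {K K' : NNReal} {f g : E d → ℝ} {A B : ℝ}
    (hf : LipschitzWith K f) (hg : LipschitzWith K' g) (hA : ∀ x, |f x| ≤ A)
    (hB : ∀ x, |g x| ≤ B) : ∃ C, LipschitzWith C fun x => f x * g x := by
  refine ⟨(A * K' + B * K).toNNReal, LipschitzWith.of_dist_le_mul fun x y => ?_⟩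
  have hA0 : 0 ≤ A := (abs_nonneg _).trans (hA x)
  have hB0 : 0 ≤ B := (abs_nonneg _).trans (hB x)
  rw [Real.coe_toNNReal _ (by positivity), Real.dist_eq]
  have h1 := hf.dist_le_mul x y
  have h2 := hg.dist_le_mul x y
  rw [Real.dist_eq] at h1 h2
  calc |f x * g x - f y * g y| = |f x * (g x - g y) + g y * (f x - f y)| := by ring_nf
    _ ≤ |f x| * |g x - g y| + |g y| * |f x - f y| := by
        refine (abs_add_le _ _).trans ?_
        rw [abs_mul, abs_mul]
    _ ≤ A * (K' * dist x y) + B * (K * dist x y) := by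
        gcongr
        · exact hA x
        · exact hB y
    _ = (A * K' + B * K) * dist x y := by ring

lemma bounded_of_continuous_hasCompactSupport {f : E d → ℝ} (hf : Continuous f)
    (hc : HasCompactSupport f) : ∃ A, ∀ x, |f x| ≤ A := by
  obtain ⟨A, hA⟩ := hc.exists_bound_of_continuous hf
  exact ⟨A, fun x => by simpa using hA x⟩

lemma gradient_mul {f g : E d → ℝ} {x : E d} (hf : DifferentiableAt ℝ f x)
    (hg : DifferentiableAt ℝ g x) :
    gradient (fun y => f y * g y) x = f x • gradient g x + g x • gradient f x := by
  refine ext_inner_right ℝ fun e => ?_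
  rw [inner_gradient, inner_add_left, real_inner_smul_left, real_inner_smul_left, inner_gradient,
    inner_gradient, fderiv_fun_mul hf hg]
  simp

/-- Extension by zero of an `L²(Ω)` function. -/
lemma memLp_indicator_of_zero {F : Type*} [NormedAddCommGroup F] (hΩ : IsOpen Ω) {f : E d → F}
    (hf : MemLp f 2 (volume.restrict Ω)) (h0 : ∀ x ∉ Ω, f x = 0) : MemLp f 2 volume := by
  have : Ω.indicator f = f := by
    rw [indicator_eq_self]; intro x hx; by_contra h; exact hx (h0 x h)
  rw [← this]
  exact (memLp_indicator_iff_restrict hΩ.measurableSet).2 hf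

/-- The product of an `H¹` function with a Lipschitz cutoff supported in `Ω` is a limit of test
functions, in the norm of `H¹`. -/
lemma exists_test_approx_cutoff (hΩ : IsOpen Ω) (w : H1 Ω) {K : NNReal} {χ : E d → ℝ}
    (hχ : LipschitzWith K χ) (hc : HasCompactSupport χ) (hs : tsupport χ ⊆ Ω) :
    ∃ φ : ℕ → E d → ℝ, (∀ n, IsTest Ω (φ n)) ∧
      MemLp (fun x => χ x * val w x) 2 volume ∧
      MemLp (fun x => χ x • grad w x + val w x • gradient χ x) 2 volume ∧
      Tendsto (fun n => eLpNorm (φ n - fun x => χ x * val w x) 2 volume) atTop (𝓝 0) ∧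
      Tendsto (fun n => eLpNorm (gradient (φ n) -
        fun x => χ x • grad w x + val w x • gradient χ x) 2 volume) atTop (𝓝 0) := by
  obtain ⟨A, hA⟩ := bounded_of_continuous_hasCompactSupport hχ.continuous hc
  have hχtop : MemLp χ ∞ (volume.restrict Ω) := memLp_top_of_bound
    hχ.continuous.aestronglyMeasurable A (Eventually.of_forall fun x => hA x)
  have hgtop : MemLp (gradient χ) ∞ (volume.restrict Ω) := memLp_top_of_bound
    (measurable_gradient χ).aestronglyMeasurable K
    (Eventually.of_forall (norm_gradient_le_of_lipschitz hχ))
  have hzero : ∀ x ∉ tsupport χ, χ x = 0 := fun x hx => image_eq_zero_of_notMem_tsupport hx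
  have hgzero : ∀ x ∉ tsupport χ, gradient χ x = 0 :=
    fun x hx => gradient_eq_zero_of_notMem_tsupport hx
  have hu : MemLp (fun x => χ x * val w x) 2 volume := by
    refine memLp_indicator_of_zero hΩ ?_ fun x hx => by rw [hzero x fun h => hx (hs h), zero_mul]
    exact (Lp.memLp (val w)).mul (p := ∞) (q := 2) (r := 2) hχtop
  have hg1 : MemLp (fun x => χ x • grad w x) 2 (volume.restrict Ω) :=
    (Lp.memLp (grad w)).smul (p := ∞) (q := 2) (r := 2) hχtop
  have hg2 : MemLp (fun x => val w x • gradient χ x) 2 (volume.restrict Ω) :=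
    hgtop.smul (p := 2) (q := ∞) (r := 2) (Lp.memLp (val w))
  have hg : MemLp (fun x => χ x • grad w x + val w x • gradient χ x) 2 volume := by
    refine memLp_indicator_of_zero hΩ (hg1.add hg2) fun x hx => ?_
    rw [hzero x fun h => hx (hs h), hgzero x fun h => hx (hs h), zero_smul, smul_zero, add_zero]
  -- it remains to prove the product rule for the weak gradient on the whole space: the defining
  -- identity of the weak gradient of `w` is tested with the Lipschitz function `χ φ`
  suffices hw : ∀ φ : E d → ℝ, ContDiff ℝ ∞ φ → HasCompactSupport φ → ∀ e : E d,
      (∫ x, χ x * val w x * fderiv ℝ φ x e)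
        = - ∫ x, inner ℝ (χ x • grad w x + val w x • gradient χ x) e * φ x by
    obtain ⟨φ, h1, h2, h3⟩ := exists_test_approx hΩ hc.isCompact hs hu hg
      (fun x hx => by rw [hzero x hx, zero_mul]) hw
    exact ⟨φ, h1, hu, hg, h2, h3⟩
  intro φ hφ hφc e
  obtain ⟨C, hC⟩ := hφ.lipschitzWith_of_hasCompactSupport hφc (by simp)
  obtain ⟨B, hB⟩ := bounded_of_continuous_hasCompactSupport hφ.continuous hφc
  obtain ⟨L, hL⟩ := lipschitzWith_mul_of_bound hχ hC hA hB
  have key := weakGradient_lipschitz hΩ (isWeakGradient_grad w) hL (hc.mul_right)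
    ((tsupport_mul_subset_left).trans hs) e
  have hd : ∀ᵐ x ∂(volume.restrict Ω), fderiv ℝ (fun x => χ x * φ x) x e
      = χ x * fderiv ℝ φ x e + φ x * inner ℝ (gradient χ x) e := by
    filter_upwards [ae_restrict_of_ae hχ.ae_differentiableAt] with x hx
    rw [← inner_gradient, gradient_mul hx (hφ.differentiable (by simp) x), inner_add_left,
      real_inner_smul_left, real_inner_smul_left, inner_gradient φ]
  have hl : ∫ x in Ω, val w x * fderiv ℝ (fun x => χ x * φ x) x e
      = (∫ x in Ω, χ x * val w x * fderiv ℝ φ x e)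
        + ∫ x in Ω, val w x * inner ℝ (gradient χ x) e * φ x := by
    rw [← integral_add]
    · refine integral_congr_ae ?_
      filter_upwards [hd] with x hx
      rw [hx]; ring
    · exact integrable_mul_test (hu.restrict Ω)
        ((hφ.continuous_fderiv (by simp)).clm_apply continuous_const)
        (hφc.fderiv_apply (𝕜 := ℝ) e)
    · refine integrable_mul_test ?_ hφ.continuous hφc
      refine (hg2.inner_const (𝕜 := ℝ) e).ae_eq (Eventually.of_forall fun x => ?_)
      exact real_inner_smul_left _ _ _
  rw [hl] at key
  have e1 : ∫ x, χ x * val w x * fderiv ℝ φ x e = ∫ x in Ω, χ x * val w x * fderiv ℝ φ x e :=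
    (setIntegral_eq_integral_of_forall_compl_eq_zero fun x hx => by
      rw [hzero x fun h => hx (hs h), zero_mul, zero_mul]).symm
  have e2 : ∫ x, inner ℝ (χ x • grad w x + val w x • gradient χ x) e * φ x
      = ∫ x in Ω, inner ℝ (χ x • grad w x + val w x • gradient χ x) e * φ x :=
    (setIntegral_eq_integral_of_forall_compl_eq_zero fun x hx => by
      rw [hzero x fun h => hx (hs h), hgzero x fun h => hx (hs h), zero_smul, smul_zero, add_zero,
        inner_zero_left, zero_mul]).symm
  have e3 : ∫ x in Ω, inner ℝ (χ x • grad w x + val w x • gradient χ x) e * φ x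
      = (∫ x in Ω, inner ℝ (grad w x) e * (χ x * φ x))
        + ∫ x in Ω, val w x * inner ℝ (gradient χ x) e * φ x := by
    rw [← integral_add]
    · refine integral_congr_ae (Eventually.of_forall fun x => ?_)
      simp only [inner_add_left, real_inner_smul_left]; ring
    · exact integrable_mul_test ((Lp.memLp (grad w)).inner_const (𝕜 := ℝ) e) hL.continuous
        hc.mul_right
    · refine integrable_mul_test ?_ hφ.continuous hφc
      refine (hg2.inner_const (𝕜 := ℝ) e).ae_eq (Eventually.of_forall fun x => ?_)
      exact real_inner_smul_left _ _ _
  rw [e1, e2, e3]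
  linarith

end SobolevSpace


/-! ### Skew-symmetric evolution equations in a Hilbert space -/

section AbstractEvolution

/-- For a bounded family, weak convergence may be tested on a dense set. -/
lemma tendsto_inner_of_dense {α X : Type*} [NormedAddCommGroup X] [InnerProductSpace ℝ X]
    {l : Filter α} {x : α → X} {x₀ : X} {M : ℝ} {S : Set X} (hS : Dense S)
    (hM : ∀ᶠ a in l, ‖x a‖ ≤ M)
    (h : ∀ k ∈ S, Tendsto (fun a => inner ℝ (x a) k) l (𝓝 (inner ℝ x₀ k))) (y : X) :
    Tendsto (fun a => inner ℝ (x a) y) l (𝓝 (inner ℝ x₀ y)) := by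
  rw [Metric.tendsto_nhds]
  intro ε hε
  set A := |M| + ‖x₀‖ + 1 with hA
  have hA0 : 0 < A := by positivity
  obtain ⟨k, hkS, hk⟩ := Metric.dense_iff.1 hS y (ε / (2 * A)) (by positivity)
  rw [Metric.mem_ball, dist_comm, dist_eq_norm] at hkS
  filter_upwards [hM, (Metric.tendsto_nhds.1 (h k hk)) (ε / 2) (by positivity)] with a h1 h2
  rw [Real.dist_eq] at h2 ⊢
  have e : inner ℝ (x a) y - inner ℝ x₀ y
      = inner ℝ (x a - x₀) (y - k) + (inner ℝ (x a) k - inner ℝ x₀ k) := by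
    simp only [inner_sub_left, inner_sub_right]; ring
  rw [e]
  have h3 : |inner ℝ (x a - x₀) (y - k)| ≤ A * ‖y - k‖ := by
    refine (abs_real_inner_le_norm _ _).trans ?_
    gcongr
    have := norm_sub_le (x a) x₀
    have := le_abs_self M
    linarith
  have h4 : A * ‖y - k‖ < ε / 2 := by
    calc A * ‖y - k‖ < A * (ε / (2 * A)) := by gcongr
      _ = ε / 2 := by field_simp
  calc _ ≤ _ := abs_add_le _ _
    _ < ε := by linarith

/-- Weak compactness: a strong limit in `H` of a bounded sequence of `V` comes from `V`, with the
limit of the bounds. -/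
lemma exists_preimage_of_tendsto {V H : Type*} [NormedAddCommGroup V] [InnerProductSpace ℝ V]
    [CompleteSpace V] [NormedAddCommGroup H] [InnerProductSpace ℝ H] [CompleteSpace H]
    (ι : V →L[ℝ] H) {x : ℕ → V} {h : H} {M : ℕ → ℝ} {M₀ : ℝ} (hx : ∀ n, ‖x n‖ ≤ M n)
    (hM : Tendsto M atTop (𝓝 M₀)) (hlim : Tendsto (fun n => ι (x n)) atTop (𝓝 h)) :
    ∃ y : V, ι y = h ∧ ‖y‖ ≤ M₀ := by
  obtain ⟨R, hR⟩ := hM.bddAbove_range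
  have hxR : ∀ n, ‖x n‖ ≤ R := fun n => (hx n).trans (hR (mem_range_self n))
  -- the Riesz representatives stay in a weak-* compact ball, so they converge along an ultrafilter
  set f : ℕ → WeakDual ℝ V := fun n =>
    StrongDual.toWeakDual (InnerProductSpace.toDual ℝ V (x n)) with hf
  set u : Ultrafilter (WeakDual ℝ V) := (hyperfilter ℕ).map f with hu
  have hcomp := WeakDual.isCompact_closedBall (0 : StrongDual ℝ V) R
  have hmem : ∀ n, f n ∈ WeakDual.toStrongDual ⁻¹' Metric.closedBall (0 : StrongDual ℝ V) R := by
    intro n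
    rw [mem_preimage, mem_closedBall_zero_iff]
    change ‖InnerProductSpace.toDual ℝ V (x n)‖ ≤ R
    rw [LinearIsometryEquiv.norm_map]
    exact hxR n
  obtain ⟨g, -, hg⟩ := hcomp.ultrafilter_le_nhds u (by
    rw [le_principal_iff]
    exact Filter.mem_map.2 (Eventually.of_forall hmem))
  set y : V := (InnerProductSpace.toDual ℝ V).symm (WeakDual.toStrongDual g) with hy
  have hgt : Tendsto f (hyperfilter ℕ) (𝓝 g) := hg
  have hy' : ∀ z, Tendsto (fun n => inner ℝ (x n) z) (hyperfilter ℕ) (𝓝 (inner ℝ y z)) := by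
    intro z
    have := ((WeakDual.eval_continuous z).tendsto g).comp hgt
    have e1 : inner ℝ y z = g z := by rw [hy, InnerProductSpace.toDual_symm_apply]; rfl
    rw [e1]
    exact this
  have hle : (hyperfilter ℕ : Filter ℕ) ≤ atTop := by
    rw [← Nat.cofinite_eq_atTop]; exact hyperfilter_le_cofinite
  refine ⟨y, ?_, ?_⟩
  -- pairing with `ι.adjoint k` identifies the weak limit with the strong one
  · refine ext_inner_right ℝ fun k => ?_
    have h1 := hy' (ι.adjoint k)
    simp only [ContinuousLinearMap.adjoint_inner_right] at h1
    exact tendsto_nhds_unique h1 ((hlim.inner tendsto_const_nhds).mono_left hle)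
  · have h1 : inner ℝ y y ≤ M₀ * ‖y‖ := by
      refine le_of_tendsto_of_tendsto (hy' y) ((hM.mono_left hle).mul_const _)
        (Eventually.of_forall fun n => ?_)
      exact (real_inner_le_norm _ _).trans (mul_le_mul_of_nonneg_right (hx n) (norm_nonneg _))
    rw [real_inner_self_eq_norm_sq, sq] at h1
    rcases (norm_nonneg y).eq_or_lt with h0 | h0
    · rw [← h0]
      exact ge_of_tendsto' hM fun n => (norm_nonneg _).trans (hx n)
    · exact le_of_mul_le_mul_right h1 h0

lemma intervalIntegrable_clm_apply {Y Z : Type*} [NormedAddCommGroup Y] [NormedSpace ℝ Y]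
    [NormedAddCommGroup Z] [NormedSpace ℝ Z] {T : ℝ} {F : ℝ → Y →L[ℝ] Z}
    (hF : ContinuousOn F (Icc 0 T)) {c : ℝ → Y} (hc : IntegrableOn c (Icc 0 T)) {s t : ℝ}
    (hs : s ∈ Icc 0 T) (ht : t ∈ Icc 0 T) :
    IntervalIntegrable (fun r => F r (c r)) volume s t := by
  have hsub : uIcc s t ⊆ Icc 0 T := (convex_Icc 0 T).ordConnected.uIcc_subset hs ht
  obtain ⟨C, hC⟩ := isCompact_Icc.exists_bound_of_continuousOn hF
  have hm : AEStronglyMeasurable (fun r => F r (c r)) (volume.restrict (Icc 0 T)) :=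
    (ContinuousLinearMap.id ℝ (Y →L[ℝ] Z)).aestronglyMeasurable_comp₂
      (hF.aestronglyMeasurable measurableSet_Icc) hc.aestronglyMeasurable
  have : IntegrableOn (fun r => F r (c r)) (Icc 0 T) := by
    refine Integrable.mono' (hc.norm.const_mul C) hm ?_
    refine ae_restrict_of_forall_mem measurableSet_Icc fun r hr => ?_
    exact ((F r).le_opNorm _).trans (by gcongr; exact hC r hr)
  exact (this.mono_set hsub).intervalIntegrable

lemma abs_intervalIntegral_le_of_nonneg {T : ℝ} {κ : ℝ → ℝ} (hκ : IntegrableOn κ (Icc 0 T))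
    (h0 : ∀ r, 0 ≤ κ r) {s t : ℝ} (hs : s ∈ Icc 0 T) (ht : t ∈ Icc 0 T) :
    |∫ r in s..t, κ r| ≤ ∫ r in Icc 0 T, κ r := by
  rw [intervalIntegral.abs_integral_eq_abs_integral_uIoc, abs_of_nonneg
    (integral_nonneg fun r => h0 r)]
  refine setIntegral_mono_set hκ (Eventually.of_forall h0) ?_
  refine Eventually.of_forall (uIoc_subset_uIcc.trans ?_)
  exact (convex_Icc 0 T).ordConnected.uIcc_subset hs ht

/-- A function on `[0, T]` whose increments are `o(1) ∫ κ`, uniformly, is constant. -/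
lemma eq_of_increment_le {T : ℝ} {Φ κ : ℝ → ℝ} (hκ : IntegrableOn κ (Icc 0 T))
    (h : ∀ ε > 0, ∃ δ > 0, ∀ s ∈ Icc 0 T, ∀ t ∈ Icc 0 T, s ≤ t → t - s < δ →
      |Φ t - Φ s| ≤ ε * ∫ r in s..t, κ r) {s t : ℝ} (hs : s ∈ Icc 0 T) (ht : t ∈ Icc 0 T) :
    Φ t = Φ s := by
  wlog hst : s ≤ t generalizing s t
  · exact (this ht hs (le_of_not_ge hst)).symm
  have key : ∀ ε > 0, |Φ t - Φ s| ≤ ε * ∫ r in s..t, κ r := by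
    intro ε hε
    obtain ⟨δ, hδ, H⟩ := h ε hε
    obtain ⟨N, hN⟩ := exists_nat_gt ((t - s) / δ)
    set n := N + 1 with hn
    have hn0 : (0 : ℝ) < n := by positivity
    -- uniform partition of `[s, t]` into steps shorter than `δ`
    set τ : ℕ → ℝ := fun k => s + k * ((t - s) / n) with hτ
    have hstep : 0 ≤ (t - s) / n := div_nonneg (by linarith) hn0.le
    have hmem : ∀ k ≤ n, τ k ∈ Icc 0 T := by
      intro k hk
      have hk' : (k : ℝ) ≤ n := by exact_mod_cast hk
      have : (k : ℝ) * ((t - s) / n) ≤ t - s := by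
        calc (k : ℝ) * ((t - s) / n) ≤ n * ((t - s) / n) := by gcongr
          _ = t - s := by field_simp
      have h2 : 0 ≤ (k : ℝ) * ((t - s) / n) := by positivity
      constructor <;> simp only [hτ] <;> linarith [hs.1, ht.2]
    have hτ0 : τ 0 = s := by simp [hτ]
    have hτn : τ n = t := by simp only [hτ]; field_simp; ring
    have hsub : ∀ k, τ (k + 1) - τ k = (t - s) / n := by
      intro k; simp only [hτ]; push_cast; ring
    have hint : ∀ k < n, IntervalIntegrable κ volume (τ k) (τ (k + 1)) := by
      intro k hk
      refine (hκ.mono_set ?_).intervalIntegrable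
      exact (convex_Icc 0 T).ordConnected.uIcc_subset (hmem k hk.le) (hmem (k + 1) hk)
    have hsum := intervalIntegral.sum_integral_adjacent_intervals hint
    rw [hτ0, hτn] at hsum
    rw [← hsum, Finset.mul_sum, ← hτ0, ← hτn, ← Finset.sum_range_sub (fun k => Φ (τ k))]
    refine (Finset.abs_sum_le_sum_abs _ _).trans (Finset.sum_le_sum fun k hk => ?_)
    have hk' := Finset.mem_range.1 hk
    refine H _ (hmem k hk'.le) _ (hmem (k + 1) hk') ?_ ?_
    · linarith [hsub k]
    · rw [hsub k, div_lt_iff₀ hn0]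
      rw [div_lt_iff₀ hδ] at hN
      have : (N : ℝ) ≤ n := by rw [hn]; push_cast; linarith
      nlinarith
  have : |Φ t - Φ s| ≤ 0 := by
    have hl : Tendsto (fun ε : ℝ => ε * ∫ r in s..t, κ r) (𝓝[>] 0) (𝓝 0) := by
      have : Tendsto (fun ε : ℝ => ε * ∫ r in s..t, κ r) (𝓝 0) (𝓝 (0 * ∫ r in s..t, κ r)) :=
        tendsto_id.mul_const _
      rw [zero_mul] at this
      exact this.mono_left nhdsWithin_le_nhds
    exact ge_of_tendsto hl (eventually_nhdsWithin_of_forall fun ε hε => key ε hε)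
  have := abs_nonpos_iff.1 this
  linarith

variable {U V H : Type*} [NormedAddCommGroup U] [NormedSpace ℝ U]
  [NormedAddCommGroup V] [InnerProductSpace ℝ V]
  [NormedAddCommGroup H] [InnerProductSpace ℝ H]

/-- `θ ∈ C([0,T]; H)` is a weak solution of `θ' = D(c)* θ`: for every test element `ψ ∈ V`, the
increments of `⟪θ, ψ⟫` are the integrals of `⟪θ, D(c) ψ⟫`. With `D(v) ψ = v · ∇ψ` this is the
transport equation with test functions that need not vanish on the boundary. -/
structure IsWeakEvolution (ι : V →L[ℝ] H) (D : U →L[ℝ] V →L[ℝ] H) (T : ℝ) (c : ℝ → U)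
    (θ : ℝ → H) : Prop where
  continuousOn : ContinuousOn θ (Icc 0 T)
  weak : ∀ ψ : V, ∀ s ∈ Icc 0 T, ∀ t ∈ Icc 0 T,
    inner ℝ (θ t - θ s) (ι ψ) = ∫ r in s..t, inner ℝ (θ r) (D (c r) ψ)

variable {ι : V →L[ℝ] H} {D : U →L[ℝ] V →L[ℝ] H} {T : ℝ} {c c₁ c₂ : ℝ → U}

lemma intervalIntegrable_inner_apply {θ : ℝ → H} {ρ : ℝ → V} (hθ : ContinuousOn θ (Icc 0 T))
    (hρ : ContinuousOn ρ (Icc 0 T)) (hc : IntegrableOn c (Icc 0 T)) {s t : ℝ}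
    (hs : s ∈ Icc 0 T) (ht : t ∈ Icc 0 T) :
    IntervalIntegrable (fun r => inner ℝ (θ r) (D (c r) (ρ r))) volume s t := by
  have hF : ContinuousOn (fun r => (innerSL ℝ (θ r)).comp (D.flip (ρ r))) (Icc 0 T) :=
    ((innerSL ℝ).continuous.comp_continuousOn hθ).clm_comp
      (D.flip.continuous.comp_continuousOn hρ)
  exact intervalIntegrable_clm_apply hF hc hs ht

lemma integrableOn_apply {ρ : ℝ → V} (hT : 0 ≤ T)
    (hρ : ContinuousOn ρ (Icc 0 T)) (hc : IntegrableOn c (Icc 0 T)) :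
    IntegrableOn (fun r => D (c r) (ρ r)) (Icc 0 T) := by
  have hF : ContinuousOn (fun r => D.flip (ρ r)) (Icc 0 T) :=
    D.flip.continuous.comp_continuousOn hρ
  have := intervalIntegrable_clm_apply hF hc (left_mem_Icc.2 hT) (right_mem_Icc.2 hT)
  exact (intervalIntegrable_iff_integrableOn_Icc_of_le hT).1 this

lemma IsWeakEvolution.sub {θ₁ θ₂ : ℝ → H} (h₁ : IsWeakEvolution ι D T c θ₁)
    (h₂ : IsWeakEvolution ι D T c θ₂) (hc : IntegrableOn c (Icc 0 T)) :
    IsWeakEvolution ι D T c (fun t => θ₁ t - θ₂ t) := by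
  refine ⟨h₁.continuousOn.sub h₂.continuousOn, fun ψ s hs t ht => ?_⟩
  have i1 := intervalIntegrable_inner_apply (D := D) h₁.continuousOn
    (continuousOn_const (c := ψ)) hc hs ht
  have i2 := intervalIntegrable_inner_apply (D := D) h₂.continuousOn
    (continuousOn_const (c := ψ)) hc hs ht
  simp only [inner_sub_left]
  rw [intervalIntegral.integral_sub i1 i2, ← h₁.weak ψ s hs t ht, ← h₂.weak ψ s hs t ht]
  simp only [inner_sub_left]
  ring

/-- The product rule for a weak solution `θ` against a curve `ρ` that is continuous in `V` and has
the integrable derivative `f` in `H`. -/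
lemma IsWeakEvolution.pairing {θ : ℝ → H} (hθ : IsWeakEvolution ι D T c θ)
    (hc : IntegrableOn c (Icc 0 T)) {ρ : ℝ → V} (hρ : ContinuousOn ρ (Icc 0 T))
    {f : ℝ → H} (hf : IntegrableOn f (Icc 0 T))
    (hder : ∀ h : H, ∀ s ∈ Icc 0 T, ∀ t ∈ Icc 0 T,
      inner ℝ (ι (ρ t) - ι (ρ s)) h = ∫ r in s..t, inner ℝ (f r) h)
    {s t : ℝ} (hs : s ∈ Icc 0 T) (ht : t ∈ Icc 0 T) :
    inner ℝ (θ t) (ι (ρ t)) - inner ℝ (θ s) (ι (ρ s))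
      = ∫ r in s..t, (inner ℝ (θ r) (D (c r) (ρ r)) + inner ℝ (θ r) (f r)) := by
  have hT : 0 ≤ T := hs.1.trans hs.2
  have h0 : (0 : ℝ) ∈ Icc 0 T := left_mem_Icc.2 hT
  have hif : ∀ {θ' : ℝ → H}, ContinuousOn θ' (Icc 0 T) → ∀ {s t : ℝ}, s ∈ Icc 0 T → t ∈ Icc 0 T →
      IntervalIntegrable (fun r => inner ℝ (θ' r) (f r)) volume s t := by
    intro θ' hθ' s t hs ht
    exact intervalIntegrable_clm_apply ((innerSL ℝ).continuous.comp_continuousOn hθ') hf hs ht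
  have hig : ∀ {s t : ℝ}, s ∈ Icc 0 T → t ∈ Icc 0 T → IntervalIntegrable
      (fun r => inner ℝ (θ r) (D (c r) (ρ r)) + inner ℝ (θ r) (f r)) volume s t :=
    fun hs ht => (intervalIntegrable_inner_apply hθ.continuousOn hρ hc hs ht).add
      (hif hθ.continuousOn hs ht)
  -- the difference of the two sides has increments of order `o(1) ∫ κ`, hence is constant
  set Φ : ℝ → ℝ := fun t => inner ℝ (θ t) (ι (ρ t))
    - ∫ r in (0 : ℝ)..t, (inner ℝ (θ r) (D (c r) (ρ r)) + inner ℝ (θ r) (f r)) with hΦ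
  obtain ⟨M, hM⟩ := isCompact_Icc.exists_bound_of_continuousOn hθ.continuousOn
  have hM0 : 0 ≤ M := (norm_nonneg _).trans (hM 0 h0)
  set κ : ℝ → ℝ := fun r => M * ‖D‖ * ‖c r‖ + ‖f r‖ with hκ
  have hκi : IntegrableOn κ (Icc 0 T) := (hc.norm.const_mul _).add hf.norm
  have hconst : Φ t = Φ s := by
    refine eq_of_increment_le hκi (fun ε hε => ?_) hs ht
    have u1 := isCompact_Icc.uniformContinuousOn_of_continuous hρ
    have u2 := isCompact_Icc.uniformContinuousOn_of_continuous hθ.continuousOn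
    obtain ⟨δ₁, hδ₁, H₁⟩ := Metric.uniformContinuousOn_iff.1 u1 ε hε
    obtain ⟨δ₂, hδ₂, H₂⟩ := Metric.uniformContinuousOn_iff.1 u2 ε hε
    refine ⟨min δ₁ δ₂, by positivity, fun s hs t ht hst hlt => ?_⟩
    have hsub : Icc s t ⊆ Icc 0 T := Icc_subset_Icc hs.1 ht.2
    have i1 := intervalIntegrable_inner_apply (D := D) hθ.continuousOn
      (continuousOn_const (c := ρ s)) hc hs ht
    have i2 := hif (continuousOn_const (c := θ t)) hs ht
    -- on a short interval, freezing `ρ` at the left and `θ` at the right end leaves only the errors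
    -- of the freezing
    have hsplit : Φ t - Φ s = ∫ r in s..t, (inner ℝ (θ r) (D (c r) (ρ s - ρ r))
        + inner ℝ (θ t - θ r) (f r)) := by
      have e1 : inner ℝ (θ t) (ι (ρ t)) - inner ℝ (θ s) (ι (ρ s))
          = inner ℝ (θ t - θ s) (ι (ρ s)) + inner ℝ (ι (ρ t) - ι (ρ s)) (θ t) := by
        rw [real_inner_comm (θ t)]
        simp only [inner_sub_left, inner_sub_right]; ring
      have e2 : ∫ r in s..t, inner ℝ (f r) (θ t) = ∫ r in s..t, inner ℝ (θ t) (f r) := by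
        simp only [real_inner_comm]
      have e3 := intervalIntegral.integral_interval_sub_left (hig h0 ht) (hig h0 hs)
      have : Φ t - Φ s = (inner ℝ (θ t) (ι (ρ t)) - inner ℝ (θ s) (ι (ρ s)))
          - ∫ r in s..t, (inner ℝ (θ r) (D (c r) (ρ r)) + inner ℝ (θ r) (f r)) := by
        rw [← e3]; simp only [hΦ]; ring
      rw [this, e1, hθ.weak (ρ s) s hs t ht, hder (θ t) s hs t ht, e2,
        ← intervalIntegral.integral_add i1 i2, ← intervalIntegral.integral_sub (i1.add i2)
          (hig hs ht)]
      refine intervalIntegral.integral_congr fun r _ => ?_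
      simp only [map_sub, inner_sub_left, inner_sub_right]
      ring
    rw [hsplit, ← Real.norm_eq_abs, ← intervalIntegral.integral_const_mul]
    refine intervalIntegral.norm_integral_le_of_norm_le hst ?_
      ((hκi.mono_set (by rwa [uIcc_of_le hst])).intervalIntegrable.const_mul ε)
    refine Eventually.of_forall fun r hr => ?_
    have hr' : r ∈ Icc 0 T := hsub (Ioc_subset_Icc_self hr)
    have d1 : ‖ρ s - ρ r‖ ≤ ε := by
      rw [← dist_eq_norm]
      refine (H₁ s hs r hr' ?_).le
      rw [Real.dist_eq, abs_lt]
      have := min_le_left δ₁ δ₂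
      constructor <;> linarith [hr.1, hr.2]
    have d2 : ‖θ t - θ r‖ ≤ ε := by
      rw [← dist_eq_norm]
      refine (H₂ t ht r hr' ?_).le
      rw [Real.dist_eq, abs_lt]
      have := min_le_right δ₁ δ₂
      constructor <;> linarith [hr.1, hr.2]
    have b1 : ‖D (c r) (ρ s - ρ r)‖ ≤ ‖D‖ * ‖c r‖ * ε :=
      (D.le_opNorm₂ _ _).trans (by gcongr)
    calc ‖_‖ ≤ ‖θ r‖ * ‖D (c r) (ρ s - ρ r)‖ + ‖θ t - θ r‖ * ‖f r‖ :=
          (norm_add_le _ _).trans (add_le_add (norm_inner_le_norm _ _) (norm_inner_le_norm _ _))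
      _ ≤ M * (‖D‖ * ‖c r‖ * ε) + ε * ‖f r‖ := by
          gcongr
          exact hM r hr'
      _ = ε * κ r := by rw [hκ]; ring
  have e3 := intervalIntegral.integral_interval_sub_left (hig h0 ht) (hig h0 hs)
  rw [← e3]
  simp only [hΦ] at hconst
  linarith

/-- The pairing of two solutions of transport equations with controls `c₁` and `c₂`. It is
constant if the controls agree. -/
lemma IsWeakEvolution.pairing_evolution [CompleteSpace H]
    (hskew : ∀ u ψ φ, inner ℝ (D u ψ) (ι φ) = - inner ℝ (ι ψ) (D u φ)) (hdense : DenseRange ι)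
    {θ : ℝ → H} (hθ : IsWeakEvolution ι D T c₁ θ) (hc₁ : IntegrableOn c₁ (Icc 0 T))
    {ρ : ℝ → V} (hρ : ContinuousOn ρ (Icc 0 T))
    (hρw : IsWeakEvolution ι D T c₂ (fun t => ι (ρ t))) (hc₂ : IntegrableOn c₂ (Icc 0 T))
    {s t : ℝ} (hs : s ∈ Icc 0 T) (ht : t ∈ Icc 0 T) :
    inner ℝ (θ t) (ι (ρ t)) - inner ℝ (θ s) (ι (ρ s))
      = ∫ r in s..t, inner ℝ (θ r) (D (c₁ r - c₂ r) (ρ r)) := by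
  have hT : 0 ≤ T := hs.1.trans hs.2
  have hf : IntegrableOn (fun r => - D (c₂ r) (ρ r)) (Icc 0 T) :=
    (integrableOn_apply hT hρ hc₂).neg
  have hfi : ∀ {s t : ℝ}, s ∈ Icc 0 T → t ∈ Icc 0 T →
      IntervalIntegrable (fun r => - D (c₂ r) (ρ r)) volume s t := fun hs ht =>
    (hf.mono_set ((convex_Icc 0 T).ordConnected.uIcc_subset hs ht)).intervalIntegrable
  -- by skew-symmetry and density, `ρ` solves its equation strongly: its derivative in `H` is
  -- `-D(c₂) ρ`
  have hvec : ∀ s ∈ Icc 0 T, ∀ t ∈ Icc 0 T,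
      ι (ρ t) - ι (ρ s) = ∫ r in s..t, - D (c₂ r) (ρ r) := by
    intro s hs t ht
    have hcl : IsClosed {h : H | inner ℝ (ι (ρ t) - ι (ρ s)) h
        = inner ℝ (∫ r in s..t, - D (c₂ r) (ρ r)) h} :=
      isClosed_eq (continuous_const.inner continuous_id) (continuous_const.inner continuous_id)
    refine ext_inner_right ℝ fun h => ?_
    refine hdense.induction_on (p := fun h => inner ℝ (ι (ρ t) - ι (ρ s)) h
        = inner ℝ (∫ r in s..t, - D (c₂ r) (ρ r)) h) h hcl fun ψ => ?_
    have := (innerSL ℝ (ι ψ)).intervalIntegral_comp_comm (hfi hs ht)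
    rw [hρw.weak ψ s hs t ht, real_inner_comm]
    simp only [innerSL_apply_apply] at this
    rw [← this]
    refine intervalIntegral.integral_congr fun r _ => ?_
    have h1 := hskew (c₂ r) (ρ r) ψ
    rw [real_inner_comm] at h1
    simp only [inner_neg_right]
    linarith
  rw [hθ.pairing hc₁ hρ hf (fun h s hs t ht => ?_) hs ht]
  · refine intervalIntegral.integral_congr fun r _ => ?_
    simp only [map_sub, sub_apply, inner_sub_right, inner_neg_right]
    ring
  · rw [hvec s hs t ht, real_inner_comm]
    have := (innerSL ℝ h).intervalIntegral_comp_comm (hfi hs ht)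
    simp only [innerSL_apply_apply] at this
    rw [← this]
    exact intervalIntegral.integral_congr fun r _ => real_inner_comm _ _

end AbstractEvolution


section AbstractEvolution

variable {U V H : Type*} [NormedAddCommGroup U] [NormedSpace ℝ U]
  [NormedAddCommGroup V] [InnerProductSpace ℝ V]
  [NormedAddCommGroup H] [InnerProductSpace ℝ H]
  {ι : V →L[ℝ] H} {D : U →L[ℝ] V →L[ℝ] H} {T L : ℝ} {c : ℝ → U} {𝒦 : Set H}

/-- A two-sided growth bound in `V` upgrades continuity in `H` to continuity in `V`: the norms are
then upper semicontinuous along the curve, and weak convergence with convergence of the norms is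
strong convergence. -/
lemma continuousOn_of_growth [CompleteSpace V] [CompleteSpace H] (hinj : Function.Injective ι)
    {ρ : ℝ → V} {κ : ℝ → ℝ}
    (hκ : IntegrableOn κ (Icc 0 T)) (hcont : ContinuousOn (fun t => ι (ρ t)) (Icc 0 T))
    (hgrow : ∀ s ∈ Icc 0 T, ∀ t ∈ Icc 0 T, ‖ρ t‖ ≤ Real.exp |∫ r in s..t, κ r| * ‖ρ s‖) :
    ContinuousOn ρ (Icc 0 T) := by
  intro s hs
  have hprim : ContinuousOn (fun t => ∫ r in s..t, κ r) (Icc 0 T) := by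
    have hT : 0 ≤ T := hs.1.trans hs.2
    have h1 : IntegrableOn κ (uIcc 0 T) := by rwa [uIcc_of_le hT]
    have := intervalIntegral.continuousOn_primitive_interval' (a := s)
      (h1.intervalIntegrable) (by rwa [uIcc_of_le hT])
    rwa [uIcc_of_le hT] at this
  have hexp : Tendsto (fun t => Real.exp |∫ r in s..t, κ r|) (𝓝[Icc 0 T] s) (𝓝 1) := by
    have := (Real.continuous_exp.comp continuous_abs).continuousAt.tendsto.comp (hprim s hs)
    simpa [Function.comp_def] using this
  have hbd : ∀ᶠ t in 𝓝[Icc 0 T] s, ‖ρ t‖ ≤ 2 * ‖ρ s‖ := by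
    filter_upwards [self_mem_nhdsWithin, (tendsto_order.1 hexp).2 2 (by norm_num)] with t ht h2
    exact (hgrow s hs t ht).trans (by gcongr)
  -- injectivity of `ι` makes the range of its adjoint dense, so weak continuity in `V` follows
  -- from continuity in `H`
  have hdense : Dense (range (ContinuousLinearMap.adjoint ι)) := by
    have h1 : (LinearMap.range (ContinuousLinearMap.adjoint ι).toLinearMap)ᗮ = ⊥ := by
      rw [Submodule.eq_bot_iff]
      intro x hx
      refine hinj ?_
      rw [map_zero]
      refine ext_inner_left ℝ fun k => ?_
      rw [inner_zero_right, ← ContinuousLinearMap.adjoint_inner_left]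
      exact (Submodule.mem_orthogonal _ _).1 hx _ ⟨k, rfl⟩
    have h2 := (Submodule.topologicalClosure_eq_top_iff
      (K := LinearMap.range (ContinuousLinearMap.adjoint ι).toLinearMap)).2 h1
    exact (Submodule.dense_iff_topologicalClosure_eq_top).2 h2
  have hweak : Tendsto (fun t => inner ℝ (ρ t) (ρ s)) (𝓝[Icc 0 T] s) (𝓝 (inner ℝ (ρ s) (ρ s))) := by
    refine tendsto_inner_of_dense hdense hbd ?_ (ρ s)
    rintro _ ⟨k, rfl⟩
    simp only [ContinuousLinearMap.adjoint_inner_right]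
    exact (hcont s hs).inner tendsto_const_nhds
  -- `‖ρ t - ρ s‖²` is bounded by a quantity whose limit is `‖ρ s‖² - 2 ‖ρ s‖² + ‖ρ s‖² = 0`
  have hupper : Tendsto (fun t => (Real.exp |∫ r in s..t, κ r| * ‖ρ s‖) ^ 2
      - 2 * inner ℝ (ρ t) (ρ s) + ‖ρ s‖ ^ 2) (𝓝[Icc 0 T] s) (𝓝 0) := by
    have := (((hexp.mul_const ‖ρ s‖).pow 2).sub (hweak.const_mul 2)).add_const (‖ρ s‖ ^ 2)
    convert this using 2
    rw [real_inner_self_eq_norm_sq]; ring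
  have hsq : Tendsto (fun t => ‖ρ t - ρ s‖ ^ 2) (𝓝[Icc 0 T] s) (𝓝 0) := by
    refine tendsto_of_tendsto_of_tendsto_of_le_of_le' tendsto_const_nhds hupper
      (Eventually.of_forall fun t => by positivity) ?_
    filter_upwards [self_mem_nhdsWithin] with t ht
    rw [norm_sub_sq_real]
    gcongr
    exact hgrow s hs t ht
  have := hsq.sqrt
  simp only [Real.sqrt_sq (norm_nonneg _), Real.sqrt_zero] at this
  exact tendsto_iff_norm_sub_tendsto_zero.2 this

/-- The Cauchy problem for the control `c` is solvable in `V`, forwards and backwards from every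
time `s`, with the growth bound in `V` and conservation of the `H` norm and of the set `𝒦`. -/
def HasRegularEvolution (ι : V →L[ℝ] H) (D : U →L[ℝ] V →L[ℝ] H) (T L : ℝ) (𝒦 : Set H)
    (c : ℝ → U) : Prop :=
  ∀ s ∈ Icc 0 T, ∀ x : V, ∃ ρ : ℝ → V, ρ s = x ∧ IsWeakEvolution ι D T c (fun t => ι (ρ t)) ∧
    ContinuousOn ρ (Icc 0 T) ∧
    (∀ s' ∈ Icc 0 T, ∀ t ∈ Icc 0 T, ‖ρ t‖ ≤ Real.exp |∫ r in s'..t, L * ‖c r‖| * ‖ρ s'‖) ∧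
    (∀ t ∈ Icc 0 T, ‖ι (ρ t)‖ = ‖ι x‖) ∧ (ι x ∈ 𝒦 → ∀ t ∈ Icc 0 T, ι (ρ t) ∈ 𝒦)

/-- The bilinear estimate for the transport term, with both factors bounded on `[0, T]`. -/
lemma abs_integral_inner_apply_le {c : ℝ → U} (hc : IntegrableOn c (Icc 0 T)) {θ : ℝ → H}
    {ρ : ℝ → V} {A B : ℝ} (hA : ∀ t ∈ Icc 0 T, ‖θ t‖ ≤ A) (hB : ∀ t ∈ Icc 0 T, ‖ρ t‖ ≤ B)
    {s t : ℝ} (hs : s ∈ Icc 0 T) (ht : t ∈ Icc 0 T) :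
    |∫ r in s..t, inner ℝ (θ r) (D (c r) (ρ r))| ≤ A * ‖D‖ * B * ∫ r in Icc 0 T, ‖c r‖ := by
  have hA0 : 0 ≤ A := (norm_nonneg _).trans (hA s hs)
  have hB0 : 0 ≤ B := (norm_nonneg _).trans (hB s hs)
  have hsub : uIoc s t ⊆ Icc 0 T :=
    uIoc_subset_uIcc.trans ((convex_Icc 0 T).ordConnected.uIcc_subset hs ht)
  have hi : IntegrableOn (fun r => A * ‖D‖ * B * ‖c r‖) (Icc 0 T) := hc.norm.const_mul _
  rw [← Real.norm_eq_abs, intervalIntegral.norm_integral_eq_norm_integral_uIoc,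
    ← integral_const_mul]
  refine (norm_integral_le_of_norm_le (hi.mono_set hsub) ?_).trans
    (setIntegral_mono_set hi (Eventually.of_forall fun r => by positivity)
      (Eventually.of_forall hsub))
  refine ae_restrict_of_forall_mem measurableSet_uIoc fun r hr => ?_
  calc _ ≤ ‖θ r‖ * ‖D (c r) (ρ r)‖ := norm_inner_le_norm _ _
    _ ≤ A * (‖D‖ * ‖c r‖ * B) := by
        gcongr
        · exact hA r (hsub hr)
        · exact (D.le_opNorm₂ _ _).trans (by gcongr; exact hB r (hsub hr))
    _ = _ := by ring

lemma exists_continuous_approx (hc : IntegrableOn c (Icc 0 T)) :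
    ∃ cn : ℕ → ℝ → U, (∀ n, Continuous (cn n)) ∧ (∀ n, IntegrableOn (cn n) (Icc 0 T)) ∧
      Tendsto (fun n => ∫ r in Icc 0 T, ‖cn n r - c r‖) atTop (𝓝 0) := by
  have h : ∀ n : ℕ, ∃ g : BoundedContinuousFunction ℝ U,
      ∫ r in Icc 0 T, ‖c r - g r‖ ≤ 1 / (n + 1) ∧ Integrable g (volume.restrict (Icc 0 T)) :=
    fun n => Integrable.exists_boundedContinuous_integral_sub_le hc (by positivity)
  choose g h1 h2 using h
  refine ⟨fun n => g n, fun n => (g n).continuous, h2, ?_⟩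
  refine tendsto_of_tendsto_of_tendsto_of_le_of_le tendsto_const_nhds
    tendsto_one_div_add_atTop_nhds_zero_nat (fun n => integral_nonneg fun _ => norm_nonneg _)
    fun n => ?_
  simp only [norm_sub_rev _ (c _)]
  exact h1 n

/-- Limits of regular evolutions with continuous controls: solutions with controls that are only
integrable, before the growth bound is known between arbitrary times. -/
lemma exists_evolution_of_integrable [CompleteSpace V] [CompleteSpace H]
    (hskew : ∀ u ψ φ, inner ℝ (D u ψ) (ι φ) = - inner ℝ (ι ψ) (D u φ)) (hdense : DenseRange ι)
    (hinj : Function.Injective ι) (hL : 0 ≤ L) (h𝒦 : IsClosed 𝒦)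
    (hreg : ∀ c : ℝ → U, Continuous c → HasRegularEvolution ι D T L 𝒦 c)
    (hc : IntegrableOn c (Icc 0 T)) {s : ℝ} (hs : s ∈ Icc 0 T) (x : V) :
    ∃ ρ : ℝ → V, ρ s = x ∧ IsWeakEvolution ι D T c (fun t => ι (ρ t)) ∧
      (∀ t ∈ Icc 0 T, ‖ρ t‖ ≤ Real.exp |∫ r in s..t, L * ‖c r‖| * ‖x‖) ∧
      (∀ t ∈ Icc 0 T, ‖ι (ρ t)‖ = ‖ι x‖) ∧ (ι x ∈ 𝒦 → ∀ t ∈ Icc 0 T, ι (ρ t) ∈ 𝒦) ∧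
      (∀ θ, IsWeakEvolution ι D T c θ → ∀ t ∈ Icc 0 T,
        inner ℝ (θ t) (ι (ρ t)) = inner ℝ (θ s) (ι x)) := by
  obtain ⟨cn, hcn, hcni, hlim⟩ := exists_continuous_approx hc
  choose ρ hρs hρw hρc hρg hρn hρ𝒦 using fun n => hreg (cn n) (hcn n) s hs x
  set e : ℕ → ℝ := fun n => ∫ r in Icc 0 T, ‖cn n r - c r‖ with he
  have he0 : ∀ n, 0 ≤ e n := fun n => integral_nonneg fun _ => norm_nonneg _
  have hdi : ∀ n, IntegrableOn (fun r => cn n r - c r) (Icc 0 T) := fun n => (hcni n).sub hc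
  have hnormle : ∀ n, ∫ r in Icc 0 T, ‖cn n r‖ ≤ e n + ∫ r in Icc 0 T, ‖c r‖ := by
    intro n
    rw [he, ← integral_add (hdi n).norm hc.norm]
    refine integral_mono (hcni n).norm ((hdi n).norm.add hc.norm) fun r => ?_
    simpa using norm_add_le (cn n r - c r) (c r)
  obtain ⟨E0, hE0⟩ := hlim.bddAbove_range
  have hE0' : ∀ n, e n ≤ E0 := fun n => hE0 (mem_range_self n)
  set A := ∫ r in Icc 0 T, ‖c r‖ with hA
  -- `R` bounds all approximate solutions in `V`
  set R := Real.exp (L * (E0 + A)) * ‖x‖ with hR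
  have hR0 : 0 ≤ R := by positivity
  have hbdR : ∀ n, ∀ t ∈ Icc 0 T, ‖ρ n t‖ ≤ R := by
    intro n t ht
    refine (hρg n s hs t ht).trans ?_
    rw [hρs n]
    refine mul_le_mul_of_nonneg_right (Real.exp_le_exp.2 ?_) (norm_nonneg x)
    refine (abs_intervalIntegral_le_of_nonneg ((hcni n).norm.const_mul L)
      (fun r => by positivity) hs ht).trans ?_
    rw [integral_const_mul]
    refine mul_le_mul_of_nonneg_left ?_ hL
    exact (hnormle n).trans (by linarith [hE0' n])
  set K := ‖ι x‖ * ‖D‖ * R with hK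
  have hK0 : 0 ≤ K := by positivity
  -- the pairing of two approximate solutions changes by at most `K ‖cₙ - cₘ‖`, while their `H`
  -- norms are conserved: this gives a Cauchy estimate in `H`
  have hcauchy : ∀ n m, ∀ t ∈ Icc 0 T, ‖ι (ρ n t) - ι (ρ m t)‖ ^ 2 ≤ 2 * K * (e n + e m) := by
    intro n m t ht
    have hp := (hρw n).pairing_evolution hskew hdense (hcni n) (hρc m) (hρw m) (hcni m) hs ht
    have hb := abs_integral_inner_apply_le (D := D) (c := fun r => cn n r - cn m r)
      ((hcni n).sub (hcni m)) (fun t ht => (hρn n t ht).le) (hbdR m) hs ht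
    rw [← hp] at hb
    simp only [hρs] at hb
    rw [real_inner_self_eq_norm_sq] at hb
    have h1 : ∫ r in Icc 0 T, ‖cn n r - cn m r‖ ≤ e n + e m := by
      rw [he, ← integral_add (hdi n).norm (hdi m).norm]
      refine integral_mono ((hcni n).sub (hcni m)).norm ((hdi n).norm.add (hdi m).norm) fun r => ?_
      simpa using norm_sub_le (cn n r - c r) (cn m r - c r)
    have h2 := (abs_le.1 (hb.trans (mul_le_mul_of_nonneg_left h1 hK0))).1
    rw [norm_sub_sq_real, hρn n t ht, hρn m t ht]
    linarith
  have hKlim : ∀ m, Tendsto (fun n => 2 * K * (e n + e m)) atTop (𝓝 (2 * K * e m)) := by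
    intro m
    have := (hlim.add_const (e m)).const_mul (2 * K)
    simpa using this
  have hlimit : ∀ t, ∃ y : H, t ∈ Icc 0 T → Tendsto (fun n => ι (ρ n t)) atTop (𝓝 y) := by
    intro t
    by_cases ht : t ∈ Icc 0 T
    · have : CauchySeq fun n => ι (ρ n t) := by
        rw [Metric.cauchySeq_iff]
        intro ε hε
        have hev : ∀ᶠ n in atTop, 2 * K * (e n + e n) < ε ^ 2 := by
          have : Tendsto (fun n => 2 * K * (e n + e n)) atTop (𝓝 0) := by
            have := (hlim.add hlim).const_mul (2 * K)
            simpa using this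
          exact (tendsto_order.1 this).2 _ (by positivity)
        obtain ⟨N, hN⟩ := eventually_atTop.1 hev
        refine ⟨N, fun n hn m hm => ?_⟩
        rw [dist_eq_norm]
        refine lt_of_pow_lt_pow_left₀ 2 hε.le ((hcauchy n m t ht).trans_lt ?_)
        have := hN n hn
        have := hN m hm
        linarith
      obtain ⟨y, hy⟩ := cauchySeq_tendsto_of_complete this
      exact ⟨y, fun _ => hy⟩
    · exact ⟨0, fun h => absurd h ht⟩
  choose θ hθ using hlimit
  have hrate : ∀ m, ∀ t ∈ Icc 0 T, ‖ι (ρ m t) - θ t‖ ^ 2 ≤ 2 * K * e m := by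
    intro m t ht
    rw [norm_sub_rev]
    refine le_of_tendsto_of_tendsto ((((hθ t ht).sub_const _).norm).pow 2) (hKlim m)
      (Eventually.of_forall fun n => hcauchy n m t ht)
  have hrate' : ∀ m, ∀ t ∈ Icc 0 T, ‖ι (ρ m t) - θ t‖ ≤ Real.sqrt (2 * K * e m) :=
    fun m t ht => Real.le_sqrt_of_sq_le (hrate m t ht)
  have hsq : Tendsto (fun m => Real.sqrt (2 * K * e m)) atTop (𝓝 0) := by
    have := (hlim.const_mul (2 * K)).sqrt
    simpa using this
  have hθn : ∀ t ∈ Icc 0 T, ‖θ t‖ = ‖ι x‖ := fun t ht =>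
    tendsto_nhds_unique ((hθ t ht).norm) (tendsto_const_nhds.congr fun n => (hρn n t ht).symm)
  have hθc : ContinuousOn θ (Icc 0 T) := by
    refine TendstoUniformlyOn.continuousOn (F := fun n t => ι (ρ n t)) (p := atTop) ?_
      (Frequently.of_forall fun n => (hρw n).continuousOn)
    rw [Metric.tendstoUniformlyOn_iff]
    intro ε hε
    filter_upwards [(tendsto_order.1 hsq).2 ε hε] with n hn t ht
    rw [dist_comm, dist_eq_norm]
    exact (hrate' n t ht).trans_lt hn
  have hθw : IsWeakEvolution ι D T c θ := by
    refine ⟨hθc, fun ψ s' hs' t' ht' => ?_⟩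
    have hl : Tendsto (fun n => inner ℝ (ι (ρ n t') - ι (ρ n s')) (ι ψ)) atTop
        (𝓝 (inner ℝ (θ t' - θ s') (ι ψ))) :=
      ((hθ t' ht').sub (hθ s' hs')).inner tendsto_const_nhds
    refine tendsto_nhds_unique hl ?_
    rw [tendsto_iff_norm_sub_tendsto_zero]
    have hup : Tendsto (fun n => Real.sqrt (2 * K * e n) * ‖D‖ * ‖ψ‖ * A
        + ‖ι x‖ * ‖D‖ * ‖ψ‖ * e n) atTop (𝓝 0) := by
      have := (((hsq.mul_const ‖D‖).mul_const ‖ψ‖).mul_const A).add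
        (hlim.const_mul (‖ι x‖ * ‖D‖ * ‖ψ‖))
      simpa using this
    refine tendsto_of_tendsto_of_tendsto_of_le_of_le tendsto_const_nhds hup
      (fun n => norm_nonneg _) fun n => ?_
    have i1 := intervalIntegrable_inner_apply (D := D) (θ := fun r => ι (ρ n r) - θ r)
      ((hρw n).continuousOn.sub hθc) (continuousOn_const (c := ψ)) hc hs' ht'
    have i2 := intervalIntegrable_inner_apply (D := D) (hρw n).continuousOn
      (continuousOn_const (c := ψ)) (hdi n) hs' ht'
    have i3 := intervalIntegrable_inner_apply (D := D) hθc
      (continuousOn_const (c := ψ)) hc hs' ht'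
    have i4 := intervalIntegrable_inner_apply (D := D) (hρw n).continuousOn
      (continuousOn_const (c := ψ)) (hcni n) hs' ht'
    have hsplit : inner ℝ (ι (ρ n t') - ι (ρ n s')) (ι ψ)
        - ∫ r in s'..t', inner ℝ (θ r) (D (c r) ψ)
        = (∫ r in s'..t', inner ℝ (ι (ρ n r) - θ r) (D (c r) ψ))
          + ∫ r in s'..t', inner ℝ (ι (ρ n r)) (D (cn n r - c r) ψ) := by
      rw [(hρw n).weak ψ s' hs' t' ht', ← intervalIntegral.integral_sub i4 i3,
        ← intervalIntegral.integral_add i1 i2]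
      refine intervalIntegral.integral_congr fun r _ => ?_
      simp only [map_sub, sub_apply, inner_sub_left, inner_sub_right]
      ring
    rw [hsplit]
    refine (norm_add_le _ _).trans (add_le_add ?_ ?_)
    · exact abs_integral_inner_apply_le (θ := fun r => ι (ρ n r) - θ r) (ρ := fun _ => ψ) hc
        (hrate' n) (fun _ _ => le_rfl) hs' ht'
    · exact abs_integral_inner_apply_le (θ := fun r => ι (ρ n r)) (ρ := fun _ => ψ) (hdi n)
        (fun t ht => (hρn n t ht).le) (fun _ _ => le_rfl) hs' ht'
  -- the limit takes values in `V`
  have hgrow : ∀ t, ∃ y : V, t ∈ Icc 0 T → ι y = θ t ∧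
      ‖y‖ ≤ Real.exp |∫ r in s..t, L * ‖c r‖| * ‖x‖ := by
    intro t
    by_cases ht : t ∈ Icc 0 T
    · have hM : Tendsto (fun n => Real.exp |∫ r in s..t, L * ‖cn n r‖| * ‖x‖) atTop
          (𝓝 (Real.exp |∫ r in s..t, L * ‖c r‖| * ‖x‖)) := by
        have h1 : Tendsto (fun n => ∫ r in s..t, L * ‖cn n r‖) atTop
            (𝓝 (∫ r in s..t, L * ‖c r‖)) := by
          rw [tendsto_iff_norm_sub_tendsto_zero]
          have hup : Tendsto (fun n => L * e n) atTop (𝓝 0) := by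
            simpa using hlim.const_mul L
          refine tendsto_of_tendsto_of_tendsto_of_le_of_le tendsto_const_nhds hup
            (fun n => norm_nonneg _) fun n => ?_
          have hsub : uIcc s t ⊆ Icc 0 T := (convex_Icc 0 T).ordConnected.uIcc_subset hs ht
          have i1 : IntegrableOn (fun r => L * ‖cn n r‖) (Icc 0 T) := (hcni n).norm.const_mul L
          have i2 : IntegrableOn (fun r => L * ‖c r‖) (Icc 0 T) := hc.norm.const_mul L
          have j1 := (i1.mono_set hsub).intervalIntegrable
          have j2 := (i2.mono_set hsub).intervalIntegrable
          rw [← intervalIntegral.integral_sub j1 j2,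
            intervalIntegral.norm_integral_eq_norm_integral_uIoc, he, ← integral_const_mul]
          have hsub' := uIoc_subset_uIcc.trans hsub
          have hi : IntegrableOn (fun r => L * ‖cn n r - c r‖) (Icc 0 T) :=
            (hdi n).norm.const_mul L
          refine (norm_integral_le_of_norm_le (hi.mono_set hsub') ?_).trans
            (setIntegral_mono_set hi (Eventually.of_forall fun r => by positivity)
              (Eventually.of_forall hsub'))
          refine Eventually.of_forall fun r => ?_
          rw [← mul_sub, norm_mul, Real.norm_of_nonneg hL]
          gcongr
          exact abs_norm_sub_norm_le _ _
        exact ((Real.continuous_exp.tendsto _).comp h1.abs).mul_const _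
      obtain ⟨y, hy1, hy2⟩ := exists_preimage_of_tendsto ι
        (fun n => by simpa only [hρs] using hρg n s hs t ht) hM (hθ t ht)
      exact ⟨y, fun _ => ⟨hy1, hy2⟩⟩
    · exact ⟨0, fun h => absurd h ht⟩
  choose y hy using hgrow
  have hιy : ∀ t ∈ Icc 0 T, ι (y t) = θ t := fun t ht => (hy t ht).1
  refine ⟨y, hinj ?_, ?_, fun t ht => (hy t ht).2, fun t ht => ?_, fun hx t ht => ?_, ?_⟩
  · rw [hιy s hs]
    exact tendsto_nhds_unique (hθ s hs) (by simp only [hρs]; exact tendsto_const_nhds)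
  · refine ⟨hθc.congr hιy, fun ψ s' hs' t' ht' => ?_⟩
    rw [hιy s' hs', hιy t' ht', hθw.weak ψ s' hs' t' ht']
    refine intervalIntegral.integral_congr fun r hr => ?_
    rw [hιy r ((convex_Icc 0 T).ordConnected.uIcc_subset hs' ht' hr)]
  · rw [hιy t ht, hθn t ht]
  · rw [hιy t ht]
    exact h𝒦.mem_of_tendsto (hθ t ht) (Eventually.of_forall fun n => hρ𝒦 n hx t ht)
  -- conservation of the pairing with an arbitrary weak solution `ζ`, from the approximations
  · intro ζ hζ t ht
    obtain ⟨M, hM⟩ := isCompact_Icc.exists_bound_of_continuousOn hζ.continuousOn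
    rw [hιy t ht]
    have h1 : Tendsto (fun n => inner ℝ (ζ t) (ι (ρ n t)) - inner ℝ (ζ s) (ι x)) atTop
        (𝓝 (inner ℝ (ζ t) (θ t) - inner ℝ (ζ s) (ι x))) :=
      ((tendsto_const_nhds).inner (hθ t ht)).sub_const _
    have h2 : Tendsto (fun n => inner ℝ (ζ t) (ι (ρ n t)) - inner ℝ (ζ s) (ι x)) atTop (𝓝 0) := by
      have hup : Tendsto (fun n => M * ‖D‖ * R * e n) atTop (𝓝 0) := by
        simpa using hlim.const_mul (M * ‖D‖ * R)
      refine squeeze_zero_norm (fun n => ?_) hup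
      have hp := hζ.pairing_evolution hskew hdense hc (hρc n) (hρw n) (hcni n) hs ht
      rw [hρs n] at hp
      rw [hp]
      refine (abs_integral_inner_apply_le (D := D) (c := fun r => c r - cn n r)
        (hc.sub (hcni n)) hM (hbdR n) hs ht).trans (le_of_eq ?_)
      simp only [he, norm_sub_rev]
    exact sub_eq_zero.1 (tendsto_nhds_unique h1 h2)

/-- Regular evolutions for all continuous controls give regular evolutions for all integrable
controls. -/
theorem hasRegularEvolution_of_integrable [CompleteSpace V] [CompleteSpace H]
    (hskew : ∀ u ψ φ, inner ℝ (D u ψ) (ι φ) = - inner ℝ (ι ψ) (D u φ)) (hdense : DenseRange ι)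
    (hinj : Function.Injective ι) (hL : 0 ≤ L) (h𝒦 : IsClosed 𝒦)
    (hreg : ∀ c : ℝ → U, Continuous c → HasRegularEvolution ι D T L 𝒦 c)
    (hc : IntegrableOn c (Icc 0 T)) : HasRegularEvolution ι D T L 𝒦 c := by
  intro s hs x
  have H := fun {s : ℝ} (hs : s ∈ Icc 0 T) (x : V) =>
    exists_evolution_of_integrable hskew hdense hinj hL h𝒦 hreg hc hs x
  obtain ⟨ρ, h1, h2, h3, h4, h5, -⟩ := H hs x
  have hgrow : ∀ s' ∈ Icc 0 T, ∀ t ∈ Icc 0 T,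
      ‖ρ t‖ ≤ Real.exp |∫ r in s'..t, L * ‖c r‖| * ‖ρ s'‖ := by
    intro s' hs' t ht
    -- the solution restarted from `ρ s'` at time `s'` has the growth bound from `s'`; it coincides
    -- with `ρ`, since their pairing and their norms are all equal to `‖ρ s'‖²` measured in `H`
    obtain ⟨ρ', k1, k2, k3, k4, -, k6⟩ := H hs' (ρ s')
    have hp := k6 _ h2 t ht
    rw [real_inner_self_eq_norm_sq, h4 s' hs'] at hp
    have : ‖ι (ρ t) - ι (ρ' t)‖ ^ 2 = 0 := by
      rw [norm_sub_sq_real, hp, h4 t ht, k4 t ht, h4 s' hs']; ring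
    have : ρ t = ρ' t := hinj
      (sub_eq_zero.1 (norm_eq_zero.1 (pow_eq_zero_iff two_ne_zero |>.1 this)))
    rw [this]
    exact k3 t ht
  exact ⟨ρ, h1, h2, continuousOn_of_growth hinj (hc.norm.const_mul L) h2.continuousOn hgrow,
    hgrow, h4, h5⟩

/-- Uniqueness by duality: a weak solution is tested with regular solutions of the same equation. -/
theorem IsWeakEvolution.eqOn [CompleteSpace H]
    (hskew : ∀ u ψ φ, inner ℝ (D u ψ) (ι φ) = - inner ℝ (ι ψ) (D u φ)) (hdense : DenseRange ι)
    (hc : IntegrableOn c (Icc 0 T)) (hreg : HasRegularEvolution ι D T L 𝒦 c) {θ₁ θ₂ : ℝ → H}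
    (h₁ : IsWeakEvolution ι D T c θ₁) (h₂ : IsWeakEvolution ι D T c θ₂) {s : ℝ}
    (hs : s ∈ Icc 0 T) (h : θ₁ s = θ₂ s) : EqOn θ₁ θ₂ (Icc 0 T) := by
  intro t ht
  refine sub_eq_zero.1 ?_
  refine hdense.eq_zero_of_inner_left (𝕜 := ℝ) fun x => ?_
  -- the regular solution with value `x` at time `t` is tested at times `s` and `t`
  obtain ⟨ρ, hρt, hρw, hρc, -⟩ := hreg t ht x
  have := (h₁.sub h₂ hc).pairing_evolution hskew hdense hc hρc hρw hc hs ht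
  simp only [h, sub_self, map_zero, zero_apply, inner_zero_right, inner_zero_left,
    intervalIntegral.integral_zero, sub_zero, hρt] at this
  exact this

/-- Solvability in `H`, by approximation of the datum with elements of `V`. -/
theorem exists_weakEvolution [CompleteSpace H]
    (hskew : ∀ u ψ φ, inner ℝ (D u ψ) (ι φ) = - inner ℝ (ι ψ) (D u φ)) (hdense : DenseRange ι)
    (h𝒦 : IsClosed 𝒦) (hc : IntegrableOn c (Icc 0 T)) (hreg : HasRegularEvolution ι D T L 𝒦 c)
    {s : ℝ} (hs : s ∈ Icc 0 T) {h : H} {x : ℕ → V} (hx : Tendsto (fun n => ι (x n)) atTop (𝓝 h))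
    (hx𝒦 : ∀ n, ι (x n) ∈ 𝒦) :
    ∃ θ : ℝ → H, θ s = h ∧ IsWeakEvolution ι D T c θ ∧ (∀ t ∈ Icc 0 T, ‖θ t‖ = ‖h‖) ∧
      ∀ t ∈ Icc 0 T, θ t ∈ 𝒦 := by
  choose ρ hρs hρw hρc hρg hρn hρ𝒦 using fun n => hreg s hs (x n)
  -- the evolution is isometric in `H`, so convergence of the data gives uniform convergence
  have hiso : ∀ n m, ∀ t ∈ Icc 0 T, ‖ι (ρ n t) - ι (ρ m t)‖ = ‖ι (x n) - ι (x m)‖ := by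
    intro n m t ht
    have hp := (hρw n).pairing_evolution hskew hdense hc (hρc m) (hρw m) hc hs ht
    simp only [sub_self, map_zero, zero_apply, inner_zero_right, intervalIntegral.integral_zero,
      hρs] at hp
    refine (sq_eq_sq₀ (norm_nonneg _) (norm_nonneg _)).1 ?_
    rw [norm_sub_sq_real, norm_sub_sq_real, hρn n t ht, hρn m t ht]
    linarith
  have hlimit : ∀ t, ∃ y : H, t ∈ Icc 0 T → Tendsto (fun n => ι (ρ n t)) atTop (𝓝 y) := by
    intro t
    by_cases ht : t ∈ Icc 0 T
    · have : CauchySeq fun n => ι (ρ n t) := by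
        rw [Metric.cauchySeq_iff]
        intro ε hε
        obtain ⟨N, hN⟩ := Metric.cauchySeq_iff.1 hx.cauchySeq ε hε
        refine ⟨N, fun n hn m hm => ?_⟩
        rw [dist_eq_norm, hiso n m t ht, ← dist_eq_norm]
        exact hN n hn m hm
      obtain ⟨y, hy⟩ := cauchySeq_tendsto_of_complete this
      exact ⟨y, fun _ => hy⟩
    · exact ⟨0, fun h => absurd h ht⟩
  choose θ hθ using hlimit
  have hrate : ∀ m, ∀ t ∈ Icc 0 T, ‖ι (ρ m t) - θ t‖ ≤ ‖ι (x m) - h‖ := by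
    intro m t ht
    rw [norm_sub_rev, norm_sub_rev (ι (x m))]
    refine le_of_tendsto_of_tendsto ((hθ t ht).sub_const _).norm ((hx.sub_const _).norm)
      (Eventually.of_forall fun n => (hiso n m t ht).le)
  have hx0 : Tendsto (fun n => ‖ι (x n) - h‖) atTop (𝓝 0) :=
    tendsto_iff_norm_sub_tendsto_zero.1 hx
  have hθc : ContinuousOn θ (Icc 0 T) := by
    refine TendstoUniformlyOn.continuousOn (F := fun n t => ι (ρ n t)) (p := atTop) ?_
      (Frequently.of_forall fun n => (hρw n).continuousOn)
    rw [Metric.tendstoUniformlyOn_iff]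
    intro ε hε
    filter_upwards [(tendsto_order.1 hx0).2 ε hε] with n hn t ht
    rw [dist_comm, dist_eq_norm]
    exact (hrate n t ht).trans_lt hn
  refine ⟨θ, ?_, ⟨hθc, fun ψ s' hs' t' ht' => ?_⟩, fun t ht => ?_, fun t ht => ?_⟩
  · exact tendsto_nhds_unique (hθ s hs) (by simpa only [hρs] using hx)
  · have hl : Tendsto (fun n => inner ℝ (ι (ρ n t') - ι (ρ n s')) (ι ψ)) atTop
        (𝓝 (inner ℝ (θ t' - θ s') (ι ψ))) :=
      ((hθ t' ht').sub (hθ s' hs')).inner tendsto_const_nhds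
    refine tendsto_nhds_unique hl ?_
    rw [tendsto_iff_norm_sub_tendsto_zero]
    have hup : Tendsto (fun n => ‖ι (x n) - h‖ * ‖D‖ * ‖ψ‖ * ∫ r in Icc 0 T, ‖c r‖) atTop
        (𝓝 0) := by
      simpa using ((hx0.mul_const ‖D‖).mul_const ‖ψ‖).mul_const (∫ r in Icc 0 T, ‖c r‖)
    refine tendsto_of_tendsto_of_tendsto_of_le_of_le tendsto_const_nhds hup
      (fun n => norm_nonneg _) fun n => ?_
    have i3 := intervalIntegrable_inner_apply (D := D) hθc
      (continuousOn_const (c := ψ)) hc hs' ht'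
    have i4 := intervalIntegrable_inner_apply (D := D) (hρw n).continuousOn
      (continuousOn_const (c := ψ)) hc hs' ht'
    rw [(hρw n).weak ψ s' hs' t' ht', ← intervalIntegral.integral_sub i4 i3]
    simp only [← inner_sub_left]
    exact abs_integral_inner_apply_le (θ := fun r => ι (ρ n r) - θ r) (ρ := fun _ => ψ) hc
        (hrate n) (fun _ _ => le_rfl) hs' ht'
  · exact tendsto_nhds_unique (hθ t ht).norm
      (hx.norm.congr fun n => (hρn n t ht).symm)
  · exact h𝒦.mem_of_tendsto (hθ t ht) (Eventually.of_forall fun n => hρ𝒦 n (hx𝒦 n) t ht)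

end AbstractEvolution


/-! ### Lipschitz domains: defining functions and the Lipschitz bound for the fields -/

section LipschitzDomain

variable {d : ℕ} {Ω : Set (E d)}

/-- Near a boundary point the domain is the set where a Lipschitz function `g` is negative, and `g`
grows with slope `1` in a fixed direction `e`. -/
lemma exists_defining_function (hΩ : IsBoundedLipschitzDomain Ω) {x₀ : E d}
    (hx₀ : x₀ ∈ frontier Ω) : ∃ e : E d, ‖e‖ = 1 ∧ ∃ (M : NNReal) (g : E d → ℝ),
      LipschitzWith M g ∧ (∀ y t, g (y + t • e) = g y + t) ∧ g x₀ = 0 ∧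
      ∃ r > 0, ∀ y ∈ Metric.ball x₀ r, (y ∈ Ω ↔ g y < 0) := by
  obtain ⟨e, he, K, f, hf, r, hr, H⟩ := hΩ.lipschitz_boundary x₀ hx₀
  have hlin : LipschitzWith ‖innerSL ℝ e‖₊ (fun y : E d => (inner ℝ e y : ℝ)) :=
    (innerSL ℝ e).lipschitz
  have hproj := (ContinuousLinearMap.id ℝ (E d) -
    (innerSL ℝ e).smulRight e).lipschitz
  have hF := hf.comp hproj
  have hg := hlin.sub hF
  have hee : inner ℝ e e = (1 : ℝ) := by rw [real_inner_self_eq_norm_sq, he]; norm_num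
  -- `g` is the signed height over the graph in the direction `e`
  refine ⟨e, he, _, fun y => inner ℝ e y - f (y - (inner ℝ e y : ℝ) • e), hg, ?_, ?_, r, hr, ?_⟩
  · intro y t
    simp only [inner_add_right, real_inner_smul_right, hee, mul_one]
    have : y + t • e - (inner ℝ e y + t) • e = y - (inner ℝ e y : ℝ) • e := by
      rw [add_smul]; abel
    rw [this, add_sub_right_comm]
  · have hx₀Ω : x₀ ∉ Ω := fun h => by
      have := hx₀.2
      rw [hΩ.isOpen.interior_eq] at this
      exact this h
    have h1 := H x₀ (Metric.mem_ball_self hr)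
    by_contra hne
    have hpos : 0 < inner ℝ e x₀ - f (x₀ - (inner ℝ e x₀ : ℝ) • e) := by
      refine lt_of_le_of_ne ?_ (Ne.symm hne)
      have := mt h1.2 hx₀Ω
      linarith
    -- if `g x₀ > 0`, a neighbourhood of `x₀` would miss `Ω`, although `x₀` is in its closure
    have hcont : Continuous (fun y => inner ℝ e y - f (y - (inner ℝ e y : ℝ) • e)) := hg.continuous
    have hnhds : {y | 0 < inner ℝ e y - f (y - (inner ℝ e y : ℝ) • e)} ∩ Metric.ball x₀ r ∈ 𝓝 x₀ :=
      inter_mem (hcont.continuousAt.preimage_mem_nhds (lt_mem_nhds hpos)) (Metric.ball_mem_nhds _ hr)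
    obtain ⟨y, ⟨hy1, hy2⟩, hyΩ⟩ := mem_closure_iff_nhds.1 hx₀.1 _ hnhds
    have := (H y hy2).1 hyΩ
    have hy1' : 0 < inner ℝ e y - f (y - (inner ℝ e y : ℝ) • e) := hy1
    linarith
  · intro y hy
    rw [H y hy, sub_neg]

/-- A bounded Lipschitz domain is the interior of its closure. -/
lemma interior_closure_subset (hΩ : IsBoundedLipschitzDomain Ω) : interior (closure Ω) ⊆ Ω := by
  intro x hx
  by_contra hxΩ
  have hfr : x ∈ frontier Ω := ⟨interior_subset hx, fun h => hxΩ (interior_subset h)⟩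
  obtain ⟨e, he, M, g, hg, hge, hgx, r, hr, H⟩ := exists_defining_function hΩ hfr
  -- the points `x + t • e` with `t > 0` are exterior points arbitrarily close to `x`
  have hline : Tendsto (fun t : ℝ => x + t • e) (𝓝[>] 0) (𝓝 x) := by
    have : Tendsto (fun t : ℝ => x + t • e) (𝓝 0) (𝓝 (x + (0 : ℝ) • e)) :=
      (by fun_prop : Continuous fun t : ℝ => x + t • e).tendsto 0
    rw [zero_smul, add_zero] at this
    exact this.mono_left nhdsWithin_le_nhds
  have hev := hline.eventually ((isOpen_interior.mem_nhds hx |> fun h => inter_mem h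
    (Metric.ball_mem_nhds x hr)))
  obtain ⟨t, ⟨ht1, ht2⟩, ht0⟩ := (hev.and self_mem_nhdsWithin).exists
  have ht0' : (0 : ℝ) < t := ht0
  have hpos : 0 < g (x + t • e) := by rw [hge, hgx]; linarith
  have hnhds : {y | 0 < g y} ∩ Metric.ball x r ∈ 𝓝 (x + t • e) :=
    inter_mem (hg.continuous.continuousAt.preimage_mem_nhds (lt_mem_nhds hpos))
      (Metric.isOpen_ball.mem_nhds ht2)
  obtain ⟨y, ⟨hy1, hy2⟩, hyΩ⟩ := mem_closure_iff_nhds.1 (interior_subset ht1) _ hnhds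
  have := (H y hy2).1 hyΩ
  have hy1' : 0 < g y := hy1
  linarith

/-- The zeros of the defining function are boundary points: moving against `e` enters `Ω`. -/
lemma mem_frontier_of_defining {e : E d} {g : E d → ℝ} {x₀ y : E d} {r : ℝ}
    (hge : ∀ y t, g (y + t • e) = g y + t)
    (H : ∀ y ∈ Metric.ball x₀ r, (y ∈ Ω ↔ g y < 0)) (hy : y ∈ Metric.ball x₀ r) (h0 : g y = 0) :
    y ∈ frontier Ω := by
  have hyΩ : y ∉ Ω := fun h => by have := (H y hy).1 h; linarith
  refine ⟨?_, fun h => hyΩ (interior_subset h)⟩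
  have hline : Tendsto (fun t : ℝ => y + (-t) • e) (𝓝[>] 0) (𝓝 y) := by
    have : Tendsto (fun t : ℝ => y + (-t) • e) (𝓝 0) (𝓝 (y + (-0 : ℝ) • e)) :=
      (by fun_prop : Continuous fun t : ℝ => y + (-t) • e).tendsto 0
    rw [neg_zero, zero_smul, add_zero] at this
    exact this.mono_left nhdsWithin_le_nhds
  refine mem_closure_of_tendsto hline ?_
  filter_upwards [hline.eventually (Metric.isOpen_ball.mem_nhds hy), self_mem_nhdsWithin]
    with t ht1 ht2
  have : (0 : ℝ) < t := ht2
  rw [H _ ht1, hge, h0]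
  linarith

/-- Near every point of the closure of a Lipschitz domain, two points of the domain are joined by a
polygonal path of comparable length: both are first pushed into the domain. -/
lemma exists_polygonal_path (hΩ : IsBoundedLipschitzDomain Ω) {x : E d} (hx : x ∈ closure Ω)
    {δ₀ : ℝ} (hδ₀ : 0 < δ₀) : ∃ δ > 0, ∃ C : ℝ, 0 ≤ C ∧ ∀ y ∈ Ω ∩ Metric.ball x δ,
      ∀ z ∈ Ω ∩ Metric.ball x δ, ∃ p q : E d, segment ℝ y p ⊆ Ω ∩ Metric.ball x δ₀ ∧
        segment ℝ p q ⊆ Ω ∩ Metric.ball x δ₀ ∧ segment ℝ q z ⊆ Ω ∩ Metric.ball x δ₀ ∧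
        ‖p - y‖ ≤ C * ‖z - y‖ ∧ ‖q - p‖ ≤ C * ‖z - y‖ ∧ ‖z - q‖ ≤ C * ‖z - y‖ := by
  by_cases hxΩ : x ∈ Ω
  · obtain ⟨δ, hδ, hδΩ⟩ := Metric.isOpen_iff.1 hΩ.isOpen x hxΩ
    refine ⟨min δ δ₀, by positivity, 1, zero_le_one, fun y hy z hz => ⟨y, z, ?_, ?_, ?_, ?_, ?_, ?_⟩⟩
    · rw [segment_same, singleton_subset_iff]
      exact ⟨hy.1, Metric.ball_subset_ball (min_le_right _ _) hy.2⟩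
    · refine ((convex_ball x (min δ δ₀)).segment_subset hy.2 hz.2).trans fun w hw => ⟨hδΩ ?_, ?_⟩
      · exact Metric.ball_subset_ball (min_le_left _ _) hw
      · exact Metric.ball_subset_ball (min_le_right _ _) hw
    · rw [segment_same, singleton_subset_iff]
      exact ⟨hz.1, Metric.ball_subset_ball (min_le_right _ _) hz.2⟩
    all_goals simp
  have hfr : x ∈ frontier Ω := ⟨hx, fun h => hxΩ (interior_subset h)⟩
  obtain ⟨e, he, M, g, hg, hge, hgx, r, hr, H⟩ := exists_defining_function hΩ hfr
  set R := min r δ₀ with hR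
  have hR0 : 0 < R := by positivity
  set N : ℝ := 1 + M with hN
  have hN1 : 1 ≤ N := by rw [hN]; linarith [M.coe_nonneg]
  -- room for moving both points by `N * ‖z - y‖`
  refine ⟨R / (4 * N), by positivity, N, by linarith, fun y hy z hz => ?_⟩
  set s : ℝ := N * ‖z - y‖ with hs
  have hyx := hy.2
  have hzx := hz.2
  rw [Metric.mem_ball, dist_eq_norm] at hyx hzx
  have hzy : ‖z - y‖ < R / (2 * N) := by
    have : ‖z - y‖ ≤ ‖z - x‖ + ‖y - x‖ := by
      have := norm_sub_le (z - x) (y - x); simpa using this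
    calc ‖z - y‖ < R / (4 * N) + R / (4 * N) := by linarith
      _ = R / (2 * N) := by field_simp; norm_num
  have hs0 : 0 ≤ s := by positivity
  have hsR : s < R / 2 := by
    calc s < N * (R / (2 * N)) := by rw [hs]; gcongr
      _ = R / 2 := by field_simp
  have hRN : R / (4 * N) ≤ R / 4 := by
    rw [div_le_div_iff₀ (by positivity) (by norm_num)]; nlinarith
  have hgM : ∀ a b : E d, g a ≤ g b + M * ‖a - b‖ := by
    intro a b
    have := hg.dist_le_mul a b
    rw [Real.dist_eq, dist_eq_norm] at this
    have := le_abs_self (g a - g b)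
    linarith
  have hgy : g y < 0 := (H y (Metric.ball_subset_ball (by
    have := min_le_left r δ₀; linarith) hy.2)).1 hy.1
  have hgz : g z < 0 := (H z (Metric.ball_subset_ball (by
    have := min_le_left r δ₀; linarith) hz.2)).1 hz.1
  have hin : ∀ w : E d, ‖w - x‖ < R → g w < 0 → w ∈ Ω ∩ Metric.ball x δ₀ := by
    intro w hw hgw
    have hwR : w ∈ Metric.ball x R := by rwa [Metric.mem_ball, dist_eq_norm]
    exact ⟨(H w (Metric.ball_subset_ball (min_le_left _ _) hwR)).2 hgw,
      Metric.ball_subset_ball (min_le_right _ _) hwR⟩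
  -- moving down from a point of `Ω` does not leave `Ω`
  have hvert : ∀ w : E d, ‖w - x‖ < R / 4 → g w < 0 → ∀ τ ∈ Icc (0 : ℝ) s,
      w + (-τ) • e ∈ Ω ∩ Metric.ball x δ₀ := by
    intro w hw hgw τ hτ
    refine hin _ ?_ (by rw [hge]; linarith [hτ.1])
    have : w + (-τ) • e - x = (w - x) + (-τ) • e := by abel
    rw [this]
    refine (norm_add_le _ _).trans_lt ?_
    rw [norm_smul, he, mul_one, Real.norm_eq_abs, abs_neg, abs_of_nonneg hτ.1]
    linarith [hτ.2]
  have hseg : ∀ w : E d, ‖w - x‖ < R / 4 → g w < 0 →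
      segment ℝ w (w + (-s) • e) ⊆ Ω ∩ Metric.ball x δ₀ := by
    intro w hw hgw v hv
    rw [segment_eq_image'] at hv
    obtain ⟨τ, hτ, rfl⟩ := hv
    have : w + τ • (w + (-s) • e - w) = w + (-(τ * s)) • e := by
      rw [add_sub_cancel_left, smul_smul, mul_neg]
    simp only [this]
    exact hvert w hw hgw _ ⟨mul_nonneg hτ.1 hs0, mul_le_of_le_one_left hs0 hτ.2⟩
  refine ⟨y + (-s) • e, z + (-s) • e, hseg y (by linarith) hgy, ?_, ?_, ?_, ?_, ?_⟩
  · intro v hv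
    rw [segment_eq_image'] at hv
    obtain ⟨τ, hτ, rfl⟩ := hv
    have e1 : y + (-s) • e + τ • (z + (-s) • e - (y + (-s) • e))
        = (y + τ • (z - y)) + (-s) • e := by
      rw [add_sub_add_right_eq_sub]; abel
    simp only [e1]
    have hτn : ‖τ • (z - y)‖ ≤ ‖z - y‖ := by
      rw [norm_smul, Real.norm_of_nonneg hτ.1]
      exact mul_le_of_le_one_left (norm_nonneg _) hτ.2
    have hconv : ‖y + τ • (z - y) - x‖ < R / (4 * N) := by
      have := (convex_ball x (R / (4 * N))).segment_subset hy.2 hz.2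
        (show y + τ • (z - y) ∈ segment ℝ y z by rw [segment_eq_image']; exact ⟨τ, hτ, rfl⟩)
      rwa [Metric.mem_ball, dist_eq_norm] at this
    refine hin _ ?_ ?_
    · have : y + τ • (z - y) + (-s) • e - x = (y + τ • (z - y) - x) + (-s) • e := by abel
      rw [this]
      refine (norm_add_le _ _).trans_lt ?_
      rw [norm_smul, he, mul_one, Real.norm_eq_abs, abs_neg, abs_of_nonneg hs0]
      linarith
    · rw [hge]
      have h1 := hgM (y + τ • (z - y)) y
      rw [add_sub_cancel_left] at h1
      -- moving from `y` towards `z` raises `g` by at most `M * ‖z - y‖`, less than the descent `s`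
      have h2 : (M : ℝ) * ‖τ • (z - y)‖ ≤ M * ‖z - y‖ := by gcongr
      have h3 : (M : ℝ) * ‖z - y‖ ≤ s := by
        rw [hs, hN]; nlinarith [norm_nonneg (z - y)]
      linarith
  · rw [segment_symm]; exact hseg z (by linarith) hgz
  · rw [add_sub_cancel_left, norm_smul, he, mul_one, Real.norm_eq_abs, abs_neg,
      abs_of_nonneg hs0]
  · rw [add_sub_add_right_eq_sub]
    nlinarith [norm_nonneg (z - y)]
  · rw [sub_add_cancel_left, norm_neg, norm_smul, he, mul_one, Real.norm_eq_abs, abs_neg,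
      abs_of_nonneg hs0]

/-- A field that is `C¹` up to the boundary of a bounded Lipschitz domain is Lipschitz. -/
lemma exists_lipschitzOnWith_closure (hΩ : IsBoundedLipschitzDomain Ω) {b : E d → E d}
    (hb : ContDiffOn ℝ 1 b (closure Ω)) : ∃ K, LipschitzOnWith K b (closure Ω) := by
  have hcomp : IsCompact (closure Ω) := hΩ.isBounded.isCompact_closure
  refine LocallyLipschitzOn.exists_lipschitzOnWith_of_compact hcomp fun x hx => ?_
  have hbx : ContDiffWithinAt ℝ (0 + 1) b (closure Ω) x := by simpa using hb x hx
  obtain ⟨u, hu, -, b', hb', hcont⟩ :=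
    (contDiffWithinAt_succ_iff_hasFDerivWithinAt (by simp)).1 hbx
  rw [insert_eq_of_mem hx] at hu
  have hbd : ∀ᶠ y in 𝓝[u] x, ‖b' y‖ < ‖b' x‖ + 1 :=
    (hcont.continuousWithinAt.norm).eventually_lt continuousWithinAt_const (by simp)
  have hle : 𝓝[closure Ω] x ≤ 𝓝[u] x := nhdsWithin_le_of_mem hu
  obtain ⟨δ₀, hδ₀, hball⟩ := Metric.mem_nhdsWithin_iff.1 (inter_mem hu (hle hbd))
  obtain ⟨δ, hδ, C, hC, hpath⟩ := exists_polygonal_path hΩ hx hδ₀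
  set N := ‖b' x‖ + 1 with hN
  have hN0 : 0 ≤ N := by positivity
  -- near `x` the derivative extends continuously to the closure, hence is bounded
  have hder : ∀ y ∈ Ω ∩ Metric.ball x δ₀, HasFDerivAt b (b' y) y ∧ ‖b' y‖ ≤ N := by
    intro y hy
    have hsub : Ω ∩ Metric.ball x δ₀ ⊆ u := fun w hw =>
      (hball ⟨hw.2, subset_closure hw.1⟩).1
    have hmem : u ∈ 𝓝 y :=
      mem_of_superset ((hΩ.isOpen.inter Metric.isOpen_ball).mem_nhds hy) hsub
    have hy2 := (hball ⟨hy.2, subset_closure hy.1⟩).2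
    exact ⟨(hb' y (hsub hy)).hasFDerivAt hmem, le_of_lt hy2⟩
  have hseg : ∀ p q : E d, segment ℝ p q ⊆ Ω ∩ Metric.ball x δ₀ → ‖b q - b p‖ ≤ N * ‖q - p‖ := by
    intro p q hpq
    exact (convex_segment p q).norm_image_sub_le_of_norm_hasFDerivWithin_le
      (fun w hw => (hder w (hpq hw)).1.hasFDerivWithinAt) (fun w hw => (hder w (hpq hw)).2)
      (left_mem_segment ℝ p q) (right_mem_segment ℝ p q)
  have hlip : LipschitzOnWith (3 * N * C).toNNReal b (Ω ∩ Metric.ball x δ) := by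
    refine LipschitzOnWith.of_dist_le_mul fun z hz y hy => ?_
    obtain ⟨p, q, h1, h2, h3, l1, l2, l3⟩ := hpath y hy z hz
    rw [Real.coe_toNNReal _ (by positivity), dist_eq_norm, dist_eq_norm]
    have k1 := hseg _ _ h1
    have k2 := hseg _ _ h2
    have k3 := hseg _ _ h3
    have : b z - b y = (b z - b q) + (b q - b p) + (b p - b y) := by abel
    rw [this]
    calc _ ≤ ‖b z - b q‖ + ‖b q - b p‖ + ‖b p - b y‖ := norm_add₃_le
      _ ≤ N * (C * ‖z - y‖) + N * (C * ‖z - y‖) + N * (C * ‖z - y‖) := by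
          gcongr
          · exact k3.trans (by gcongr)
          · exact k2.trans (by gcongr)
          · exact k1.trans (by gcongr)
      _ = 3 * N * C * ‖z - y‖ := by ring
  have hlipc := LipschitzOnWith.closure
    (hb.continuousOn.mono (closure_mono inter_subset_left)) hlip
  refine ⟨_, _, ?_, hlipc⟩
  refine Metric.mem_nhdsWithin_iff.2 ⟨δ, hδ, ?_⟩
  rw [inter_comm Ω]
  exact Metric.isOpen_ball.inter_closure

/-- Lipschitz extension of a bounded field, with a bound. -/
lemma exists_bounded_lipschitz_extension {K : NNReal} {b : E d → E d} {s : Set (E d)}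
    (hb : LipschitzOnWith K b s) {S : ℝ} (hS : ∀ x ∈ s, ‖b x‖ ≤ S) :
    ∃ (K' : NNReal) (S' : ℝ) (B : E d → E d), LipschitzWith K' B ∧ (∀ x, ‖B x‖ ≤ S') ∧
      EqOn b B s := by
  -- the coordinates are extended one by one and truncated at height `|S|`
  have hcoord : ∀ i : Fin d, ∃ β : E d → ℝ, LipschitzWith K β ∧ (∀ x, |β x| ≤ |S|) ∧
      ∀ x ∈ s, b x i = β x := by
    intro i
    have h1 : LipschitzOnWith K (fun x => b x i) s := by
      refine LipschitzOnWith.of_dist_le_mul fun x hx y hy => ?_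
      refine le_trans ?_ (hb.dist_le_mul x hx y hy)
      rw [dist_eq_norm, dist_eq_norm]
      exact PiLp.norm_apply_le (b x - b y) i
    obtain ⟨β, hβ, hβs⟩ := h1.extend_real
    refine ⟨fun x => max (-|S|) (min (β x) |S|), (hβ.min_const _).const_max _, fun x => ?_,
      fun x hx => ?_⟩
    · rw [abs_le]
      exact ⟨le_max_left _ _, max_le (by linarith [abs_nonneg S]) (min_le_right _ _)⟩
    · have h2 : |b x i| ≤ |S| :=
        (PiLp.norm_apply_le (b x) i).trans ((hS x hx).trans (le_abs_self S))
      have h3 := hβs hx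
      beta_reduce at h3 ⊢
      rw [← h3, min_eq_left (abs_le.1 h2).2, max_eq_right (abs_le.1 h2).1]
  choose β hβ hβS hβs using hcoord
  refine ⟨d * K, d * |S|, fun x => ∑ i, β i x • EuclideanSpace.single i (1 : ℝ), ?_, ?_, ?_⟩
  · refine LipschitzWith.of_dist_le_mul fun x y => ?_
    rw [dist_eq_norm, ← Finset.sum_sub_distrib]
    refine (norm_sum_le _ _).trans ?_
    calc _ ≤ ∑ _i : Fin d, (K : ℝ) * dist x y := by
          refine Finset.sum_le_sum fun i _ => ?_
          rw [← sub_smul, norm_smul, PiLp.norm_single]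
          simpa [Real.dist_eq] using (hβ i).dist_le_mul x y
      _ = _ := by simp [mul_assoc]
  · intro x
    refine (norm_sum_le _ _).trans ?_
    calc _ ≤ ∑ _i : Fin d, |S| := by
          refine Finset.sum_le_sum fun i _ => ?_
          rw [norm_smul, PiLp.norm_single]
          simpa using hβS i x
      _ = _ := by simp
  · intro x hx
    ext j
    simp only [WithLp.ofLp_sum, WithLp.ofLp_smul, Finset.sum_apply, Pi.smul_apply,
      PiLp.single_apply, smul_eq_mul]
    simp [hβs j x hx]

end LipschitzDomain


/-! ### Cutoff functions adapted to tangential fields -/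

section Cutoff

variable {d m : ℕ} {Ω : Set (E d)}

/-- A test function that is `1` near a given compact subset of the open set `Ω`. -/
lemma exists_test_eq_one {K : Set (E d)} (hΩ : IsOpen Ω) (hK : IsCompact K) (hKΩ : K ⊆ Ω) :
    ∃ κ : E d → ℝ, IsTest Ω κ ∧ (∀ x, κ x ∈ Icc (0 : ℝ) 1) ∧ ∀ x ∈ K, κ =ᶠ[𝓝 x] 1 := by
  obtain ⟨δ, hδ, hδΩ⟩ := hK.exists_cthickening_subset_open hΩ hKΩ
  obtain ⟨κ, h1, h2, h3, h4⟩ := exists_contMDiff_support_eq_eq_one_iff (n := ⊤)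
    (modelWithCornersSelf ℝ (E d))
    (Metric.isOpen_thickening (δ := δ) (E := K)) (Metric.isClosed_cthickening (δ := δ / 2) (E := K))
    (Metric.cthickening_subset_thickening' hδ (by linarith) K)
  have hts : tsupport κ ⊆ Metric.cthickening δ K := by
    rw [tsupport, h3]
    exact Metric.closure_thickening_subset_cthickening _ _
  refine ⟨κ, ⟨h1.contDiff, hK.cthickening.of_isClosed_subset (isClosed_tsupport _) hts,
    hts.trans hδΩ⟩, fun x => h2 (mem_range_self x), fun x hx => ?_⟩
  have hδ2 : 0 < δ / 2 := by linarith
  filter_upwards [Metric.isOpen_thickening.mem_nhds (Metric.self_subset_thickening hδ2 K hx)]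
    with y hy
  exact (h4 y).1 (Metric.thickening_subset_cthickening _ _ hy)

/-- Almost everywhere in `Ω` near a boundary point, the derivative of the defining function along a
tangential field is controlled by the defining function itself: at the point of the boundary
that lies above in the direction `e`, the defining function has the same derivative, and there it
annihilates the field because the normal exists. -/
lemma exists_ae_fderiv_defining_le (hΩ : IsBoundedLipschitzDomain Ω) {b : Fin m → E d → E d}
    (hb : ∀ i x n, IsOutwardNormal Ω x n → inner ℝ (b i x) n = 0)
    {K : NNReal} (hK : ∀ i, LipschitzOnWith K (b i) (closure Ω)) {e : E d} (he : ‖e‖ = 1)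
    {M : NNReal} {g : E d → ℝ} (hg : LipschitzWith M g) (hge : ∀ y t, g (y + t • e) = g y + t)
    {x₀ : E d} (hgx : g x₀ = 0) {r : ℝ} (hr : 0 < r)
    (H : ∀ y ∈ Metric.ball x₀ r, (y ∈ Ω ↔ g y < 0)) :
    ∃ r₁ > 0, r₁ ≤ r ∧ ∀ᵐ y ∂(volume.restrict Ω), y ∈ Metric.ball x₀ r₁ → ∀ i,
      |fderiv ℝ g y (b i y)| ≤ M * K * |g y| := by
  have hM1 : (0 : ℝ) < 1 + M := by positivity
  have hle : r / (1 + M) ≤ r := div_le_self hr.le (by linarith [M.coe_nonneg])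
  refine ⟨r / (1 + M), by positivity, hle, ?_⟩
  have hae : ∀ᵐ y ∂(volume.restrict Ω), DifferentiableAt ℝ g y :=
    ae_restrict_of_ae hg.ae_differentiableAt
  filter_upwards [hae, ae_restrict_mem hΩ.isOpen.measurableSet] with y hy hyΩ hyb i
  set L := fderiv ℝ g y with hL
  -- `y'` is the boundary point over `y`; as `g` is affine along `e`, it has there the same derivative
  set y' := y + (-g y) • e with hy'
  have hgy' : g y' = 0 := by rw [hy', hge]; ring
  have hder : HasFDerivAt g L y' := by
    have h1 : HasFDerivAt (fun z => g (z + (g y) • e) - g y) L y' := by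
      have h2 : HasFDerivAt g L (y' + (g y) • e) := by
        have : y' + (g y) • e = y := by rw [hy', neg_smul]; abel
        rw [this]; exact hy.hasFDerivAt
      exact ((hasFDerivAt_comp_add_right _).2 h2).sub_const _
    refine h1.congr_of_eventuallyEq (Eventually.of_forall fun z => ?_)
    simp only [hge]; ring
  have hyy' : ‖y - y'‖ = |g y| := by
    rw [hy', sub_add_cancel_left, norm_neg, norm_smul, he, mul_one, Real.norm_eq_abs, abs_neg]
  have hball : y' ∈ Metric.ball x₀ r := by
    rw [Metric.mem_ball, dist_eq_norm] at hyb ⊢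
    have h1 : |g y| ≤ M * ‖y - x₀‖ := by
      have := hg.dist_le_mul y x₀
      rwa [Real.dist_eq, hgx, sub_zero, dist_eq_norm] at this
    have h2 : ‖y' - x₀‖ ≤ ‖y - x₀‖ + |g y| := by
      rw [← hyy', norm_sub_rev y y', add_comm]
      exact norm_sub_le_norm_sub_add_norm_sub _ _ _
    calc ‖y' - x₀‖ ≤ (1 + M) * ‖y - x₀‖ := by linarith
      _ < (1 + M) * (r / (1 + M)) := by gcongr
      _ = r := by field_simp
  have hfr : y' ∈ frontier Ω := mem_frontier_of_defining hge H hball hgy'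
  -- the gradient of `g` does not vanish: its derivative along `e` is `1`
  have hLe : L e = 1 := by
    have h1 : HasDerivAt (fun t : ℝ => g (y' + t • e)) (L e) 0 := by
      have h0 : HasFDerivAt g L (y' + (0 : ℝ) • e) := by simpa using hder
      have := h0.comp_hasDerivAt (0 : ℝ) (((hasDerivAt_id (0 : ℝ)).smul_const e).const_add y')
      rw [one_smul] at this; exact this
    have h2 : HasDerivAt (fun t : ℝ => g (y' + t • e)) 1 0 := by
      simp only [hge]
      exact (hasDerivAt_id (0 : ℝ)).const_add _
    exact h1.unique h2
  set G := (InnerProductSpace.toDual ℝ (E d)).symm L with hG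
  have hGL : ∀ v, inner ℝ G v = L v := fun v => InnerProductSpace.toDual_symm_apply
  have hG0 : 0 < ‖G‖ := by
    rw [norm_pos_iff]; intro h
    have := hGL e
    rw [h, inner_zero_left, hLe] at this
    exact zero_ne_one this
  -- the normalised gradient of `g` at `y'` is an outward normal in the sense of the definition
  have hnormal : IsOutwardNormal Ω y' (‖G‖⁻¹ • G) := by
    refine ⟨hfr, by rw [norm_smul, norm_inv, norm_norm, inv_mul_cancel₀ hG0.ne'], fun ε hε => ?_⟩
    have hlo := hder.isLittleO.def (show 0 < ε * ‖G‖ by positivity)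
    filter_upwards [hlo, Metric.isOpen_ball.mem_nhds hball] with z hz hzb
    rw [hgy', sub_zero, Real.norm_eq_abs, abs_le] at hz
    have hLz : L (z - y') = ‖G‖ * inner ℝ (‖G‖⁻¹ • G) (z - y') := by
      rw [real_inner_smul_left, hGL]; field_simp
    rw [hLz] at hz
    constructor
    · intro h
      rw [H z hzb]
      have := mul_lt_mul_of_pos_left h hG0
      nlinarith [hz.2]
    · intro h hzΩ
      rw [H z hzb] at hzΩ
      have := mul_lt_mul_of_pos_left h hG0
      nlinarith [hz.1]
  have hzero : L (b i y') = 0 := by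
    have := hb i y' _ hnormal
    rw [real_inner_smul_right, real_inner_comm, hGL] at this
    rcases mul_eq_zero.1 this with h | h
    · exact absurd h (inv_ne_zero hG0.ne')
    · exact h
  have hLM : ‖L‖ ≤ M := norm_fderiv_le_of_lipschitz ℝ hg
  calc |L (b i y)| = ‖L (b i y - b i y')‖ := by rw [map_sub, hzero, sub_zero, Real.norm_eq_abs]
    _ ≤ ‖L‖ * ‖b i y - b i y'‖ := L.le_opNorm _
    _ ≤ M * (K * ‖y - y'‖) := by
        gcongr
        have := (hK i).dist_le_mul y (subset_closure hyΩ) y' hfr.1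
        rwa [dist_eq_norm, dist_eq_norm] at this
    _ = M * K * |g y| := by rw [hyy']; ring

/-- A smooth function that is `1` on `(-∞, -2]` and `0` on `[-1, ∞)`. -/
noncomputable def step (s : ℝ) : ℝ := Real.smoothTransition (-s - 1)

lemma step_contDiff : ContDiff ℝ ∞ step :=
  Real.smoothTransition.contDiff.comp (by fun_prop)

lemma step_mem (s : ℝ) : step s ∈ Icc (0 : ℝ) 1 :=
  ⟨Real.smoothTransition.nonneg _, Real.smoothTransition.le_one _⟩

lemma step_zero {s : ℝ} (hs : -1 ≤ s) : step s = 0 :=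
  Real.smoothTransition.zero_of_nonpos (by linarith)

lemma step_one {s : ℝ} (hs : s ≤ -2) : step s = 1 :=
  Real.smoothTransition.one_of_one_le (by linarith)

lemma deriv_step_eq_zero {s : ℝ} (hs : s ∉ Icc (-2 : ℝ) (-1)) : deriv step s = 0 := by
  rw [mem_Icc, not_and_or, not_le, not_le] at hs
  rcases hs with h | h
  · have : step =ᶠ[𝓝 s] fun _ => 1 := by
      filter_upwards [Iio_mem_nhds h] with t ht using step_one (le_of_lt ht)
    rw [this.deriv_eq, deriv_const]
  · have : step =ᶠ[𝓝 s] fun _ => 0 := by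
      filter_upwards [Ioi_mem_nhds h] with t ht using step_zero (le_of_lt ht)
    rw [this.deriv_eq, deriv_const]

/-- The derivative of `step` lives in `[-2, -1]`, so `s ↦ step' s` and `s ↦ s * step' s` are both
bounded. The second bound is what makes the cutoffs at all scales uniform. -/
lemma exists_deriv_step_bound : ∃ A : ℝ, 0 ≤ A ∧ ∀ s, |deriv step s| ≤ A ∧ |deriv step s * s| ≤ A := by
  have hc : Continuous (deriv step) := step_contDiff.continuous_deriv (by simp)
  obtain ⟨A, hA⟩ := (isCompact_Icc (a := (-2 : ℝ)) (b := -1)).exists_bound_of_continuousOn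
    hc.continuousOn
  have hA0 : 0 ≤ A := (norm_nonneg _).trans (hA (-1) (by norm_num))
  refine ⟨2 * A, by linarith, fun s => ?_⟩
  by_cases hs : s ∈ Icc (-2 : ℝ) (-1)
  · have h1 := hA s hs
    rw [Real.norm_eq_abs] at h1
    have h2 : |s| ≤ 2 := abs_le.2 ⟨hs.1, by linarith [hs.2]⟩
    refine ⟨by linarith, ?_⟩
    rw [abs_mul, mul_comm]
    gcongr
  · rw [deriv_step_eq_zero hs]
    simp [hA0]

/-- A sequence of Lipschitz cutoffs with values in `[0, 1]` that are eventually `1` near every point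
of `Ω`, and whose derivatives along the fields `b i` are bounded in `Ω` uniformly in the
sequence. -/
structure IsTangentialCutoff (Ω : Set (E d)) (b : Fin m → E d → E d) (χ : ℕ → E d → ℝ) :
    Prop where
  lipschitz : ∀ n, ∃ K, LipschitzWith K (χ n)
  mem_Icc : ∀ n x, χ n x ∈ Icc (0 : ℝ) 1
  eventually_one : ∀ x ∈ Ω, ∀ᶠ n in atTop, χ n =ᶠ[𝓝 x] 1
  bounded : ∃ C, ∀ n i, ∀ᵐ x ∂(volume.restrict Ω), |fderiv ℝ (χ n) x (b i x)| ≤ C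

lemma IsTangentialCutoff.abs_le {b : Fin m → E d → E d} {χ : ℕ → E d → ℝ}
    (h : IsTangentialCutoff Ω b χ) (n : ℕ) (x : E d) : |χ n x| ≤ 1 := by
  rw [abs_of_nonneg (h.mem_Icc n x).1]; exact (h.mem_Icc n x).2

lemma IsTangentialCutoff.mul {b : Fin m → E d → E d} {χ χ' : ℕ → E d → ℝ}
    (h : IsTangentialCutoff Ω b χ) (h' : IsTangentialCutoff Ω b χ') :
    IsTangentialCutoff Ω b (fun n x => χ n x * χ' n x) := by
  refine ⟨fun n => ?_, fun n x => ?_, fun x hx => ?_, ?_⟩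
  · obtain ⟨K, hK⟩ := h.lipschitz n
    obtain ⟨K', hK'⟩ := h'.lipschitz n
    exact lipschitzWith_mul_of_bound hK hK' (h.abs_le n) (h'.abs_le n)
  · exact ⟨mul_nonneg (h.mem_Icc n x).1 (h'.mem_Icc n x).1,
      mul_le_one₀ (h.mem_Icc n x).2 (h'.mem_Icc n x).1 (h'.mem_Icc n x).2⟩
  · filter_upwards [h.eventually_one x hx, h'.eventually_one x hx] with n h1 h2
    filter_upwards [h1, h2] with y hy1 hy2
    simp [hy1, hy2]
  · obtain ⟨C, hC⟩ := h.bounded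
    obtain ⟨C', hC'⟩ := h'.bounded
    refine ⟨C + C', fun n i => ?_⟩
    obtain ⟨K, hK⟩ := h.lipschitz n
    obtain ⟨K', hK'⟩ := h'.lipschitz n
    filter_upwards [hC n i, hC' n i, ae_restrict_of_ae hK.ae_differentiableAt,
      ae_restrict_of_ae hK'.ae_differentiableAt] with x h1 h2 h3 h4
    rw [fderiv_fun_mul h3 h4]
    simp only [add_apply, smul_apply, smul_eq_mul]
    refine (abs_add_le _ _).trans ?_
    rw [abs_mul, abs_mul]
    have := h.abs_le n x
    have := h'.abs_le n x
    have h5 : |χ n x| * |fderiv ℝ (χ' n) x (b i x)| ≤ 1 * C' := by gcongr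
    have h6 : |χ' n x| * |fderiv ℝ (χ n) x (b i x)| ≤ 1 * C := by gcongr
    linarith

/-- The cutoffs that cut nothing off. They are the starting point for multiplying local cutoffs. -/
lemma isTangentialCutoff_one (b : Fin m → E d → E d) :
    IsTangentialCutoff Ω b (fun _ _ => 1) := by
  refine ⟨fun n => ⟨0, LipschitzWith.const 1⟩, fun n x => ⟨zero_le_one, le_rfl⟩, fun x _ => ?_, 0,
    fun n i => ?_⟩
  · exact Eventually.of_forall fun n => EventuallyEq.rfl
  · simp

/-- Near a boundary point there are tangential cutoffs that vanish near the boundary. -/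
lemma exists_local_tangentialCutoff (hΩ : IsBoundedLipschitzDomain Ω) {b : Fin m → E d → E d}
    (hb : ∀ i x n, IsOutwardNormal Ω x n → inner ℝ (b i x) n = 0)
    {K : NNReal} (hK : ∀ i, LipschitzOnWith K (b i) (closure Ω)) {S : ℝ}
    (hS : ∀ i, ∀ x ∈ Ω, ‖b i x‖ ≤ S) {x₀ : E d} (hx₀ : x₀ ∈ frontier Ω) :
    ∃ χ : ℕ → E d → ℝ, IsTangentialCutoff Ω b χ ∧ ∃ δ > 0, ∀ n, ∃ O : Set (E d), IsOpen O ∧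
      frontier Ω ∩ Metric.ball x₀ δ ⊆ O ∧ ∀ x ∈ O, χ n x = 0 := by
  obtain ⟨e, he, M, g, hg, hge, hgx, r, hr, H⟩ := exists_defining_function hΩ hx₀
  obtain ⟨r₁, hr₁, hr₁r, hae⟩ := exists_ae_fderiv_defining_le hΩ hb hK he hg hge hgx hr H
  obtain ⟨A, hA0, hA⟩ := exists_deriv_step_bound
  have hg0 : ∀ y ∈ frontier Ω, y ∈ Metric.ball x₀ r → 0 ≤ g y := by
    intro y hy hyb
    by_contra h
    have hyΩ := (H y hyb).2 (not_le.1 h)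
    have := hy.2
    rw [hΩ.isOpen.interior_eq] at this
    exact this hyΩ
  -- `ζ` localises near `x₀`; there `χ n` is `step ((n + 1) * g)`, a cutoff at distance about
  -- `1 / n` from the boundary
  set ζ : ContDiffBump x₀ := ⟨r₁ / 4, r₁ / 2, by positivity, by linarith⟩ with hζ
  have hζs : ContDiff ℝ ∞ ζ := ζ.contDiff
  have hζd : ∀ x, DifferentiableAt ℝ ζ x := fun x => hζs.differentiable (by simp) x
  obtain ⟨Kζ, hKζ⟩ := hζs.lipschitzWith_of_hasCompactSupport ζ.hasCompactSupport (by simp)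
  have hsd : ∀ s, HasDerivAt step (deriv step s) s := fun s =>
    (step_contDiff.differentiable (by simp) s).hasDerivAt
  have hstepL : LipschitzWith A.toNNReal step :=
    lipschitzWith_of_nnnorm_deriv_le (step_contDiff.differentiable (by simp)) fun s => by
      rw [← NNReal.coe_le_coe, coe_nnnorm, Real.coe_toNNReal _ hA0]
      exact (hA s).1
  set h : ℕ → E d → ℝ := fun n y => step ((n + 1) * g y) with hh
  set χ : ℕ → E d → ℝ := fun n y => 1 - ζ y * (1 - h n y) with hχ
  have hhL : ∀ n, ∃ C, LipschitzWith C (fun y => 1 - h n y) := by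
    intro n
    have h1 : LipschitzWith ((n + 1 : NNReal) * M) (fun y => ((n : ℝ) + 1) * g y) := by
      refine LipschitzWith.of_dist_le_mul fun x y => ?_
      rw [Real.dist_eq, ← mul_sub, abs_mul, abs_of_nonneg (by positivity : (0 : ℝ) ≤ n + 1)]
      have := hg.dist_le_mul x y
      rw [Real.dist_eq] at this
      push_cast
      rw [mul_assoc]
      gcongr
    exact ⟨_, (LipschitzWith.const (1 : ℝ)).sub (hstepL.comp h1)⟩
  have hh01 : ∀ n y, 0 ≤ 1 - h n y ∧ 1 - h n y ≤ 1 := fun n y =>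
    ⟨by linarith [(step_mem ((n + 1) * g y)).2], by linarith [(step_mem ((n + 1) * g y)).1]⟩
  have hr₁r4 : Metric.closedBall x₀ (r₁ / 2) ⊆ Metric.ball x₀ r :=
    Metric.closedBall_subset_ball (by linarith)
  refine ⟨χ, ⟨fun n => ?_, fun n y => ?_, fun x hx => ?_, ?_⟩, r₁ / 4, by positivity,
    fun n => ?_⟩
  · obtain ⟨C, hC⟩ := hhL n
    obtain ⟨C', hC'⟩ := lipschitzWith_mul_of_bound hKζ hC (A := 1) (B := 1)
      (fun x => by rw [abs_of_nonneg ζ.nonneg]; exact ζ.le_one)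
      (fun y => by rw [abs_of_nonneg (hh01 n y).1]; exact (hh01 n y).2)
    exact ⟨_, (LipschitzWith.const (1 : ℝ)).sub hC'⟩
  · have h1 := hh01 n y
    have h2 : 0 ≤ ζ y := ζ.nonneg
    have h3 : ζ y ≤ 1 := ζ.le_one
    have h4 : 0 ≤ ζ y * (1 - h n y) := mul_nonneg h2 h1.1
    have h5 : ζ y * (1 - h n y) ≤ 1 := mul_le_one₀ h3 h1.1 h1.2
    constructor <;> simp only [hχ] <;> linarith
  -- eventually one: where `ζ` does not vanish, `(n + 1) * g` tends to `-∞`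
  · by_cases hxb : x ∈ Metric.closedBall x₀ (r₁ / 2)
    · have hgneg : g x < 0 := (H x (hr₁r4 hxb)).1 hx
      obtain ⟨N, hN⟩ := exists_nat_gt (2 / (-(g x / 2)))
      filter_upwards [eventually_ge_atTop N] with n hn
      have hnn : (N : ℝ) ≤ n := by exact_mod_cast hn
      have hev : ∀ᶠ y in 𝓝 x, g y < g x / 2 :=
        hg.continuous.continuousAt.eventually (gt_mem_nhds (by linarith))
      filter_upwards [hev] with y hy
      have hs : ((n : ℝ) + 1) * g y ≤ -2 := by
        rw [div_lt_iff₀ (by linarith)] at hN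
        nlinarith
      simp only [hχ, hh, step_one hs, sub_self, mul_zero, sub_zero, Pi.one_apply]
    · refine Eventually.of_forall fun n => ?_
      filter_upwards [Metric.isClosed_closedBall.isOpen_compl.mem_nhds hxb] with y hy
      have : ζ y = 0 := ζ.zero_of_le_dist (by
        rw [mem_compl_iff, Metric.mem_closedBall, not_le] at hy; exact hy.le)
      simp only [hχ, this, zero_mul, sub_zero, Pi.one_apply]
  -- uniform bound: `|g|` from the tangential estimate compensates the factor `n + 1`, as
  -- `s * step' s` is bounded
  · refine ⟨Kζ * S + A * (M * K), fun n i => ?_⟩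
    filter_upwards [hae, ae_restrict_of_ae hg.ae_differentiableAt,
      ae_restrict_mem hΩ.isOpen.measurableSet] with x hx hgd hxΩ
    have hcomp : HasFDerivAt (h n) (deriv step ((n + 1) * g x) • (((n : ℝ) + 1) • fderiv ℝ g x))
        x := (hsd _).comp_hasFDerivAt x (hgd.hasFDerivAt.const_mul ((n : ℝ) + 1))
    have hd : HasFDerivAt (χ n) (-(ζ x • (-(deriv step ((n + 1) * g x) •
        (((n : ℝ) + 1) • fderiv ℝ g x))) + (1 - h n x) • fderiv ℝ ζ x)) x :=
      ((hζd x).hasFDerivAt.mul (hcomp.const_sub 1)).const_sub 1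
    rw [hd.fderiv]
    simp only [neg_apply, add_apply, smul_apply, smul_eq_mul, abs_neg]
    refine (abs_add_le _ _).trans ?_
    rw [add_comm]
    have hS' : ‖b i x‖ ≤ S := hS i x hxΩ
    refine add_le_add ?_ ?_
    · rw [abs_mul, abs_of_nonneg (hh01 n x).1]
      have h1 : |fderiv ℝ ζ x (b i x)| ≤ Kζ * S := by
        refine ((fderiv ℝ ζ x).le_opNorm _).trans ?_
        gcongr
        exact norm_fderiv_le_of_lipschitz ℝ hKζ
      calc _ ≤ 1 * |fderiv ℝ ζ x (b i x)| := by gcongr; exact (hh01 n x).2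
        _ ≤ _ := by linarith
    · rw [abs_mul, abs_of_nonneg ζ.nonneg, abs_neg]
      by_cases hxb : x ∈ Metric.ball x₀ r₁
      · have h1 := hx hxb i
        have h2 := (hA ((n + 1) * g x)).2
        calc _ ≤ 1 * |deriv step ((n + 1) * g x) * ((n + 1) * fderiv ℝ g x (b i x))| := by
              gcongr; exact ζ.le_one
          _ = |deriv step ((n + 1) * g x)| * ((n + 1) * |fderiv ℝ g x (b i x)|) := by
              rw [one_mul, abs_mul, abs_mul, abs_of_nonneg (by positivity : (0 : ℝ) ≤ n + 1)]
          _ ≤ |deriv step ((n + 1) * g x)| * ((n + 1) * (M * K * |g x|)) := by gcongr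
          _ = |deriv step ((n + 1) * g x) * ((n + 1) * g x)| * (M * K) := by
              rw [abs_mul, abs_mul, abs_of_nonneg (by positivity : (0 : ℝ) ≤ n + 1)]; ring
          _ ≤ A * (M * K) := by gcongr
      · have : ζ x = 0 := ζ.zero_of_le_dist (by
          rw [Metric.mem_ball, not_lt] at hxb
          change r₁ / 2 ≤ _
          linarith)
        rw [this, zero_mul]
        positivity
  -- vanishing near the boundary: `step` is `0` where `(n + 1) * g > -1`
  · refine ⟨Metric.ball x₀ (r₁ / 4) ∩ {y | -1 < (n + 1) * g y}, ?_, ?_, ?_⟩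
    · exact Metric.isOpen_ball.inter
        (isOpen_lt continuous_const (continuous_const.mul hg.continuous))
    · rintro y ⟨hy1, hy2⟩
      refine ⟨hy2, ?_⟩
      have := hg0 y hy1 (Metric.ball_subset_ball (by linarith) hy2)
      have : 0 ≤ ((n : ℝ) + 1) * g y := by positivity
      change -1 < ((n : ℝ) + 1) * g y
      linarith
    · rintro y ⟨hy1, hy2⟩
      have h1 : ζ y = 1 := ζ.one_of_mem_closedBall (Metric.ball_subset_closedBall hy1)
      have h2 : step ((n + 1) * g y) = 0 := step_zero (le_of_lt hy2)
      simp [hχ, hh, h1, h2]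

/-- Tangential cutoffs with compact support in `Ω`. -/
theorem exists_tangentialCutoff (hΩ : IsBoundedLipschitzDomain Ω) {b : Fin m → E d → E d}
    (hb : ∀ i x n, IsOutwardNormal Ω x n → inner ℝ (b i x) n = 0)
    {K : NNReal} (hK : ∀ i, LipschitzOnWith K (b i) (closure Ω)) {S : ℝ}
    (hS : ∀ i, ∀ x ∈ Ω, ‖b i x‖ ≤ S) :
    ∃ χ : ℕ → E d → ℝ, IsTangentialCutoff Ω b χ ∧
      ∀ n, HasCompactSupport (χ n) ∧ tsupport (χ n) ⊆ Ω := by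
  have hcl : IsCompact (closure Ω) := hΩ.isBounded.isCompact_closure
  have hfr : IsCompact (frontier Ω) := hcl.of_isClosed_subset isClosed_frontier
    frontier_subset_closure
  -- finitely many local cutoffs, multiplied together, vanish near the whole boundary
  obtain ⟨χ, hχ, hO⟩ : ∃ χ : ℕ → E d → ℝ, IsTangentialCutoff Ω b χ ∧ ∀ n, ∃ O : Set (E d),
      IsOpen O ∧ frontier Ω ⊆ O ∧ ∀ x ∈ O, χ n x = 0 := by
    refine hfr.induction_on (p := fun s => ∃ χ : ℕ → E d → ℝ, IsTangentialCutoff Ω b χ ∧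
      ∀ n, ∃ O : Set (E d), IsOpen O ∧ s ⊆ O ∧ ∀ x ∈ O, χ n x = 0) ?_ ?_ ?_ ?_
    · exact ⟨_, isTangentialCutoff_one b, fun n => ⟨∅, isOpen_empty, Subset.rfl, by simp⟩⟩
    · rintro s t hst ⟨χ, hχ, hO⟩
      refine ⟨χ, hχ, fun n => ?_⟩
      obtain ⟨O, h1, h2, h3⟩ := hO n
      exact ⟨O, h1, hst.trans h2, h3⟩
    · rintro s t ⟨χ, hχ, hO⟩ ⟨χ', hχ', hO'⟩
      refine ⟨_, hχ.mul hχ', fun n => ?_⟩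
      obtain ⟨O, h1, h2, h3⟩ := hO n
      obtain ⟨O', h1', h2', h3'⟩ := hO' n
      refine ⟨O ∪ O', h1.union h1', union_subset_union h2 h2', ?_⟩
      rintro x (hx | hx)
      · rw [h3 x hx, zero_mul]
      · rw [h3' x hx, mul_zero]
    · intro x₀ hx₀
      obtain ⟨χ, hχ, δ, hδ, hO⟩ := exists_local_tangentialCutoff hΩ hb hK hS hx₀
      exact ⟨frontier Ω ∩ Metric.ball x₀ δ, inter_mem self_mem_nhdsWithin
        (mem_nhdsWithin_of_mem_nhds (Metric.ball_mem_nhds _ hδ)), χ, hχ, hO⟩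
  choose O hOo hOf hO0 using hO
  have hKc : ∀ n, IsCompact (closure Ω \ O n) := fun n => hcl.diff (hOo n)
  have hKΩ : ∀ n, closure Ω \ O n ⊆ Ω := by
    intro n x hx
    by_contra h
    exact hx.2 (hOf n ⟨hx.1, fun hi => h (interior_subset hi)⟩)
  -- a test function equal to `1` on the rest of `Ω` removes the part of `χ n` outside `Ω`
  choose κ hκ hκ01 hκ1 using fun n => exists_test_eq_one hΩ.isOpen (hKc n) (hKΩ n)
  have heq : ∀ n, ∀ x ∈ Ω, κ n x * χ n x = χ n x := by
    intro n x hx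
    by_cases h : x ∈ O n
    · rw [hO0 n x h, mul_zero]
    · rw [(hκ1 n x ⟨subset_closure hx, h⟩).self_of_nhds, Pi.one_apply, one_mul]
  have hev : ∀ n, ∀ x ∈ Ω, (fun x => κ n x * χ n x) =ᶠ[𝓝 x] χ n := by
    intro n x hx
    filter_upwards [hΩ.isOpen.mem_nhds hx] with y hy using heq n y hy
  refine ⟨fun n x => κ n x * χ n x, ⟨fun n => ?_, fun n x => ?_, fun x hx => ?_, ?_⟩, fun n => ?_⟩
  · obtain ⟨L, hL⟩ := (hκ n).lipschitz
    obtain ⟨L', hL'⟩ := hχ.lipschitz n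
    exact lipschitzWith_mul_of_bound hL hL' (A := 1)
      (fun x => by rw [abs_of_nonneg (hκ01 n x).1]; exact (hκ01 n x).2) (hχ.abs_le n)
  · exact ⟨mul_nonneg (hκ01 n x).1 (hχ.mem_Icc n x).1,
      mul_le_one₀ (hκ01 n x).2 (hχ.mem_Icc n x).1 (hχ.mem_Icc n x).2⟩
  · filter_upwards [hχ.eventually_one x hx] with n hn
    exact (hev n x hx).trans hn
  · obtain ⟨C, hC⟩ := hχ.bounded
    refine ⟨C, fun n i => ?_⟩
    filter_upwards [hC n i, ae_restrict_mem hΩ.isOpen.measurableSet] with x h1 h2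
    rwa [(hev n x h2).fderiv_eq]
  · exact ⟨(hκ n).compact.mul_right, tsupport_mul_subset_left.trans (hκ n).subset⟩

end Cutoff


/-! ### The transport operator of a family of tangential fields -/

section TransportOperator

variable {d m : ℕ} {Ω : Set (E d)} {B : Fin m → E d → E d} {K : NNReal} {S : ℝ}

/-- Dominated convergence in `L²`. -/
lemma tendsto_eLpNorm_sub_of_dominated {α F : Type*} [MeasurableSpace α] {ν : Measure α}
    [NormedAddCommGroup F] {f : ℕ → α → F} {f₀ : α → F} {g : α → ℝ}
    (hf : ∀ n, AEStronglyMeasurable (f n) ν) (hf₀ : AEStronglyMeasurable f₀ ν) (hg : MemLp g 2 ν)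
    (hbound : ∀ n, ∀ᵐ x ∂ν, ‖f n x - f₀ x‖ ≤ g x)
    (hlim : ∀ᵐ x ∂ν, Tendsto (fun n => f n x) atTop (𝓝 (f₀ x))) :
    Tendsto (fun n => eLpNorm (f n - f₀) 2 ν) atTop (𝓝 0) := by
  have h2 : ∀ h : α → F, eLpNorm h 2 ν = (∫⁻ x, ‖h x‖ₑ ^ (2 : ℝ) ∂ν) ^ (1 / 2 : ℝ) := fun h => by
    rw [eLpNorm_eq_lintegral_rpow_enorm_toReal (by norm_num) (by norm_num)]; norm_num
  simp only [h2]
  have h0 : (0 : ℝ≥0∞) = (∫⁻ _x, 0 ∂ν) ^ (1 / 2 : ℝ) := by simp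
  rw [h0]
  refine (ENNReal.continuous_rpow_const.tendsto _).comp ?_
  refine tendsto_lintegral_of_dominated_convergence' (fun x => ‖g x‖ₑ ^ (2 : ℝ))
    (fun n => ((hf n).sub hf₀).enorm.pow_const _) (fun n => ?_) ?_ ?_
  · filter_upwards [hbound n] with x hx
    gcongr
    refine enorm_le_iff_norm_le.2 (hx.trans (le_abs_self _))
  · have := lintegral_rpow_enorm_lt_top_of_eLpNorm_lt_top (p := 2) (by norm_num) (by norm_num)
      hg.eLpNorm_lt_top
    simpa using this.ne
  · filter_upwards [hlim] with x hx
    have h3 : Tendsto (fun n => ‖f n x - f₀ x‖ₑ) atTop (𝓝 0) := by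
      have := (hx.sub_const (f₀ x)).enorm
      simpa using this
    have h4 := (ENNReal.continuous_rpow_const (y := 2)).tendsto 0 |>.comp h3
    simpa [Function.comp_def] using h4

/-- A finite family of bounded Lipschitz fields on `ℝᵈ` that are divergence free in `Ω` and tangent
to its boundary, tangency being expressed by the existence of compactly supported tangential
cutoffs. -/
structure IsStirringFamily (Ω : Set (E d)) (B : Fin m → E d → E d) (K : NNReal) (S : ℝ) :
    Prop where
  lipschitz : ∀ i, LipschitzWith K (B i)
  bounded : ∀ i x, ‖B i x‖ ≤ S
  div_eq_zero : ∀ i, ∀ x ∈ Ω, divergence (B i) x = 0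
  cutoff : ∃ χ : ℕ → E d → ℝ, IsTangentialCutoff Ω B χ ∧
    ∀ n, HasCompactSupport (χ n) ∧ tsupport (χ n) ⊆ Ω

/-- Stirring fields extend from the closure of the domain to bounded Lipschitz fields on `ℝᵈ`. -/
theorem exists_stirringFamily (hΩ : IsBoundedLipschitzDomain Ω) {b : Fin m → E d → E d}
    (hb : ∀ i, IsStirringField Ω (b i)) :
    ∃ (B : Fin m → E d → E d) (K : NNReal) (S : ℝ), IsStirringFamily Ω B K S ∧
      ∀ i, EqOn (b i) (B i) (closure Ω) := by
  have h1 : ∀ i, ∃ (K : NNReal) (S : ℝ) (B : E d → E d), LipschitzWith K B ∧ (∀ x, ‖B x‖ ≤ S) ∧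
      EqOn (b i) B (closure Ω) := by
    intro i
    obtain ⟨K, hK⟩ := exists_lipschitzOnWith_closure hΩ (hb i).contDiffOn
    obtain ⟨S, hS⟩ := hΩ.isBounded.isCompact_closure.exists_bound_of_continuousOn hK.continuousOn
    exact exists_bounded_lipschitz_extension hK hS
  choose K S B hK hS hB using h1
  have hlip : ∀ i, LipschitzWith (∑ j, K j) (B i) := fun i =>
    (hK i).weaken (Finset.single_le_sum (f := K) (fun _ _ => zero_le) (Finset.mem_univ i))
  have hbd : ∀ i x, ‖B i x‖ ≤ ∑ j, |S j| := fun i x =>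
    ((hS i x).trans (le_abs_self _)).trans
      (Finset.single_le_sum (f := fun j => |S j|) (fun _ _ => abs_nonneg _) (Finset.mem_univ i))
  have hnormal : ∀ i x n, IsOutwardNormal Ω x n → inner ℝ (B i x) n = 0 := fun i x n h => by
    rw [← hB i (frontier_subset_closure h.1)]
    exact (hb i).no_penetration x n h
  refine ⟨B, _, _, ⟨hlip, hbd, fun i x hx => ?_, ?_⟩, hB⟩
  · rw [← (hb i).div_eq_zero x hx]
    have : b i =ᶠ[𝓝 x] B i := by
      filter_upwards [hΩ.isOpen.mem_nhds hx] with y hy using hB i (subset_closure hy)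
    simp only [divergence, this.fderiv_eq]
  · exact exists_tangentialCutoff hΩ hnormal (fun i => (hlip i).lipschitzOnWith)
      (fun i x _ => hbd i x)

/-- The elements of `H¹(Ω)` given by test functions. -/
def testSet (Ω : Set (E d)) : Set (H1 Ω) :=
  {w | ∃ φ, IsTest Ω φ ∧ val w =ᵐ[volume.restrict Ω] φ ∧
    grad w =ᵐ[volume.restrict Ω] gradient φ}

lemma IsTest.exists_mem_testSet (hΩ : IsOpen Ω) (hbd : Bornology.IsBounded Ω) {φ : E d → ℝ}
    (hφ : IsTest Ω φ) : ∃ w ∈ testSet Ω, val w =ᵐ[volume.restrict Ω] φ ∧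
      grad w =ᵐ[volume.restrict Ω] gradient φ := by
  obtain ⟨C, hC⟩ := hφ.lipschitz
  obtain ⟨w, h1, h2⟩ := exists_H1_of_lipschitz hΩ hbd hC
  exact ⟨w, ⟨φ, hφ, h1, h2⟩, h1, h2⟩

/-- `H¹(Ω)` is dense in `L²(Ω)`, as it contains the test functions. -/
lemma denseRange_valL (hΩ : IsOpen Ω) (hbd : Bornology.IsBounded Ω) : DenseRange (valL Ω) := by
  have : (LinearMap.range (valL Ω : H1 Ω →ₗ[ℝ] L2 Ω)).topologicalClosure = ⊤ := by
    rw [Submodule.topologicalClosure_eq_top_iff, Submodule.eq_bot_iff]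
    intro f hf
    refine (Lp.eq_zero_iff_ae_eq_zero).2 (ae_zero_of_forall_test hΩ (Lp.memLp f) fun φ hφ => ?_)
    obtain ⟨w, -, hw, -⟩ := hφ.exists_mem_testSet hΩ hbd
    have h0 := (Submodule.mem_orthogonal _ f).1 hf (val w) ⟨w, rfl⟩
    rw [inner_L2_eq] at h0
    rw [← h0]
    refine integral_congr_ae ?_
    filter_upwards [hw] with x hx
    rw [hx, smul_eq_mul]
  have h2 := Submodule.dense_iff_topologicalClosure_eq_top.2 this
  exact h2

lemma IsStirringFamily.memLp_inner (hB : IsStirringFamily Ω B K S) (i : Fin m) (w : L2Vec Ω) :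
    MemLp (fun x => (inner ℝ (B i x) (w x) : ℝ)) 2 (volume.restrict Ω) := by
  refine MemLp.of_le_mul (c := S) (Lp.memLp w)
    ((hB.lipschitz i).continuous.aestronglyMeasurable.inner (Lp.memLp w).1)
    (Eventually.of_forall fun x => ?_)
  refine (norm_inner_le_norm _ _).trans ?_
  gcongr
  exact hB.bounded i x

/-- The derivative along the field `B i`, as an operator from `H¹(Ω)` to `L²(Ω)`. -/
noncomputable def fieldDeriv (hB : IsStirringFamily Ω B K S) (i : Fin m) :
    H1 Ω →L[ℝ] L2 Ω :=
  (LinearMap.mkContinuous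
    { toFun := fun g : L2Vec Ω => (hB.memLp_inner i g).toLp _
      map_add' := fun g h => by
        rw [← MemLp.toLp_add]
        refine MemLp.toLp_congr _ _ ?_
        filter_upwards [Lp.coeFn_add g h] with x hx
        rw [hx, Pi.add_apply, inner_add_right, Pi.add_apply]
      map_smul' := fun c g => by
        rw [RingHom.id_apply, ← MemLp.toLp_const_smul]
        refine MemLp.toLp_congr _ _ ?_
        filter_upwards [Lp.coeFn_smul c g] with x hx
        rw [hx, Pi.smul_apply, real_inner_smul_right, Pi.smul_apply, smul_eq_mul] }
    S (fun g => by
      refine Lp.norm_le_mul_norm_of_ae_le_mul ?_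
      filter_upwards [(hB.memLp_inner i g).coeFn_toLp] with x hx
      simp only [LinearMap.coe_mk, AddHom.coe_mk]
      rw [hx]
      refine (norm_inner_le_norm _ _).trans ?_
      gcongr
      exact hB.bounded i x)).comp (gradL Ω)

lemma coeFn_fieldDeriv (hB : IsStirringFamily Ω B K S) (i : Fin m) (w : H1 Ω) :
    fieldDeriv hB i w =ᵐ[volume.restrict Ω] fun x => inner ℝ (B i x) (grad w x) :=
  (hB.memLp_inner i (grad w)).coeFn_toLp

/-- A function of `H¹(Ω)` together with its derivatives along the fields. -/
noncomputable def fieldGraph (hB : IsStirringFamily Ω B K S) (w : H1 Ω) : L2 Ω × (Fin m → L2 Ω) :=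
  (val w, fun i => fieldDeriv hB i w)

/-- Test functions are dense in `H¹(Ω)` for the graph norm of the derivatives along tangential
fields: multiplication by tangential cutoffs reduces to compact support, as the derivatives of the
cutoffs along the fields stay bounded and tend to zero pointwise. -/
theorem fieldGraph_mem_closure (hΩ : IsBoundedLipschitzDomain Ω) (hB : IsStirringFamily Ω B K S)
    (w : H1 Ω) : fieldGraph hB w ∈ closure (fieldGraph hB '' testSet Ω) := by
  have hm : ∀ i, AEStronglyMeasurable (B i) (volume.restrict Ω) := fun i =>
    (hB.lipschitz i).continuous.aestronglyMeasurable
  obtain ⟨χ, hχ, hχc⟩ := hB.cutoff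
  choose C hC using hχ.lipschitz
  obtain ⟨A, hA⟩ := hχ.bounded
  have hval := Lp.memLp (val w)
  have hder := fun i => hB.memLp_inner i (grad w)
  have hmd : ∀ n i, AEStronglyMeasurable (fun x => fderiv ℝ (χ n) x (B i x))
      (volume.restrict Ω) := fun n i => by
    have : (fun x => fderiv ℝ (χ n) x (B i x)) = fun x => inner ℝ (gradient (χ n) x) (B i x) := by
      funext x; rw [inner_gradient]
    rw [this]
    exact (measurable_gradient _).aestronglyMeasurable.inner (hm i)
  have h1 : ∀ n, MemLp (fun x => χ n x * val w x) 2 (volume.restrict Ω) := fun n =>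
    MemLp.of_le hval ((hC n).continuous.aestronglyMeasurable.mul hval.1)
      (Eventually.of_forall fun x => by
        rw [norm_mul]
        exact mul_le_of_le_one_left (norm_nonneg _) (hχ.abs_le n x))
  have h2 : ∀ n i, MemLp (fun x => χ n x * inner ℝ (B i x) (grad w x)
      + val w x * fderiv ℝ (χ n) x (B i x)) 2 (volume.restrict Ω) := fun n i => by
    refine MemLp.add ?_ ?_
    · exact MemLp.of_le (hder i) ((hC n).continuous.aestronglyMeasurable.mul (hder i).1)
        (Eventually.of_forall fun x => by
          rw [norm_mul]
          exact mul_le_of_le_one_left (norm_nonneg _) (hχ.abs_le n x))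
    · refine MemLp.of_le_mul (c := A) hval (hval.1.mul (hmd n i)) ?_
      filter_upwards [hA n i] with x hx
      rw [norm_mul, mul_comm]
      gcongr
      exact hx
  set p : ℕ → L2 Ω × (Fin m → L2 Ω) := fun n => ((h1 n).toLp _, fun i => (h2 n i).toLp _) with hp
  -- each cut-off function is a limit of test functions
  have hpn : ∀ n, p n ∈ closure (fieldGraph hB '' testSet Ω) := by
    intro n
    obtain ⟨φ, hφ, hL1, hL2, hlim1, hlim2⟩ :=
      exists_test_approx_cutoff hΩ.isOpen w (hC n) (hχc n).1 (hχc n).2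
    choose v hv hv1 hv2 using fun k => (hφ k).exists_mem_testSet hΩ.isOpen hΩ.isBounded
    refine mem_closure_of_tendsto (b := atTop) (f := fun k => fieldGraph hB (v k)) ?_
      (Eventually.of_forall fun k => ⟨_, hv k, rfl⟩)
    refine Prod.tendsto_iff _ _ |>.2 ⟨?_, tendsto_pi_nhds.2 fun i => ?_⟩
    · refine (Lp.tendsto_Lp_iff_tendsto_eLpNorm' _ _).2 ?_
      refine (tendsto_congr fun k => eLpNorm_congr_ae ?_).1 (tendsto_eLpNorm_restrict (s := Ω) hlim1)
      filter_upwards [hv1 k, (h1 n).coeFn_toLp] with x hx1 hx2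
      simp only [Pi.sub_apply, fieldGraph, hp, hx1, hx2]
    · refine (Lp.tendsto_Lp_iff_tendsto_eLpNorm' _ _).2 ?_
      have hle : ∀ k, eLpNorm (⇑(fieldDeriv hB i (v k)) - ⇑((h2 n i).toLp _)) 2
          (volume.restrict Ω) ≤ ENNReal.ofReal S * eLpNorm (gradient (φ k) -
            fun x => χ n x • grad w x + val w x • gradient (χ n) x) 2 (volume.restrict Ω) := by
        intro k
        refine eLpNorm_le_mul_eLpNorm_of_ae_le_mul ?_ _
        filter_upwards [hv2 k, (h2 n i).coeFn_toLp, coeFn_fieldDeriv hB i (v k)] with x hx1 hx2 hx3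
        simp only [Pi.sub_apply]
        rw [hx2, hx3, hx1]
        have : inner ℝ (B i x) (gradient (φ k) x) - (χ n x * inner ℝ (B i x) (grad w x)
            + val w x * fderiv ℝ (χ n) x (B i x)) = inner ℝ (B i x) (gradient (φ k) x -
              (χ n x • grad w x + val w x • gradient (χ n) x)) := by
          rw [inner_sub_right, inner_add_right, real_inner_smul_right, real_inner_smul_right,
            ← inner_gradient, real_inner_comm (B i x) (gradient (χ n) x)]
        rw [this]
        refine (norm_inner_le_norm _ _).trans ?_
        gcongr
        exact hB.bounded i x
      refine tendsto_of_tendsto_of_tendsto_of_le_of_le tendsto_const_nhds ?_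
        (fun k => zero_le) hle
      have := ENNReal.Tendsto.const_mul (a := ENNReal.ofReal S)
        (tendsto_eLpNorm_restrict (s := Ω) hlim2) (Or.inr ENNReal.ofReal_ne_top)
      simpa using this
  -- the cut-off functions converge in the graph norm, by dominated convergence
  have hlim : Tendsto p atTop (𝓝 (fieldGraph hB w)) := by
    have hone : ∀ᵐ x ∂(volume.restrict Ω), ∀ᶠ n in atTop, χ n =ᶠ[𝓝 x] 1 := by
      filter_upwards [ae_restrict_mem hΩ.isOpen.measurableSet] with x hx
        using hχ.eventually_one x hx
    refine Prod.tendsto_iff _ _ |>.2 ⟨?_, tendsto_pi_nhds.2 fun i => ?_⟩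
    · refine (Lp.tendsto_Lp_iff_tendsto_eLpNorm' _ _).2 ?_
      have := tendsto_eLpNorm_sub_of_dominated (fun n => (h1 n).1) hval.1
        (g := fun x => 2 * ‖val w x‖) (hval.norm.const_mul 2) (fun n => ?_) ?_
      · refine (tendsto_congr fun k => eLpNorm_congr_ae ?_).1 this
        filter_upwards [(h1 k).coeFn_toLp] with x hx
        simp only [Pi.sub_apply, fieldGraph, hp, hx]
      · refine Eventually.of_forall fun x => ?_
        refine (norm_sub_le _ _).trans ?_
        rw [norm_mul, two_mul]
        gcongr
        exact mul_le_of_le_one_left (norm_nonneg _) (hχ.abs_le n x)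
      · filter_upwards [hone] with x hx
        refine tendsto_const_nhds.congr' ?_
        filter_upwards [hx] with n hn
        rw [hn.eq_of_nhds, Pi.one_apply, one_mul]
    · refine (Lp.tendsto_Lp_iff_tendsto_eLpNorm' _ _).2 ?_
      have := tendsto_eLpNorm_sub_of_dominated (fun n => (h2 n i).1) (hder i).1
        (g := fun x => 2 * ‖(inner ℝ (B i x) (grad w x) : ℝ)‖ + A * ‖val w x‖)
        (((hder i).norm.const_mul 2).add (hval.norm.const_mul A)) (fun n => ?_) ?_
      · refine (tendsto_congr fun k => eLpNorm_congr_ae ?_).1 this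
        filter_upwards [(h2 k i).coeFn_toLp, coeFn_fieldDeriv hB i w] with x hx hx'
        simp only [Pi.sub_apply, fieldGraph, hp, hx, hx']
      · filter_upwards [hA n i] with x hx
        refine (norm_sub_le _ _).trans ?_
        refine (add_le_add_left (norm_add_le _ _) _).trans ?_
        rw [norm_mul, norm_mul]
        have h3 : ‖χ n x‖ * ‖(inner ℝ (B i x) (grad w x) : ℝ)‖ ≤
            ‖(inner ℝ (B i x) (grad w x) : ℝ)‖ :=
          mul_le_of_le_one_left (norm_nonneg _) (hχ.abs_le n x)
        have h4 : ‖val w x‖ * ‖fderiv ℝ (χ n) x (B i x)‖ ≤ ‖val w x‖ * A :=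
          mul_le_mul_of_nonneg_left hx (norm_nonneg _)
        linarith
      · filter_upwards [hone] with x hx
        refine tendsto_const_nhds.congr' ?_
        filter_upwards [hx] with n hn
        rw [hn.eq_of_nhds, hn.fderiv_eq]
        simp
  exact isClosed_closure.mem_of_tendsto hlim (Eventually.of_forall hpn)

/-- Integration by parts against a test function; there is no other term as the field is divergence
free. -/
lemma inner_fieldDeriv_of_mem_testSet (hΩ : IsOpen Ω) (hB : IsStirringFamily Ω B K S) (i : Fin m)
    (ψ : H1 Ω) {w : H1 Ω} (hw : w ∈ testSet Ω) :
    inner ℝ (fieldDeriv hB i ψ) (val w) = - inner ℝ (val ψ) (fieldDeriv hB i w) := by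
  obtain ⟨φ, hφ, hw1, hw2⟩ := hw
  obtain ⟨C, hC⟩ := hφ.lipschitz
  obtain ⟨A, hA⟩ := bounded_of_continuous_hasCompactSupport hφ.contDiff.continuous hφ.compact
  set e : Fin d → E d := fun j => EuclideanSpace.single j 1 with he
  have hcomp : ∀ j, LipschitzWith K fun x => B i x j := fun j =>
    LipschitzWith.of_dist_le_mul fun x y => by
      refine le_trans ?_ ((hB.lipschitz i).dist_le_mul x y)
      rw [dist_eq_norm, dist_eq_norm]
      simpa using PiLp.norm_apply_le (B i x - B i y) j
  have hξ : ∀ j, ∃ C', LipschitzWith C' fun x => B i x j * φ x := fun j =>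
    lipschitzWith_mul_of_bound (hcomp j) hC
      (fun x => (PiLp.norm_apply_le (B i x) j).trans (hB.bounded i x)) hA
  choose C' hC' using hξ
  have hsupp : ∀ j, tsupport (fun x => B i x j * φ x) ⊆ tsupport φ := fun j =>
    tsupport_mul_subset_right
  have hcs : ∀ j, HasCompactSupport fun x => B i x j * φ x := fun j => hφ.compact.mul_left
  -- the weak gradient of `ψ` is tested, coordinate by coordinate, with the Lipschitz function
  -- `(B i)ⱼ φ`
  have key := fun j => weakGradient_lipschitz hΩ (isWeakGradient_grad ψ) (hC' j) (hcs j)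
    ((hsupp j).trans hφ.subset) (e j)
  have hval := Lp.memLp (val ψ)
  have hgrad := Lp.memLp (grad ψ)
  have i1 : ∀ j, Integrable (fun x => val ψ x * fderiv ℝ (fun x => B i x j * φ x) x (e j))
      (volume.restrict Ω) := fun j => by
    have h := ((memLp_gradient_lipschitz (hC' j) (hcs j)).restrict Ω).inner_const (𝕜 := ℝ) (e j)
    simp only [inner_gradient] at h
    exact hval.integrable_mul h
  have i2 : ∀ j, Integrable (fun x => (inner ℝ (grad ψ x) (e j) : ℝ) * (B i x j * φ x))
      (volume.restrict Ω) := fun j =>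
    (hgrad.inner_const (𝕜 := ℝ) (e j)).integrable_mul
      ((memLp_lipschitz (hC' j) (hcs j)).restrict Ω)
  have hsum := Finset.sum_congr rfl fun j (_ : j ∈ Finset.univ) => key j
  rw [Finset.sum_neg_distrib, ← integral_finsetSum _ fun j _ => i1 j,
    ← integral_finsetSum _ fun j _ => i2 j] at hsum
  rw [inner_L2_eq, inner_L2_eq]
  have e1 : ∫ x in Ω, fieldDeriv hB i ψ x * val w x =
      ∫ x in Ω, ∑ j, (inner ℝ (grad ψ x) (e j) : ℝ) * (B i x j * φ x) := by
    refine integral_congr_ae ?_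
    filter_upwards [coeFn_fieldDeriv hB i ψ, hw1] with x hx1 hx2
    rw [hx1, hx2, PiLp.inner_apply, Finset.sum_mul]
    refine Finset.sum_congr rfl fun j _ => ?_
    simp [he, EuclideanSpace.inner_single_right]
    ring
  have e2 : ∫ x in Ω, val ψ x * fieldDeriv hB i w x =
      ∫ x in Ω, ∑ j, val ψ x * fderiv ℝ (fun x => B i x j * φ x) x (e j) := by
    refine integral_congr_ae ?_
    filter_upwards [coeFn_fieldDeriv hB i w, hw2, ae_restrict_mem hΩ.measurableSet,
      ae_restrict_of_ae (hB.lipschitz i).ae_differentiableAt] with x hx1 hx2 hx3 hx4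
    rw [hx1, hx2, ← Finset.mul_sum]
    congr 1
    have h1 : ∀ j, HasFDerivAt (fun x => B i x j) ((EuclideanSpace.proj j).comp
        (fderiv ℝ (B i) x)) x := fun j =>
      ((EuclideanSpace.proj (𝕜 := ℝ) j).hasFDerivAt.comp x hx4.hasFDerivAt)
    have h2 : DifferentiableAt ℝ φ x := hφ.contDiff.differentiable (by simp) x
    have h3 : ∀ j, fderiv ℝ (fun x => B i x j * φ x) x (e j) =
        B i x j * fderiv ℝ φ x (e j) + φ x * (fderiv ℝ (B i) x (e j)) j := fun j => by
      have h5 := (h1 j).mul h2.hasFDerivAt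
      rw [show fderiv ℝ (fun x => B i x j * φ x) x = _ from h5.fderiv]
      simp
    simp only [h3, Finset.sum_add_distrib, ← Finset.mul_sum]
    -- the terms with the derivative of `B i` sum to the divergence, which vanishes
    have h4 := hB.div_eq_zero i x hx3
    rw [divergence] at h4
    rw [h4, mul_zero, add_zero, PiLp.inner_apply]
    refine Finset.sum_congr rfl fun j _ => ?_
    have h5 : (gradient φ x) j = fderiv ℝ φ x (e j) := by
      rw [← inner_gradient, he, EuclideanSpace.inner_single_right]
      simp
    rw [← h5]
    simp [mul_comm]
  rw [e1, e2, hsum, neg_neg]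

/-- The derivatives along the fields are skew-symmetric, without boundary term. -/
theorem inner_fieldDeriv (hΩ : IsBoundedLipschitzDomain Ω) (hB : IsStirringFamily Ω B K S)
    (i : Fin m) (ψ w : H1 Ω) :
    inner ℝ (fieldDeriv hB i ψ) (val w) = - inner ℝ (val ψ) (fieldDeriv hB i w) := by
  have hcl : IsClosed {p : L2 Ω × (Fin m → L2 Ω) |
      inner ℝ (fieldDeriv hB i ψ) p.1 = - inner ℝ (val ψ) (p.2 i)} :=
    isClosed_eq (by fun_prop) (by fun_prop)
  refine closure_minimal ?_ hcl (fieldGraph_mem_closure hΩ hB w)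
  rintro _ ⟨v, hv, rfl⟩
  exact inner_fieldDeriv_of_mem_testSet hΩ.isOpen hB i ψ hv

/-- The operator `(c, ψ) ↦ ∑ᵢ cᵢ Bᵢ · ∇ψ`. -/
noncomputable def transportOp (hB : IsStirringFamily Ω B K S) :
    E m →L[ℝ] H1 Ω →L[ℝ] L2 Ω :=
  ∑ i, (EuclideanSpace.proj (𝕜 := ℝ) i).smulRight (fieldDeriv hB i)

lemma transportOp_apply (hB : IsStirringFamily Ω B K S) (c : E m) (w : H1 Ω) :
    transportOp hB c w = ∑ i, c i • fieldDeriv hB i w := by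
  simp [transportOp]

lemma coeFn_transportOp (hB : IsStirringFamily Ω B K S) (c : E m) (w : H1 Ω) :
    transportOp hB c w =ᵐ[volume.restrict Ω] fun x => inner ℝ (∑ i, c i • B i x) (grad w x) := by
  have h : ∀ s : Finset (Fin m), (∑ i ∈ s, c i • fieldDeriv hB i w : L2 Ω)
      =ᵐ[volume.restrict Ω] fun x => ∑ i ∈ s, c i * inner ℝ (B i x) (grad w x) := by
    intro s
    induction s using Finset.cons_induction with
    | empty =>
      simp only [Finset.sum_empty]
      exact Lp.coeFn_zero ℝ 2 (volume.restrict Ω)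
    | cons a s ha ih =>
      rw [Finset.sum_cons]
      filter_upwards [ih, Lp.coeFn_add (c a • fieldDeriv hB a w) (∑ i ∈ s, c i • fieldDeriv hB i w),
        Lp.coeFn_smul (c a) (fieldDeriv hB a w), coeFn_fieldDeriv hB a w] with x h1 h2 h3 h4
      rw [h2, Pi.add_apply, h1, h3, Pi.smul_apply, h4, Finset.sum_cons, smul_eq_mul]
  rw [transportOp_apply]
  filter_upwards [h Finset.univ] with x hx
  rw [hx, sum_inner]
  simp [real_inner_smul_left]

/-- The transport operator is skew-symmetric on all of `H¹(Ω)`. This is the only way in which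
incompressibility and tangency enter the evolution equations. -/
theorem inner_transportOp (hΩ : IsBoundedLipschitzDomain Ω) (hB : IsStirringFamily Ω B K S)
    (c : E m) (ψ w : H1 Ω) :
    inner ℝ (transportOp hB c ψ) (valL Ω w) = - inner ℝ (valL Ω ψ) (transportOp hB c w) := by
  simp only [transportOp_apply, sum_inner, inner_sum, real_inner_smul_left, real_inner_smul_right,
    valL_apply, inner_fieldDeriv hΩ hB, mul_neg, Finset.sum_neg_distrib]

/-- A combination of the fields has no flux against the gradient of a Lipschitz function. -/
lemma integral_inner_gradient_eq_zero (hΩ : IsBoundedLipschitzDomain Ω)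
    (hB : IsStirringFamily Ω B K S) (c : E m) {C : NNReal} {ξ : E d → ℝ}
    (hξ : LipschitzWith C ξ) : ∫ x in Ω, fderiv ℝ ξ x (∑ i, c i • B i x) = 0 := by
  obtain ⟨w, hw1, hw2⟩ := exists_H1_of_lipschitz hΩ.isOpen hΩ.isBounded hξ
  obtain ⟨u, hu1, hu2⟩ := exists_H1_of_lipschitz hΩ.isOpen hΩ.isBounded
    (LipschitzWith.const (1 : ℝ) : LipschitzWith 0 fun _ : E d => (1 : ℝ))
  -- skew-symmetry against the constant function `1`, which has no gradient
  have h := inner_transportOp hΩ hB c u w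
  have h0 : transportOp hB c u = 0 := by
    refine (Lp.eq_zero_iff_ae_eq_zero).2 ?_
    filter_upwards [coeFn_transportOp hB c u, hu2] with x h1 h2
    rw [h1, h2]
    simp [gradient]
  rw [h0, inner_zero_left, eq_comm, neg_eq_zero, inner_L2_eq] at h
  rw [← h]
  refine integral_congr_ae ?_
  filter_upwards [hu1, hw2, coeFn_transportOp hB c w] with x h1 h2 h3
  rw [valL_apply, h1, h3, h2, one_mul, real_inner_comm, inner_gradient]

end TransportOperator


/-! ### The flow of a bounded Lipschitz field -/

section Flow

variable {F : Type*} [NormedAddCommGroup F] [InnerProductSpace ℝ F]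
  {v : ℝ → F → F} {K : NNReal} {M : ℝ}

/-- Global existence for the ordinary differential equation of a bounded Lipschitz field. -/
lemma exists_integralCurve [CompleteSpace F] (hK : ∀ t, LipschitzWith K (v t)) (hM : ∀ t x, ‖v t x‖ ≤ M)
    (hc : ∀ x, Continuous fun t => v t x) (s : ℝ) (x : F) :
    ∃ α : ℝ → F, α s = x ∧ ∀ t, HasDerivAt α (v t (α t)) t := by
  have hM0 : 0 ≤ M := (norm_nonneg _).trans (hM 0 0)
  have h1 : ∀ n : ℕ, ∃ α : ℝ → F, α s = x ∧ ∀ t ∈ Ioo (s - (n + 1)) (s + (n + 1)),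
      HasDerivAt α (v t (α t)) t := by
    intro n
    have hn : (0 : ℝ) ≤ n + 1 := by positivity
    have hp : IsPicardLindelof v (tmin := s - (n + 1)) (tmax := s + (n + 1))
        -- a Picard–Lindelöf box of radius `M * (n + 1)`, which the trajectory cannot leave in time `n + 1`
        ⟨s, by constructor <;> linarith⟩ x (M.toNNReal * (n + 1)) 0 M.toNNReal K := by
      refine ⟨fun t _ => (hK t).lipschitzOnWith, fun y _ => (hc y).continuousOn,
        fun t _ y _ => (hM t y).trans (Real.le_coe_toNNReal M), ?_⟩
      simp
    obtain ⟨α, h0, h1⟩ := hp.exists_eq_forall_mem_Icc_hasDerivWithinAt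
      (x := x) (Metric.mem_closedBall_self (by simp))
    exact ⟨α, h0, fun t ht => (h1 t (Ioo_subset_Icc_self ht)).hasDerivAt
      (Icc_mem_nhds ht.1 ht.2)⟩
  choose α hα0 hα using h1
  have hmem : ∀ {n k : ℕ} {t : ℝ}, n ≤ k → t ∈ Ioo (s - (n + 1)) (s + (n + 1)) →
      t ∈ Ioo (s - ((k : ℝ) + 1)) (s + (k + 1)) := fun {n k t} h ht => by
    have : (n : ℝ) ≤ k := by exact_mod_cast h
    exact ⟨by linarith [ht.1], by linarith [ht.2]⟩
  have hcons : ∀ {n k : ℕ}, n ≤ k → EqOn (α n) (α k) (Ioo (s - (n + 1)) (s + (n + 1))) := by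
    intro n k h
    have hn : (0 : ℝ) ≤ n := by positivity
    exact ODE_solution_unique_of_mem_Ioo (s := fun _ => univ)
      (fun t _ => (hK t).lipschitzOnWith) (t₀ := s)
      ⟨by linarith, by linarith⟩ (fun t ht => ⟨hα n t ht, mem_univ _⟩)
      (fun t ht => ⟨hα k t (hmem h ht), mem_univ _⟩) ((hα0 n).trans (hα0 k).symm)
  -- the solutions on the growing intervals agree, and are glued at time `t` by the `N t`-th one
  set N : ℝ → ℕ := fun t => ⌈|t - s|⌉₊ with hN
  have hNt : ∀ t, t ∈ Ioo (s - (N t + 1)) (s + (N t + 1)) := fun t => by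
    have := Nat.le_ceil |t - s|
    have h2 := abs_le.1 (le_refl |t - s|)
    exact ⟨by linarith, by linarith⟩
  refine ⟨fun t => α (N t) t, hα0 _, fun t => ?_⟩
  have hev : (fun r => α (N r) r) =ᶠ[𝓝 t] α (N t) := by
    filter_upwards [Ioo_mem_nhds (hNt t).1 (hNt t).2] with r hr
    rcases le_total (N r) (N t) with h | h
    · exact hcons h (hNt r)
    · exact (hcons h hr).symm
  exact (hα (N t) t (hNt t)).congr_of_eventuallyEq hev

/-- `X s t x` is the position at time `t` of the particle that is at `x` at time `s`, for the
motion with velocity `v`. -/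
structure IsFlow (v : ℝ → F → F) (X : ℝ → ℝ → F → F) : Prop where
  self : ∀ s x, X s s x = x
  hasDerivAt : ∀ s x t, HasDerivAt (fun r => X s r x) (v t (X s t x)) t
  comp : ∀ s t r x, X t r (X s t x) = X s r x

lemma exists_isFlow [CompleteSpace F] (hK : ∀ t, LipschitzWith K (v t)) (hM : ∀ t x, ‖v t x‖ ≤ M)
    (hc : ∀ x, Continuous fun t => v t x) : ∃ X, IsFlow v X := by
  choose X h0 h1 using exists_integralCurve hK hM hc
  refine ⟨fun s t x => X s x t, h0, h1, fun s t r x => ?_⟩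
  have := ODE_solution_unique_univ (s := fun _ => univ) (fun t => (hK t).lipschitzOnWith)
    (f := X t (X s x t)) (g := X s x) (t₀ := t) (fun r => ⟨h1 _ _ _, mem_univ _⟩)
    (fun r => ⟨h1 _ _ _, mem_univ _⟩) (h0 _ _)
  exact congrFun this r

namespace IsFlow

variable {X : ℝ → ℝ → F → F}

/-- The flow is Lipschitz, with the sharp constant given by the time integral of the Lipschitz
constants of the velocity. -/
lemma norm_sub_le (hX : IsFlow v X) {κ : ℝ → ℝ} (hκ : Continuous κ)
    (hv : ∀ t x y, ‖v t x - v t y‖ ≤ κ t * ‖x - y‖) (s t : ℝ) (x y : F) :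
    ‖X s t x - X s t y‖ ≤ Real.exp |∫ r in s..t, κ r| * ‖x - y‖ := by
  set G : ℝ → ℝ := fun t => ∫ r in s..t, κ r with hG
  have hGd : ∀ t, HasDerivAt G (κ t) t := fun t =>
    intervalIntegral.integral_hasDerivAt_right (hκ.intervalIntegrable _ _)
      (hκ.stronglyMeasurableAtFilter _ _) hκ.continuousAt
  set w : ℝ → F := fun t => X s t x - X s t y with hw
  have hwd : ∀ t, HasDerivAt w (v t (X s t x) - v t (X s t y)) t := fun t =>
    (hX.hasDerivAt s x t).sub (hX.hasDerivAt s y t)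
  have hfd := fun t => (hwd t).norm_sq
  have hbd : ∀ t, |2 * inner ℝ (w t) (v t (X s t x) - v t (X s t y))| ≤ 2 * κ t * ‖w t‖ ^ 2 := by
    intro t
    rw [abs_mul, abs_two, mul_assoc]
    gcongr
    calc _ ≤ ‖w t‖ * ‖v t (X s t x) - v t (X s t y)‖ := abs_real_inner_le_norm _ _
      _ ≤ ‖w t‖ * (κ t * ‖w t‖) := by gcongr; exact hv t _ _
      _ = κ t * ‖w t‖ ^ 2 := by ring
  have hws : w s = x - y := by simp [hw, hX.self]
  have hGs : G s = 0 := by simp [hG]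
  -- `‖w‖²` grows at rate at most `2 κ` in both directions of time, so multiplication by
  -- `exp (∓ 2 G)` makes it monotone
  have key : ‖w t‖ ^ 2 ≤ Real.exp (2 * |G t|) * ‖x - y‖ ^ 2 := by
    rcases le_total s t with hst | hst
    · have hd : ∀ r, HasDerivAt (fun r => ‖w r‖ ^ 2 * Real.exp (-2 * G r))
          (2 * inner ℝ (w r) (v r (X s r x) - v r (X s r y)) * Real.exp (-2 * G r) +
            ‖w r‖ ^ 2 * (Real.exp (-2 * G r) * (-2 * κ r))) r := fun r =>
        (hfd r).mul ((hGd r).const_mul (-2)).exp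
      have hanti := antitone_of_deriv_nonpos (fun r => (hd r).differentiableAt) (fun r => by
        rw [(hd r).deriv]
        have := (abs_le.1 (hbd r)).2
        have := Real.exp_pos (-2 * G r)
        nlinarith)
      have h1 := hanti hst
      simp only [hws, hGs, mul_zero, Real.exp_zero, mul_one] at h1
      calc ‖w t‖ ^ 2 = Real.exp (2 * G t) * (‖w t‖ ^ 2 * Real.exp (-2 * G t)) := by
            rw [mul_comm (‖w t‖ ^ 2), ← mul_assoc, ← Real.exp_add]; simp
        _ ≤ Real.exp (2 * |G t|) * ‖x - y‖ ^ 2 := by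
            gcongr
            exact le_abs_self _
    · have hd : ∀ r, HasDerivAt (fun r => ‖w r‖ ^ 2 * Real.exp (2 * G r))
          (2 * inner ℝ (w r) (v r (X s r x) - v r (X s r y)) * Real.exp (2 * G r) +
            ‖w r‖ ^ 2 * (Real.exp (2 * G r) * (2 * κ r))) r := fun r =>
        (hfd r).mul ((hGd r).const_mul 2).exp
      have hmono := monotone_of_deriv_nonneg (fun r => (hd r).differentiableAt) (fun r => by
        rw [(hd r).deriv]
        have := (abs_le.1 (hbd r)).1
        have := Real.exp_pos (2 * G r)
        nlinarith)
      have h1 := hmono hst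
      simp only [hws, hGs, mul_zero, Real.exp_zero, mul_one] at h1
      calc ‖w t‖ ^ 2 = Real.exp (2 * -G t) * (‖w t‖ ^ 2 * Real.exp (2 * G t)) := by
            rw [mul_comm (‖w t‖ ^ 2), ← mul_assoc, ← Real.exp_add]; simp
        _ ≤ Real.exp (2 * |G t|) * ‖x - y‖ ^ 2 := by
            gcongr
            exact neg_le_abs _
  refine le_of_sq_le_sq ?_ (by positivity)
  rw [mul_pow, ← Real.exp_nat_mul]
  exact_mod_cast key

/-- Trajectories have speed at most `M`. -/
lemma norm_sub_le_of_time (hX : IsFlow v X) (hM : ∀ t x, ‖v t x‖ ≤ M) (s t r : ℝ) (x : F) :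
    ‖X s t x - X s r x‖ ≤ M * |t - r| :=
  convex_univ.norm_image_sub_le_of_norm_hasDerivWithin_le
    (fun r _ => (hX.hasDerivAt s x r).hasDerivWithinAt) (fun r _ => hM r _) (mem_univ r)
    (mem_univ t)

lemma lipschitzWith (hX : IsFlow v X) (hK : ∀ t, LipschitzWith K (v t)) (s t : ℝ) :
    LipschitzWith (Real.exp (K * |t - s|)).toNNReal (X s t) := by
  refine LipschitzWith.of_dist_le_mul fun x y => ?_
  rw [dist_eq_norm, dist_eq_norm, Real.coe_toNNReal _ (Real.exp_pos _).le]
  have := hX.norm_sub_le (κ := fun _ => (K : ℝ)) continuous_const (fun t x y => by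
    simpa [dist_eq_norm] using (hK t).dist_le_mul x y) s t x y
  simpa [abs_mul, mul_comm] using this

/-- The starting point of a fixed trajectory moves back along the velocity as the starting time
increases. -/
lemma hasDerivAt_start (hX : IsFlow v X) (hK : ∀ t, LipschitzWith K (v t))
    (hM : ∀ t x, ‖v t x‖ ≤ M) (hc : ∀ x, Continuous fun t => v t x) (s : ℝ) (x : F) :
    HasDerivAt (fun r => X r s x) (-v s x) s := by
  rw [hasDerivAt_iff_isLittleO]
  refine Asymptotics.isLittleO_iff.2 fun ε hε => ?_
  have h1 : ∀ᶠ r in 𝓝 s, ‖v r x - v s x‖ < ε / 2 := by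
    have := ((hc x).tendsto s)
    filter_upwards [Metric.tendsto_nhds.1 this (ε / 2) (half_pos hε)] with r hr
    rwa [← dist_eq_norm]
  have h2 : ∀ᶠ r in 𝓝 s, K * (M * |r - s|) < ε / 2 := by
    have : Tendsto (fun r => K * (M * |r - s|)) (𝓝 s) (𝓝 (K * (M * |s - s|))) :=
      Continuous.tendsto (by fun_prop) s
    rw [sub_self, abs_zero, mul_zero, mul_zero] at this
    exact this.eventually (gt_mem_nhds (half_pos hε))
  obtain ⟨δ, hδ, hball⟩ := Metric.eventually_nhds_iff_ball.1 (h1.and h2)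
  filter_upwards [Metric.ball_mem_nhds s hδ] with r hr
  have hsub : uIcc r s ⊆ Metric.ball s δ := by
    have := (convex_ball s δ).ordConnected
    exact this.uIcc_subset hr (Metric.mem_ball_self hδ)
  have hM0 : 0 ≤ M := (norm_nonneg _).trans (hM 0 0)
  -- compare the trajectory with the straight line of velocity `v s x`
  have hd : ∀ q, HasDerivAt (fun q => X r q x - q • v s x) (v q (X r q x) - v s x) q := fun q => by
    have := (hX.hasDerivAt r x q).sub ((hasDerivAt_id q).smul_const (v s x))
    rw [one_smul] at this
    exact this
  have hb : ∀ q ∈ uIcc r s, ‖v q (X r q x) - v s x‖ ≤ ε := by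
    intro q hq
    have h3 := hball q (hsub hq)
    have h4 := hball r hr
    have h5 : ‖X r q x - x‖ ≤ M * |r - s| := by
      have := hX.norm_sub_le_of_time hM r q r x
      rw [hX.self] at this
      refine this.trans (mul_le_mul_of_nonneg_left ?_ hM0)
      rw [abs_sub_comm r s]
      exact abs_sub_left_of_mem_uIcc hq
    calc ‖v q (X r q x) - v s x‖ ≤ ‖v q (X r q x) - v q x‖ + ‖v q x - v s x‖ :=
          norm_sub_le_norm_sub_add_norm_sub _ _ _
      _ ≤ K * (M * |r - s|) + ‖v q x - v s x‖ := by
          gcongr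
          have := (hK q).dist_le_mul (X r q x) x
          rw [dist_eq_norm, dist_eq_norm] at this
          exact this.trans (by gcongr)
      _ ≤ ε := by linarith [h3.1, h4.2]
  have h6 := (convex_uIcc r s).norm_image_sub_le_of_norm_hasDerivWithin_le
    (fun q _ => (hd q).hasDerivWithinAt) hb left_mem_uIcc right_mem_uIcc
  simp only [hX.self] at h6 ⊢
  rw [← norm_sub_rev s r]
  refine le_trans (le_of_eq ?_) h6
  congr 1
  rw [smul_neg, sub_smul]
  abel

end IsFlow

end Flow


/-! ### The flow of a tangential divergence-free field -/

section StirringFlow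

variable {d m : ℕ} {Ω : Set (E d)} {B : Fin m → E d → E d} {K : NNReal} {S : ℝ}

/-- The velocity field `∑ᵢ cᵢ Bᵢ`. -/
def stirVelocity (B : Fin m → E d → E d) (c : E m) (x : E d) : E d := ∑ i, c i • B i x

/-- The velocity field is Lipschitz in space, with constant proportional to `‖c‖`. -/
lemma IsStirringFamily.norm_stirVelocity_sub_le (hB : IsStirringFamily Ω B K S) (c : E m)
    (x y : E d) :
    ‖stirVelocity B c x - stirVelocity B c y‖ ≤ m * K * ‖c‖ * ‖x - y‖ := by
  simp only [stirVelocity, ← Finset.sum_sub_distrib, ← smul_sub]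
  refine (norm_sum_le _ _).trans ?_
  have h : ∀ i ∈ Finset.univ, ‖c i • (B i x - B i y)‖ ≤ ‖c‖ * (K * ‖x - y‖) := fun i _ => by
    rw [norm_smul]
    gcongr
    · exact PiLp.norm_apply_le c i
    · simpa [dist_eq_norm] using (hB.lipschitz i).dist_le_mul x y
  refine (Finset.sum_le_sum h).trans (le_of_eq ?_)
  rw [Finset.sum_const, Finset.card_univ, Fintype.card_fin, nsmul_eq_mul]
  ring

lemma IsStirringFamily.norm_stirVelocity_le (hB : IsStirringFamily Ω B K S) (c : E m) (x : E d) :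
    ‖stirVelocity B c x‖ ≤ m * S * ‖c‖ := by
  refine (norm_sum_le _ _).trans ?_
  have h : ∀ i ∈ Finset.univ, ‖c i • B i x‖ ≤ ‖c‖ * S := fun i _ => by
    rw [norm_smul]
    gcongr
    · exact PiLp.norm_apply_le c i
    · exact hB.bounded i x
  refine (Finset.sum_le_sum h).trans (le_of_eq ?_)
  rw [Finset.sum_const, Finset.card_univ, Fintype.card_fin, nsmul_eq_mul]
  ring

lemma continuous_stirVelocity_left (c : ℝ → E m) (hc : Continuous c) (x : E d) :
    Continuous fun t => stirVelocity B (c t) x := by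
  unfold stirVelocity
  refine continuous_finsetSum _ fun i _ => ?_
  exact ((EuclideanSpace.proj (𝕜 := ℝ) i).continuous.comp hc).smul continuous_const

variable {c : ℝ → E m} {R : ℝ} {X : ℝ → ℝ → E d → E d}

lemma IsStirringFamily.lipschitz_stirVelocity (hB : IsStirringFamily Ω B K S)
    (hR : ∀ t, ‖c t‖ ≤ R) (t : ℝ) :
    LipschitzWith (m * K * R.toNNReal) (stirVelocity B (c t)) := by
  refine LipschitzWith.of_dist_le_mul fun x y => ?_
  rw [dist_eq_norm, dist_eq_norm]
  refine (hB.norm_stirVelocity_sub_le (c t) x y).trans ?_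
  push_cast
  gcongr
  exact (hR t).trans (Real.le_coe_toNNReal R)

lemma IsStirringFamily.norm_stirVelocity_le' (hB : IsStirringFamily Ω B K S)
    (hR : ∀ t, ‖c t‖ ≤ R) (t : ℝ) (x : E d) : ‖stirVelocity B (c t) x‖ ≤ m * |S| * R := by
  refine (hB.norm_stirVelocity_le (c t) x).trans ?_
  gcongr
  · exact le_abs_self S
  · exact hR t

/-- A measurable self-map that preserves the integrals of bounded Lipschitz functions preserves the
measure. -/
lemma measurePreserving_of_lipschitz {α : Type*} [MeasurableSpace α] [PseudoMetricSpace α]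
    [BorelSpace α] {ν : Measure α} [IsFiniteMeasure ν] {Y : α → α} (hY : Measurable Y)
    (h : ∀ (φ : α → ℝ) (C : NNReal), LipschitzWith C φ → (∀ x, |φ x| ≤ 1) →
      ∫ x, φ (Y x) ∂ν = ∫ x, φ x ∂ν) : MeasurePreserving Y ν ν := by
  refine ⟨hY, ?_⟩
  have : IsFiniteMeasure (Measure.map Y ν) := Measure.isFiniteMeasure_map ν Y
  have hcl : ∀ A : Set α, IsClosed A → Measure.map Y ν A = ν A := by
    intro A hA
    have hpos : ∀ n : ℕ, (0 : ℝ) < 1 / (n + 1) := fun n => Nat.one_div_pos_of_nat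
    have h0 : Tendsto (fun n : ℕ => (1 : ℝ) / (n + 1)) atTop (𝓝 0) :=
      tendsto_one_div_add_atTop_nhds_zero_nat
    have h1 := tendsto_lintegral_thickenedIndicator_of_isClosed (Measure.map Y ν) hA hpos h0
    have h2 := tendsto_lintegral_thickenedIndicator_of_isClosed ν hA hpos h0
    refine tendsto_nhds_unique h1 (h2.congr fun n => ?_)
    set φ := thickenedIndicator (hpos n) A with hφ
    have hle : ∀ x, (φ x : ℝ) ≤ 1 := fun x => by
      exact NNReal.coe_le_one.2 (thickenedIndicator_le_one (hpos n) A x)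
    have hlip : LipschitzWith (Real.toNNReal (1 / (n + 1)))⁻¹ fun x => (φ x : ℝ) := by
      have := lipschitzWith_thickenedIndicator (hpos n) A
      exact NNReal.isometry_coe.lipschitz.comp this |>.weaken (by simp)
    have h3 := h (fun x => φ x) _ hlip fun x => by
      rw [abs_of_nonneg (NNReal.coe_nonneg _)]; exact hle x
    have h4 : ∫ x, (φ x : ℝ) ∂(Measure.map Y ν) = ∫ x, (φ x : ℝ) ∂ν := by
      rw [integral_map hY.aemeasurable hlip.continuous.aestronglyMeasurable, h3]
    have h5 : ∀ ξ : Measure α, ∫ x, (φ x : ℝ) ∂ξ = (∫⁻ x, φ x ∂ξ).toReal := fun ξ => by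
      rw [integral_eq_lintegral_of_nonneg_ae (Eventually.of_forall fun x => NNReal.coe_nonneg _)
        hlip.continuous.aestronglyMeasurable]
      simp
    rw [h5, h5, ENNReal.toReal_eq_toReal_iff'] at h4
    · exact h4.symm
    · exact (φ.lintegral_lt_top_of_nnreal _).ne
    · exact (φ.lintegral_lt_top_of_nnreal _).ne
  refine ext_of_generate_finite {A | IsClosed A} ?_ isPiSystem_isClosed (fun A hA => hcl A hA)
    (hcl _ isClosed_univ)
  rw [← borel_eq_generateFrom_isClosed]
  exact BorelSpace.measurable_eq

/-- The flow of a tangential divergence-free field preserves the Lebesgue measure on `Ω`. -/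
theorem measurePreserving_flow (hΩ : IsBoundedLipschitzDomain Ω) (hB : IsStirringFamily Ω B K S)
    (hc : Continuous c) (hR : ∀ t, ‖c t‖ ≤ R)
    (hX : IsFlow (fun t => stirVelocity B (c t)) X) (s t : ℝ) :
    MeasurePreserving (X s t) (volume.restrict Ω) (volume.restrict Ω) := by
  have hK := hB.lipschitz_stirVelocity hR
  have hM := hB.norm_stirVelocity_le' hR
  have hcc := continuous_stirVelocity_left (B := B) c hc
  have hM0 : 0 ≤ m * |S| * R := (norm_nonneg _).trans (hM 0 0)
  set M := m * |S| * R with hMdef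
  set κ := m * K * R.toNNReal with hκ
  have hfin : IsFiniteMeasure (volume.restrict Ω) :=
    ⟨by simpa using hΩ.isBounded.measure_lt_top⟩
  have hlip := fun s t => hX.lipschitzWith hK s t
  refine measurePreserving_of_lipschitz (hlip s t).continuous.measurable fun φ C hφ hφ1 => ?_
  -- the derivative with respect to the starting time `s` is the flux integral of the Lipschitz
  -- function `φ ∘ X s t` along the velocity, which vanishes
  have hder : ∀ s, HasDerivAt (fun s => ∫ x in Ω, φ (X s t x)) 0 s := by
    intro s
    have hF := hφ.comp (hlip s t)
    set Λ : ℝ := C * Real.exp (κ * (|t - s| + 1)) * M with hΛ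
    have h := (hasDerivAt_integral_of_dominated_loc_of_lip (μ := volume.restrict Ω)
      (F := fun r x => φ (X r t x)) (x₀ := s) (s := Metric.ball s 1)
      (F' := fun x => - fderiv ℝ (φ ∘ X s t) x (∑ i, c s i • B i x)) (bound := fun _ => Λ)
      (Metric.ball_mem_nhds s one_pos)
      (Eventually.of_forall fun r => (hφ.comp (hlip r t)).continuous.aestronglyMeasurable)
      ((integrable_const (1 : ℝ)).mono' hF.continuous.aestronglyMeasurable
        (Eventually.of_forall fun x => hφ1 _)) ?_ ?_ (integrable_const Λ) ?_).2
    · rwa [integral_neg, integral_inner_gradient_eq_zero hΩ hB (c s) hF, neg_zero] at h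
    · have h1 : Continuous (fun x => ∑ i, c s i • B i x) :=
        continuous_finsetSum _ fun i _ => by
          have := (hB.lipschitz i).continuous
          fun_prop
      have h2 : (fun x => - fderiv ℝ (φ ∘ X s t) x (∑ i, c s i • B i x)) =
          fun x => - inner ℝ (gradient (φ ∘ X s t) x) (∑ i, c s i • B i x) := by
        funext x; rw [inner_gradient]
      rw [h2]
      exact ((measurable_gradient _).aestronglyMeasurable.inner h1.aestronglyMeasurable).neg
    · refine Eventually.of_forall fun x => LipschitzOnWith.of_dist_le_mul fun r hr r' hr' => ?_
      have e1 : X r' t x = X r t (X r' r x) := (hX.comp r' r t x).symm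
      have e2 : ‖x - X r' r x‖ ≤ M * |r' - r| := by
        have := hX.norm_sub_le_of_time hM r' r' r x
        rwa [hX.self] at this
      have e3 := (hlip r t).dist_le_mul x (X r' r x)
      rw [Real.coe_toNNReal _ (Real.exp_pos _).le, dist_eq_norm x] at e3
      have e4 : |t - r| ≤ |t - s| + 1 := by
        rw [Metric.mem_ball, Real.dist_eq] at hr
        have := abs_sub_le t s r
        rw [abs_sub_comm s r] at this
        linarith
      have hΛ0 : 0 ≤ Λ := by positivity
      have e5 : ((Real.nnabs Λ : NNReal) : ℝ) = Λ := by simp [abs_of_nonneg hΛ0]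
      rw [e5, Real.dist_eq r r', e1]
      calc dist (φ (X r t x)) (φ (X r t (X r' r x))) ≤ C * dist (X r t x) (X r t (X r' r x)) :=
            hφ.dist_le_mul _ _
        _ ≤ C * (Real.exp (κ * (|t - s| + 1)) * (M * |r' - r|)) := by
            gcongr
            refine e3.trans ?_
            gcongr
        _ = Λ * |r - r'| := by rw [hΛ, abs_sub_comm r r']; ring
    · filter_upwards [ae_restrict_of_ae hF.ae_differentiableAt] with x hx
      have h1 := hX.hasDerivAt_start hK hM hcc s x
      have h2 : HasFDerivAt (φ ∘ X s t) (fderiv ℝ (φ ∘ X s t) x) (X s s x) := by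
        rw [hX.self]; exact hx.hasFDerivAt
      have h3 := h2.comp_hasDerivAt s h1
      rw [map_neg] at h3
      refine h3.congr_of_eventuallyEq (Eventually.of_forall fun r => ?_)
      simp only [Function.comp_apply]
      rw [hX.comp]
  have hconst := is_const_of_deriv_eq_zero (fun s => (hder s).differentiableAt)
    (fun s => (hder s).deriv) s t
  simpa only [hX.self] using hconst

/-- The flow maps the domain into itself: it preserves the measure, so it maps no open set to the
exterior, and `Ω` is the interior of its closure. -/
theorem mapsTo_flow (hΩ : IsBoundedLipschitzDomain Ω) (hB : IsStirringFamily Ω B K S)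
    (hc : Continuous c) (hR : ∀ t, ‖c t‖ ≤ R)
    (hX : IsFlow (fun t => stirVelocity B (c t)) X) (s t : ℝ) : MapsTo (X s t) Ω Ω := by
  have hK := hB.lipschitz_stirVelocity hR
  have hcont := fun s t => (hX.lipschitzWith hK s t).continuous
  have hmp := measurePreserving_flow hΩ hB hc hR hX s t
  have hinv : ∀ s t x, X t s (X s t x) = x := fun s t x => by rw [hX.comp, hX.self]
  have hopen : IsOpen (X s t ⁻¹' (closure Ω)ᶜ ∩ Ω) :=
    ((isClosed_closure.isOpen_compl).preimage (hcont s t)).inter hΩ.isOpen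
  have hnull : volume (X s t ⁻¹' (closure Ω)ᶜ ∩ Ω) = 0 := by
    have h1 := hmp.measure_preimage
      isClosed_closure.isOpen_compl.measurableSet.nullMeasurableSet (s := (closure Ω)ᶜ)
    rw [Measure.restrict_apply ((isClosed_closure.isOpen_compl).preimage (hcont s t)).measurableSet,
      Measure.restrict_apply isClosed_closure.isOpen_compl.measurableSet] at h1
    rw [h1]
    convert measure_empty (μ := (volume : Measure (E d)))
    exact (disjoint_compl_left.mono_right subset_closure).inter_eq
  have hempty := (hopen.measure_eq_zero_iff volume).1 hnull
  have hcl : MapsTo (X s t) Ω (closure Ω) := by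
    intro x hx
    by_contra h
    exact (Set.eq_empty_iff_forall_notMem.1 hempty x) ⟨h, hx⟩
  -- the image of `Ω` is open, because it is the preimage of `Ω` under the inverse flow
  have himg : X s t '' Ω = X t s ⁻¹' Ω := by
    ext y
    constructor
    · rintro ⟨x, hx, rfl⟩
      rwa [mem_preimage, hinv]
    · intro hy
      exact ⟨X t s y, hy, hinv t s y⟩
  have himo : IsOpen (X s t '' Ω) := by
    rw [himg]; exact hΩ.isOpen.preimage (hcont t s)
  intro x hx
  exact interior_closure_subset hΩ (interior_maximal hcl.image_subset himo ⟨x, hx, rfl⟩)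

/-- The composition of an `H¹(Ω)` function with a Lipschitz map that preserves `Ω` and its
Lebesgue measure. -/
theorem exists_H1_comp (hΩ : IsOpen Ω) (u : H1 Ω) {Y : E d → E d} {Λ : NNReal}
    (hY : LipschitzWith Λ Y) (hmaps : MapsTo Y Ω Ω)
    (hmp : MeasurePreserving Y (volume.restrict Ω) (volume.restrict Ω)) :
    ∃ w : H1 Ω, val w =ᵐ[volume.restrict Ω] (fun x => val u (Y x)) ∧
      ‖grad w‖ ≤ Λ * ‖grad u‖ := by
  -- the chain rule gradient; it is the weak gradient of the composition by approximation of `u`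
  -- with test functions, which is possible near the image of the support of the test function
  set g : E d → E d := fun x => ContinuousLinearMap.adjoint (fderiv ℝ Y x) (grad u (Y x)) with hg
  have hgradY : MemLp (fun x => grad u (Y x)) 2 (volume.restrict Ω) :=
    (Lp.memLp (grad u)).comp_measurePreserving hmp
  have hvalY : MemLp (fun x => val u (Y x)) 2 (volume.restrict Ω) :=
    (Lp.memLp (val u)).comp_measurePreserving hmp
  have hdY : ∀ x, ‖fderiv ℝ Y x‖ ≤ Λ := fun x => norm_fderiv_le_of_lipschitz ℝ hY
  have hgm : AEStronglyMeasurable g (volume.restrict Ω) := by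
    have h1 : Measurable fun x => ContinuousLinearMap.adjoint (fderiv ℝ Y x) :=
      ContinuousLinearMap.adjoint.continuous.measurable.comp (measurable_fderiv ℝ Y)
    exact isBoundedBilinearMap_apply.continuous.comp_aestronglyMeasurable
      (h1.aestronglyMeasurable.prodMk hgradY.1)
  have hgle : ∀ x, ‖g x‖ ≤ Λ * ‖grad u (Y x)‖ := fun x => by
    refine (ContinuousLinearMap.le_opNorm _ _).trans ?_
    gcongr
    rw [LinearIsometryEquiv.norm_map]
    exact hdY x
  have hgL : MemLp g 2 (volume.restrict Ω) :=
    MemLp.of_le_mul hgradY hgm (Eventually.of_forall hgle)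
  have hweak : ∀ φ : E d → ℝ, IsTest Ω φ → ∀ e : E d,
      (∫ x in Ω, val u (Y x) * fderiv ℝ φ x e) = - ∫ x in Ω, (inner ℝ (g x) e : ℝ) * φ x := by
    intro φ hφ e
    set A := tsupport φ with hA
    have hAc : IsCompact A := hφ.compact
    -- `κ` localises `u` near the image of the support of `φ`
    obtain ⟨κ, hκ, -, hκ1⟩ := exists_test_eq_one hΩ (hAc.image hY.continuous)
      (image_subset_iff.2 fun x hx => hmaps (hφ.subset hx))
    obtain ⟨Cκ, hCκ⟩ := hκ.lipschitz
    obtain ⟨ψ, hψ, hL1, hL2, hlim1, hlim2⟩ := exists_test_approx_cutoff hΩ u hCκ hκ.compact hκ.subset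
    have hcomp : ∀ {f : E d → ℝ}, MemLp f 2 volume → MemLp (f ∘ Y) 2 (volume.restrict Ω) :=
      fun hf => (hf.restrict Ω).comp_measurePreserving hmp
    have hcomp' : ∀ {f : E d → E d}, MemLp f 2 volume → MemLp (f ∘ Y) 2 (volume.restrict Ω) :=
      fun hf => (hf.restrict Ω).comp_measurePreserving hmp
    -- the two sides of the identity for `ψ n ∘ Y`, and their limits
    have hid : ∀ n, ∫ x in Ω, inner ℝ (fderiv ℝ φ x e) ((ψ n ∘ Y) x) =
        - ∫ x in Ω, inner ℝ (φ x • fderiv ℝ Y x e) ((gradient (ψ n) ∘ Y) x) := by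
      intro n
      obtain ⟨C, hC⟩ := (hψ n).lipschitz
      have h := integral_lipschitz_mul_fderiv (hC.comp hY) hφ.contDiff hφ.compact e
      have h0 : ∀ x ∉ Ω, φ x = 0 := fun x hx => image_eq_zero_of_notMem_tsupport
        fun h => hx (hφ.subset h)
      have h0' : ∀ x ∉ Ω, fderiv ℝ φ x = 0 := fun x hx => by
        rw [fderiv_of_notMem_tsupport]
        exact fun h => hx (hφ.subset h)
      have r1 : ∫ x in Ω, (ψ n ∘ Y) x * fderiv ℝ φ x e = ∫ x, (ψ n ∘ Y) x * fderiv ℝ φ x e :=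
        setIntegral_eq_integral_of_forall_compl_eq_zero fun x hx => by rw [h0' x hx]; simp
      have r2 : ∫ x in Ω, inner ℝ (gradient (ψ n ∘ Y) x) e * φ x =
          ∫ x, inner ℝ (gradient (ψ n ∘ Y) x) e * φ x :=
        setIntegral_eq_integral_of_forall_compl_eq_zero fun x hx => by rw [h0 x hx, mul_zero]
      rw [← r1, ← r2] at h
      refine Eq.trans ?_ (h.trans ?_)
      · exact integral_congr_ae (Eventually.of_forall fun x => by simp)
      · congr 1
        refine integral_congr_ae ?_
        filter_upwards [ae_restrict_of_ae hY.ae_differentiableAt] with x hx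
        rw [real_inner_smul_left, inner_gradient, Function.comp_apply, real_inner_comm,
          inner_gradient, mul_comm]
        congr 1
        rw [fderiv_comp x ((hψ n).contDiff.differentiable (by simp) _) hx]
        rfl
    have hφ1 : MemLp (fun x => fderiv ℝ φ x e) 2 (volume.restrict Ω) :=
      (((hφ.contDiff.continuous_fderiv (by simp)).clm_apply
        continuous_const).memLp_of_hasCompactSupport
          (hφ.compact.fderiv_apply (𝕜 := ℝ) e)).restrict Ω
    have hφ2 : MemLp (fun x => φ x • fderiv ℝ Y x e) 2 (volume.restrict Ω) := by
      refine MemLp.of_le_mul (c := Λ * ‖e‖) (hφ.memLp.restrict Ω)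
        (hφ.contDiff.continuous.aestronglyMeasurable.smul
          (measurable_fderiv_apply_const ℝ Y e).aestronglyMeasurable)
        (Eventually.of_forall fun x => ?_)
      rw [norm_smul, mul_comm]
      gcongr
      exact (ContinuousLinearMap.le_opNorm _ _).trans (by gcongr; exact hdY x)
    have T1 := tendsto_integral_inner hφ1 (hcomp hL1) (fun n => hcomp (hψ n).memLp)
      ((tendsto_congr fun n => by
        rw [← eLpNorm_comp_measurePreserving
          (((hψ n).memLp.sub hL1).restrict Ω).1 hmp]; rfl).1 (tendsto_eLpNorm_restrict (s := Ω) hlim1))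
    have T2 := tendsto_integral_inner hφ2 (hcomp' hL2) (fun n => hcomp' (hψ n).memLp_gradient)
      ((tendsto_congr fun n => by
        rw [← eLpNorm_comp_measurePreserving
          (((hψ n).memLp_gradient.sub hL2).restrict Ω).1 hmp]; rfl).1
            (tendsto_eLpNorm_restrict (s := Ω) hlim2))
    have hlim := tendsto_nhds_unique T1 ((tendsto_congr hid).2 T2.neg)
    -- on the support of `φ` the cutoff is `1`
    have hone : ∀ x ∈ A, κ (Y x) = 1 ∧ gradient κ (Y x) = 0 := fun x hx => by
      have h1 := hκ1 (Y x) (mem_image_of_mem _ hx)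
      refine ⟨h1.eq_of_nhds, ?_⟩
      rw [gradient, h1.fderiv_eq]
      simp
    refine Eq.trans ?_ (hlim.trans ?_)
    · refine integral_congr_ae (Eventually.of_forall fun x => ?_)
      by_cases hx : x ∈ A
      · simp [(hone x hx).1]
      · simp [fderiv_of_notMem_tsupport (𝕜 := ℝ) hx]
    · congr 1
      refine integral_congr_ae (Eventually.of_forall fun x => ?_)
      by_cases hx : x ∈ A
      · simp only [Function.comp_apply, (hone x hx).1, (hone x hx).2, one_smul, smul_zero,
          add_zero, hg, real_inner_smul_left, ContinuousLinearMap.adjoint_inner_left]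
        rw [real_inner_comm, mul_comm]
      · simp [image_eq_zero_of_notMem_tsupport hx]
  refine ⟨mkH1 hvalY hgL hweak, coeFn_val_mkH1 hvalY hgL hweak, ?_⟩
  have h1 : ‖(hgradY.toLp _ : L2Vec Ω)‖ = ‖grad u‖ := by
    rw [Lp.norm_toLp, Lp.norm_def]
    congr 1
    exact eLpNorm_comp_measurePreserving (Lp.memLp (grad u)).1 hmp
  rw [← h1]
  refine Lp.norm_le_mul_norm_of_ae_le_mul ?_
  filter_upwards [coeFn_grad_mkH1 hvalY hgL hweak, hgradY.coeFn_toLp] with x hx1 hx2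
  rw [hx1, hx2]
  exact hgle x

end StirringFlow


/-! ### Transport by the flow solves the weak evolution equation -/

section FlowEvolution

variable {d m : ℕ} {Ω : Set (E d)} {B : Fin m → E d → E d} {K : NNReal} {S : ℝ}
  {c : ℝ → E m} {R : ℝ} {X : ℝ → ℝ → E d → E d}

/-- The functions of `L²(Ω)` bounded by `M`. -/
def boundedBy (Ω : Set (E d)) (M : ℝ) : Set (L2 Ω) := {f | ∀ᵐ x ∂(volume.restrict Ω), |f x| ≤ M}

lemma isClosed_boundedBy (Ω : Set (E d)) (M : ℝ) : IsClosed (boundedBy Ω M) := by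
  refine IsSeqClosed.isClosed fun f g hf hlim => ?_
  obtain ⟨k, -, hk⟩ := (tendstoInMeasure_of_tendsto_Lp hlim).exists_seq_tendsto_ae
  have hall : ∀ᵐ x ∂(volume.restrict Ω), ∀ n, |f n x| ≤ M := ae_all_iff.2 hf
  filter_upwards [hk, hall] with x hx1 hx2
  exact le_of_tendsto hx1.abs (Eventually.of_forall fun n => hx2 _)

/-- Test functions are dense in `L²(Ω)`. -/
lemma dense_val_testSet (hΩ : IsBoundedLipschitzDomain Ω) (hB : IsStirringFamily Ω B K S) :
    Dense (val '' testSet Ω) := by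
  have h1 : range (valL Ω) ⊆ closure (val '' testSet Ω) := by
    rintro _ ⟨w, rfl⟩
    have h2 := mem_image_of_mem Prod.fst (fieldGraph_mem_closure hΩ hB w)
    have h3 := image_closure_subset_closure_image continuous_fst h2
    rwa [image_image] at h3
  exact dense_closure.1 ((denseRange_valL hΩ.isOpen hΩ.isBounded).mono h1)

/-- The weak evolution equation need only be tested with test functions. -/
lemma isWeakEvolution_of_testSet (hΩ : IsBoundedLipschitzDomain Ω)
    (hB : IsStirringFamily Ω B K S) {T : ℝ} (hc : IntegrableOn c (Icc 0 T)) {θ : ℝ → L2 Ω}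
    (hθ : ContinuousOn θ (Icc 0 T))
    (h : ∀ ψ ∈ testSet Ω, ∀ a ∈ Icc 0 T, ∀ b ∈ Icc 0 T, inner ℝ (θ b - θ a) (val ψ) =
      ∫ r in a..b, inner ℝ (θ r) (transportOp hB (c r) ψ)) :
    IsWeakEvolution (valL Ω) (transportOp hB) T c θ := by
  refine ⟨hθ, fun ψ a ha b hb => ?_⟩
  have hci : ∀ i, IntervalIntegrable (fun r => c r i • θ r) volume a b := fun i => by
    have hF : ContinuousOn (fun r => ContinuousLinearMap.smulRightL ℝ (E m) (L2 Ω)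
        (EuclideanSpace.proj i) (θ r)) (Icc 0 T) :=
      (ContinuousLinearMap.continuous _).comp_continuousOn hθ
    exact intervalIntegrable_clm_apply hF hc ha hb
  -- with `∫ cᵢ θ` taken out of the pairings, the right-hand side is continuous in the graph norm,
  -- for which test functions are dense
  have hrew : ∀ ψ, ∫ r in a..b, inner ℝ (θ r) (transportOp hB (c r) ψ) =
      ∑ i, inner ℝ (∫ r in a..b, c r i • θ r) (fieldDeriv hB i ψ) := by
    intro ψ
    have h1 : ∀ i, inner ℝ (∫ r in a..b, c r i • θ r) (fieldDeriv hB i ψ) =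
        ∫ r in a..b, inner ℝ (fieldDeriv hB i ψ) (c r i • θ r) := fun i => by
      rw [real_inner_comm]
      exact (ContinuousLinearMap.intervalIntegral_comp_comm
        (innerSL ℝ (fieldDeriv hB i ψ)) (hci i)).symm
    simp only [h1]
    rw [← intervalIntegral.integral_finsetSum]
    · refine intervalIntegral.integral_congr fun r _ => ?_
      simp [transportOp_apply, inner_sum, real_inner_smul_right, real_inner_smul_left,
        real_inner_comm]
    · intro i _
      have h2 := (hci i).1.const_inner (𝕜 := ℝ) (fieldDeriv hB i ψ)
      have h3 := (hci i).2.const_inner (𝕜 := ℝ) (fieldDeriv hB i ψ)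
      exact ⟨h2, h3⟩
  have hcl : IsClosed {p : L2 Ω × (Fin m → L2 Ω) | inner ℝ (θ b - θ a) p.1 =
      ∑ i, inner ℝ (∫ r in a..b, c r i • θ r) (p.2 i)} :=
    isClosed_eq (by fun_prop) (by fun_prop)
  rw [hrew]
  refine closure_minimal ?_ hcl (fieldGraph_mem_closure hΩ hB ψ)
  rintro _ ⟨w, hw, rfl⟩
  exact (h w hw a ha b hb).trans (hrew w)

lemma integral_comp_of_measurePreserving {α : Type*} [MeasurableSpace α] {ν : Measure α}
    {Y : α → α} (hY : MeasurePreserving Y ν ν) {g : α → ℝ} (hg : AEStronglyMeasurable g ν) :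
    ∫ x, g (Y x) ∂ν = ∫ x, g x ∂ν := by
  have h := integral_map (μ := ν) hY.measurable.aemeasurable (f := g) (by rwa [hY.map_eq])
  rw [hY.map_eq] at h
  exact h.symm

lemma ae_comp_of_measurePreserving {α β : Type*} [MeasurableSpace α] {ν : Measure α}
    {Y : α → α} (hY : MeasurePreserving Y ν ν) {f g : α → β} (h : f =ᵐ[ν] g) :
    (fun x => f (Y x)) =ᵐ[ν] fun x => g (Y x) :=
  hY.quasiMeasurePreserving.ae_eq_comp h

/-- The weak evolution equation for the transport of `u` by the flow, tested with a test function: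
differentiate `∫ u (φ ∘ X s r)` in `r`. -/
lemma inner_flow_sub (hΩ : IsBoundedLipschitzDomain Ω) (hB : IsStirringFamily Ω B K S)
    (hc : Continuous c) (hR : ∀ t, ‖c t‖ ≤ R)
    (hX : IsFlow (fun t => stirVelocity B (c t)) X) (s : ℝ) (u : L2 Ω) {ρ : ℝ → L2 Ω}
    (hρ : ∀ t, ρ t =ᵐ[volume.restrict Ω] fun x => u (X t s x)) {ψ : H1 Ω} (hψ : ψ ∈ testSet Ω)
    (a b : ℝ) :
    inner ℝ (ρ b - ρ a) (val ψ) = ∫ r in a..b, inner ℝ (ρ r) (transportOp hB (c r) ψ) := by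
  obtain ⟨φ, hφ, hψ1, hψ2⟩ := hψ
  have hK := hB.lipschitz_stirVelocity hR
  have hM := hB.norm_stirVelocity_le' hR
  set M := m * |S| * R with hMdef
  have hfin : IsFiniteMeasure (volume.restrict Ω) :=
    ⟨by simpa using hΩ.isBounded.measure_lt_top⟩
  have hcont := fun s t => (hX.lipschitzWith hK s t).continuous
  have hmp := measurePreserving_flow hΩ hB hc hR hX
  have hinv : ∀ s t x, X t s (X s t x) = x := fun s t x => by rw [hX.comp, hX.self]
  have hvc : ∀ r, Continuous (stirVelocity B (c r)) := fun r => (hK r).continuous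
  obtain ⟨C, hC⟩ := hφ.lipschitz
  obtain ⟨A, hA⟩ := bounded_of_continuous_hasCompactSupport hφ.contDiff.continuous hφ.compact
  have hdφ : Continuous (fderiv ℝ φ) := hφ.contDiff.continuous_fderiv (by simp)
  have hu1 : Integrable u (volume.restrict Ω) := (Lp.memLp u).integrable (by norm_num)
  -- move the flow from `u` to the test function
  have hmove : ∀ r (q : E d → ℝ) , AEStronglyMeasurable q (volume.restrict Ω) →
      ∫ x in Ω, ρ r x * q x = ∫ y in Ω, u y * q (X s r y) := by
    intro r q hq
    have hu : AEStronglyMeasurable (fun x => u (X r s x)) (volume.restrict Ω) :=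
      ((Lp.memLp u).comp_measurePreserving (hmp r s)).1
    have h := integral_comp_of_measurePreserving (hmp s r) (hu.mul hq)
    simp only [Pi.mul_apply, hinv] at h
    rw [h]
    refine integral_congr_ae ?_
    filter_upwards [hρ r] with x hx
    rw [hx]
  set N : ℝ → ℝ := fun r => ∫ y in Ω, u y * φ (X s r y) with hN
  set G : ℝ → ℝ := fun r => inner ℝ (ρ r) (transportOp hB (c r) ψ) with hG
  have hN' : ∀ r, inner ℝ (ρ r) (val ψ) = N r := by
    intro r
    rw [hN, inner_L2_eq]
    dsimp only
    rw [← hmove r φ hφ.contDiff.continuous.aestronglyMeasurable]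
    refine integral_congr_ae ?_
    filter_upwards [hψ1] with x hx
    rw [hx]
  have hq : ∀ r, Continuous fun x => fderiv ℝ φ x (stirVelocity B (c r) x) := fun r =>
    hdφ.clm_apply (hvc r)
  have hqle : ∀ r x, |fderiv ℝ φ x (stirVelocity B (c r) x)| ≤ C * M := fun r x => by
    rw [← Real.norm_eq_abs]
    refine (ContinuousLinearMap.le_opNorm _ _).trans ?_
    gcongr
    · exact norm_fderiv_le_of_lipschitz ℝ hC
    · exact hM r x
  have hG' : ∀ r, G r = ∫ y in Ω, u y * fderiv ℝ φ (X s r y) (stirVelocity B (c r) (X s r y)) := by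
    intro r
    rw [← hmove r _ (hq r).aestronglyMeasurable, hG]
    dsimp only
    rw [inner_L2_eq]
    refine integral_congr_ae ?_
    filter_upwards [coeFn_transportOp hB (c r) ψ, hψ2] with x hx1 hx2
    rw [hx1, hx2, real_inner_comm, inner_gradient]
    rfl
  have hder : ∀ r, HasDerivAt N (G r) r := by
    intro r
    rw [hG']
    refine (hasDerivAt_integral_of_dominated_loc_of_deriv_le (μ := volume.restrict Ω)
      (F := fun r y => u y * φ (X s r y)) (s := univ)
      (F' := fun r y => u y * fderiv ℝ φ (X s r y) (stirVelocity B (c r) (X s r y)))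
      (bound := fun y => |u y| * (C * M)) univ_mem (Eventually.of_forall fun r =>
        hu1.1.mul (hφ.contDiff.continuous.comp (hcont s r)).aestronglyMeasurable) ?_ ?_ ?_ ?_ ?_).2
    · exact hu1.mul_of_top_left (memLp_top_of_bound
        (hφ.contDiff.continuous.comp (hcont s r)).aestronglyMeasurable A
        (Eventually.of_forall fun y => hA _))
    · exact hu1.1.mul ((hq r).comp (hcont s r)).aestronglyMeasurable
    · refine Eventually.of_forall fun y r _ => ?_
      rw [norm_mul, Real.norm_eq_abs, Real.norm_eq_abs]
      gcongr
      exact hqle r _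
    · exact hu1.abs.mul_const _
    · refine Eventually.of_forall fun y r _ => ?_
      have h1 := (hφ.contDiff.differentiable (by simp) (X s r y)).hasFDerivAt.comp_hasDerivAt r
        (hX.hasDerivAt s y r)
      exact h1.const_mul (u y)
  have hGm : Measurable G := by
    have : G = deriv N := by funext r; exact (hder r).deriv.symm
    rw [this]
    exact measurable_deriv N
  have hGle : ∀ r, ‖G r‖ ≤ ∫ y in Ω, |u y| * (C * M) := fun r => by
    rw [hG']
    refine norm_integral_le_of_norm_le (hu1.abs.mul_const _) (Eventually.of_forall fun y => ?_)
    rw [norm_mul, Real.norm_eq_abs, Real.norm_eq_abs]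
    gcongr
    exact hqle r _
  have hGi : IntervalIntegrable G volume a b :=
    (intervalIntegrable_const (c := ∫ y in Ω, |u y| * (C * M))).mono_fun
      hGm.aestronglyMeasurable (Eventually.of_forall fun r =>
        (hGle r).trans (le_abs_self _))
  rw [intervalIntegral.integral_eq_sub_of_hasDerivAt (fun r _ => hder r) hGi, inner_sub_left, hN',
    hN']

lemma norm_transportOp_apply_le (hB : IsStirringFamily Ω B K S) (c : E m) (ψ : H1 Ω) :
    ‖transportOp hB c ψ‖ ≤ (∑ i, ‖fieldDeriv hB i ψ‖) * ‖c‖ := by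
  rw [transportOp_apply, Finset.sum_mul]
  refine (norm_sum_le _ _).trans (Finset.sum_le_sum fun i _ => ?_)
  rw [norm_smul, mul_comm]
  gcongr
  exact PiLp.norm_apply_le c i

/-- The evolution equation is solved by composition with the flow, if the control is continuous and
bounded. -/
theorem hasRegularEvolution_of_bounded (hΩ : IsBoundedLipschitzDomain Ω)
    (hB : IsStirringFamily Ω B K S) (hc : Continuous c) (hR : ∀ t, ‖c t‖ ≤ R) (T M : ℝ) :
    HasRegularEvolution (valL Ω) (transportOp hB) T (m * K) (boundedBy Ω M) c := by
  have hK := hB.lipschitz_stirVelocity hR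
  have hM := hB.norm_stirVelocity_le' hR
  obtain ⟨X, hX⟩ := exists_isFlow hK hM (continuous_stirVelocity_left c hc)
  have hmp := measurePreserving_flow hΩ hB hc hR hX
  have hmaps := mapsTo_flow hΩ hB hc hR hX
  set κ : ℝ → ℝ := fun r => m * K * ‖c r‖ with hκ
  have hκc : Continuous κ := by fun_prop
  have hlip : ∀ t s, LipschitzWith (Real.exp |∫ r in t..s, κ r|).toNNReal (X t s) := fun t s =>
    LipschitzWith.of_dist_le_mul fun x y => by
      rw [dist_eq_norm, dist_eq_norm, Real.coe_toNNReal _ (Real.exp_pos _).le]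
      exact hX.norm_sub_le hκc (fun r x y => hB.norm_stirVelocity_sub_le (c r) x y) t s x y
  intro s hs u
  -- the solution is `W t = u ∘ X t s`
  choose W hW1 hW2 using fun t => exists_H1_comp hΩ.isOpen u (hlip t s) (hmaps t s) (hmp t s)
  have hnorm_comp : ∀ {f g : L2 Ω} {Y : E d → E d},
      MeasurePreserving Y (volume.restrict Ω) (volume.restrict Ω) →
      (f =ᵐ[volume.restrict Ω] fun x => g (Y x)) → ‖f‖ = ‖g‖ := by
    intro f g Y hY h
    rw [Lp.norm_def, Lp.norm_def, eLpNorm_congr_ae h]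
    congr 1
    exact eLpNorm_comp_measurePreserving (Lp.memLp g).1 hY
  have hnorm : ∀ t, ‖val (W t)‖ = ‖val u‖ := fun t => hnorm_comp (hmp t s) (hW1 t)
  have hcocycle : ∀ s' t, val (W t) =ᵐ[volume.restrict Ω] fun x => val (W s') (X t s' x) := by
    intro s' t
    filter_upwards [hW1 t, ae_comp_of_measurePreserving (hmp t s') (hW1 s')] with x hx1 hx2
    rw [hx1, hx2, hX.comp]
  -- `W t = W s' ∘ X t s'`, and composition with the flow multiplies the norm of the gradient by
  -- at most the Lipschitz constant of the flow
  have hgrow : ∀ s' t, ‖W t‖ ≤ Real.exp |∫ r in s'..t, κ r| * ‖W s'‖ := by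
    intro s' t
    obtain ⟨w, hw1, hw2⟩ := exists_H1_comp hΩ.isOpen (W s') (hlip t s') (hmaps t s') (hmp t s')
    have hw : w = W t := val_injective hΩ.isOpen (Lp.ext (hw1.trans (hcocycle s' t).symm))
    rw [hw, Real.coe_toNNReal _ (Real.exp_pos _).le, intervalIntegral.integral_symm, abs_neg] at hw2
    have h1 : ‖val (W t)‖ = ‖val (W s')‖ := by rw [hnorm, hnorm]
    have h2 : 1 ≤ Real.exp |∫ r in s'..t, κ r| := Real.one_le_exp (abs_nonneg _)
    refine le_of_sq_le_sq ?_ (by positivity)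
    rw [mul_pow, norm_sq_H1, norm_sq_H1, h1, mul_add]
    have h3 : ‖grad (W t)‖ ^ 2 ≤ (Real.exp |∫ r in s'..t, κ r| * ‖grad (W s')‖) ^ 2 := by gcongr
    rw [mul_pow] at h3
    refine add_le_add (le_mul_of_one_le_left (sq_nonneg _) ?_) h3
    exact one_le_pow₀ h2
  have htest : ∀ ψ ∈ testSet Ω, ∀ a b, inner ℝ (val (W b) - val (W a)) (val ψ) =
      ∫ r in a..b, inner ℝ (val (W r)) (transportOp hB (c r) ψ) := fun ψ hψ a b =>
    inner_flow_sub hΩ hB hc hR hX s (val u) (ρ := fun t => val (W t)) hW1 hψ a b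
  -- weak continuity and constancy of the norm give strong continuity
  have hcontW : Continuous fun t => val (W t) := by
    refine continuous_iff_continuousAt.2 fun a => ?_
    have hweak : ∀ y, Tendsto (fun t => inner ℝ (val (W t)) y) (𝓝 a)
        (𝓝 (inner ℝ (val (W a)) y)) := by
      refine tendsto_inner_of_dense (dense_val_testSet hΩ hB)
        (Eventually.of_forall fun t => (hnorm t).le) ?_
      rintro _ ⟨ψ, hψ, rfl⟩
      have hbd : ∀ t, |inner ℝ (val (W t)) (val ψ) - inner ℝ (val (W a)) (val ψ)| ≤
          (‖val u‖ * ((∑ i, ‖fieldDeriv hB i ψ‖) * R)) * |t - a| := by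
        intro t
        rw [← inner_sub_left, htest ψ hψ a t, ← Real.norm_eq_abs]
        refine intervalIntegral.norm_integral_le_of_norm_le_const
          (f := fun r => (inner ℝ (val (W r)) (transportOp hB (c r) ψ) : ℝ)) fun r _ => ?_
        refine (norm_inner_le_norm _ _).trans ?_
        rw [hnorm]
        gcongr
        refine (norm_transportOp_apply_le hB (c r) ψ).trans ?_
        gcongr
        exact hR r
      rw [tendsto_iff_norm_sub_tendsto_zero]
      refine squeeze_zero (fun _ => norm_nonneg _) hbd ?_
      have h0 : Tendsto (fun t => (‖val u‖ * ((∑ i, ‖fieldDeriv hB i ψ‖) * R)) * |t - a|) (𝓝 a)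
          (𝓝 ((‖val u‖ * ((∑ i, ‖fieldDeriv hB i ψ‖) * R)) * |a - a|)) :=
        Continuous.tendsto (by fun_prop) a
      simpa using h0
    rw [ContinuousAt, tendsto_iff_norm_sub_tendsto_zero]
    have h1 : Tendsto (fun t => ‖val (W t) - val (W a)‖ ^ 2) (𝓝 a) (𝓝 0) := by
      have h2 : ∀ t, ‖val (W t) - val (W a)‖ ^ 2 =
          2 * ‖val u‖ ^ 2 - 2 * inner ℝ (val (W t)) (val (W a)) := fun t => by
        rw [norm_sub_sq_real, hnorm, hnorm]; ring
      simp only [h2]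
      have h3 := ((hweak (val (W a))).const_mul 2).const_sub (2 * ‖val u‖ ^ 2)
      rwa [real_inner_self_eq_norm_sq, hnorm, sub_self] at h3
    have h4 := (Real.continuous_sqrt.tendsto 0).comp h1
    simpa [Function.comp_def, Real.sqrt_sq] using h4
  refine ⟨W, ?_, isWeakEvolution_of_testSet hΩ hB hc.continuousOn.integrableOn_Icc
    hcontW.continuousOn fun ψ hψ a _ b _ => htest ψ hψ a b, ?_,
    fun s' _ t _ => hgrow s' t, fun t _ => hnorm t, fun hu t _ => ?_⟩
  · refine val_injective hΩ.isOpen (Lp.ext ?_)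
    filter_upwards [hW1 s] with x hx
    rw [hx, hX.self]
  · exact continuousOn_of_growth (ι := valL Ω) (κ := κ)
      (fun _ _ h => val_injective hΩ.isOpen h)
      hκc.continuousOn.integrableOn_Icc hcontW.continuousOn fun s' _ t _ => hgrow s' t
  -- composition with a measure-preserving map keeps an almost everywhere bound
  · have hu' : ∀ᵐ x ∂(volume.restrict Ω), |val u x| ≤ M := hu
    have := (hmp t s).quasiMeasurePreserving.ae hu'
    change ∀ᵐ x ∂(volume.restrict Ω), |val (W t) x| ≤ M
    filter_upwards [this, hW1 t] with x hx1 hx2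
    rw [hx2]
    exact hx1

/-- Well-posedness of the evolution equation for integrable controls. -/
theorem hasRegularEvolution (hΩ : IsBoundedLipschitzDomain Ω) (hB : IsStirringFamily Ω B K S)
    {T : ℝ} (M : ℝ) (hc : IntegrableOn c (Icc 0 T)) :
    HasRegularEvolution (valL Ω) (transportOp hB) T (m * K) (boundedBy Ω M) c := by
  refine hasRegularEvolution_of_integrable (inner_transportOp hΩ hB)
    (denseRange_valL hΩ.isOpen hΩ.isBounded) (fun _ _ h => val_injective hΩ.isOpen h)
    (by positivity) (isClosed_boundedBy Ω M) (fun c hc => ?_) hc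
  intro s hs
  have hT : 0 ≤ T := hs.1.trans hs.2
  -- outside `[0, T]` the control may be replaced by constants
  set c' : ℝ → E m := fun t => c (projIcc 0 T hT t) with hc'
  have hcc' : Continuous c' := hc.comp (continuous_subtype_val.comp continuous_projIcc)
  obtain ⟨R, hR⟩ := (isCompact_Icc (a := (0 : ℝ)) (b := T)).exists_bound_of_continuousOn
    hc.continuousOn
  have heq : ∀ t ∈ Icc 0 T, c' t = c t := fun t ht => by
    simp only [hc', projIcc_of_mem hT ht]
  have hsub : ∀ {a b}, a ∈ Icc 0 T → b ∈ Icc 0 T → uIcc a b ⊆ Icc 0 T := fun ha hb =>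
    (convex_Icc 0 T).ordConnected.uIcc_subset ha hb
  intro u
  obtain ⟨ρ, h1, h2, h3, h4, h5⟩ := hasRegularEvolution_of_bounded hΩ hB hcc'
    (fun t => hR _ (projIcc 0 T hT t).2) T M s hs u
  refine ⟨ρ, h1, ⟨h2.continuousOn, fun ψ a ha b hb => ?_⟩, h3, fun a ha b hb => ?_, h5⟩
  · rw [h2.weak ψ a ha b hb]
    exact intervalIntegral.integral_congr fun r hr => by
      simp only [heq r (hsub ha hb hr)]
  · have : ∫ r in a..b, m * K * ‖c r‖ = ∫ r in a..b, m * K * ‖c' r‖ :=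
      intervalIntegral.integral_congr fun r hr => by
        simp only [heq r (hsub ha hb hr)]
    rw [this]
    exact h4 a ha b hb

end FlowEvolution


/-! ### Space-time weak formulations -/

section SpaceTime

variable {d m : ℕ} {Ω : Set (E d)} {B : Fin m → E d → E d} {K : NNReal} {S : ℝ}
  {c : ℝ → E m} {T : ℝ}

/-- A form of the du Bois-Reymond lemma: a continuous function whose distributional derivative is
integrable is a primitive of it. -/
lemma sub_eq_integral_of_forall_test (hT : 0 < T) {p q : ℝ → ℝ} (hp : ContinuousOn p (Icc 0 T))
    (hq : IntervalIntegrable q volume 0 T)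
    (h : ∀ α : ℝ → ℝ, ContDiff ℝ ∞ α → HasCompactSupport α → tsupport α ⊆ Ioo 0 T →
      ∫ t in (0 : ℝ)..T, (deriv α t * p t + α t * q t) = 0) {s t : ℝ} (hs : s ∈ Icc 0 T)
    (ht : t ∈ Icc 0 T) : p t - p s = ∫ r in s..t, q r := by
  set Q : ℝ → ℝ := fun t => ∫ r in (0 : ℝ)..t, q r with hQ
  have hu : uIcc 0 T = Icc 0 T := uIcc_of_le hT.le
  have hQac : AbsolutelyContinuousOnInterval Q 0 T :=
    hq.absolutelyContinuousOnInterval_intervalIntegral left_mem_uIcc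
  have hQc : ContinuousOn Q (Icc 0 T) := hu ▸ hQac.continuousOn
  have hQd : ∀ᵐ r, r ∈ uIoc 0 T → deriv Q r = q r := by
    filter_upwards [hq.ae_hasDerivAt_integral] with r hr hr'
    exact (hr (uIoc_subset_uIcc hr') 0 left_mem_uIcc).deriv
  have hPc : ContinuousOn (fun t => p t - Q t) (Icc 0 T) := hp.sub hQc
  -- the distributional derivative of `p - Q` vanishes
  have h1 : ∀ α : ℝ → ℝ, ContDiff ℝ ∞ α → HasCompactSupport α → tsupport α ⊆ Ioo 0 T →
      ∫ t in (0 : ℝ)..T, deriv α t * (p t - Q t) = 0 := by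
    intro α hα hc hsupp
    have hαac : AbsolutelyContinuousOnInterval α 0 T :=
      ContDiffOn.absolutelyContinuousOnInterval (hα.of_le (by simp)).contDiffOn
    have hdα : Continuous (deriv α) := hα.continuous_deriv (by simp)
    have hα0 : α 0 = 0 := image_eq_zero_of_notMem_tsupport fun h => (lt_irrefl _ (hsupp h).1)
    have hαT : α T = 0 := image_eq_zero_of_notMem_tsupport fun h => (lt_irrefl _ (hsupp h).2)
    have hparts := hαac.integral_mul_deriv_eq_deriv_mul hQac
    rw [hα0, hαT, zero_mul, zero_mul, sub_zero, zero_sub] at hparts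
    have hcongr : ∫ x in (0 : ℝ)..T, α x * deriv Q x = ∫ x in (0 : ℝ)..T, α x * q x := by
      refine intervalIntegral.integral_congr_ae ?_
      filter_upwards [hQd] with x hx hx'
      rw [hx hx']
    rw [hcongr] at hparts
    have i1 : IntervalIntegrable (fun x => deriv α x * p x) volume 0 T :=
      (hdα.continuousOn.mul (hu ▸ hp)).intervalIntegrable
    have i2 : IntervalIntegrable (fun x => deriv α x * Q x) volume 0 T :=
      (hdα.continuousOn.mul (hu ▸ hQc)).intervalIntegrable
    have i3 : IntervalIntegrable (fun x => α x * q x) volume 0 T :=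
      hq.continuousOn_mul hα.continuous.continuousOn
    have h2 := h α hα hc hsupp
    rw [intervalIntegral.integral_add i1 i3, hparts] at h2
    simp only [mul_sub]
    rw [intervalIntegral.integral_sub i1 i2]
    linarith
  obtain ⟨β₀, hβ₀c, hβ₀s, hβ₀T, hβ₀1⟩ : ∃ β₀ : ℝ → ℝ, ContDiff ℝ ∞ β₀ ∧ HasCompactSupport β₀ ∧
      tsupport β₀ ⊆ Ioo 0 T ∧ ∫ x, β₀ x = 1 := by
    let β : ContDiffBump (T / 2) := ⟨T / 8, T / 4, by positivity, by linarith⟩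
    refine ⟨β.normed volume, β.contDiff_normed, β.hasCompactSupport_normed, ?_, β.integral_normed⟩
    rw [β.tsupport_normed_eq, Real.closedBall_eq_Icc]
    intro x hx
    have hx1 : T / 2 - T / 4 ≤ x := hx.1
    have hx2 : x ≤ T / 2 + T / 4 := hx.2
    constructor <;> linarith
  -- the constant value of `p - Q`, read off by averaging against `β₀`
  set C : ℝ := ∫ x in (0 : ℝ)..T, β₀ x * (p x - Q x) with hC
  have hint : ∀ β : ℝ → ℝ, tsupport β ⊆ Ioo 0 T → ∀ g : ℝ → ℝ,
      ∫ x in (0 : ℝ)..T, β x * g x = ∫ x, β x * g x := by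
    intro β hβ g
    refine intervalIntegral.integral_eq_integral_of_support_subset fun x hx => ?_
    have : x ∈ tsupport β := subset_tsupport _ (left_ne_zero_of_mul hx)
    exact Ioo_subset_Ioc_self (hβ this)
  have hzero : ∀ᵐ x, x ∈ Ioo 0 T → (p x - Q x) - C = 0 := by
    refine isOpen_Ioo.ae_eq_zero_of_integral_contDiff_smul_eq_zero
      (((hPc.sub continuousOn_const).mono Ioo_subset_Icc_self).locallyIntegrableOn
        measurableSet_Ioo) fun β hβ hβc hβs => ?_
    -- subtracting the multiple `I β₀` makes the mean vanish, so the primitive has compact support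
    set I : ℝ := ∫ x, β x with hI
    set g : ℝ → ℝ := fun x => β x - I * β₀ x with hg
    have hgc : ContDiff ℝ ∞ g := hβ.sub (contDiff_const.mul hβ₀c)
    have hgs : ∀ x, x ∉ tsupport β ∪ tsupport β₀ → g x = 0 := fun x hx => by
      rw [mem_union, not_or] at hx
      simp [hg, image_eq_zero_of_notMem_tsupport hx.1, image_eq_zero_of_notMem_tsupport hx.2]
    have hcomp : IsCompact (tsupport β ∪ tsupport β₀) := hβc.isCompact.union hβ₀s.isCompact
    have hsub : tsupport β ∪ tsupport β₀ ⊆ Ioo 0 T := union_subset hβs hβ₀T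
    have hβi : Integrable β := hβ.continuous.integrable_of_hasCompactSupport hβc
    have hβ₀i : Integrable β₀ := hβ₀c.continuous.integrable_of_hasCompactSupport hβ₀s
    have hg0 : ∫ x in (0 : ℝ)..T, g x = 0 := by
      rw [intervalIntegral.integral_eq_integral_of_support_subset]
      · simp only [hg]
        rw [integral_sub hβi (hβ₀i.const_mul I), integral_const_mul, hβ₀1, mul_one, sub_self]
      · intro x hx
        by_contra h
        exact hx (hgs x fun h' => h (Ioo_subset_Ioc_self (hsub h')))
    -- the primitive of `g` is a test function
    obtain ⟨a, b, ha, hb, hab⟩ : ∃ a b, 0 < a ∧ b < T ∧ tsupport β ∪ tsupport β₀ ⊆ Icc a b := by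
      have hne : (tsupport β ∪ tsupport β₀).Nonempty := by
        by_contra hne
        rw [not_nonempty_iff_eq_empty, union_empty_iff] at hne
        have : β₀ = 0 := tsupport_eq_empty_iff.1 hne.2
        rw [this] at hβ₀1
        simp at hβ₀1
      exact ⟨_, _, (hsub (hcomp.sInf_mem hne)).1, (hsub (hcomp.sSup_mem hne)).2, fun x hx =>
        ⟨csInf_le hcomp.bddBelow hx, le_csSup hcomp.bddAbove hx⟩⟩
    set α : ℝ → ℝ := fun t => ∫ x in (0 : ℝ)..t, g x with hα
    have hαd : ∀ t, HasDerivAt α (g t) t := fun t =>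
      intervalIntegral.integral_hasDerivAt_right (hgc.continuous.intervalIntegrable _ _)
        (hgc.continuous.stronglyMeasurableAtFilter _ _) hgc.continuous.continuousAt
    have hαd' : deriv α = g := funext fun t => (hαd t).deriv
    have hαc : ContDiff ℝ ∞ α :=
      contDiff_infty_iff_deriv.2 ⟨fun t => (hαd t).differentiableAt, hαd' ▸ hgc⟩
    have hg_out : ∀ x, x ∉ Icc a b → g x = 0 := fun x hx => hgs x fun h => hx (hab h)
    have hαs : ∀ t, t ∉ Icc a b → α t = 0 := by
      intro t ht
      rcases lt_or_ge t a with hta | hta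
      · refine (intervalIntegral.integral_congr (g := fun _ => (0 : ℝ)) fun x hx =>
          hg_out x fun h => ?_).trans (by simp)
        have : x ≤ max 0 t := hx.2
        exact absurd (h.1.trans this) (not_le.2 (max_lt ha hta))
      · have htb : b < t := by
          by_contra hle
          exact ht ⟨hta, not_lt.1 hle⟩
        have h2 : α t = α T + ∫ x in T..t, g x :=
          (intervalIntegral.integral_add_adjacent_intervals
            (hgc.continuous.intervalIntegrable _ _) (hgc.continuous.intervalIntegrable _ _)).symm
        rw [h2, show α T = 0 from hg0, zero_add]
        refine (intervalIntegral.integral_congr (g := fun _ => (0 : ℝ)) fun x hx =>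
          hg_out x fun h => ?_).trans (by simp)
        have : min T t ≤ x := hx.1
        exact absurd (this.trans h.2) (not_le.2 (lt_min hb htb))
    have hαts : tsupport α ⊆ Icc a b := closure_minimal
      (fun x hx => by by_contra h; exact hx (hαs x h)) isClosed_Icc
    have h3 := h1 α hαc (HasCompactSupport.of_support_subset_isCompact isCompact_Icc
      ((subset_tsupport _).trans hαts)) (hαts.trans fun x hx => ⟨ha.trans_le hx.1,
        hx.2.trans_lt hb⟩)
    rw [hαd'] at h3
    have i1 : IntervalIntegrable (fun x => β x * (p x - Q x)) volume 0 T :=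
      (hβ.continuous.continuousOn.mul (hu ▸ hPc)).intervalIntegrable
    have i2 : IntervalIntegrable (fun x => β₀ x * (p x - Q x)) volume 0 T :=
      (hβ₀c.continuous.continuousOn.mul (hu ▸ hPc)).intervalIntegrable
    have i3 : IntervalIntegrable (fun x => β x * C) volume 0 T :=
      (hβ.continuous.mul continuous_const).intervalIntegrable _ _
    have h4 : ∫ x in (0 : ℝ)..T, g x * (p x - Q x) =
        (∫ x in (0 : ℝ)..T, β x * (p x - Q x)) - I * C := by
      rw [hC, ← intervalIntegral.integral_const_mul, ← intervalIntegral.integral_sub i1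
        (i2.const_mul I)]
      refine intervalIntegral.integral_congr fun x _ => ?_
      simp only [hg]; ring
    have h5 : ∫ x, β x * C = I * C := integral_mul_const C β
    simp only [smul_eq_mul]
    rw [← hint β hβs fun x => p x - Q x - C]
    simp only [mul_sub _ _ C]
    rw [intervalIntegral.integral_sub i1 i3, hint β hβs fun _ => C, h5, ← h4, h3]
  have hconst : EqOn (fun x => p x - Q x) (fun _ => C) (Icc 0 T) := by
    refine Measure.eqOn_Icc_of_ae_eq volume hT.ne ?_ hPc continuousOn_const
    rw [← restrict_Ioo_eq_restrict_Icc, Filter.EventuallyEq, ae_restrict_iff' measurableSet_Ioo]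
    filter_upwards [hzero] with x hx hx'
    exact sub_eq_zero.1 (hx hx')
  have e1 := hconst hs
  have e2 := hconst ht
  have hsub : ∀ {r}, r ∈ Icc 0 T → IntervalIntegrable q volume 0 r := fun hr =>
    hq.mono_set (uIcc_subset_uIcc left_mem_uIcc (hu ▸ hr))
  simp only at e1 e2
  have e3 := intervalIntegral.integral_interval_sub_left (hsub ht) (hsub hs)
  simp only [hQ] at e1 e2
  linarith

end SpaceTime


section SpaceTime

variable {d m : ℕ} {Ω : Set (E d)} {B : Fin m → E d → E d} {K : NNReal} {S : ℝ}
  {c : ℝ → E m} {T : ℝ}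

/-- The slices of a continuous, compactly supported space-time function form a continuous curve in
`L²`. -/
lemma continuous_Lp_of_sections {F : Type*} [NormedAddCommGroup F] {ν : Measure (E d)}
    [IsFiniteMeasure ν] {g : ℝ × E d → F} (hg : Continuous g) (hc : HasCompactSupport g)
    {G : ℝ → Lp F 2 ν} (hG : ∀ t, G t =ᵐ[ν] fun x => g (t, x)) : Continuous G := by
  have hu := hc.uniformContinuous_of_continuous hg
  set A : ℝ := (measureUnivNNReal ν : ℝ) ^ ((2 : ℝ≥0∞).toReal⁻¹) with hA
  have hA0 : 0 ≤ A := by positivity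
  refine Metric.continuous_iff.2 fun s ε hε => ?_
  obtain ⟨δ, hδ, h⟩ := Metric.uniformContinuous_iff.1 hu (ε / (A + 1)) (by positivity)
  refine ⟨δ, hδ, fun t ht => ?_⟩
  have h1 : ‖G t - G s‖ ≤ A * (ε / (A + 1)) := by
    refine Lp.norm_le_of_ae_bound (by positivity) ?_
    filter_upwards [Lp.coeFn_sub (G t) (G s), hG t, hG s] with x h1 h2 h3
    rw [h1, Pi.sub_apply, h2, h3, ← dist_eq_norm]
    exact (h (by rwa [Prod.dist_eq, dist_self, max_eq_left dist_nonneg])).le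
  rw [dist_eq_norm]
  refine h1.trans_lt ?_
  rw [mul_div_assoc', div_lt_iff₀ (by positivity)]
  nlinarith

/-- A curve in `H¹(Ω)` is continuous if its values and its gradients are. -/
lemma continuous_H1 {ρ : ℝ → H1 Ω} (h1 : Continuous fun t => val (ρ t))
    (h2 : Continuous fun t => grad (ρ t)) : Continuous ρ := by
  refine continuous_iff_continuousAt.2 fun a => tendsto_iff_norm_sub_tendsto_zero.2 ?_
  have h3 : ∀ t, ‖ρ t - ρ a‖ =
      √(‖val (ρ t) - val (ρ a)‖ ^ 2 + ‖grad (ρ t) - grad (ρ a)‖ ^ 2) := fun t => by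
    rw [← Real.sqrt_sq (norm_nonneg (ρ t - ρ a)), norm_sq_H1]
    rfl
  simp only [h3]
  have h4 : Continuous fun t =>
      √(‖val (ρ t) - val (ρ a)‖ ^ 2 + ‖grad (ρ t) - grad (ρ a)‖ ^ 2) := by fun_prop
  simpa using h4.tendsto a

section Test

variable {φ : ℝ × E d → ℝ}

lemma isTest_section (hφ : ContDiff ℝ ∞ φ) (hc : HasCompactSupport φ)
    (hs : tsupport φ ⊆ univ ×ˢ Ω) (t : ℝ) : IsTest Ω fun x => φ (t, x) := by
  have hcomp : IsCompact (Prod.snd '' tsupport φ) := hc.isCompact.image continuous_snd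
  have hsub : tsupport (fun x => φ (t, x)) ⊆ Prod.snd '' tsupport φ :=
    closure_minimal (fun x hx => ⟨(t, x), subset_tsupport _ hx, rfl⟩) hcomp.isClosed
  refine ⟨hφ.comp (contDiff_const.prodMk contDiff_id), hcomp.of_isClosed_subset
    (isClosed_tsupport _) hsub, hsub.trans ?_⟩
  rintro _ ⟨p, hp, rfl⟩
  exact (hs hp).2

lemma fderiv_section (hφ : ContDiff ℝ ∞ φ) (t : ℝ) (x : E d) :
    fderiv ℝ (fun x => φ (t, x)) x = (fderiv ℝ φ (t, x)).comp (ContinuousLinearMap.inr ℝ ℝ (E d)) :=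
  ((hφ.differentiable (by simp) (t, x)).hasFDerivAt.comp x (hasFDerivAt_prodMk_right t x)).fderiv

/-- A space-time test function as a curve in `H¹(Ω)` with time derivative in `L²(Ω)`. -/
lemma exists_section_curve (hΩ : IsBoundedLipschitzDomain Ω) (hφ : ContDiff ℝ ∞ φ)
    (hc : HasCompactSupport φ) (hs : tsupport φ ⊆ univ ×ˢ Ω) :
    ∃ (ρ : ℝ → H1 Ω) (f : ℝ → L2 Ω), Continuous ρ ∧ Continuous f ∧
      (∀ t, val (ρ t) =ᵐ[volume.restrict Ω] fun x => φ (t, x)) ∧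
      (∀ t, grad (ρ t) =ᵐ[volume.restrict Ω] gradient fun x => φ (t, x)) ∧
      (∀ t, f t =ᵐ[volume.restrict Ω] fun x => fderiv ℝ φ (t, x) (1, 0)) ∧
      ∀ (h : L2 Ω) (s t : ℝ), inner ℝ (val (ρ t) - val (ρ s)) h = ∫ r in s..t, inner ℝ (f r) h := by
  have hfin : IsFiniteMeasure (volume.restrict Ω) :=
    ⟨by simpa using hΩ.isBounded.measure_lt_top⟩
  have hdφ : Continuous (fderiv ℝ φ) := hφ.continuous_fderiv (by simp)
  have hd1 : Continuous fun p => fderiv ℝ φ p (1, 0) := hdφ.clm_apply continuous_const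
  have hc1 : HasCompactSupport fun p => fderiv ℝ φ p (1, 0) := hc.fderiv_apply (𝕜 := ℝ) _
  obtain ⟨A, hA⟩ := hc1.exists_bound_of_continuous hd1
  choose ρ _ hρ1 hρ2 using fun t =>
    (isTest_section hφ hc hs t).exists_mem_testSet hΩ.isOpen hΩ.isBounded
  have hsec : ∀ t : ℝ, Continuous fun x : E d => (t, x) := fun t => by fun_prop
  have hfL : ∀ t, MemLp (fun x => fderiv ℝ φ (t, x) (1, 0)) 2 (volume.restrict Ω) := fun t =>
    MemLp.of_bound (hd1.comp (hsec t)).aestronglyMeasurable A (Eventually.of_forall fun x => hA _)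
  have hf : ∀ t, (hfL t).toLp _ =ᵐ[volume.restrict Ω] fun x => fderiv ℝ φ (t, x) (1, 0) :=
    fun t => (hfL t).coeFn_toLp
  have hfc : Continuous fun t => (hfL t).toLp _ := continuous_Lp_of_sections hd1 hc1 hf
  have hgrad : ∀ t x, gradient (fun x => φ (t, x)) x = (InnerProductSpace.toDual ℝ (E d)).symm
      ((fderiv ℝ φ (t, x)).comp (ContinuousLinearMap.inr ℝ ℝ (E d))) := fun t x => by
    rw [gradient, fderiv_section hφ]
  have hval : Continuous fun t => val (ρ t) := continuous_Lp_of_sections hφ.continuous hc hρ1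
  refine ⟨ρ, fun t => (hfL t).toLp _, continuous_H1 hval ?_, hfc, hρ1, hρ2, hf, fun h s t => ?_⟩
  · refine continuous_Lp_of_sections (g := fun p => (InnerProductSpace.toDual ℝ (E d)).symm
      ((fderiv ℝ φ p).comp (ContinuousLinearMap.inr ℝ ℝ (E d)))) ?_ ?_ fun t => ?_
    · exact (InnerProductSpace.toDual ℝ (E d)).symm.continuous.comp
        (hdφ.clm_comp continuous_const)
    · exact (hc.fderiv (𝕜 := ℝ)).comp_left (g := fun L : ℝ × E d →L[ℝ] ℝ =>
        (InnerProductSpace.toDual ℝ (E d)).symm (L.comp (ContinuousLinearMap.inr ℝ ℝ (E d))))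
        (by simp)
    · filter_upwards [hρ2 t] with x hx
      rw [hx, hgrad]
  · have hh : Integrable h (volume.restrict Ω) := (Lp.memLp h).integrable (by norm_num)
    obtain ⟨A', hA'⟩ := hc.exists_bound_of_continuous hφ.continuous
    have hv : ∀ t, inner ℝ (val (ρ t)) h = ∫ x in Ω, h x * φ (t, x) := fun t => by
      rw [inner_L2_eq]
      refine integral_congr_ae ?_
      filter_upwards [hρ1 t] with x hx
      rw [hx, mul_comm]
    have hv' : ∀ t, inner ℝ ((hfL t).toLp _) h = ∫ x in Ω, h x * fderiv ℝ φ (t, x) (1, 0) :=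
      fun t => by
        rw [inner_L2_eq]
        refine integral_congr_ae ?_
        filter_upwards [hf t] with x hx
        rw [hx, mul_comm]
    have hder : ∀ r, HasDerivAt (fun r => inner ℝ (val (ρ r)) h)
        (inner ℝ ((hfL r).toLp _) h) r := by
      intro r
      simp only [hv, hv']
      refine (hasDerivAt_integral_of_dominated_loc_of_deriv_le (μ := volume.restrict Ω)
        (F := fun r x => h x * φ (r, x)) (s := univ)
        (F' := fun r x => h x * fderiv ℝ φ (r, x) (1, 0)) (bound := fun x => |h x| * A) univ_mem
        (Eventually.of_forall fun r =>
          hh.1.mul (hφ.continuous.comp (hsec r)).aestronglyMeasurable) ?_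
        (hh.1.mul (hd1.comp (hsec r)).aestronglyMeasurable) ?_ (hh.abs.mul_const _) ?_).2
      · exact hh.mul_of_top_left (memLp_top_of_bound
          (hφ.continuous.comp (hsec r)).aestronglyMeasurable A'
          (Eventually.of_forall fun x => hA' _))
      · refine Eventually.of_forall fun x r _ => ?_
        rw [norm_mul, Real.norm_eq_abs]
        gcongr
        exact hA _
      · refine Eventually.of_forall fun x r _ => ?_
        have h1 : HasDerivAt (fun r : ℝ => (r, x)) ((1 : ℝ), (0 : E d)) r :=
          (hasDerivAt_id r).prodMk (hasDerivAt_const r x)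
        exact ((hφ.differentiable (by simp) (r, x)).hasFDerivAt.comp_hasDerivAt r h1).const_mul _
    rw [intervalIntegral.integral_eq_sub_of_hasDerivAt (fun r _ => hder r)
      ((hfc.inner continuous_const).intervalIntegrable _ _), inner_sub_left]

variable {v : ℝ → L2Vec Ω}

lemma intervalIntegral_eq_Ioo (hT : 0 ≤ T) (f : ℝ → ℝ) :
    ∫ t in Ioo (0 : ℝ) T, f t = ∫ t in (0 : ℝ)..T, f t := by
  rw [intervalIntegral.integral_of_le hT, integral_Ioc_eq_integral_Ioo]

/-- The space integral in the transport form. -/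
lemma integral_transport_eq (hB : IsStirringFamily Ω B K S)
    {v : L2Vec Ω} {c : E m} (hv : v =ᵐ[volume.restrict Ω] stirVelocity B c) (θ : L2 Ω)
    {φ : ℝ × E d → ℝ} (hφ : ContDiff ℝ ∞ φ) {t : ℝ} {w : H1 Ω} {f : L2 Ω}
    (hw : grad w =ᵐ[volume.restrict Ω] gradient fun x => φ (t, x))
    (hf : f =ᵐ[volume.restrict Ω] fun x => fderiv ℝ φ (t, x) (1, 0)) :
    ∫ x in Ω, θ x * (- fderiv ℝ φ (t, x) (1, 0) - fderiv ℝ φ (t, x) (0, v x)) =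
      - (inner ℝ θ (transportOp hB c w) + inner ℝ θ f) := by
  rw [← inner_add_right, ← inner_neg_right, inner_L2_eq]
  refine integral_congr_ae ?_
  filter_upwards [Lp.coeFn_neg (transportOp hB c w + f), Lp.coeFn_add (transportOp hB c w) f, hf, hw,
    coeFn_transportOp hB c w, hv] with x h1 h2 h3 h4 h5 h6
  rw [h1, Pi.neg_apply, h2, Pi.add_apply, h3, h5, h4, h6, real_inner_comm, inner_gradient,
    fderiv_section hφ]
  simp only [stirVelocity, ContinuousLinearMap.comp_apply, ContinuousLinearMap.inr_apply]
  ring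

/-- The transport form of a weak evolution is a boundary term. -/
lemma transportForm_eq (hΩ : IsBoundedLipschitzDomain Ω) (hB : IsStirringFamily Ω B K S)
    (hT : 0 ≤ T) (hc : IntegrableOn c (Icc 0 T))
    (hv : ∀ t, v t =ᵐ[volume.restrict Ω] stirVelocity B (c t)) {θ : ℝ → L2 Ω}
    (hθ : IsWeakEvolution (valL Ω) (transportOp hB) T c θ) (hφ : ContDiff ℝ ∞ φ)
    (hcs : HasCompactSupport φ) (hs : tsupport φ ⊆ univ ×ˢ Ω) :
    transportForm Ω T v θ φ = (∫ x in Ω, θ 0 x * φ (0, x)) - ∫ x in Ω, θ T x * φ (T, x) := by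
  obtain ⟨ρ, f, hρ, hf, h1, h2, h3, h4⟩ := exists_section_curve hΩ hφ hcs hs
  have h := hθ.pairing hc hρ.continuousOn hf.continuousOn.integrableOn_Icc
    (fun h s _ t _ => h4 h s t) (left_mem_Icc.2 hT) (right_mem_Icc.2 hT)
  rw [transportForm]
  simp only [integral_transport_eq hB (hv _) _ hφ (h2 _) (h3 _)]
  rw [integral_neg, intervalIntegral_eq_Ioo hT, ← h, neg_sub, valL_apply, valL_apply, inner_L2_eq,
    inner_L2_eq]
  congr 1
  · refine integral_congr_ae ?_
    filter_upwards [h1 0] with x hx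
    rw [hx]
  · refine integral_congr_ae ?_
    filter_upwards [h1 T] with x hx
    rw [hx]

/-- A product test function. -/
lemma isTest_prod {α : ℝ → ℝ} {ψ : E d → ℝ} {J : Set ℝ} (hα : ContDiff ℝ ∞ α)
    (hαc : HasCompactSupport α) (hαJ : tsupport α ⊆ J) (hψ : IsTest Ω ψ) :
    ContDiff ℝ ∞ (fun p : ℝ × E d => α p.1 * ψ p.2) ∧
      HasCompactSupport (fun p : ℝ × E d => α p.1 * ψ p.2) ∧
      tsupport (fun p : ℝ × E d => α p.1 * ψ p.2) ⊆ J ×ˢ Ω := by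
  have hsub : tsupport (fun p : ℝ × E d => α p.1 * ψ p.2) ⊆ tsupport α ×ˢ tsupport ψ := by
    refine closure_minimal (fun p hp => ?_) ((isClosed_tsupport _).prod (isClosed_tsupport _))
    exact ⟨subset_tsupport _ (left_ne_zero_of_mul hp), subset_tsupport _ (right_ne_zero_of_mul hp)⟩
  exact ⟨(hα.comp contDiff_fst).mul (hψ.contDiff.comp contDiff_snd),
    (hαc.isCompact.prod hψ.compact.isCompact).of_isClosed_subset (isClosed_tsupport _) hsub,
    hsub.trans (prod_mono hαJ hψ.subset)⟩

/-- Solutions of the transport equation in the sense of distributions are weak evolutions. -/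
lemma isWeakEvolution_of_transportForm (hΩ : IsBoundedLipschitzDomain Ω)
    (hB : IsStirringFamily Ω B K S) (hT : 0 < T) (hc : IntegrableOn c (Icc 0 T))
    (hv : ∀ t, v t =ᵐ[volume.restrict Ω] stirVelocity B (c t)) {θ : ℝ → L2 Ω}
    (hθ : ContinuousOn θ (Icc 0 T))
    (h : ∀ φ : ℝ × E d → ℝ, ContDiff ℝ ∞ φ → HasCompactSupport φ → tsupport φ ⊆ Ioo 0 T ×ˢ Ω →
      transportForm Ω T v θ φ = 0) : IsWeakEvolution (valL Ω) (transportOp hB) T c θ := by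
  refine isWeakEvolution_of_testSet hΩ hB hc hθ fun w hw a ha b hb => ?_
  obtain ⟨ψ, hψ, hw1, hw2⟩ := hw
  rw [inner_sub_left]
  refine sub_eq_integral_of_forall_test hT (hθ.inner continuousOn_const)
    (intervalIntegrable_inner_apply hθ continuousOn_const hc (left_mem_Icc.2 hT.le)
      (right_mem_Icc.2 hT.le)) (fun α hα hαc hαT => ?_) ha hb
  obtain ⟨hφ, hφc, hφs⟩ := isTest_prod hα hαc hαT hψ
  -- tensor products `α(t) ψ(x)` suffice as test functions
  have h0 := h _ hφ hφc hφs
  have hd1 : ∀ t x, fderiv ℝ (fun p : ℝ × E d => α p.1 * ψ p.2) (t, x) (1, 0) =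
      deriv α t * ψ x := fun t x => by
    have h1 : HasDerivAt (fun r : ℝ => (r, x)) ((1 : ℝ), (0 : E d)) t :=
      (hasDerivAt_id t).prodMk (hasDerivAt_const t x)
    have h2 := (hφ.differentiable (by simp) (t, x)).hasFDerivAt.comp_hasDerivAt t h1
    exact h2.unique ((hα.differentiable (by simp) t).hasDerivAt.mul_const (ψ x))
  have hgrad : ∀ t, grad (α t • w) =ᵐ[volume.restrict Ω]
      gradient fun x => (fun p : ℝ × E d => α p.1 * ψ p.2) (t, x) := fun t => by
    have e1 : grad (α t • w) = α t • grad w := map_smul (gradL Ω) _ _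
    rw [e1]
    filter_upwards [Lp.coeFn_smul (α t) (grad w), hw2] with x hx1 hx2
    rw [hx1, Pi.smul_apply, hx2]
    refine ext_inner_right ℝ fun e => ?_
    rw [real_inner_smul_left, inner_gradient, inner_gradient]
    exact (congrArg (fun L : E d →L[ℝ] ℝ => L e)
      (fderiv_const_mul (hψ.contDiff.differentiable (by simp) x) (α t))).symm
  have hdt : ∀ t, (deriv α t • val w : L2 Ω) =ᵐ[volume.restrict Ω]
      fun x => fderiv ℝ (fun p : ℝ × E d => α p.1 * ψ p.2) (t, x) (1, 0) := fun t => by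
    filter_upwards [Lp.coeFn_smul (deriv α t) (val w), hw1] with x hx1 hx2
    rw [hx1, Pi.smul_apply, hx2, hd1, smul_eq_mul]
  rw [transportForm] at h0
  simp only [integral_transport_eq hB (hv _) _ hφ (hgrad _) (hdt _)] at h0
  rw [integral_neg, neg_eq_zero, intervalIntegral_eq_Ioo hT.le] at h0
  refine Eq.trans ?_ h0
  refine intervalIntegral.integral_congr fun t _ => ?_
  simp only [map_smul, real_inner_smul_right]
  ring

lemma exists_time_cutoff (hT : 0 < T) (a : ℝ) : ∃ α : ℝ → ℝ, ContDiff ℝ ∞ α ∧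
    HasCompactSupport α ∧ α a = 1 ∧ tsupport α ⊆ Ioo (a - T) (a + T) := by
  let β : ContDiffBump a := ⟨T / 4, T / 2, by positivity, by linarith⟩
  refine ⟨β, β.contDiff, β.hasCompactSupport, β.one_of_mem_closedBall
    (Metric.mem_closedBall_self β.rIn_pos.le), ?_⟩
  rw [β.tsupport_eq, Real.closedBall_eq_Icc]
  intro x hx
  have hx1 : a - T / 2 ≤ x := hx.1
  have hx2 : x ≤ a + T / 2 := hx.2
  constructor <;> linarith

/-- Distributional solutions of the state equation are weak evolutions with the prescribed initial
value: the test functions may be freed from the condition to vanish on the boundary. -/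
theorem isStateSolution_iff (hΩ : IsBoundedLipschitzDomain Ω)
    (hB : IsStirringFamily Ω B K S) (hT : 0 < T) (hc : IntegrableOn c (Icc 0 T))
    (hv : ∀ t, v t =ᵐ[volume.restrict Ω] stirVelocity B (c t)) {θ₀ : E d → ℝ}
    (hθ₀ : MemLp θ₀ 2 (volume.restrict Ω)) {θ : ℝ → L2 Ω} :
    IsStateSolution Ω T v θ₀ θ ↔
      IsWeakEvolution (valL Ω) (transportOp hB) T c θ ∧ θ 0 = hθ₀.toLp θ₀ := by
  constructor
  · intro h
    have hW := isWeakEvolution_of_transportForm hΩ hB hT hc hv h.continuousOn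
      fun φ hφ hφc hφs => by
        rw [h.weak φ hφ hφc (hφs.trans (prod_mono Ioo_subset_Iio_self le_rfl))]
        have : ∀ x, φ (0, x) = 0 := fun x => image_eq_zero_of_notMem_tsupport
          fun hx => lt_irrefl _ (hφs hx).1.1
        simp [this]
    refine ⟨hW, Lp.ext ?_⟩
    have h0 : (fun x => θ 0 x - θ₀ x) =ᵐ[volume.restrict Ω] 0 := by
      refine ae_zero_of_forall_test hΩ.isOpen ((Lp.memLp (θ 0)).sub hθ₀) fun ψ hψ => ?_
      -- a cutoff in time that is `1` at `0` and vanishes at `T` isolates the initial datum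
      obtain ⟨α, hα, hαc, hα1, hαs⟩ := exists_time_cutoff hT 0
      rw [zero_sub, zero_add] at hαs
      obtain ⟨hφ, hφc, hφs⟩ := isTest_prod hα hαc hαs hψ
      have h1 := h.weak _ hφ hφc (hφs.trans (prod_mono Ioo_subset_Iio_self le_rfl))
      have hαT : α T = 0 := image_eq_zero_of_notMem_tsupport fun hx => lt_irrefl _ (hαs hx).2
      rw [transportForm_eq hΩ hB hT.le hc hv hW hφ hφc
        (hφs.trans (prod_mono (subset_univ _) le_rfl))] at h1
      simp only [hα1, hαT, one_mul, zero_mul, mul_zero, integral_zero, sub_zero] at h1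
      have i1 := integrable_mul_test (Lp.memLp (θ 0)) hψ.contDiff.continuous hψ.compact
      have i2 := integrable_mul_test hθ₀ hψ.contDiff.continuous hψ.compact
      simp only [smul_eq_mul, mul_comm (ψ _), sub_mul]
      rw [integral_sub i1 i2, h1, sub_self]
    filter_upwards [h0, hθ₀.coeFn_toLp] with x hx1 hx2
    rw [hx2]
    exact sub_eq_zero.1 hx1
  · rintro ⟨hW, h0⟩
    refine ⟨hW.continuousOn, fun φ hφ hφc hφs => ?_⟩
    have hT0 : ∀ x, φ (T, x) = 0 := fun x => image_eq_zero_of_notMem_tsupport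
      fun hx => lt_irrefl T (hφs hx).1
    rw [transportForm_eq hΩ hB hT.le hc hv hW hφ hφc
      (hφs.trans (prod_mono (subset_univ _) le_rfl)), h0]
    simp only [hT0, mul_zero, integral_zero, sub_zero]
    refine integral_congr_ae ?_
    filter_upwards [hθ₀.coeFn_toLp] with x hx
    rw [hx]

/-- Distributional solutions of the adjoint equation are weak evolutions with the prescribed terminal
value. By skew-symmetry of the transport operator, the state and the adjoint equation have the same
form. -/
theorem isAdjointSolution_iff (hΩ : IsBoundedLipschitzDomain Ω)
    (hB : IsStirringFamily Ω B K S) (hT : 0 < T) (hc : IntegrableOn c (Icc 0 T))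
    (hv : ∀ t, v t =ᵐ[volume.restrict Ω] stirVelocity B (c t)) {η : H1 Ω} {ρ : ℝ → H1 Ω} :
    IsAdjointSolution Ω T v η ρ ↔ ContinuousOn ρ (Icc 0 T) ∧
      IsWeakEvolution (valL Ω) (transportOp hB) T c (fun t => valL Ω (ρ t)) ∧ ρ T = η := by
  constructor
  · intro h
    have hW := isWeakEvolution_of_transportForm hΩ hB hT hc hv (θ := fun t => valL Ω (ρ t))
      ((valL Ω).continuous.comp_continuousOn h.continuousOn) fun φ hφ hφc hφs => by
        refine (h.weak φ hφ hφc (hφs.trans (prod_mono Ioo_subset_Ioi_self le_rfl))).trans ?_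
        have : ∀ x, φ (T, x) = 0 := fun x => image_eq_zero_of_notMem_tsupport
          fun hx => lt_irrefl _ (hφs hx).1.2
        simp [this]
    refine ⟨h.continuousOn, hW, val_injective hΩ.isOpen (Lp.ext ?_)⟩
    have h0 : (fun x => val (ρ T) x - val η x) =ᵐ[volume.restrict Ω] 0 := by
      refine ae_zero_of_forall_test hΩ.isOpen ((Lp.memLp _).sub (Lp.memLp _)) fun ψ hψ => ?_
      -- a cutoff in time that is `1` at `T` and vanishes at `0` isolates the terminal datum
      obtain ⟨α, hα, hαc, hα1, hαs⟩ := exists_time_cutoff hT T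
      rw [sub_self] at hαs
      obtain ⟨hφ, hφc, hφs⟩ := isTest_prod hα hαc hαs hψ
      have h1 := h.weak _ hφ hφc (hφs.trans (prod_mono Ioo_subset_Ioi_self le_rfl))
      have hα0 : α 0 = 0 := image_eq_zero_of_notMem_tsupport fun hx => lt_irrefl _ (hαs hx).1
      have h2 := transportForm_eq hΩ hB hT.le hc hv hW hφ hφc
        (hφs.trans (prod_mono (subset_univ _) le_rfl))
      simp only [valL_apply] at h2
      rw [h2] at h1
      simp only [hα1, hα0, one_mul, zero_mul, mul_zero, integral_zero, zero_sub, neg_inj] at h1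
      have i1 := integrable_mul_test (Lp.memLp (val (ρ T))) hψ.contDiff.continuous hψ.compact
      have i2 := integrable_mul_test (Lp.memLp (val η)) hψ.contDiff.continuous hψ.compact
      simp only [smul_eq_mul, mul_comm (ψ _), sub_mul]
      rw [integral_sub i1 i2, h1, sub_self]
    filter_upwards [h0] with x hx
    exact sub_eq_zero.1 hx
  · rintro ⟨hρ, hW, h0⟩
    refine ⟨hρ, fun φ hφ hφc hφs => ?_⟩
    have hT0 : ∀ x, φ (0, x) = 0 := fun x => image_eq_zero_of_notMem_tsupport
      fun hx => lt_irrefl (0 : ℝ) (hφs hx).1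
    refine (transportForm_eq hΩ hB hT.le hc hv hW hφ hφc
      (hφs.trans (prod_mono (subset_univ _) le_rfl))).trans ?_
    simp only [hT0, mul_zero, integral_zero, zero_sub, valL_apply, h0]

end Test

end SpaceTime


/-! ### The Poincaré inequality -/

section Poincare

variable {d : ℕ} {Ω A : Set (E d)}

/-- The square of the `L²` seminorm as a lower integral. -/
lemma lintegral_enorm_sq {α F : Type*} [MeasurableSpace α] {ν : Measure α} [NormedAddCommGroup F]
    (f : α → F) : ∫⁻ x, ‖f x‖ₑ ^ 2 ∂ν = eLpNorm f 2 ν ^ 2 := by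
  have := eLpNorm_nnreal_pow_eq_lintegral (f := f) (μ := ν) (p := 2) two_ne_zero
  simpa using this.symm

/-- The `L²` norm of a function is controlled by its pairings with test functions. -/
lemma norm_le_of_forall_test (hA : IsOpen A) {f : L2 A} {C : ℝ} (hC : 0 ≤ C)
    (h : ∀ ψ, IsTest A ψ → ∫ x in A, f x * ψ x ≤ C * (eLpNorm ψ 2 volume).toReal) : ‖f‖ ≤ C := by
  let V : Submodule ℝ (L2 A) :=
    { carrier := {g | ∃ ψ, IsTest A ψ ∧ g =ᵐ[volume.restrict A] ψ}
      zero_mem' := ⟨0, ⟨contDiff_const, HasCompactSupport.zero, by simp [tsupport]⟩,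
        Lp.coeFn_zero ℝ 2 _⟩
      add_mem' := by
        rintro g g' ⟨ψ, hψ, hg⟩ ⟨ψ', hψ', hg'⟩
        refine ⟨ψ + ψ', ⟨hψ.contDiff.add hψ'.contDiff, hψ.compact.add hψ'.compact,
          (tsupport_add ψ ψ').trans (union_subset hψ.subset hψ'.subset)⟩, ?_⟩
        filter_upwards [hg, hg', Lp.coeFn_add g g'] with x h1 h2 h3
        rw [h3, Pi.add_apply, h1, h2, Pi.add_apply]
      smul_mem' := by
        rintro a g ⟨ψ, hψ, hg⟩
        refine ⟨fun x => a * ψ x, ⟨contDiff_const.mul hψ.contDiff, hψ.compact.mul_left,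
          tsupport_mul_subset_right.trans hψ.subset⟩, ?_⟩
        filter_upwards [hg, Lp.coeFn_smul a g] with x h1 h2
        rw [h2, Pi.smul_apply, h1, smul_eq_mul] }
  have hV : Dense (V : Set (L2 A)) := by
    rw [Submodule.dense_iff_topologicalClosure_eq_top, Submodule.topologicalClosure_eq_top_iff,
      Submodule.eq_bot_iff]
    intro g hg
    refine (Lp.eq_zero_iff_ae_eq_zero).2 (ae_zero_of_forall_test hA (Lp.memLp g) fun ψ hψ => ?_)
    have hψL := hψ.memLp.restrict A
    have h0 := (Submodule.mem_orthogonal _ g).1 hg (hψL.toLp ψ) ⟨ψ, hψ, hψL.coeFn_toLp⟩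
    rw [inner_L2_eq] at h0
    rw [← h0]
    refine integral_congr_ae ?_
    filter_upwards [hψL.coeFn_toLp] with x hx
    rw [hx, smul_eq_mul]
  have hle : ∀ g ∈ (V : Set (L2 A)), inner ℝ f g ≤ C * ‖g‖ := by
    rintro g ⟨ψ, hψ, hg⟩
    have h1 : inner ℝ f g = ∫ x in A, f x * ψ x := by
      rw [inner_L2_eq]
      refine integral_congr_ae ?_
      filter_upwards [hg] with x hx
      rw [hx]
    rw [h1]
    refine (h ψ hψ).trans (le_of_eq ?_)
    rw [Lp.norm_def, eLpNorm_congr_ae hg,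
      eLpNorm_restrict_eq_of_support_subset ((subset_tsupport ψ).trans hψ.subset)]
  have hall : ∀ g : L2 A, inner ℝ f g ≤ C * ‖g‖ := by
    have hcl : IsClosed {g : L2 A | inner ℝ f g ≤ C * ‖g‖} :=
      isClosed_le (by fun_prop) (by fun_prop)
    intro g
    exact closure_minimal hle hcl (hV g)
  have hf := hall f
  rw [real_inner_self_eq_norm_sq, sq] at hf
  by_contra! hlt
  nlinarith [hC.trans_lt hlt]

/-- `L²` control of a difference `u(· + h) - u` by the gradient, on an open set whose translates by
`t h`, `t ∈ [0, 1]`, stay in `Ω`. -/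
lemma lintegral_sq_translate_sub_le (hΩ : Bornology.IsBounded Ω) (hA : IsOpen A) {h : E d}
    (hAh : ∀ x ∈ A, ∀ t ∈ Icc (0 : ℝ) 1, x + t • h ∈ Ω) (u : H1 Ω) :
    ∫⁻ x in A, ‖val u (x + h) - val u x‖ₑ ^ 2 ≤ ‖h‖ₑ ^ 2 * ‖grad u‖ₑ ^ 2 := by
  have hfin : IsFiniteMeasure (volume.restrict Ω) :=
    ⟨by rw [Measure.restrict_apply_univ]; exact hΩ.measure_lt_top⟩
  have hAΩ : A ⊆ Ω := fun x hx => by simpa using hAh x hx 0 (by simp)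
  have hAΩ' : A ⊆ (fun x => x + h) ⁻¹' Ω := fun x hx => by simpa using hAh x hx 1 (by simp)
  have hmp : MeasurePreserving (fun x : E d => x + h) volume volume :=
    measurePreserving_add_right volume h
  have hu1 : MemLp (fun x => val u (x + h)) 2 (volume.restrict A) := by
    have := (Lp.memLp (val u)).comp_measurePreserving
      (hmp.restrict_preimage_emb (MeasurableEquiv.addRight h).measurableEmbedding Ω)
    exact this.mono_measure (Measure.restrict_mono hAΩ' le_rfl)
  have hu0 : MemLp (val u) 2 (volume.restrict A) :=
    (Lp.memLp (val u)).mono_measure (Measure.restrict_mono hAΩ le_rfl)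
  have hf := hu1.sub hu0
  have hint : Integrable (val u) (volume.restrict Ω) := (Lp.memLp (val u)).integrable (by norm_num)
  have key : ‖hf.toLp _‖ ≤ ‖h‖ * ‖grad u‖ := by
    refine norm_le_of_forall_test hA (by positivity) fun ψ hψ => ?_
    -- `ψt t` is the test function `ψ` carried along by the translations
    set ψt : ℝ → E d → ℝ := fun t x => ψ (x - t • h) with hψt
    have htest : ∀ t ∈ Icc (0 : ℝ) 1, IsTest Ω (ψt t) := by
      intro t ht
      refine ⟨hψ.contDiff.comp (contDiff_id.sub contDiff_const),
        hψ.compact.comp_homeomorph (Homeomorph.subRight (t • h)), ?_⟩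
      intro x hx
      have hx' : x - t • h ∈ tsupport ψ :=
        tsupport_comp_subset_preimage ψ (f := fun x => x - t • h) (by fun_prop) hx
      simpa using hAh _ (hψ.subset hx') t ht
    obtain ⟨K, hK⟩ := hψ.lipschitz
    obtain ⟨S, hS⟩ := bounded_of_continuous_hasCompactSupport hψ.contDiff.continuous hψ.compact
    -- `F` interpolates between the pairings of `u` and of its translate with `ψ`; its derivative is
    -- a weak gradient pairing
    set F : ℝ → ℝ := fun t => ∫ x in Ω, val u x * ψt t x with hF
    have hderivψ : ∀ t x, HasDerivAt (fun t => ψt t x) (fderiv ℝ ψ (x - t • h) (-h)) t := by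
      intro t x
      have h1 : HasFDerivAt ψ (fderiv ℝ ψ (x - t • h)) (x - t • h) :=
        ((hψ.contDiff.differentiable (by simp)) _).hasFDerivAt
      refine h1.comp_hasDerivAt t ?_
      simpa using ((hasDerivAt_id t).smul_const h).const_sub x
    have hderiv : ∀ t, HasDerivAt F (∫ x in Ω, val u x * fderiv ℝ ψ (x - t • h) (-h)) t := by
      intro t
      refine (hasDerivAt_integral_of_dominated_loc_of_deriv_le
        (F := fun t x => val u x * ψt t x) (bound := fun x => ‖val u x‖ * (K * ‖h‖))
        (F' := fun t x => val u x * fderiv ℝ ψ (x - t • h) (-h)) (Metric.ball_mem_nhds t one_pos)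
        (Eventually.of_forall fun s => ?_) ?_ ?_ ?_ (hint.norm.mul_const _) ?_).2
      · exact hint.1.mul (hψ.contDiff.continuous.comp (by fun_prop)).aestronglyMeasurable
      · exact hint.mul_bdd (c := S)
          (hψ.contDiff.continuous.comp (by fun_prop)).aestronglyMeasurable
          (Eventually.of_forall fun x => hS _)
      · refine hint.1.mul (Continuous.aestronglyMeasurable ?_)
        exact ((hψ.contDiff.continuous_fderiv (by simp)).comp (by fun_prop)).clm_apply
          continuous_const
      · refine Eventually.of_forall fun x s _ => ?_
        rw [norm_mul]
        gcongr
        refine (ContinuousLinearMap.le_opNorm _ _).trans ?_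
        rw [norm_neg]
        gcongr
        exact norm_fderiv_le_of_lipschitz ℝ hK
      · exact Eventually.of_forall fun x s _ => (hderivψ s x).const_mul _
    have hbound : ∀ t ∈ Icc (0 : ℝ) 1, ‖∫ x in Ω, val u x * fderiv ℝ ψ (x - t • h) (-h)‖
        ≤ ‖h‖ * ‖grad u‖ * (eLpNorm ψ 2 volume).toReal := by
      intro t ht
      have hfd : ∀ x, fderiv ℝ ψ (x - t • h) (-h) = - fderiv ℝ (ψt t) x h := by
        intro x
        rw [map_neg, hψt]
        simp only
        rw [fderiv_comp_sub]
      have hweak := isWeakGradient_grad u (ψt t) (htest t ht).contDiff (htest t ht).compact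
        (htest t ht).subset h
      have h1 : ∫ x in Ω, val u x * fderiv ℝ ψ (x - t • h) (-h)
          = inner ℝ (grad u) ((memLp_smul_test (htest t ht).contDiff.continuous
            (htest t ht).compact h).toLp _) := by
        rw [← integral_inner_mul_toLp (grad u) (htest t ht).contDiff.continuous
          (htest t ht).compact h, ← neg_inj, ← hweak, ← integral_neg]
        refine integral_congr_ae (Eventually.of_forall fun x => ?_)
        simp only [hfd, mul_neg, neg_neg]
      rw [h1]
      refine (norm_inner_le_norm _ _).trans ?_
      rw [mul_comm ‖h‖, mul_assoc]
      gcongr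
      rw [Lp.norm_toLp]
      have h2 : eLpNorm (fun x => ψt t x • h) 2 (volume.restrict Ω) ≤ ‖h‖ₑ * eLpNorm ψ 2 volume := by
        calc eLpNorm (fun x => ψt t x • h) 2 (volume.restrict Ω)
            ≤ eLpNorm (fun x => ψt t x • h) 2 volume := eLpNorm_restrict_le _ _ _ _
          _ = eLpNorm (fun x => ‖h‖ • ψt t x) 2 volume := by
              refine eLpNorm_congr_norm_ae (Eventually.of_forall fun x => ?_)
              simp [norm_smul, mul_comm]
          _ = ‖h‖ₑ * eLpNorm (ψt t) 2 volume := by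
              have := eLpNorm_const_smul (‖h‖) (ψt t) 2 (volume : Measure (E d))
              rwa [enorm_norm] at this
          _ = ‖h‖ₑ * eLpNorm ψ 2 volume := by
              congr 1
              exact eLpNorm_comp_measurePreserving (g := ψ) (f := fun x => x - t • h)
                hψ.contDiff.continuous.aestronglyMeasurable
                (measurePreserving_sub_right volume (t • h))
      have h3 := ENNReal.toReal_mono (ENNReal.mul_ne_top (by simp) hψ.memLp.eLpNorm_ne_top) h2
      rwa [ENNReal.toReal_mul, toReal_enorm] at h3
    have hF01 : ∫ x in A, hf.toLp _ x * ψ x = F 1 - F 0 := by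
      have hψ0 : ∀ x ∉ A, ψ x = 0 := fun x hx =>
        image_eq_zero_of_notMem_tsupport fun h => hx (hψ.subset h)
      have e0 : F 0 = ∫ x in A, val u x * ψ x := by
        simp only [hF, hψt, zero_smul, sub_zero]
        rw [setIntegral_eq_integral_of_forall_compl_eq_zero,
          setIntegral_eq_integral_of_forall_compl_eq_zero]
        · exact fun x hx => by rw [hψ0 x hx, mul_zero]
        · exact fun x hx => by rw [hψ0 x fun h => hx (hAΩ h), mul_zero]
      have e1 : F 1 = ∫ x in A, val u (x + h) * ψ x := by
        simp only [hF, hψt, one_smul]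
        rw [setIntegral_eq_integral_of_forall_compl_eq_zero,
          setIntegral_eq_integral_of_forall_compl_eq_zero,
          ← integral_add_right_eq_self (fun x => val u x * ψ (x - h)) h]
        · simp only [add_sub_cancel_right]
        · exact fun x hx => by rw [hψ0 x hx, mul_zero]
        · refine fun x hx => ?_
          rw [hψ0 (x - h) fun h' => hx (by simpa using hAΩ' h'), mul_zero]
      rw [e0, e1, ← integral_sub]
      · refine integral_congr_ae ?_
        filter_upwards [hf.coeFn_toLp] with x hx
        rw [hx, Pi.sub_apply, sub_mul]
      · exact integrable_mul_test hu1 hψ.contDiff.continuous hψ.compact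
      · exact integrable_mul_test hu0 hψ.contDiff.continuous hψ.compact
    rw [hF01]
    have := norm_image_sub_le_of_norm_deriv_le_segment_01' (f := F)
      (fun t _ => (hderiv t).hasDerivWithinAt) (fun t ht => hbound t (Ico_subset_Icc_self ht))
    exact (le_abs_self _).trans this
  have h1 : ∫⁻ x in A, ‖val u (x + h) - val u x‖ₑ ^ 2 = ‖hf.toLp _‖ₑ ^ 2 := by
    rw [Lp.enorm_toLp, ← lintegral_enorm_sq]
    rfl
  rw [h1, ← mul_pow]
  gcongr
  rw [← ofReal_norm, ← ofReal_norm, ← ofReal_norm, ← ENNReal.ofReal_mul (norm_nonneg _)]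
  exact ENNReal.ofReal_le_ofReal key

end Poincare


section Oscillation

variable {d : ℕ} {Ω A B V : Set (E d)}

/-- The mean square oscillation `∫_A ∫_B |u(x) - u(y)|² dy dx` of a function between two sets. -/
noncomputable def oscillation (u : E d → ℝ) (A B : Set (E d)) : ℝ≥0∞ :=
  ∫⁻ x in A, ∫⁻ y in B, ‖u x - u y‖ₑ ^ 2

lemma oscillation_mono (u : E d → ℝ) {A' B' : Set (E d)} (hA : A ⊆ A') (hB : B ⊆ B') :
    oscillation u A B ≤ oscillation u A' B' :=
  (lintegral_mono_set hA).trans (lintegral_mono fun _ => lintegral_mono_set hB)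

lemma measurable_sq_sub {u : E d → ℝ} (hu : Measurable u) :
    Measurable fun p : E d × E d => ‖u p.1 - u p.2‖ₑ ^ 2 :=
  (((hu.comp measurable_fst).sub (hu.comp measurable_snd)).enorm).pow_const 2

lemma oscillation_comm {u : E d → ℝ} (hu : Measurable u) (A B : Set (E d)) :
    oscillation u A B = oscillation u B A := by
  unfold oscillation
  rw [lintegral_lintegral_swap (measurable_sq_sub hu).aemeasurable]
  simp only [enorm_sub_rev]

lemma oscillation_union_left (u : E d → ℝ) (A A' B : Set (E d)) :
    oscillation u (A ∪ A') B ≤ oscillation u A B + oscillation u A' B :=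
  lintegral_union_le _ _ _

/-- The oscillation between `A` and `B` is controlled through an intermediate set `V`: average the
triangle inequality `|u(x) - u(y)|² ≤ 2 |u(x) - u(z)|² + 2 |u(z) - u(y)|²` over `z` in `V`. -/
lemma oscillation_trans {u : E d → ℝ} (hu : Measurable u) (A V B : Set (E d)) :
    volume V * oscillation u A B ≤
      2 * (volume B * oscillation u A V) + 2 * (volume A * oscillation u V B) := by
  have hm : ∀ z, Measurable fun x => ‖u x - u z‖ₑ ^ 2 := fun z =>
    ((hu.sub_const _).enorm).pow_const 2
  have hm' : ∀ z, Measurable fun x => ‖u z - u x‖ₑ ^ 2 := fun z =>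
    ((hu.const_sub _).enorm).pow_const 2
  have hpt : ∀ x y z, ‖u x - u y‖ₑ ^ 2 ≤ 2 * ‖u x - u z‖ₑ ^ 2 + 2 * ‖u z - u y‖ₑ ^ 2 := by
    intro x y z
    have h1 : ‖u x - u y‖ ^ 2 ≤ 2 * ‖u x - u z‖ ^ 2 + 2 * ‖u z - u y‖ ^ 2 := by
      simp only [Real.norm_eq_abs, sq_abs]
      nlinarith [sq_nonneg (u x - u z - (u z - u y))]
    have h2 := ENNReal.ofReal_le_ofReal h1
    rw [ENNReal.ofReal_add (by positivity) (by positivity), ENNReal.ofReal_mul (by norm_num),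
      ENNReal.ofReal_mul (by norm_num)] at h2
    simp only [ENNReal.ofReal_pow (norm_nonneg _), ofReal_norm, ENNReal.ofReal_ofNat] at h2
    exact h2
  have hin : Measurable fun x => ∫⁻ y in V, ‖u x - u y‖ₑ ^ 2 :=
    (measurable_sq_sub hu).lintegral_prod_right'
  have hrow : ∀ x y, volume V * ‖u x - u y‖ₑ ^ 2 ≤
      2 * (∫⁻ z in V, ‖u x - u z‖ₑ ^ 2) + 2 * ∫⁻ z in V, ‖u z - u y‖ₑ ^ 2 := by
    intro x y
    calc volume V * ‖u x - u y‖ₑ ^ 2 = ∫⁻ z in V, ‖u x - u y‖ₑ ^ 2 := by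
          rw [setLIntegral_const, mul_comm]
      _ ≤ ∫⁻ z in V, (2 * ‖u x - u z‖ₑ ^ 2 + 2 * ‖u z - u y‖ₑ ^ 2) :=
          lintegral_mono fun z => hpt x y z
      _ = _ := by
          rw [lintegral_add_left ((hm' x).const_mul 2), lintegral_const_mul _ (hm' x),
            lintegral_const_mul _ (hm y)]
  calc volume V * oscillation u A B
      = ∫⁻ x in A, ∫⁻ y in B, volume V * ‖u x - u y‖ₑ ^ 2 := by
        unfold oscillation
        rw [← lintegral_const_mul _ (measurable_sq_sub hu).lintegral_prod_right']
        refine lintegral_congr fun x => ?_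
        rw [lintegral_const_mul _ (hm' x)]
    _ ≤ ∫⁻ x in A, ∫⁻ y in B, (2 * (∫⁻ z in V, ‖u x - u z‖ₑ ^ 2) +
          2 * ∫⁻ z in V, ‖u z - u y‖ₑ ^ 2) :=
        lintegral_mono fun x => lintegral_mono fun y => hrow x y
    _ = ∫⁻ x in A, (2 * (∫⁻ z in V, ‖u x - u z‖ₑ ^ 2) * volume B + 2 * oscillation u B V) := by
        refine lintegral_congr fun x => ?_
        rw [lintegral_add_left measurable_const, setLIntegral_const, lintegral_const_mul]
        · congr 2
          unfold oscillation
          simp only [enorm_sub_rev]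
        · exact (measurable_sq_sub hu).lintegral_prod_left'
    _ = _ := by
        rw [lintegral_add_right _ measurable_const, setLIntegral_const,
          lintegral_mul_const _ (hin.const_mul 2), lintegral_const_mul _ hin,
          oscillation_comm hu B V]
        unfold oscillation
        ring

/-- The oscillation between two bounded open sets is controlled by the gradient when all the
segments joining them lie in `Ω`. -/
lemma oscillation_le_of_segment_subset (hΩ : Bornology.IsBounded Ω) (hA : IsOpen A) (hB : IsOpen B)
    {R : ℝ} (hR : ∀ x ∈ A, ∀ y ∈ B, ‖y - x‖ ≤ R) (hseg : ∀ x ∈ A, ∀ y ∈ B, segment ℝ x y ⊆ Ω)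
    (u : H1 Ω) : oscillation (val u) A B ≤
      volume (Metric.closedBall (0 : E d) R) * ENNReal.ofReal R ^ 2 * ‖grad u‖ₑ ^ 2 := by
  have hu : Measurable (val u) := (Lp.stronglyMeasurable (val u)).measurable
  set W : E d → Set (E d) := fun h => A ∩ (fun x => x + h) ⁻¹' B with hW
  have hWo : ∀ h, IsOpen (W h) := fun h => hA.inter (hB.preimage (by fun_prop))
  have hle : ∀ h, ∫⁻ x in W h, ‖val u (x + h) - val u x‖ₑ ^ 2 ≤
      (Metric.closedBall (0 : E d) R).indicator
        (fun _ => ENNReal.ofReal R ^ 2 * ‖grad u‖ₑ ^ 2) h := by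
    intro h
    by_cases hne : (W h).Nonempty
    · obtain ⟨x, hx⟩ := hne
      have hhR : ‖h‖ ≤ R := by simpa using hR x hx.1 (x + h) hx.2
      rw [indicator_of_mem (by simpa using hhR)]
      refine (lintegral_sq_translate_sub_le hΩ (hWo h) (fun x hx t ht => ?_) u).trans ?_
      · refine hseg x hx.1 (x + h) hx.2 ?_
        rw [segment_eq_image']
        exact ⟨t, ht, by simp⟩
      · gcongr
        rw [← ofReal_norm]
        exact ENNReal.ofReal_le_ofReal hhR
    · rw [not_nonempty_iff_eq_empty.1 hne]
      simp
  -- substitute `y = x + h` and exchange the integrals over `x` and `h`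
  calc oscillation (val u) A B
      = ∫⁻ x, ∫⁻ h, (W h).indicator (fun x => ‖val u (x + h) - val u x‖ₑ ^ 2) x := by
        unfold oscillation
        rw [← lintegral_indicator hA.measurableSet]
        refine lintegral_congr fun x => ?_
        by_cases hx : x ∈ A
        · rw [indicator_of_mem hx, ← lintegral_indicator hB.measurableSet,
            ← lintegral_add_left_eq_self _ x]
          refine lintegral_congr fun h => ?_
          by_cases hh : x + h ∈ B
          · rw [indicator_of_mem hh, indicator_of_mem (show x ∈ W h from ⟨hx, hh⟩), enorm_sub_rev]
          · rw [indicator_of_notMem hh, indicator_of_notMem (fun h' => hh h'.2)]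
        · rw [indicator_of_notMem hx]
          symm
          rw [← lintegral_zero (μ := (volume : Measure (E d)))]
          exact lintegral_congr fun h => indicator_of_notMem (fun h' => hx h'.1) _
    _ = ∫⁻ h, ∫⁻ x, (W h).indicator (fun x => ‖val u (x + h) - val u x‖ₑ ^ 2) x := by
        refine lintegral_lintegral_swap (Measurable.aemeasurable ?_)
        have hS : MeasurableSet {p : E d × E d | p.1 ∈ A ∧ p.1 + p.2 ∈ B} :=
          ((hA.preimage continuous_fst).inter
            (hB.preimage (continuous_fst.add continuous_snd))).measurableSet
        have hF : Measurable fun p : E d × E d => ‖val u (p.1 + p.2) - val u p.1‖ₑ ^ 2 :=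
          (((hu.comp (measurable_fst.add measurable_snd)).sub
            (hu.comp measurable_fst)).enorm).pow_const 2
        exact hF.indicator hS
    _ = ∫⁻ h, ∫⁻ x in W h, ‖val u (x + h) - val u x‖ₑ ^ 2 := by
        refine lintegral_congr fun h => ?_
        rw [lintegral_indicator (hWo h).measurableSet]
    _ ≤ ∫⁻ h, (Metric.closedBall (0 : E d) R).indicator
        (fun _ => ENNReal.ofReal R ^ 2 * ‖grad u‖ₑ ^ 2) h := lintegral_mono hle
    _ = _ := by
        rw [lintegral_indicator Metric.isClosed_closedBall.measurableSet, setLIntegral_const]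
        ring

/-- `A` and `B` are linked in `Ω` if the oscillation between their traces in `Ω` is controlled by
the gradient. -/
def IsLinked (Ω A B : Set (E d)) : Prop :=
  ∃ C : ℝ≥0∞, C ≠ ⊤ ∧ ∀ u : H1 Ω, oscillation (val u) (A ∩ Ω) (B ∩ Ω) ≤ C * ‖grad u‖ₑ ^ 2

lemma IsLinked.mono {A' B' : Set (E d)} (h : IsLinked Ω A' B') (hA : A ⊆ A') (hB : B ⊆ B') :
    IsLinked Ω A B := by
  obtain ⟨C, hC, H⟩ := h
  exact ⟨C, hC, fun u => (oscillation_mono _ (inter_subset_inter_left _ hA)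
    (inter_subset_inter_left _ hB)).trans (H u)⟩

lemma IsLinked.symm (h : IsLinked Ω A B) : IsLinked Ω B A := by
  obtain ⟨C, hC, H⟩ := h
  refine ⟨C, hC, fun u => ?_⟩
  rw [oscillation_comm (Lp.stronglyMeasurable (val u)).measurable]
  exact H u

lemma IsLinked.union_left {A' : Set (E d)} (h : IsLinked Ω A B) (h' : IsLinked Ω A' B) :
    IsLinked Ω (A ∪ A') B := by
  obtain ⟨C, hC, H⟩ := h
  obtain ⟨C', hC', H'⟩ := h'
  refine ⟨C + C', by simp [hC, hC'], fun u => ?_⟩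
  rw [union_inter_distrib_right, add_mul]
  exact (oscillation_union_left _ _ _ _).trans (add_le_add (H u) (H' u))

lemma IsLinked.union_right {B' : Set (E d)} (h : IsLinked Ω A B) (h' : IsLinked Ω A B') :
    IsLinked Ω A (B ∪ B') := (h.symm.union_left h'.symm).symm

/-- Linking is transitive through any set that meets `Ω` in positive measure. -/
lemma IsLinked.trans (hΩ : Bornology.IsBounded Ω) (hV : volume (V ∩ Ω) ≠ 0)
    (h : IsLinked Ω A V) (h' : IsLinked Ω V B) : IsLinked Ω A B := by
  obtain ⟨C, hC, H⟩ := h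
  obtain ⟨C', hC', H'⟩ := h'
  have hfin : ∀ S : Set (E d), volume (S ∩ Ω) ≠ ⊤ := fun S =>
    (hΩ.subset inter_subset_right).measure_lt_top.ne
  refine ⟨(volume (V ∩ Ω))⁻¹ * (2 * (volume (B ∩ Ω) * C) + 2 * (volume (A ∩ Ω) * C')),
    ENNReal.mul_ne_top (ENNReal.inv_ne_top.2 hV) (ENNReal.add_ne_top.2
      ⟨ENNReal.mul_ne_top (by simp) (ENNReal.mul_ne_top (hfin B) hC),
        ENNReal.mul_ne_top (by simp) (ENNReal.mul_ne_top (hfin A) hC')⟩), fun u => ?_⟩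
  rw [mul_assoc, ← ENNReal.mul_le_iff_le_inv hV (hfin V)]
  refine (oscillation_trans (Lp.stronglyMeasurable (val u)).measurable _ _ _).trans ?_
  calc _ ≤ 2 * (volume (B ∩ Ω) * (C * ‖grad u‖ₑ ^ 2)) +
        2 * (volume (A ∩ Ω) * (C' * ‖grad u‖ₑ ^ 2)) := by
        gcongr
        · exact H u
        · exact H' u
    _ = _ := by ring

/-- Sets that see each other inside `Ω` are linked. -/
lemma IsLinked.of_segment_subset (hΩ : Bornology.IsBounded Ω) (hΩo : IsOpen Ω) (hA : IsOpen A)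
    (hB : IsOpen B) (hseg : ∀ x ∈ A ∩ Ω, ∀ y ∈ B ∩ Ω, segment ℝ x y ⊆ Ω) : IsLinked Ω A B := by
  obtain ⟨R, hR⟩ := Metric.isBounded_iff.1 hΩ
  refine ⟨volume (Metric.closedBall (0 : E d) R) * ENNReal.ofReal R ^ 2,
    ENNReal.mul_ne_top Metric.isBounded_closedBall.measure_lt_top.ne (by simp), fun u => ?_⟩
  refine oscillation_le_of_segment_subset hΩ (hA.inter hΩo) (hB.inter hΩo) (fun x hx y hy => ?_)
    hseg u
  rw [← dist_eq_norm]
  exact hR hy.2 hx.2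

/-- Every point of the closure of a Lipschitz domain has a neighbourhood linked to itself. At a
boundary point this goes through a ball inside the domain, which is seen from a whole
neighbourhood of the point. -/
lemma exists_isLinked_self (hΩ : IsBoundedLipschitzDomain Ω) {x₀ : E d} (hx₀ : x₀ ∈ closure Ω) :
    ∃ U ∈ 𝓝 x₀, IsLinked Ω U U := by
  by_cases hxΩ : x₀ ∈ Ω
  · obtain ⟨r, hr, hrΩ⟩ := Metric.isOpen_iff.1 hΩ.isOpen x₀ hxΩ
    refine ⟨Metric.ball x₀ r, Metric.ball_mem_nhds _ hr, .of_segment_subset hΩ.isBounded hΩ.isOpen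
      Metric.isOpen_ball Metric.isOpen_ball fun x hx y hy => ?_⟩
    exact ((convex_ball x₀ r).segment_subset hx.1 hy.1).trans hrΩ
  · have hfr : x₀ ∈ frontier Ω := ⟨hx₀, by rwa [hΩ.isOpen.interior_eq]⟩
    obtain ⟨e, he, M, g, hg, hge, hg0, r, hr, H⟩ := exists_defining_function hΩ hfr
    -- the ball of radius `δ` around `x₀ - s e`, with `s > 2 M δ` and `s + δ ≤ r`
    set s : ℝ := r / 2 with hs
    set δ : ℝ := r / (4 * (M + 1)) with hδ
    have hM : (0 : ℝ) ≤ M := M.2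
    have hδ0 : 0 < δ := by positivity
    have hδr : 4 * (M + 1) * δ = r := by rw [hδ]; field_simp
    have hseg : ∀ x ∈ Metric.ball x₀ δ ∩ Ω, ∀ y ∈ Metric.ball (x₀ - s • e) δ,
        segment ℝ x y ⊆ Ω := by
      rintro x ⟨hx, hxΩ⟩ y hy z hz
      have hxr : x ∈ Metric.ball x₀ r := Metric.ball_subset_ball (by nlinarith) hx
      have hyr : y ∈ Metric.ball x₀ r := by
        rw [Metric.mem_ball, dist_eq_norm] at hy ⊢
        have : y - x₀ = (y - (x₀ - s • e)) - s • e := by abel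
        rw [this]
        refine (norm_sub_le _ _).trans_lt ?_
        rw [norm_smul, he, mul_one, Real.norm_of_nonneg (by positivity)]
        nlinarith
      refine (H z ((convex_ball x₀ r).segment_subset hxr hyr hz)).2 ?_
      rw [segment_eq_image'] at hz
      obtain ⟨t, ⟨ht0, ht1⟩, rfl⟩ := hz
      have hw : ‖y - x + s • e‖ ≤ 2 * δ := by
        rw [Metric.mem_ball, dist_eq_norm] at hx hy
        have : y - x + s • e = (y - (x₀ - s • e)) - (x - x₀) := by abel
        rw [this]
        exact (norm_sub_le _ _).trans (by linarith)
      have hz : x + t • (y - x) = (x + t • (y - x + s • e)) + (-(t * s)) • e := by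
        module
      have hgx : g x < 0 := (H x hxr).1 hxΩ
      have hlip := hg.dist_le_mul (x + t • (y - x + s • e)) x
      rw [dist_eq_norm, dist_eq_norm, add_sub_cancel_left, norm_smul, Real.norm_eq_abs,
        Real.norm_of_nonneg ht0] at hlip
      change g (x + t • (y - x)) < 0
      rw [hz, hge]
      have h1 : M * (t * ‖y - x + s • e‖) ≤ M * (t * (2 * δ)) := by gcongr
      have h2 : t * (2 * M * δ) ≤ t * s := by
        gcongr
        nlinarith
      have := le_abs_self (g (x + t • (y - x + s • e)) - g x)
      linarith
    have hsub : Metric.ball (x₀ - s • e) δ ⊆ Ω := by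
      obtain ⟨x, hxΩ, hx⟩ := mem_closure_iff_nhds.1 hx₀ _ (Metric.ball_mem_nhds x₀ hδ0)
      exact fun y hy => hseg x ⟨hxΩ, hx⟩ y hy (right_mem_segment ℝ x y)
    have hlink : IsLinked Ω (Metric.ball x₀ δ) (Metric.ball (x₀ - s • e) δ) :=
      .of_segment_subset hΩ.isBounded hΩ.isOpen Metric.isOpen_ball Metric.isOpen_ball
        fun x hx y hy => hseg x hx y hy.1
    refine ⟨_, Metric.ball_mem_nhds x₀ hδ0, hlink.trans hΩ.isBounded ?_ hlink.symm⟩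
    rw [inter_eq_left.2 hsub]
    exact (Metric.measure_ball_pos volume _ hδ0).ne'

/-- Linking propagates along the connected set `closure Ω` and, by compactness, to all of `Ω`. -/
lemma isLinked_closure (hΩ : IsBoundedLipschitzDomain Ω) : IsLinked Ω (closure Ω) (closure Ω) := by
  have hpts : ∀ x ∈ closure Ω, ∀ y ∈ closure Ω, ∃ U ∈ 𝓝 x, ∃ V ∈ 𝓝 y, IsLinked Ω U V := by
    intro x hx y hy
    refine hΩ.isConnected.closure.isPreconnected.induction₂
      (fun x y => ∃ U ∈ 𝓝 x, ∃ V ∈ 𝓝 y, IsLinked Ω U V) ?_ ?_ ?_ hx hy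
    · intro x hx
      obtain ⟨U, hU, hl⟩ := exists_isLinked_self hΩ hx
      filter_upwards [mem_nhdsWithin_of_mem_nhds (eventually_mem_nhds_iff.2 hU)] with y hyU
      exact ⟨U, hU, U, hyU, hl⟩
    · rintro x y z - hy - ⟨U, hU, V, hV, h1⟩ ⟨V', hV', W, hW, h2⟩
      refine ⟨U, hU, W, hW, (h1.mono le_rfl inter_subset_left).trans hΩ.isBounded ?_
        (h2.mono (inter_subset_right (s := V)) le_rfl)⟩
      -- the common neighbourhood of `y` meets `Ω` in a set of positive measure, as `y` is in the closure
      obtain ⟨O, hO, hOo, hyO⟩ := mem_nhds_iff.1 (inter_mem hV hV')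
      have hne : (O ∩ Ω).Nonempty := mem_closure_iff.1 hy O hOo hyO
      have hpos : 0 < volume (O ∩ Ω) := (hOo.inter hΩ.isOpen).measure_pos volume hne
      exact (hpos.trans_le (measure_mono (inter_subset_inter_left _ hO))).ne'
    · rintro x y - - ⟨U, hU, V, hV, h⟩
      exact ⟨V, hV, U, hU, h.symm⟩
  have hempty : ∀ A : Set (E d), IsLinked Ω A ∅ := fun A =>
    ⟨0, by simp, fun u => by simp [oscillation]⟩
  have hcomp : IsCompact (closure Ω) := hΩ.isBounded.isCompact_closure
  refine hcomp.induction_on (p := fun A => IsLinked Ω A (closure Ω)) (hempty _).symm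
    (fun s t hst h => h.mono hst le_rfl) (fun s t hs ht => hs.union_left ht) fun x hx => ?_
  have : ∃ U ∈ 𝓝 x, IsLinked Ω U (closure Ω) := by
    refine hcomp.induction_on (p := fun B => ∃ U ∈ 𝓝 x, IsLinked Ω U B)
      ⟨univ, univ_mem, hempty _⟩ ?_ ?_ ?_
    · rintro s t hst ⟨U, hU, h⟩
      exact ⟨U, hU, h.mono le_rfl hst⟩
    · rintro s t ⟨U, hU, h⟩ ⟨U', hU', h'⟩
      exact ⟨U ∩ U', inter_mem hU hU', (h.mono inter_subset_left le_rfl).union_right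
        (h'.mono inter_subset_right le_rfl)⟩
    · intro y hy
      obtain ⟨U, hU, V, hV, h⟩ := hpts x hx y hy
      exact ⟨V, mem_nhdsWithin_of_mem_nhds hV, U, hU, h⟩
  obtain ⟨U, hU, h⟩ := this
  exact ⟨U, mem_nhdsWithin_of_mem_nhds hU, h⟩

/-- For a function of zero mean, the oscillation over `Ω` controls the `L²` norm. -/
lemma volume_mul_norm_sq_le_oscillation (hΩ : Bornology.IsBounded Ω) {u : L2 Ω}
    (hu : ∫ x in Ω, u x = 0) : volume Ω * ‖u‖ₑ ^ 2 ≤ oscillation u Ω Ω := by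
  have hfin : IsFiniteMeasure (volume.restrict Ω) :=
    ⟨by rw [Measure.restrict_apply_univ]; exact hΩ.measure_lt_top⟩
  have hmem := Lp.memLp u
  have hint : Integrable u (volume.restrict Ω) := hmem.integrable (by norm_num)
  have hsq : Integrable (fun y => u y ^ 2) (volume.restrict Ω) := hmem.integrable_sq
  have hrow : ∀ x, volume Ω * ‖u x‖ₑ ^ 2 ≤ ∫⁻ y in Ω, ‖u x - u y‖ₑ ^ 2 := by
    intro x
    -- zero mean removes the mixed term of the square
    have h1 : ∫ y in Ω, (u x - u y) ^ 2 = volume.real Ω * u x ^ 2 + ∫ y in Ω, u y ^ 2 := by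
      have : ∀ y, (u x - u y) ^ 2 = u x ^ 2 - 2 * u x * u y + u y ^ 2 := fun y => by ring
      simp only [this]
      rw [integral_add (f := fun y => u x ^ 2 - 2 * u x * u y)
          ((integrable_const _).sub (hint.const_mul _)) hsq,
        integral_sub (integrable_const _) (hint.const_mul _), integral_const_mul, hu]
      simp
    have h2 : ∫⁻ y in Ω, ‖u x - u y‖ₑ ^ 2 = ENNReal.ofReal (∫ y in Ω, (u x - u y) ^ 2) := by
      rw [ofReal_integral_eq_lintegral_ofReal (f := fun y => (u x - u y) ^ 2)
        ((memLp_const (u x)).sub hmem).integrable_sq (Eventually.of_forall fun y => sq_nonneg _)]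
      refine lintegral_congr fun y => ?_
      rw [← ofReal_norm, ← ENNReal.ofReal_pow (norm_nonneg _), Real.norm_eq_abs, sq_abs]
    have h3 : volume Ω * ‖u x‖ₑ ^ 2 = ENNReal.ofReal (volume.real Ω * u x ^ 2) := by
      rw [ENNReal.ofReal_mul measureReal_nonneg, measureReal_def,
        ENNReal.ofReal_toReal hΩ.measure_lt_top.ne, ← ofReal_norm,
        ← ENNReal.ofReal_pow (norm_nonneg _), Real.norm_eq_abs, sq_abs]
    rw [h2, h3, h1]
    refine ENNReal.ofReal_le_ofReal (le_add_of_nonneg_right ?_)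
    exact integral_nonneg fun y => sq_nonneg _
  have hm : Measurable fun x => ‖u x‖ₑ ^ 2 :=
    ((Lp.stronglyMeasurable u).measurable.enorm).pow_const 2
  rw [Lp.enorm_def, ← lintegral_enorm_sq, ← lintegral_const_mul _ hm]
  exact lintegral_mono hrow

/-- The Poincaré inequality for functions of zero mean on a bounded Lipschitz domain. -/
theorem poincare (hΩ : IsBoundedLipschitzDomain Ω) :
    ∃ C : ℝ, 0 ≤ C ∧ ∀ u : H1 Ω, ∫ x in Ω, val u x = 0 → ‖val u‖ ≤ C * ‖grad u‖ := by
  obtain ⟨C, hC, H⟩ := isLinked_closure hΩ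
  have hpos : volume Ω ≠ 0 := (hΩ.isOpen.measure_pos volume hΩ.isConnected.nonempty).ne'
  have hfin : volume Ω ≠ ⊤ := hΩ.isBounded.measure_lt_top.ne
  have hD : (volume Ω)⁻¹ * C ≠ ⊤ := ENNReal.mul_ne_top (ENNReal.inv_ne_top.2 hpos) hC
  refine ⟨√((volume Ω)⁻¹ * C).toReal, Real.sqrt_nonneg _, fun u hu => ?_⟩
  have h1 : ‖val u‖ₑ ^ 2 ≤ (volume Ω)⁻¹ * C * ‖grad u‖ₑ ^ 2 := by
    rw [mul_assoc, ← ENNReal.mul_le_iff_le_inv hpos hfin]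
    refine (volume_mul_norm_sq_le_oscillation hΩ.isBounded hu).trans ?_
    simpa [inter_eq_right.2 subset_closure] using H u
  have h2 : ‖val u‖ ^ 2 ≤ ((volume Ω)⁻¹ * C).toReal * ‖grad u‖ ^ 2 := by
    have := ENNReal.toReal_mono (ENNReal.mul_ne_top hD (by simp)) h1
    simpa using this
  rw [← Real.sqrt_sq (norm_nonneg (grad u)), ← Real.sqrt_mul ENNReal.toReal_nonneg]
  exact Real.le_sqrt_of_sq_le h2

end Oscillation


/-! ### The Neumann problem and the negative Sobolev norm -/

section Neumann

variable {d : ℕ} {Ω : Set (E d)}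

lemma memLp_one_of_isBounded (hΩ : Bornology.IsBounded Ω) :
    MemLp (fun _ : E d => (1 : ℝ)) 2 (volume.restrict Ω) := by
  have hfin : IsFiniteMeasure (volume.restrict Ω) :=
    ⟨by rw [Measure.restrict_apply_univ]; exact hΩ.measure_lt_top⟩
  exact memLp_const 1

/-- The integral over a bounded domain, as a functional on `H¹(Ω)`. -/
noncomputable def meanL (hΩ : Bornology.IsBounded Ω) : H1 Ω →L[ℝ] ℝ :=
  (innerSL ℝ ((memLp_one_of_isBounded hΩ).toLp _)).comp (valL Ω)

lemma meanL_apply (hΩ : Bornology.IsBounded Ω) (u : H1 Ω) :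
    meanL hΩ u = ∫ x in Ω, val u x := by
  change inner ℝ ((memLp_one_of_isBounded hΩ).toLp _) (val u) = _
  rw [real_inner_comm, ← integral_mul_toLp]
  simp

/-- The full `H¹` norm is controlled by the gradient for functions of zero mean. -/
lemma exists_norm_le_norm_grad (hΩ : IsBoundedLipschitzDomain Ω) :
    ∃ C : ℝ, 0 < C ∧ ∀ u : H1 Ω, ∫ x in Ω, val u x = 0 → ‖u‖ ^ 2 ≤ C * ‖grad u‖ ^ 2 := by
  obtain ⟨C, hC, H⟩ := poincare hΩ
  refine ⟨C ^ 2 + 1, by positivity, fun u hu => ?_⟩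
  rw [norm_sq_H1]
  have := pow_le_pow_left₀ (norm_nonneg _) (H u hu) 2
  rw [mul_pow] at this
  linarith

/-- The solution operator of the variational problem `⟪G η, G φ⟫ = ⟪f, ι φ⟫`, `φ ∈ K`, on a closed
subspace `K` on which `G` controls the norm. -/
lemma exists_variational_solution {X Y H : Type*} [NormedAddCommGroup X] [InnerProductSpace ℝ X]
    [CompleteSpace X] [NormedAddCommGroup Y] [InnerProductSpace ℝ Y] [NormedAddCommGroup H]
    [InnerProductSpace ℝ H] [CompleteSpace H] (ι : X →L[ℝ] H) (G : X →L[ℝ] Y) (K : Submodule ℝ X)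
    (hK : IsClosed (K : Set X)) {C : ℝ} (hC : 0 < C) (hG : ∀ u ∈ K, ‖u‖ ^ 2 ≤ C * ‖G u‖ ^ 2) :
    ∃ N : H →L[ℝ] X, ∀ f, N f ∈ K ∧ ∀ φ ∈ K, inner ℝ (G (N f)) (G φ) = inner ℝ f (ι φ) := by
  have : CompleteSpace K := hK.completeSpace_coe
  let a : K →L[ℝ] K →L[ℝ] ℝ :=
    (innerSL ℝ).bilinearComp (G.comp K.subtypeL) (G.comp K.subtypeL)
  have ha : ∀ u w : K, a u w = inner ℝ (G u) (G w) := fun _ _ => rfl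
  have hcoer : IsCoercive a := by
    refine ⟨C⁻¹, by positivity, fun u => ?_⟩
    rw [ha, real_inner_self_eq_norm_sq, mul_assoc, ← sq, inv_mul_le_iff₀ hC]
    exact hG u u.2
  set e := hcoer.continuousLinearEquivOfBilin with he
  refine ⟨K.subtypeL.comp ((e.symm : K →L[ℝ] K).comp
    (ContinuousLinearMap.adjoint (ι.comp K.subtypeL))), fun f => ⟨Subtype.prop _, fun φ hφ => ?_⟩⟩
  set g := ContinuousLinearMap.adjoint (ι.comp K.subtypeL) f with hg
  have h1 : inner ℝ (e (e.symm g)) (⟨φ, hφ⟩ : K) = a (e.symm g) ⟨φ, hφ⟩ :=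
    hcoer.continuousLinearEquivOfBilin_apply _ _
  rw [ContinuousLinearEquiv.apply_symm_apply, hg, ContinuousLinearMap.adjoint_inner_left] at h1
  exact h1.symm

/-- Solvability of the variational Neumann problem on the functions of zero mean. -/
lemma exists_neumann (hΩ : IsBoundedLipschitzDomain Ω) : ∃ N : L2 Ω →L[ℝ] H1 Ω, ∀ f,
    ∫ x in Ω, val (N f) x = 0 ∧ ∀ φ : H1 Ω, ∫ x in Ω, val φ x = 0 →
      inner ℝ (grad (N f)) (grad φ) = inner ℝ f (val φ) := by
  obtain ⟨C, hC, H⟩ := exists_norm_le_norm_grad hΩ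
  have hmem : ∀ u : H1 Ω, u ∈ LinearMap.ker (meanL hΩ.isBounded : H1 Ω →ₗ[ℝ] ℝ) ↔
      ∫ x in Ω, val u x = 0 := fun u => by
    rw [← meanL_apply hΩ.isBounded]
    exact LinearMap.mem_ker
  obtain ⟨N, hN⟩ := exists_variational_solution (valL Ω) (gradL Ω)
    (LinearMap.ker (meanL hΩ.isBounded : H1 Ω →ₗ[ℝ] ℝ)) (meanL hΩ.isBounded).isClosed_ker hC
    fun u hu => H u ((hmem u).1 hu)
  exact ⟨N, fun f => ⟨(hmem _).1 (hN f).1, fun φ hφ => (hN f).2 φ ((hmem φ).2 hφ)⟩⟩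

/-- The solution operator of the Neumann problem; for data of nonzero mean the weak equation is
satisfied against test functions of zero mean only. -/
noncomputable def neumann (hΩ : IsBoundedLipschitzDomain Ω) : L2 Ω →L[ℝ] H1 Ω :=
  (exists_neumann hΩ).choose

lemma integral_neumann (hΩ : IsBoundedLipschitzDomain Ω) (f : L2 Ω) :
    ∫ x in Ω, val (neumann hΩ f) x = 0 := ((exists_neumann hΩ).choose_spec f).1

lemma inner_grad_neumann (hΩ : IsBoundedLipschitzDomain Ω) (f : L2 Ω) {φ : H1 Ω}
    (hφ : ∫ x in Ω, val φ x = 0) :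
    inner ℝ (grad (neumann hΩ f)) (grad φ) = inner ℝ f (val φ) :=
  ((exists_neumann hΩ).choose_spec f).2 φ hφ

/-- Constants belong to `H¹(Ω)`, with vanishing gradient. -/
lemma exists_H1_one (hΩ : IsOpen Ω) (hb : Bornology.IsBounded Ω) :
    ∃ w : H1 Ω, val w =ᵐ[volume.restrict Ω] (fun _ => (1 : ℝ)) ∧ grad w = 0 := by
  obtain ⟨w, h1, h2⟩ := exists_H1_of_lipschitz hΩ hb (LipschitzWith.const (1 : ℝ) (α := E d))
  refine ⟨w, h1, (Lp.eq_zero_iff_ae_eq_zero).2 ?_⟩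
  filter_upwards [h2] with x hx
  rw [hx]
  simp [gradient]

/-- For data of zero mean the Neumann equation may be tested with all of `H¹(Ω)`. -/
lemma isNeumannSolution_neumann (hΩ : IsBoundedLipschitzDomain Ω) {f : L2 Ω}
    (hf : ∫ x in Ω, f x = 0) : IsNeumannSolution Ω f (neumann hΩ f) := by
  refine ⟨integral_neumann hΩ f, fun φ => ?_⟩
  rw [← inner_L2Vec_eq, ← inner_L2_eq]
  obtain ⟨w, hw, hgw⟩ := exists_H1_one hΩ.isOpen hΩ.isBounded
  -- subtract the mean of `φ`
  set a : ℝ := (volume.real Ω)⁻¹ * ∫ x in Ω, val φ x with ha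
  have hpos : volume.real Ω ≠ 0 := by
    rw [measureReal_def, ENNReal.toReal_ne_zero]
    exact ⟨(hΩ.isOpen.measure_pos volume hΩ.isConnected.nonempty).ne',
      hΩ.isBounded.measure_lt_top.ne⟩
  have hmw : ∫ x in Ω, val w x = volume.real Ω := by
    rw [integral_congr_ae hw]
    simp
  have h0 : ∫ x in Ω, val (φ - a • w) x = 0 := by
    rw [← meanL_apply hΩ.isBounded, map_sub, map_smul, meanL_apply, meanL_apply, hmw, ha,
      smul_eq_mul]
    field_simp
    ring
  have hfw : inner ℝ f (val w) = (0 : ℝ) := by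
    rw [inner_L2_eq, ← hf]
    refine integral_congr_ae ?_
    filter_upwards [hw] with x hx
    rw [hx, mul_one]
  have h := inner_grad_neumann hΩ f h0
  rw [← gradL_apply (φ - a • w), ← valL_apply (φ - a • w), map_sub, map_sub, map_smul, map_smul,
    gradL_apply, gradL_apply, valL_apply, valL_apply, hgw, smul_zero, sub_zero, inner_sub_right,
    inner_smul_right, hfw, mul_zero, sub_zero] at h
  exact h

lemma IsNeumannSolution.unique (hΩ : IsBoundedLipschitzDomain Ω) {f : L2 Ω} {η η' : H1 Ω}
    (h : IsNeumannSolution Ω f η) (h' : IsNeumannSolution Ω f η') : η' = η := by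
  obtain ⟨C, hC, H⟩ := exists_norm_le_norm_grad hΩ
  have h0 : ∫ x in Ω, val (η' - η) x = 0 := by
    rw [← meanL_apply hΩ.isBounded, map_sub, meanL_apply, meanL_apply, h.mean_zero, h'.mean_zero,
      sub_zero]
  have h1 : ‖grad (η' - η)‖ ^ 2 = 0 := by
    have e1 := h.weak (η' - η)
    have e2 := h'.weak (η' - η)
    rw [← e1, ← inner_L2Vec_eq, ← inner_L2Vec_eq, ← sub_eq_zero, ← inner_sub_left] at e2
    rw [← real_inner_self_eq_norm_sq]
    exact e2
  have h2 := H _ h0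
  rw [h1, mul_zero] at h2
  have h3 : ‖η' - η‖ = 0 := by
    have := sq_nonneg ‖η' - η‖
    nlinarith
  exact sub_eq_zero.1 (norm_eq_zero.1 h3)

/-- The supremum that defines the negative Sobolev norm is a maximum, equal to the Dirichlet norm of
the Neumann potential. In particular it is finite. -/
lemma isGreatest_dualPairings (hΩ : IsBoundedLipschitzDomain Ω) (f : L2 Ω) :
    IsGreatest (dualPairings Ω f) ‖grad (neumann hΩ f)‖ := by
  set η := neumann hΩ f with hη
  constructor
  · -- the supremum is attained at `η / ‖∇η‖`
    refine ⟨‖grad η‖⁻¹ • η, ?_, ?_, ?_⟩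
    · rw [← meanL_apply hΩ.isBounded, map_smul, meanL_apply, integral_neumann, smul_zero]
    · rw [← norm_sq_L2Vec, ← gradL_apply, map_smul, norm_smul, norm_inv, norm_norm, gradL_apply,
        ← div_eq_inv_mul]
      exact pow_le_one₀ (by positivity) (div_self_le_one _)
    · rw [← inner_L2_eq, ← valL_apply, map_smul, valL_apply, inner_smul_right,
        ← inner_grad_neumann hΩ f (integral_neumann hΩ f), real_inner_self_eq_norm_sq]
      by_cases h0 : ‖grad η‖ = 0
      · rw [h0]; simp
      · rw [hη] at h0 ⊢
        field_simp
  · rintro s ⟨φ, hφ, hφ1, rfl⟩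
    rw [← inner_L2_eq, ← inner_grad_neumann hΩ f hφ]
    rw [← norm_sq_L2Vec] at hφ1
    have h1 : ‖grad φ‖ ≤ 1 := (sq_le_one_iff₀ (norm_nonneg _)).1 hφ1
    refine (real_inner_le_norm _ _).trans ?_
    exact mul_le_of_le_one_right (norm_nonneg _) h1

/-- The negative Sobolev norm is the Dirichlet norm of the Neumann potential. -/
lemma negSobolevNorm_eq (hΩ : IsBoundedLipschitzDomain Ω) (f : L2 Ω) :
    negSobolevNorm Ω f = ‖grad (neumann hΩ f)‖ :=
  (isGreatest_dualPairings hΩ f).csSup_eq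

/-- Expansion of the squared negative Sobolev norm to second order. -/
lemma negSobolevNorm_sq_eq (hΩ : IsBoundedLipschitzDomain Ω) (f g : L2 Ω) :
    negSobolevNorm Ω g ^ 2 = negSobolevNorm Ω f ^ 2 + 2 * inner ℝ (g - f) (val (neumann hΩ f))
      + negSobolevNorm Ω (g - f) ^ 2 := by
  rw [negSobolevNorm_eq hΩ, negSobolevNorm_eq hΩ, negSobolevNorm_eq hΩ,
    ← inner_grad_neumann hΩ (g - f) (integral_neumann hΩ f)]
  have h : grad (neumann hΩ g) = grad (neumann hΩ f) + grad (neumann hΩ (g - f)) := by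
    rw [← gradL_apply, ← gradL_apply, ← gradL_apply, ← map_add, ← map_add, add_sub_cancel]
  rw [h, norm_add_sq_real, real_inner_comm]

/-- A functional bounded on `H¹(Ω)` by `a ‖φ‖` has negative Sobolev norm of order `a`. -/
lemma exists_negSobolevNorm_le (hΩ : IsBoundedLipschitzDomain Ω) :
    ∃ C : ℝ, 0 ≤ C ∧ ∀ (f : L2 Ω) (a : ℝ), 0 ≤ a → (∀ φ : H1 Ω, inner ℝ f (val φ) ≤ a * ‖φ‖) →
      negSobolevNorm Ω f ≤ C * a := by
  obtain ⟨C, hC, H⟩ := exists_norm_le_norm_grad hΩ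
  refine ⟨√C, by positivity, fun f a ha h => ?_⟩
  rw [negSobolevNorm_eq hΩ]
  set η := neumann hΩ f with hη
  have h1 : ‖η‖ ≤ √C * ‖grad η‖ := by
    rw [← Real.sqrt_sq (norm_nonneg (grad η)), ← Real.sqrt_mul hC.le]
    exact Real.le_sqrt_of_sq_le (H η (integral_neumann hΩ f))
  have h2 : ‖grad η‖ ^ 2 ≤ a * (√C * ‖grad η‖) := by
    rw [← real_inner_self_eq_norm_sq, inner_grad_neumann hΩ f (integral_neumann hΩ f)]
    exact (h η).trans (by gcongr)
  by_contra! hlt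
  nlinarith [(by positivity : 0 ≤ √C * a).trans_lt hlt]

end Neumann


/-! ### Dependence of evolutions on the control -/

section Sensitivity

variable {U V H : Type*} [NormedAddCommGroup U] [NormedSpace ℝ U]
  [NormedAddCommGroup V] [InnerProductSpace ℝ V] [NormedAddCommGroup H] [InnerProductSpace ℝ H]
  {ι : V →L[ℝ] H} {D : U →L[ℝ] V →L[ℝ] H} {T L : ℝ} {𝒦 : Set H} {c c' w : ℝ → U}

/-- Being a weak evolution depends on the control only almost everywhere in time. -/
lemma IsWeakEvolution.congr {θ : ℝ → H} (h : IsWeakEvolution ι D T c θ)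
    (hcc : c =ᵐ[volume.restrict (Icc 0 T)] c') : IsWeakEvolution ι D T c' θ := by
  refine ⟨h.continuousOn, fun ψ s hs t ht => ?_⟩
  rw [h.weak ψ s hs t ht]
  have hsub : uIoc s t ⊆ Icc 0 T :=
    uIoc_subset_uIcc.trans ((convex_Icc 0 T).ordConnected.uIcc_subset hs ht)
  refine intervalIntegral.integral_congr_ae ?_
  rw [← ae_restrict_iff' measurableSet_uIoc]
  filter_upwards [ae_restrict_of_ae_restrict_of_subset hsub hcc] with r hr
  rw [hr]

/-- Difference of two evolutions whose controls differ by `ε w`, tested against a solution of the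
equation for the first control. -/
lemma inner_sub_eq_mul_integral [CompleteSpace H]
    (hskew : ∀ u ψ φ, inner ℝ (D u ψ) (ι φ) = - inner ℝ (ι ψ) (D u φ)) (hdense : DenseRange ι)
    (hc : IntegrableOn c (Icc 0 T)) (hw : IntegrableOn w (Icc 0 T)) {θ : ℝ → ℝ → H}
    (hθ : ∀ ε, IsWeakEvolution ι D T (fun t => c t + ε • w t) (θ ε))
    (h0 : ∀ ε, θ ε 0 = θ 0 0) {ρ : ℝ → V} (hρ : ContinuousOn ρ (Icc 0 T))
    (hρw : IsWeakEvolution ι D T c (fun t => ι (ρ t))) (ε : ℝ) {t : ℝ} (ht : t ∈ Icc 0 T) :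
    inner ℝ (θ ε t - θ 0 t) (ι (ρ t)) = ε * ∫ r in 0..t, inner ℝ (θ ε r) (D (w r) (ρ r)) := by
  have h0T : (0 : ℝ) ∈ Icc 0 T := ⟨le_rfl, ht.1.trans ht.2⟩
  have key : ∀ ε, inner ℝ (θ ε t) (ι (ρ t)) - inner ℝ (θ ε 0) (ι (ρ 0))
      = ε * ∫ r in 0..t, inner ℝ (θ ε r) (D (w r) (ρ r)) := by
    intro ε
    have hcε : IntegrableOn (fun t => c t + ε • w t) (Icc 0 T) := hc.add (hw.smul ε)
    rw [(hθ ε).pairing_evolution hskew hdense hcε hρ hρw hc h0T ht,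
      ← intervalIntegral.integral_const_mul]
    refine intervalIntegral.integral_congr fun r _ => ?_
    simp only [add_sub_cancel_left, map_smul, smul_apply, inner_smul_right]
  have k0 := key 0
  have k1 := key ε
  rw [zero_mul] at k0
  rw [h0 ε] at k1
  rw [inner_sub_left, ← k1]
  linarith

/-- Lipschitz dependence of an evolution on the control, in the dual norm of `V`. -/
lemma exists_abs_inner_sub_le [CompleteSpace H]
    (hskew : ∀ u ψ φ, inner ℝ (D u ψ) (ι φ) = - inner ℝ (ι ψ) (D u φ)) (hdense : DenseRange ι)
    (hT : 0 ≤ T) (hL : 0 ≤ L) (hc : IntegrableOn c (Icc 0 T)) (hw : IntegrableOn w (Icc 0 T))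
    (hreg : HasRegularEvolution ι D T L 𝒦 c) {θ : ℝ → ℝ → H} {A : ℝ}
    (hθ : ∀ ε, IsWeakEvolution ι D T (fun t => c t + ε • w t) (θ ε))
    (hA : ∀ ε, ∀ t ∈ Icc 0 T, ‖θ ε t‖ ≤ A) (h0 : ∀ ε, θ ε 0 = θ 0 0) :
    ∃ C, 0 ≤ C ∧ ∀ ε, ∀ t ∈ Icc 0 T, ∀ ψ : V,
      |inner ℝ (θ ε t - θ 0 t) (ι ψ)| ≤ |ε| * C * ‖ψ‖ := by
  have hA0 : 0 ≤ A := (norm_nonneg _).trans (hA 0 0 ⟨le_rfl, hT⟩)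
  have hw0 : 0 ≤ ∫ r in Icc 0 T, ‖w r‖ := integral_nonneg fun _ => norm_nonneg _
  refine ⟨A * ‖D‖ * Real.exp (∫ r in Icc 0 T, L * ‖c r‖) * ∫ r in Icc 0 T, ‖w r‖,
    by positivity, fun ε t ht ψ => ?_⟩
  -- test with the regular solution of the unperturbed equation that equals `ψ` at time `t`
  obtain ⟨ρ, h1, h2, h3, h4, -, -⟩ := hreg t ht ψ
  have hB : ∀ r ∈ Icc 0 T, ‖ρ r‖ ≤ Real.exp (∫ r in Icc 0 T, L * ‖c r‖) * ‖ψ‖ := by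
    intro r hr
    rw [← h1]
    refine (h4 t ht r hr).trans ?_
    gcongr
    exact abs_intervalIntegral_le_of_nonneg (hc.norm.const_mul L) (fun r => by positivity) ht hr
  have h5 := inner_sub_eq_mul_integral hskew hdense hc hw hθ h0 h3 h2 ε ht
  rw [h1] at h5
  rw [h5, abs_mul, mul_assoc]
  gcongr
  refine (abs_integral_inner_apply_le hw (hA ε) hB ⟨le_rfl, hT⟩ ht).trans (le_of_eq ?_)
  ring

/-- Evolutions depend on the control continuously for the weak topology of `H`. -/
lemma tendsto_inner_evolution [CompleteSpace H]
    (hskew : ∀ u ψ φ, inner ℝ (D u ψ) (ι φ) = - inner ℝ (ι ψ) (D u φ)) (hdense : DenseRange ι)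
    (hL : 0 ≤ L) (hc : IntegrableOn c (Icc 0 T)) (hw : IntegrableOn w (Icc 0 T))
    (hreg : HasRegularEvolution ι D T L 𝒦 c) {θ : ℝ → ℝ → H} {A : ℝ}
    (hθ : ∀ ε, IsWeakEvolution ι D T (fun t => c t + ε • w t) (θ ε))
    (hA : ∀ ε, ∀ t ∈ Icc 0 T, ‖θ ε t‖ ≤ A) (h0 : ∀ ε, θ ε 0 = θ 0 0) {t : ℝ}
    (ht : t ∈ Icc 0 T) (y : H) :
    Tendsto (fun ε => inner ℝ (θ ε t) y) (𝓝 0) (𝓝 (inner ℝ (θ 0 t) y)) := by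
  obtain ⟨C, -, hC⟩ :=
    exists_abs_inner_sub_le hskew hdense (ht.1.trans ht.2) hL hc hw hreg hθ hA h0
  refine tendsto_inner_of_dense (S := range ι) hdense (Eventually.of_forall fun ε => hA ε t ht) ?_ y
  rintro _ ⟨ψ, rfl⟩
  rw [← tendsto_sub_nhds_zero_iff]
  have hlim : Tendsto (fun ε : ℝ => |ε| * C * ‖ψ‖) (𝓝 0) (𝓝 0) := by
    have : Continuous fun ε : ℝ => |ε| * C * ‖ψ‖ := by fun_prop
    simpa using this.tendsto 0
  refine squeeze_zero_norm (fun ε => ?_) hlim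
  rw [Real.norm_eq_abs, ← inner_sub_left]
  exact hC ε t ht ψ

/-- Derivative of an evolution with respect to the control, tested against the terminal value of a
solution `ρ` of the unperturbed equation. -/
lemma hasDerivAt_inner_evolution [CompleteSpace H]
    (hskew : ∀ u ψ φ, inner ℝ (D u ψ) (ι φ) = - inner ℝ (ι ψ) (D u φ)) (hdense : DenseRange ι)
    (hT : 0 ≤ T) (hL : 0 ≤ L) (hc : IntegrableOn c (Icc 0 T)) (hw : IntegrableOn w (Icc 0 T))
    (hreg : HasRegularEvolution ι D T L 𝒦 c) {θ : ℝ → ℝ → H} {A : ℝ}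
    (hθ : ∀ ε, IsWeakEvolution ι D T (fun t => c t + ε • w t) (θ ε))
    (hA : ∀ ε, ∀ t ∈ Icc 0 T, ‖θ ε t‖ ≤ A) (h0 : ∀ ε, θ ε 0 = θ 0 0)
    {ρ : ℝ → V} (hρ : ContinuousOn ρ (Icc 0 T))
    (hρw : IsWeakEvolution ι D T c (fun t => ι (ρ t))) :
    HasDerivAt (fun ε => inner ℝ (θ ε T - θ 0 T) (ι (ρ T)))
      (∫ r in 0..T, inner ℝ (θ 0 r) (D (w r) (ρ r))) 0 := by
  have h0T : (0 : ℝ) ∈ Icc 0 T := ⟨le_rfl, hT⟩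
  have hTT : T ∈ Icc 0 T := ⟨hT, le_rfl⟩
  have hsub : uIoc 0 T ⊆ Icc 0 T :=
    uIoc_subset_uIcc.trans ((convex_Icc 0 T).ordConnected.uIcc_subset h0T hTT)
  have hlim : Tendsto (fun ε => ∫ r in 0..T, inner ℝ (θ ε r) (D (w r) (ρ r))) (𝓝 0)
      (𝓝 (∫ r in 0..T, inner ℝ (θ 0 r) (D (w r) (ρ r)))) := by
    refine intervalIntegral.tendsto_integral_filter_of_dominated_convergence
      (fun r => A * ‖D (w r) (ρ r)‖) (Eventually.of_forall fun ε => ?_)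
      (Eventually.of_forall fun ε => Eventually.of_forall fun r hr => ?_) ?_
      (Eventually.of_forall fun r hr => ?_)
    · exact (intervalIntegrable_iff.1 (intervalIntegrable_inner_apply (D := D)
        (hθ ε).continuousOn hρ hw h0T hTT)).aestronglyMeasurable
    · refine (norm_inner_le_norm _ _).trans ?_
      gcongr
      exact hA ε r (hsub hr)
    · rw [intervalIntegrable_iff]
      exact ((integrableOn_apply (D := D) hT hρ hw).mono_set hsub).norm.const_mul A
    · exact tendsto_inner_evolution hskew hdense hL hc hw hreg hθ hA h0 (hsub hr) _
  rw [hasDerivAt_iff_tendsto_slope_zero]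
  refine (hlim.mono_left nhdsWithin_le_nhds).congr' ?_
  filter_upwards [self_mem_nhdsWithin] with ε hε
  have hε' : ε ≠ 0 := hε
  rw [zero_add, sub_self, inner_zero_left, sub_zero,
    inner_sub_eq_mul_integral hskew hdense hc hw hθ h0 hρ hρw ε hTT, smul_eq_mul,
    inv_mul_cancel_left₀ hε']

end Sensitivity

section MixNorm

variable {d m : ℕ} {Ω : Set (E d)} {B : Fin m → E d → E d} {K : NNReal} {S : ℝ} {T : ℝ}
  {c w : ℝ → E m}

/-- Derivative of the squared negative Sobolev norm of the terminal state, in terms of a solution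
`ρ` of the transport equation ending at the Neumann potential of that state. -/
theorem hasDerivAt_negSobolevNorm_sq (hΩ : IsBoundedLipschitzDomain Ω)
    (hB : IsStirringFamily Ω B K S) (hT : 0 ≤ T) (hc : IntegrableOn c (Icc 0 T))
    (hw : IntegrableOn w (Icc 0 T)) {θ : ℝ → ℝ → L2 Ω} {A : ℝ}
    (hθ : ∀ ε, IsWeakEvolution (valL Ω) (transportOp hB) T (fun t => c t + ε • w t) (θ ε))
    (hA : ∀ ε, ∀ t ∈ Icc 0 T, ‖θ ε t‖ ≤ A) (h0 : ∀ ε, θ ε 0 = θ 0 0)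
    {ρ : ℝ → H1 Ω} (hρ : ContinuousOn ρ (Icc 0 T))
    (hρw : IsWeakEvolution (valL Ω) (transportOp hB) T c (fun t => valL Ω (ρ t)))
    (hρT : ρ T = neumann hΩ (θ 0 T)) :
    HasDerivAt (fun ε => 1 / 2 * negSobolevNorm Ω (θ ε T) ^ 2)
      (∫ r in 0..T, inner ℝ (θ 0 r) (transportOp hB (w r) (ρ r))) 0 := by
  have hskew := inner_transportOp hΩ hB
  have hdense := denseRange_valL hΩ.isOpen hΩ.isBounded
  have hreg := hasRegularEvolution hΩ hB (T := T) 0 hc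
  have hL : (0 : ℝ) ≤ m * K := by positivity
  have h1 := hasDerivAt_inner_evolution hskew hdense hT hL hc hw hreg hθ hA h0 hρ hρw
  obtain ⟨C, hC, hle⟩ := exists_abs_inner_sub_le hskew hdense hT hL hc hw hreg hθ hA h0
  obtain ⟨C', hC', hneg⟩ := exists_negSobolevNorm_le hΩ
  -- the quadratic remainder: the state is Lipschitz in `ε` for the negative norm
  have h2 : HasDerivAt (fun ε => 1 / 2 * negSobolevNorm Ω (θ ε T - θ 0 T) ^ 2) 0 0 := by
    have hO : (fun ε => 1 / 2 * negSobolevNorm Ω (θ ε T - θ 0 T) ^ 2)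
        =O[𝓝 0] fun ε : ℝ => ‖ε - 0‖ ^ 2 := by
      refine Asymptotics.IsBigO.of_bound (1 / 2 * (C' * C) ^ 2) (Eventually.of_forall fun ε => ?_)
      have h3 := hneg (θ ε T - θ 0 T) (|ε| * C) (by positivity) fun φ =>
        (le_abs_self _).trans (hle ε T ⟨hT, le_rfl⟩ φ)
      have h4 : 0 ≤ negSobolevNorm Ω (θ ε T - θ 0 T) := by
        rw [negSobolevNorm_eq hΩ]
        exact norm_nonneg _
      have h5 := pow_le_pow_left₀ h4 h3 2
      rw [sub_zero, norm_pow, norm_norm, Real.norm_of_nonneg (by positivity), Real.norm_eq_abs]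
      calc _ ≤ 1 / 2 * (C' * (|ε| * C)) ^ 2 := by gcongr
        _ = _ := by ring
    have := (hO.hasFDerivAt one_lt_two).hasDerivAt
    simpa using this
  have h3 := (h1.add h2).const_add (1 / 2 * negSobolevNorm Ω (θ 0 T) ^ 2)
  rw [add_zero] at h3
  refine h3.congr_of_eventuallyEq (Eventually.of_forall fun ε => ?_)
  simp only [Pi.add_apply, hρT]
  rw [negSobolevNorm_sq_eq hΩ (θ 0 T) (θ ε T), valL_apply]
  ring

end MixNorm


/-! ### Coordinates of controls -/

section Coordinates

variable {d m : ℕ} {Ω : Set (E d)} {b B : Fin m → E d → E d} {K : NNReal} {S T : ℝ}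

lemma IsStirringFamily.memLp (hΩ : IsBoundedLipschitzDomain Ω) (hB : IsStirringFamily Ω B K S)
    (i : Fin m) : MemLp (B i) 2 (volume.restrict Ω) := by
  have hfin : IsFiniteMeasure (volume.restrict Ω) :=
    ⟨by rw [Measure.restrict_apply_univ]; exact hΩ.isBounded.measure_lt_top⟩
  exact MemLp.of_bound (hB.lipschitz i).continuous.aestronglyMeasurable S
    (Eventually.of_forall (hB.bounded i))

/-- The coefficients `⟪Bᵢ, f⟫` of a vector field with respect to the stirring fields. -/
noncomputable def coordL (hΩ : IsBoundedLipschitzDomain Ω) (hB : IsStirringFamily Ω B K S) :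
    L2Vec Ω →L[ℝ] E m :=
  ((EuclideanSpace.equiv (Fin m) ℝ).symm : (Fin m → ℝ) →L[ℝ] E m).comp
    (ContinuousLinearMap.pi fun i => innerSL ℝ ((hB.memLp hΩ i).toLp (B i)))

lemma coordL_apply (hΩ : IsBoundedLipschitzDomain Ω) (hB : IsStirringFamily Ω B K S)
    (f : L2Vec Ω) (i : Fin m) : coordL hΩ hB f i = inner ℝ ((hB.memLp hΩ i).toLp (B i)) f := rfl

/-- On the span of orthonormal stirring fields, a vector field is recovered from its
coefficients. -/
lemma coeFn_eq_stirVelocity (hΩ : IsBoundedLipschitzDomain Ω) (hB : IsStirringFamily Ω B K S)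
    (hbB : ∀ i, EqOn (b i) (B i) (closure Ω))
    (hb : ∀ i j, (∫ x in Ω, (inner ℝ (b i x) (b j x) : ℝ)) = if i = j then 1 else 0)
    {f : L2Vec Ω} (hf : f ∈ controlSpace Ω b) :
    f =ᵐ[volume.restrict Ω] stirVelocity B (coordL hΩ hB f) := by
  have hae : ∀ i, b i =ᵐ[volume.restrict Ω] B i := fun i =>
    ae_restrict_of_forall_mem hΩ.isOpen.measurableSet fun x hx => hbB i (subset_closure hx)
  induction hf using Submodule.span_induction with
  | mem f hf =>
    obtain ⟨j, hj⟩ := hf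
    have hcoord : ∀ i, coordL hΩ hB f i = if i = j then 1 else 0 := by
      intro i
      rw [coordL_apply, inner_L2Vec_eq, ← hb i j]
      refine integral_congr_ae ?_
      filter_upwards [hj, hae i, (hB.memLp hΩ i).coeFn_toLp] with x h1 h2 h3
      rw [h1, h2, h3]
    filter_upwards [hj, hae j] with x h1 h2
    rw [h1, h2, stirVelocity]
    simp [hcoord]
  | zero =>
    filter_upwards [Lp.coeFn_zero (E d) 2 (volume.restrict Ω)] with x hx
    rw [hx, stirVelocity, map_zero]
    simp
  | add f g _ _ hf hg =>
    filter_upwards [hf, hg, Lp.coeFn_add f g] with x h1 h2 h3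
    rw [h3, Pi.add_apply, h1, h2, map_add, stirVelocity, stirVelocity, stirVelocity,
      ← Finset.sum_add_distrib]
    simp [add_smul]
  | smul a f _ hf =>
    filter_upwards [hf, Lp.coeFn_smul a f] with x h1 h2
    rw [h2, Pi.smul_apply, h1, map_smul, stirVelocity, stirVelocity, Finset.smul_sum]
    simp [mul_smul]

/-- The coefficients of a control, as functions of time. -/
noncomputable def controlCoord (hΩ : IsBoundedLipschitzDomain Ω) (hB : IsStirringFamily Ω B K S)
    (v : Control Ω b T) (t : ℝ) : E m := coordL hΩ hB (velocity v t)

lemma integrableOn_controlCoord (hΩ : IsBoundedLipschitzDomain Ω)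
    (hB : IsStirringFamily Ω B K S) (v : Control Ω b T) :
    IntegrableOn (controlCoord hΩ hB v) (Icc 0 T) := by
  rw [integrableOn_Icc_iff_integrableOn_Ioo]
  have h1 : Integrable v (volume.restrict (Ioo 0 T)) := (Lp.memLp v).integrable (by norm_num)
  exact ((coordL hΩ hB).comp (controlSpace Ω b).subtypeL).integrable_comp h1

/-- The velocity of a control is at every time the combination of the fields with its
coefficients. -/
lemma velocity_eq_stirVelocity (hΩ : IsBoundedLipschitzDomain Ω)
    (hB : IsStirringFamily Ω B K S) (hbB : ∀ i, EqOn (b i) (B i) (closure Ω))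
    (hb : ∀ i j, (∫ x in Ω, (inner ℝ (b i x) (b j x) : ℝ)) = if i = j then 1 else 0)
    (v : Control Ω b T) (t : ℝ) :
    velocity v t =ᵐ[volume.restrict Ω] stirVelocity B (controlCoord hΩ hB v t) :=
  coeFn_eq_stirVelocity hΩ hB hbB hb (v t).2

/-- The coefficients depend linearly on the control, for almost every time. -/
lemma controlCoord_add_smul (hΩ : IsBoundedLipschitzDomain Ω) (hB : IsStirringFamily Ω B K S)
    (v w : Control Ω b T) (ε : ℝ) :
    controlCoord hΩ hB (v + ε • w) =ᵐ[volume.restrict (Icc 0 T)]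
      fun t => controlCoord hΩ hB v t + ε • controlCoord hΩ hB w t := by
  rw [← restrict_Ioo_eq_restrict_Icc]
  filter_upwards [Lp.coeFn_add v (ε • w), Lp.coeFn_smul ε w] with t h1 h2
  rw [controlCoord, velocity, h1, Pi.add_apply, h2, Pi.smul_apply, Submodule.coe_add,
    Submodule.coe_smul, map_add, map_smul]
  rfl

end Coordinates

/-! ### The state and the adjoint equation -/

section State

variable {d m : ℕ} {Ω : Set (E d)} {b B : Fin m → E d → E d} {K : NNReal} {S T : ℝ}

/-- Bounded functions are `L²` limits of `H¹` functions with the same bound. -/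
lemma exists_bounded_approx (hΩ : IsBoundedLipschitzDomain Ω) (hB : IsStirringFamily Ω B K S)
    {M : ℝ} (hM : 0 ≤ M) {f : L2 Ω} (hf : f ∈ boundedBy Ω M) :
    ∃ x : ℕ → H1 Ω, Tendsto (fun n => valL Ω (x n)) atTop (𝓝 f) ∧
      ∀ n, valL Ω (x n) ∈ boundedBy Ω M := by
  obtain ⟨g, hg, hlim⟩ := mem_closure_iff_seq_limit.1 (dense_val_testSet hΩ hB f)
  choose w hw hwg using hg
  choose φ hφ hwφ _ using hw
  -- truncate the test functions at height `M`
  have hproj : ∀ n, ∃ x : H1 Ω, val x =ᵐ[volume.restrict Ω] fun y => max (-M) (min M (φ n y)) := by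
    intro n
    obtain ⟨C, hC⟩ := (hφ n).lipschitz
    obtain ⟨x, hx, -⟩ := exists_H1_of_lipschitz hΩ.isOpen hΩ.isBounded
      ((hC.const_min M).const_max (-M))
    exact ⟨x, hx⟩
  choose x hx using hproj
  refine ⟨x, ?_, fun n => ?_⟩
  · rw [tendsto_iff_norm_sub_tendsto_zero] at hlim ⊢
    refine squeeze_zero (fun _ => norm_nonneg _) (fun n => ?_) hlim
    rw [← hwg n]
    refine Lp.norm_le_norm_of_ae_le ?_
    filter_upwards [hx n, hwφ n, hf, Lp.coeFn_sub (val (x n)) f, Lp.coeFn_sub (val (w n)) f]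
      with y h1 h2 h3 h4 h5
    rw [valL_apply, h4, h5, Pi.sub_apply, Pi.sub_apply, h1, h2, Real.norm_eq_abs, Real.norm_eq_abs]
    -- truncation is nonexpansive and fixes `f`, so it does not spoil the convergence
    have h6 : f y = max (-M) (min M (f y)) := by
      rw [min_eq_right (abs_le.1 h3).2, max_eq_right (abs_le.1 h3).1]
    rw [h6]
    refine (abs_max_sub_max_le_max _ _ _ _).trans ?_
    rw [sub_self, abs_zero, max_eq_right (abs_nonneg _)]
    refine (abs_min_sub_min_le_max _ _ _ _).trans ?_
    rw [sub_self, abs_zero, max_eq_right (abs_nonneg _), ← h6]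
  · filter_upwards [hx n] with y hy
    rw [valL_apply, hy, abs_le]
    exact ⟨le_max_left _ _, max_le (by linarith) (min_le_left _ _)⟩

/-- Well-posedness of the state equation, with the properties of the state. -/
theorem state_spec (hΩ : IsBoundedLipschitzDomain Ω) (hB : IsStirringFamily Ω B K S)
    (hbB : ∀ i, EqOn (b i) (B i) (closure Ω))
    (hb : ∀ i j, (∫ x in Ω, (inner ℝ (b i x) (b j x) : ℝ)) = if i = j then 1 else 0)
    (hT : 0 < T) {θ₀ : E d → ℝ} (hθ₀ : MemLp θ₀ 2 (volume.restrict Ω)) {M : ℝ} (hM : 0 ≤ M)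
    (hθ₀M : hθ₀.toLp θ₀ ∈ boundedBy Ω M) (v : Control Ω b T) :
    IsStateSolution Ω T (velocity v) θ₀ (state Ω b T θ₀ v) ∧
      (∀ θ, IsStateSolution Ω T (velocity v) θ₀ θ → EqOn θ (state Ω b T θ₀ v) (Icc 0 T)) ∧
      IsWeakEvolution (valL Ω) (transportOp hB) T (controlCoord hΩ hB v) (state Ω b T θ₀ v) ∧
      state Ω b T θ₀ v 0 = hθ₀.toLp θ₀ ∧
      ∀ t ∈ Icc 0 T, ‖state Ω b T θ₀ v t‖ = ‖hθ₀.toLp θ₀‖ ∧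
        state Ω b T θ₀ v t ∈ boundedBy Ω M := by
  have hc := integrableOn_controlCoord hΩ hB v
  have h0T : (0 : ℝ) ∈ Icc 0 T := ⟨le_rfl, hT.le⟩
  have hreg := hasRegularEvolution hΩ hB M hc
  have hskew := inner_transportOp hΩ hB
  have hdense := denseRange_valL hΩ.isOpen hΩ.isBounded
  have hiff := fun θ => isStateSolution_iff hΩ hB hT hc
    (velocity_eq_stirVelocity hΩ hB hbB hb v) hθ₀ (θ := θ)
  obtain ⟨x, hx, hxM⟩ := exists_bounded_approx hΩ hB hM hθ₀M
  obtain ⟨θ, h1, h2, h3, h4⟩ := exists_weakEvolution hskew hdense (isClosed_boundedBy Ω M) hc hreg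
    h0T hx hxM
  have hstate : IsStateSolution Ω T (velocity v) θ₀ (state Ω b T θ₀ v) :=
    Classical.epsilon_spec (p := fun θ => IsStateSolution Ω T (velocity v) θ₀ θ)
      ⟨θ, (hiff θ).2 ⟨h2, h1⟩⟩
  obtain ⟨k1, k2⟩ := (hiff _).1 hstate
  have heq : EqOn θ (state Ω b T θ₀ v) (Icc 0 T) :=
    h2.eqOn hskew hdense hc hreg k1 h0T (h1.trans k2.symm)
  refine ⟨hstate, fun θ' hθ' => ?_, k1, k2, fun t ht => ?_⟩
  · obtain ⟨l1, l2⟩ := (hiff _).1 hθ'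
    exact l1.eqOn hskew hdense hc hreg k1 h0T (l2.trans k2.symm)
  · rw [← heq ht]
    exact ⟨h3 t ht, h4 t ht⟩

/-- The transport equation conserves the mean. -/
lemma integral_eq_of_isWeakEvolution (hΩ : IsBoundedLipschitzDomain Ω)
    (hB : IsStirringFamily Ω B K S) {c : ℝ → E m} {θ : ℝ → L2 Ω}
    (hθ : IsWeakEvolution (valL Ω) (transportOp hB) T c θ) {s t : ℝ} (hs : s ∈ Icc 0 T)
    (ht : t ∈ Icc 0 T) : ∫ x in Ω, θ t x = ∫ x in Ω, θ s x := by
  -- test with the constant function `1`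
  obtain ⟨w, hw, hgw⟩ := exists_H1_one hΩ.isOpen hΩ.isBounded
  have hD : ∀ c, transportOp hB c w = 0 := by
    intro c
    refine (Lp.eq_zero_iff_ae_eq_zero).2 ?_
    filter_upwards [coeFn_transportOp hB c w, Lp.coeFn_zero (E d) 2 (volume.restrict Ω)]
      with x h1 h2
    rw [h1, hgw, h2, Pi.zero_apply, inner_zero_right, Pi.zero_apply]
  have hone : ∀ f : L2 Ω, ∫ x in Ω, f x = inner ℝ f (val w) := by
    intro f
    rw [inner_L2_eq]
    refine integral_congr_ae ?_
    filter_upwards [hw] with x hx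
    rw [hx, mul_one]
  have h := hθ.weak w s hs t ht
  simp only [hD, inner_zero_right, intervalIntegral.integral_zero, inner_sub_left,
    valL_apply] at h
  rw [hone, hone]
  linarith

/-- Well-posedness of the adjoint equation. -/
theorem exists_adjoint (hΩ : IsBoundedLipschitzDomain Ω) (hB : IsStirringFamily Ω B K S)
    (hbB : ∀ i, EqOn (b i) (B i) (closure Ω))
    (hb : ∀ i j, (∫ x in Ω, (inner ℝ (b i x) (b j x) : ℝ)) = if i = j then 1 else 0)
    (hT : 0 < T) (v : Control Ω b T) (η : H1 Ω) :
    ∃ ρ : ℝ → H1 Ω, IsAdjointSolution Ω T (velocity v) η ρ ∧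
      (∀ ρ', IsAdjointSolution Ω T (velocity v) η ρ' → EqOn ρ' ρ (Icc 0 T)) ∧
      ContinuousOn ρ (Icc 0 T) ∧
      IsWeakEvolution (valL Ω) (transportOp hB) T (controlCoord hΩ hB v)
        (fun t => valL Ω (ρ t)) ∧ ρ T = η := by
  have hc := integrableOn_controlCoord hΩ hB v
  have hTT : T ∈ Icc 0 T := ⟨hT.le, le_rfl⟩
  have hreg := hasRegularEvolution hΩ hB 0 hc
  have hiff := fun ρ => isAdjointSolution_iff hΩ hB hT hc
    (velocity_eq_stirVelocity hΩ hB hbB hb v) (η := η) (ρ := ρ)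
  obtain ⟨ρ, h1, h2, h3, -⟩ := hreg T hTT η
  refine ⟨ρ, (hiff ρ).2 ⟨h3, h2, h1⟩, fun ρ' hρ' t ht => ?_, h3, h2, h1⟩
  obtain ⟨-, k2, k3⟩ := (hiff ρ').1 hρ'
  refine val_injective hΩ.isOpen ?_
  exact k2.eqOn (inner_transportOp hΩ hB) (denseRange_valL hΩ.isOpen hΩ.isBounded) hc hreg h2 hTT
    (by rw [k3, h1]) ht

end State


/-! ### The product of a bounded state with a gradient -/

section Product

variable {d : ℕ} {Ω : Set (E d)} {M : ℝ}

/-- The product `θ ∇ρ` is square integrable because `θ` is bounded. -/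
lemma memLp_smul_of_boundedBy {f : L2 Ω} (hf : f ∈ boundedBy Ω M) (g : L2Vec Ω) :
    MemLp (fun x => f x • g x) 2 (volume.restrict Ω) := by
  refine (Lp.memLp g).of_le_mul (c := M) ((Lp.aestronglyMeasurable f).smul
    (Lp.aestronglyMeasurable g)) ?_
  filter_upwards [hf] with x hx
  rw [norm_smul]
  gcongr
  exact hx

open Classical in
/-- The product `f g` in `L²(Ω; ℝᵈ)` of a scalar function and a vector field, set to zero when the
product is not square integrable. -/
noncomputable def smulVec (f : L2 Ω) (g : L2Vec Ω) : L2Vec Ω :=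
  if h : MemLp (fun x => f x • g x) 2 (volume.restrict Ω) then h.toLp _ else 0

lemma coeFn_smulVec {f : L2 Ω} (hf : f ∈ boundedBy Ω M) (g : L2Vec Ω) :
    smulVec f g =ᵐ[volume.restrict Ω] fun x => f x • g x := by
  rw [smulVec, dif_pos (memLp_smul_of_boundedBy hf g)]
  exact (memLp_smul_of_boundedBy hf g).coeFn_toLp

lemma norm_smulVec_le {f : L2 Ω} (hf : f ∈ boundedBy Ω M) (g : L2Vec Ω) :
    ‖smulVec f g‖ ≤ M * ‖g‖ := by
  refine Lp.norm_le_mul_norm_of_ae_le_mul ?_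
  filter_upwards [hf, coeFn_smulVec hf g] with x h1 h2
  rw [h2, norm_smul]
  gcongr
  exact h1

lemma smulVec_sub_right {f : L2 Ω} (hf : f ∈ boundedBy Ω M) (g h : L2Vec Ω) :
    smulVec f (g - h) = smulVec f g - smulVec f h := by
  refine Lp.ext ?_
  filter_upwards [coeFn_smulVec hf g, coeFn_smulVec hf h, coeFn_smulVec hf (g - h),
    Lp.coeFn_sub g h, Lp.coeFn_sub (smulVec f g) (smulVec f h)] with x h1 h2 h3 h4 h5
  rw [h3, h5, Pi.sub_apply, h1, h2, h4, Pi.sub_apply, smul_sub]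

/-- Multiplication by uniformly bounded functions is continuous from `L² × L²` to `L²`. -/
lemma tendsto_smulVec {f : ℕ → L2 Ω} {f₀ : L2 Ω} {g : ℕ → L2Vec Ω} {g₀ : L2Vec Ω}
    (hf : ∀ n, f n ∈ boundedBy Ω M) (hlim : Tendsto f atTop (𝓝 f₀))
    (hg : Tendsto g atTop (𝓝 g₀)) :
    Tendsto (fun n => smulVec (f n) (g n)) atTop (𝓝 (smulVec f₀ g₀)) := by
  have hf₀ : f₀ ∈ boundedBy Ω M :=
    (isClosed_boundedBy Ω M).mem_of_tendsto hlim (Eventually.of_forall hf)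
  -- convergence in `L²` gives convergence almost everywhere along subsequences, which dominated
  -- convergence requires
  have h1 : Tendsto (fun n => smulVec (f n) g₀) atTop (𝓝 (smulVec f₀ g₀)) := by
    refine tendsto_of_subseq_tendsto fun ns hns => ?_
    obtain ⟨k, -, hk⟩ :=
      (tendstoInMeasure_of_tendsto_Lp (hlim.comp hns)).exists_seq_tendsto_ae
    refine ⟨k, ?_⟩
    rw [Lp.tendsto_Lp_iff_tendsto_eLpNorm']
    refine tendsto_eLpNorm_sub_of_dominated (g := fun x => 2 * M * ‖g₀ x‖)
      (fun n => Lp.aestronglyMeasurable _) (Lp.aestronglyMeasurable _)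
      ((Lp.memLp g₀).norm.const_mul _) (fun n => ?_) ?_
    · filter_upwards [coeFn_smulVec (hf (ns (k n))) g₀, coeFn_smulVec hf₀ g₀, hf (ns (k n)), hf₀]
        with x h1 h2 h3 h4
      rw [h1, h2, ← sub_smul, norm_smul]
      gcongr
      exact (norm_sub_le _ _).trans (by rw [Real.norm_eq_abs, Real.norm_eq_abs]; linarith)
    · filter_upwards [hk, coeFn_smulVec hf₀ g₀,
        ae_all_iff.2 fun n => coeFn_smulVec (hf (ns (k n))) g₀] with x h1 h2 h3
      simp only [h2, h3]
      exact h1.smul_const _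
  -- the bound `M` is uniform, so the second factor may be varied as well
  have h2 : Tendsto (fun n => smulVec (f n) (g n) - smulVec (f n) g₀) atTop (𝓝 0) := by
    refine squeeze_zero_norm (a := fun n => M * ‖g n - g₀‖) (fun n => ?_) ?_
    · rw [← smulVec_sub_right (hf n)]
      exact norm_smulVec_le (hf n) _
    · simpa using (tendsto_iff_norm_sub_tendsto_zero.1 hg).const_mul M
  simpa using h2.add h1

lemma continuousOn_smulVec {s : Set ℝ} {θ : ℝ → L2 Ω} {g : ℝ → L2Vec Ω}
    (hθ : ContinuousOn θ s) (hg : ContinuousOn g s) (hθM : ∀ t ∈ s, θ t ∈ boundedBy Ω M) :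
    ContinuousOn (fun t => smulVec (θ t) (g t)) s := by
  rw [continuousOn_iff_continuous_domRestrict] at hθ hg ⊢
  refine continuous_iff_seqContinuous.2 fun t t₀ ht => ?_
  exact tendsto_smulVec (fun n => hθM _ (t n).2) ((hθ.tendsto t₀).comp ht)
    ((hg.tendsto t₀).comp ht)

end Product

/-! ### The cost functional -/

section Cost

variable {d m : ℕ} {Ω : Set (E d)} {b B : Fin m → E d → E d} {K : NNReal} {S T : ℝ}

/-- The projection of a field onto the controls has the same pairings with controls. -/
lemma inner_projControl (F : Lp (L2Vec Ω) 2 (volume.restrict (Ioo (0 : ℝ) T)))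
    (w : Control Ω b T) : inner ℝ (projControl Ω b T F) w = inner ℝ F (inclControl Ω b T w) := by
  rw [L2.inner_def, L2.inner_def]
  refine integral_congr_ae ?_
  filter_upwards [(controlSpace Ω b).orthogonalProjectionOnto.coeFn_compLp F,
    (controlSpace Ω b).subtypeL.coeFn_compLp w] with t h1 h2
  rw [projControl, h1, inclControl, h2]
  exact Submodule.inner_orthogonalProjectionOnto_eq_of_mem_right _ _

lemma integral_norm_sq_velocity (v : Control Ω b T) :
    ∫ t in Ioo (0 : ℝ) T, ‖velocity v t‖ ^ 2 = ‖inclControl Ω b T v‖ ^ 2 := by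
  rw [← real_inner_self_eq_norm_sq, L2.inner_def]
  refine integral_congr_ae ?_
  filter_upwards [(controlSpace Ω b).subtypeL.coeFn_compLp v] with t ht
  rw [inclControl, ht, real_inner_self_eq_norm_sq]
  rfl

lemma inclControl_add_smul (v w : Control Ω b T) (ε : ℝ) :
    inclControl Ω b T (v + ε • w) = inclControl Ω b T v + ε • inclControl Ω b T w := by
  have h : ∀ v, inclControl Ω b T v = (controlSpace Ω b).subtypeL.compLpL 2
    (volume.restrict (Ioo (0 : ℝ) T)) v := fun _ => rfl
  rw [h, h, h, map_add, map_smul]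

/-- The quadratic cost of the control is differentiable along lines. -/
lemma hasDerivAt_control_cost (γ : ℝ) (v w : Control Ω b T) :
    HasDerivAt (fun ε : ℝ => γ / 2 * ∫ t in Ioo (0 : ℝ) T, ‖velocity (v + ε • w) t‖ ^ 2)
      (γ * inner ℝ (inclControl Ω b T v) (inclControl Ω b T w)) 0 := by
  simp only [integral_norm_sq_velocity, inclControl_add_smul]
  set x := inclControl Ω b T v
  set y := inclControl Ω b T w
  have h1 : HasDerivAt (fun ε : ℝ => x + ε • y) y 0 := by
    simpa using ((hasDerivAt_id (0 : ℝ)).smul_const y).const_add x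
  have h2 := (h1.norm_sq).const_mul (γ / 2)
  simp only [zero_smul, add_zero] at h2
  refine h2.congr_deriv ?_
  ring

/-- The pairing of `θ ∇ρ` with a control is the transport term of the state equation. -/
lemma inner_smulVec_velocity (hΩ : IsBoundedLipschitzDomain Ω) (hB : IsStirringFamily Ω B K S)
    (hbB : ∀ i, EqOn (b i) (B i) (closure Ω))
    (hb : ∀ i j, (∫ x in Ω, (inner ℝ (b i x) (b j x) : ℝ)) = if i = j then 1 else 0)
    {M : ℝ} {f : L2 Ω} (hf : f ∈ boundedBy Ω M) (ψ : H1 Ω) (w : Control Ω b T) (t : ℝ) :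
    inner ℝ (smulVec f (grad ψ)) (velocity w t)
      = inner ℝ f (transportOp hB (controlCoord hΩ hB w t) ψ) := by
  rw [inner_L2Vec_eq, inner_L2_eq]
  refine integral_congr_ae ?_
  filter_upwards [coeFn_smulVec hf (grad ψ), velocity_eq_stirVelocity hΩ hB hbB hb w t,
    coeFn_transportOp hB (controlCoord hΩ hB w t) ψ] with x h1 h2 h3
  rw [h1, h2, h3, real_inner_smul_left, real_inner_comm, stirVelocity]

end Cost

end MixingControl

theorem mainTheorem5 {d m : ℕ} (hd : 1 ≤ d) (Ω : Set (E d)) (hΩ : IsBoundedLipschitzDomain Ω)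
    (T γ : ℝ) (hT : 0 < T) (hγ : 0 < γ)
    (b : Fin m → E d → E d) (hb : ∀ i, IsStirringField Ω (b i))
    (hb_orth : ∀ i j, (∫ x in Ω, (inner ℝ (b i x) (b j x) : ℝ)) = if i = j then 1 else 0)
    (θ₀ : E d → ℝ) (hθ₀ : MemLp θ₀ ∞ (volume.restrict Ω)) (hθ₀_mean : (∫ x in Ω, θ₀ x) = 0) :
    -- the state equation is well posed and the cost is finite, for every control
    (∀ v : Control Ω b T,
      IsStateSolution Ω T (velocity v) θ₀ (state Ω b T θ₀ v) ∧
      (∀ θ, IsStateSolution Ω T (velocity v) θ₀ θ → EqOn θ (state Ω b T θ₀ v) (Icc 0 T)) ∧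
      BddAbove (dualPairings Ω (state Ω b T θ₀ v T))) ∧
    ∀ v : Control Ω b T,
      ∃ (η : H1 Ω) (ρ : ℝ → H1 Ω) (F : Lp (L2Vec Ω) 2 (volume.restrict (Ioo (0 : ℝ) T))),
        -- `η` is the unique zero-mean solution of the Neumann problem with datum `θ(T; v)`
        IsNeumannSolution Ω (state Ω b T θ₀ v T) η ∧
        (∀ η', IsNeumannSolution Ω (state Ω b T θ₀ v T) η' → η' = η) ∧
        -- `ρ` is the unique solution of the adjoint equation with terminal datum `η`
        IsAdjointSolution Ω T (velocity v) η ρ ∧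
        (∀ ρ', IsAdjointSolution Ω T (velocity v) η ρ' → EqOn ρ' ρ (Icc 0 T)) ∧
        -- `F = θ ∇ρ`, an element of `L²((0,T); L²(Ω; ℝᵈ))`
        (∀ᵐ t ∂(volume.restrict (Ioo (0 : ℝ) T)),
          F t =ᵐ[volume.restrict Ω] fun x => state Ω b T θ₀ v t x • grad (ρ t) x) ∧
        -- `J'(v) = P_U (γ v + θ ∇ρ)` in `L²((0,T); U)`
        HasGateauxGradientAt (cost Ω b T γ θ₀)
          (projControl Ω b T (γ • inclControl Ω b T v + F)) v := by
  obtain ⟨B, K, S, hB, hbB⟩ := exists_stirringFamily hΩ hb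
  have hfin : IsFiniteMeasure (volume.restrict Ω) :=
    ⟨by rw [Measure.restrict_apply_univ]; exact hΩ.isBounded.measure_lt_top⟩
  have hθ₀2 : MemLp θ₀ 2 (volume.restrict Ω) := hθ₀.mono_exponent le_top
  -- `M` is the essential supremum of the initial datum; the state inherits the bound
  obtain ⟨M, hM, hθ₀M⟩ : ∃ M : ℝ, 0 ≤ M ∧ hθ₀2.toLp θ₀ ∈ boundedBy Ω M := by
    refine ⟨(eLpNorm θ₀ ⊤ (volume.restrict Ω)).toReal, ENNReal.toReal_nonneg, ?_⟩
    filter_upwards [hθ₀2.coeFn_toLp, ae_le_eLpNormEssSup (f := θ₀) (μ := volume.restrict Ω)]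
      with x h1 h2
    rw [h1, ← Real.norm_eq_abs, ← toReal_enorm]
    rw [← eLpNorm_exponent_top] at h2
    exact ENNReal.toReal_mono hθ₀.eLpNorm_ne_top h2
  have hspec := state_spec hΩ hB hbB hb_orth hT hθ₀2 hM hθ₀M
  refine ⟨fun v => ⟨(hspec v).1, (hspec v).2.1, (isGreatest_dualPairings hΩ _).bddAbove⟩,
    fun v => ?_⟩
  obtain ⟨-, -, hθ, hθ0, hθM⟩ := hspec v
  set θ := state Ω b T θ₀ v with hθdef
  have h0T : (0 : ℝ) ∈ Icc 0 T := ⟨le_rfl, hT.le⟩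
  have hTT : T ∈ Icc 0 T := ⟨hT.le, le_rfl⟩
  have hmean : ∫ x in Ω, θ T x = 0 := by
    rw [integral_eq_of_isWeakEvolution hΩ hB hθ h0T hTT, hθ0, ← hθ₀_mean]
    exact integral_congr_ae hθ₀2.coeFn_toLp
  have hη := isNeumannSolution_neumann hΩ hmean
  obtain ⟨ρ, hρ1, hρ2, hρ3, hρ4, hρ5⟩ :=
    exists_adjoint hΩ hB hbB hb_orth hT v (neumann hΩ (θ T))
  have hcont : ContinuousOn (fun t => smulVec (θ t) (grad (ρ t))) (Icc 0 T) :=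
    continuousOn_smulVec hθ.continuousOn ((gradL Ω).continuous.comp_continuousOn hρ3)
      fun t ht => (hθM t ht).2
  have hF : MemLp (fun t => smulVec (θ t) (grad (ρ t))) 2 (volume.restrict (Ioo 0 T)) := by
    obtain ⟨A, hA⟩ := isCompact_Icc.exists_bound_of_continuousOn hcont
    refine MemLp.of_bound
      ((hcont.mono Ioo_subset_Icc_self).aestronglyMeasurable measurableSet_Ioo) A ?_
    exact ae_restrict_of_forall_mem measurableSet_Ioo fun t ht => hA t (Ioo_subset_Icc_self ht)
  refine ⟨neumann hΩ (θ T), ρ, hF.toLp _, hη, fun η' hη' => hη.unique hΩ hη', hρ1, hρ2, ?_, ?_⟩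
  · filter_upwards [hF.coeFn_toLp, ae_restrict_mem measurableSet_Ioo] with t h1 h2
    rw [h1]
    exact coeFn_smulVec (hθM t (Ioo_subset_Icc_self h2)).2 _
  · intro w
    have hc := integrableOn_controlCoord hΩ hB v
    have hw := integrableOn_controlCoord hΩ hB w
    have hv0 : v + (0 : ℝ) • w = v := by
      have h : (0 : ℝ) • w = 0 := zero_smul ℝ w
      rw [h, add_zero]
    -- the perturbed states, with controls `v + ε w`, have coefficients `c + ε w` almost everywhere
    have h1 := hasDerivAt_negSobolevNorm_sq hΩ hB hT.le hc hw
      (θ := fun ε => state Ω b T θ₀ (v + ε • w)) (A := ‖hθ₀2.toLp θ₀‖)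
      (fun ε => (hspec (v + ε • w)).2.2.1.congr (controlCoord_add_smul hΩ hB v w ε))
      (fun ε t ht => ((hspec (v + ε • w)).2.2.2.2 t ht).1.le)
      (fun ε => (hspec _).2.2.2.1.trans (hspec _).2.2.2.1.symm) hρ3 hρ4
      (by rw [hρ5]; simp only [hv0]; rfl)
    have h2 := h1.add (hasDerivAt_control_cost γ v w)
    refine h2.congr_deriv ?_
    rw [inner_projControl, inner_add_left, real_inner_smul_left, add_comm]
    congr 1
    -- the pairing of `θ ∇ρ` with `w` is the derivative of the negative norm
    rw [L2.inner_def, ← intervalIntegral_eq_Ioo hT.le]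
    simp only [hv0]
    refine integral_congr_ae ?_
    filter_upwards [hF.coeFn_toLp, ae_restrict_mem measurableSet_Ioo,
      (controlSpace Ω b).subtypeL.coeFn_compLp w] with t k1 k2 k3
    rw [k1, inclControl, k3]
    exact (inner_smulVec_velocity hΩ hB hbB hb_orth (hθM t (Ioo_subset_Icc_self k2)).2 (ρ t) w t).symm
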